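/- Let $n\ge 2$ be an integer and put $$\mathcal F[v]=v\,v_{rr}-\tfrac12 v_r^2+\frac{n-1-v}{r}\,v_r+\frac{2(n-1)}{r^2}\,v(1-v),\qquad v_0(r)=\frac{n-1}{-4\log r}\ (0<r<1),\quad v_0(0)=0 .$$ **Solutions considered.** Let $v_{\rm init}$ satisfy $v_{\rm init}(r)=[1+o(1)]\,v_0(r)$ as $r\searrow0$, with $v_{\rm init}(0)=0$ by convention. A *solution* is a function $v\ge 0$ on $[0,r_1)\times[0,t_1)$ (for some $r_1,t_1>0$) that is smooth on $[0,r_1)\times(0,t_1)$ (including the tip $r=0$), satisfies $v_t=\mathcal F[v]$ for $0<r<r_1$, $0<t<t_1$, is continuous on $(0,r_1)\times[0,t_1)$, and has $v(r,0)=v_{\rm init}(r)$. **Soliton profiles.** There is a function $\mathfrak B:[0,\infty)\to(0,1]$, the profile of the Bryant steady soliton metric $\frac{(d\sigma)^2}{\mathfrak B(\sigma)}+\sigma^2g_{\rm can}$ on $\mathbb R^{n+1}$, such that $\mathfrak B$ is a smooth function of $\sigma^2$, $\mathfrak B(0)=1$, $0<\mathfrak B<1$ and $\mathcal F[\mathfrak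 B]=0$ on $(0,\infty)$, and $\mathfrak B(\sigma)=\sigma^{-2}+o(\sigma^{-2})$ as $\sigma\to\infty$. There is a smooth $\mathfrak C>0$ on $(0,\infty)$ (set $\mathfrak C(0)=0$) with $d\mathcal F_{\mathfrak B}[\mathfrak C]=-\sigma\mathfrak B'(\sigma)$, where $d\mathcal F_{\mathfrak B}$ is the first variation of $\mathcal F$ at $\mathfrak B$, with $\mathfrak C(\sigma)=M\sigma^2+o(\sigma^2)$ as $\sigma\searrow0$ for some $M>0$ and $\mathfrak C(\sigma)\to\frac1{n-1}$ as $\sigma\to\infty$. **Barriers.** For $A,B,\varepsilon,\delta>0$ put $\rho_*=A\varepsilon^{-1/2}$, $\sigma_*=B\varepsilon^{-1/2}$, $\tau=\log t$, $\rho=r/\sqrt t$, $\theta=\sqrt{t/(-\log t)}$, $\sigma=r/\theta$, $W_0(\rho)=\frac{n-1}2\bigl[1+\frac{2(n-1)}{\rho^2}\bigr]$, $$\gamma_\pm=\delta+\frac{(1\pm\delta)\varepsilon^2}{\varepsilon+2A^2/(n-1)},\qquad k_\pm=\frac1{n-1}\Bigl(1\pm\gamma_\pm\pm\frac{\varepsilon}{2(n-1)^2}\Bigr)^{-1/2},$$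 $$v^\pm_{\rm out}=(1\pm\delta)v_0+(1\pm\varepsilon)\,t\,\mathcal F[(1\pm\delta)v_0],\qquad v^\pm_{\rm par}=(1\pm\gamma_\pm)\frac{W_0(\rho)}{-\tau}\pm\frac{B^2}{\tau^2\rho^4},$$ $$v^\pm_{\rm in}=\mathfrak B(k_\pm\sigma)+(1\mp\varepsilon)\,\theta\theta_t\,k_\pm^{-2}\,\mathfrak C(k_\pm\sigma).$$ Let $v^-_{\varepsilon,\delta}$ be $v^-_{\rm in}$ for $r<\sigma_*\theta$; $\max\{v^-_{\rm in},v^-_{\rm par}\}$ for $\sigma_*\theta\le r<3\sigma_*\theta$; $v^-_{\rm par}$ for $3\sigma_*\theta\le r<\rho_*\sqrt t$; $\max\{v^-_{\rm par},v^-_{\rm out}\}$ for $\rho_*\sqrt t\le r<3\rho_*\sqrt t$; and $v^-_{\rm out}$ for $r\ge3\rho_*\sqrt t$ (so $v^-_{\varepsilon,\delta}(r,0)=(1-\delta)v_0(r)$). Let $v^+_{\varepsilon,\delta}$ be defined in the same way with $+$ for $-$ and $\min$ for $\max$. **Theorem.** Such $\mathfrak B,\mathfrak C$ exist, and for them the following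 holds. (i) There are $A_0>0$ and $r_*\in(0,1)$ depending only on $n$ such that for every $A\ge A_0$ there are $\varepsilon_0,\delta_0>0$ such that for every $\varepsilon\in(0,\varepsilon_0)$ there is $B_0\ge1$ such that for every $B\ge B_0$ there is $t_*\in(0,1)$ such that for every $\delta\in(0,\delta_0)$: * for $0<t<t_*$ one has $3\sigma_*\theta<\rho_*\sqrt t$ and $3\rho_*\sqrt t<r_*$; the functions $v^-_{\rm out},v^-_{\rm par},v^-_{\rm in}$ are subsolutions, and $v^+_{\rm out},v^+_{\rm par},v^+_{\rm in}$ supersolutions, of $v_t=\mathcal F[v]$ in the regions $\{\rho_*\sqrt t\le r\le r_*\}$, $\{\sigma_*\theta\le r\le3\rho_*\sqrt t\}$, $\{0<r\le3\sigma_*\theta\}$ respectively; and the gluing conditions hold: $v^-_{\rm out}<v^-_{\rm par}$ at $r=\rho_*\sqrt t$, $v^-_{\rm par}<v^-_{\rm out}$ at $r=3\rho_*\sqrt t$, $v^-_{\rm par}<v^-_{\rm in}$ at $r=\sigma_*\theta$, $v^-_{\rm in}<v^-_{\rm par}$ at $r=3\sigma_*\theta$, and the reversed inequalities for the supersolutions;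 * for every solution $v$ there are $\bar r\in(0,r_*]$, $\bar r<r_1$, and $0<\bar t<\min\{t_1,t_*\}$ (depending on $v$ and all the parameters) such that $$v^-_{\varepsilon,\delta}(r,t)\le v(r,t)\le v^+_{\varepsilon,\delta}(r,t)\qquad\text{for all }(r,t)\in[0,\bar r]\times[0,\bar t].$$ (ii) Every solution $v$ has the following asymptotic profile. * Outer region: for all $\eta,c_1>0$ there are $c_2,t_0>0$ such that for $0<t<t_0$ and $c_1\sqrt t<r<c_2$ the quotient of $v(r,t)$ by $\frac{n-1}{-4\log r}\bigl[1+2(n-1)\frac t{r^2}\bigr]$ differs from $1$ by at most $\eta$. * Parabolic region: for all $\eta,c_4>0$ there are $c_3,t_0>0$ such that for $0<t<t_0$ and $c_3/\sqrt{-\tau}<\rho<c_4$ the quotient of $v(\rho\sqrt t,t)$ by $\frac{n-1}{-2\tau}\bigl[1+\frac{2(n-1)}{\rho^2}\bigr]$ differs from $1$ by at most $\eta$. * Inner region: for every $c_5>0$, $v(\sigma\theta,t)=[1+o(1)]\,\mathfrak B\bigl(\frac{\sigma}{n-1}\bigr)$ uniformly for $0<\sigma<c_5$ as $t\searrow0$.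 -/

import Mathlib

open Set Filter Topology
open scoped ContDiff

noncomputable section

namespace RicciNeckpinch

/-- The quasilinear operator
`𝓕[w] = w w'' - (w')²/2 + (n-1-w) w'/r + 2(n-1) w (1-w)/r²`
acting on functions of one variable. -/
def opF (n : ℕ) (w : ℝ → ℝ) (r : ℝ) : ℝ :=
  w r * deriv (deriv w) r - (1 / 2) * (deriv w r) ^ 2
    + ((n : ℝ) - 1 - w r) / r * deriv w r
    + 2 * ((n : ℝ) - 1) / r ^ 2 * (w r * (1 - w r))

/-- The first variation `d𝓕_V[W]` of `opF` at `V` in the direction `W`. -/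
def opDF (n : ℕ) (V W : ℝ → ℝ) (σ : ℝ) : ℝ :=
  V σ * deriv (deriv W) σ
    + (((n : ℝ) - 1 - V σ) / σ - deriv V σ) * deriv W σ
    + (deriv (deriv V) σ - deriv V σ / σ
        + 2 * ((n : ℝ) - 1) / σ ^ 2 * (1 - 2 * V σ)) * W σ

/-- The model cusp `v₀(r) = ((n-1)/4) / (-log r)`; note `v₀(0) = 0`. -/
def v0 (n : ℕ) (r : ℝ) : ℝ := (((n : ℝ) - 1) / 4) / (-Real.log r)

/-- Neckpinch initial data in the `r`-coordinate: `v_init = (1 + o(1)) v₀` as `r ↘ 0`,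
extended by its limit `0` to `r = 0`. -/
structure IsNeckpinchData (n : ℕ) (vInit : ℝ → ℝ) : Prop where
  zero : vInit 0 = 0
  asymp : Tendsto (fun r => vInit r / v0 n r) (𝓝[>] 0) (𝓝 1)

/-- `v` is a nonnegative solution of `v_t = 𝓕[v]`, `v(r,0) = v_init(r)`, for `0 ≤ r < r₁`,
smooth (up to the tip `r = 0`) for `0 < t < t₁`, and attaining its initial values
continuously away from the singular point `r = 0`. -/
structure IsSmoothSolution (n : ℕ) (vInit : ℝ → ℝ) (r₁ t₁ : ℝ) (v : ℝ → ℝ → ℝ) : Prop where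
  nonneg : ∀ r ∈ Ico 0 r₁, ∀ t ∈ Ico 0 t₁, 0 ≤ v r t
  smooth : ContDiffOn ℝ ∞ (fun p : ℝ × ℝ => v p.1 p.2) (Ico 0 r₁ ×ˢ Ioo 0 t₁)
  pde : ∀ r ∈ Ioo 0 r₁, ∀ t ∈ Ioo 0 t₁,
    deriv (fun s => v r s) t = opF n (fun x => v x t) r
  cont : ContinuousOn (fun p : ℝ × ℝ => v p.1 p.2) (Ioo 0 r₁ ×ˢ Ico 0 t₁)
  initial : ∀ r ∈ Ico 0 r₁, v r 0 = vInit r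

/-- `𝔅` is the profile of the Bryant steady soliton metric `dσ²/𝔅(σ) + σ² g_can` on `ℝⁿ⁺¹`,
scaled so that `𝔅(σ) = σ⁻² + o(σ⁻²)` at infinity. The first field says that this metric closes
up smoothly at the origin. -/
structure IsBryantProfile (n : ℕ) (𝔅 : ℝ → ℝ) : Prop where
  smooth : ∃ β : ℝ → ℝ, ContDiffOn ℝ ∞ β (Ici 0) ∧ ∀ σ, 0 ≤ σ → 𝔅 σ = β (σ ^ 2)
  center : 𝔅 0 = 1
  between : ∀ σ, 0 < σ → 0 < 𝔅 σ ∧ 𝔅 σ < 1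
  stationary : ∀ σ, 0 < σ → opF n 𝔅 σ = 0
  normalized : Tendsto (fun σ => σ ^ 2 * 𝔅 σ) atTop (𝓝 1)

/-- `ℭ` is a strictly positive solution of `d𝓕_𝔅[ℭ] = -σ 𝔅'(σ)` on `(0,∞)` with
`ℭ(σ) = M σ² + o(σ²)`, `M > 0`, at the origin and `ℭ(σ) → 1/(n-1)` at infinity. -/
structure IsBryantCorrection (n : ℕ) (𝔅 ℭ : ℝ → ℝ) : Prop where
  zero : ℭ 0 = 0
  smooth : ContDiffOn ℝ ∞ ℭ (Ioi 0)
  pos : ∀ σ, 0 < σ → 0 < ℭ σ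
  ode : ∀ σ, 0 < σ → opDF n 𝔅 ℭ σ = -(σ * deriv 𝔅 σ)
  at_zero : ∃ M : ℝ, 0 < M ∧ Tendsto (fun σ => ℭ σ / σ ^ 2) (𝓝[>] 0) (𝓝 M)
  at_top : Tendsto ℭ atTop (𝓝 (1 / ((n : ℝ) - 1)))

/-- The inner length scale `θ(t) = √(t / (-log t))`. -/
def theta (t : ℝ) : ℝ := Real.sqrt (t / (-Real.log t))

/-- `ρ_* = A ε^{-1/2}`. -/
def rhoStar (A ε : ℝ) : ℝ := A / Real.sqrt ε

/-- `σ_* = B ε^{-1/2}`. -/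
def sigmaStar (B ε : ℝ) : ℝ := B / Real.sqrt ε

/-- `W₀(ρ) = ((n-1)/2) (1 + 2(n-1)/ρ²)`. -/
def W0 (n : ℕ) (ρ : ℝ) : ℝ := ((n : ℝ) - 1) / 2 * (1 + 2 * ((n : ℝ) - 1) / ρ ^ 2)

/-! In the following definitions `s = -1` gives the subsolution and `s = 1` the supersolution. -/

/-- `γ_± = δ + (1 ± δ) ε² / (ε + 2A²/(n-1))`. -/
def gammaC (n : ℕ) (A ε δ s : ℝ) : ℝ :=
  δ + (1 + s * δ) * ε ^ 2 / (ε + 2 * A ^ 2 / ((n : ℝ) - 1))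

/-- `k_± = (n-1)⁻¹ (1 ± γ_± ± ε/(2(n-1)²))^{-1/2}`. -/
def kC (n : ℕ) (A ε δ s : ℝ) : ℝ :=
  1 / ((n : ℝ) - 1) *
    (1 / Real.sqrt (1 + s * gammaC n A ε δ s + s * (ε / (2 * ((n : ℝ) - 1) ^ 2))))

/-- Outer barriers `(1 ± δ) v₀ + (1 ± ε) t 𝓕[(1 ± δ) v₀]`. -/
def vOut (n : ℕ) (ε δ s : ℝ) (r t : ℝ) : ℝ :=
  (1 + s * δ) * v0 n r + (1 + s * ε) * t * opF n (fun x => (1 + s * δ) * v0 n x) r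

/-- Parabolic barriers `(1 ± γ_±) W₀(ρ)/(-τ) ± B²/(τ² ρ⁴)`, with `ρ = r/√t`, `τ = log t`. -/
def vPar (n : ℕ) (A B ε δ s : ℝ) (r t : ℝ) : ℝ :=
  (1 + s * gammaC n A ε δ s) * (W0 n (r / Real.sqrt t) / (-Real.log t))
    + s * (B ^ 2 / ((Real.log t) ^ 2 * (r / Real.sqrt t) ^ 4))

/-- Inner barriers `𝔅(k_± σ) + (1 ∓ ε) θ θ_t k_±⁻² ℭ(k_± σ)`, with `σ = r/θ(t)`. -/
def vIn (n : ℕ) (𝔅 ℭ : ℝ → ℝ) (A ε δ s : ℝ) (r t : ℝ) : ℝ :=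
  𝔅 (kC n A ε δ s * (r / theta t))
    + (1 - s * ε) * (theta t * deriv theta t) *
        (ℭ (kC n A ε δ s * (r / theta t)) / (kC n A ε δ s) ^ 2)

/-- The glued lower barrier `v⁻_{ε,δ}`. -/
def vMinus (n : ℕ) (𝔅 ℭ : ℝ → ℝ) (A B ε δ : ℝ) (r t : ℝ) : ℝ :=
  if 3 * rhoStar A ε * Real.sqrt t ≤ r then vOut n ε δ (-1) r t
  else if rhoStar A ε * Real.sqrt t ≤ r then
    max (vOut n ε δ (-1) r t) (vPar n A B ε δ (-1) r t)
  else if 3 * sigmaStar B ε * theta t ≤ r then vPar n A B ε δ (-1) r t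
  else if sigmaStar B ε * theta t ≤ r then
    max (vIn n 𝔅 ℭ A ε δ (-1) r t) (vPar n A B ε δ (-1) r t)
  else vIn n 𝔅 ℭ A ε δ (-1) r t

/-- The glued upper barrier `v⁺_{ε,δ}`. -/
def vPlus (n : ℕ) (𝔅 ℭ : ℝ → ℝ) (A B ε δ : ℝ) (r t : ℝ) : ℝ :=
  if 3 * rhoStar A ε * Real.sqrt t ≤ r then vOut n ε δ 1 r t
  else if rhoStar A ε * Real.sqrt t ≤ r then
    min (vOut n ε δ 1 r t) (vPar n A B ε δ 1 r t)
  else if 3 * sigmaStar B ε * theta t ≤ r then vPar n A B ε δ 1 r t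
  else if sigmaStar B ε * theta t ≤ r then
    min (vIn n 𝔅 ℭ A ε δ 1 r t) (vPar n A B ε δ 1 r t)
  else vIn n 𝔅 ℭ A ε δ 1 r t

/-- The outer, parabolic and inner space-time regions, for `0 < t < ts`. -/
def regionOut (A ε rs ts : ℝ) : Set (ℝ × ℝ) :=
  {p | rhoStar A ε * Real.sqrt p.2 ≤ p.1 ∧ p.1 ≤ rs ∧ 0 < p.2 ∧ p.2 < ts}

def regionPar (A B ε ts : ℝ) : Set (ℝ × ℝ) :=
  {p | sigmaStar B ε * theta p.2 ≤ p.1 ∧ p.1 ≤ 3 * rhoStar A ε * Real.sqrt p.2 ∧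
    0 < p.2 ∧ p.2 < ts}

def regionIn (B ε ts : ℝ) : Set (ℝ × ℝ) :=
  {p | 0 < p.1 ∧ p.1 ≤ 3 * sigmaStar B ε * theta p.2 ∧ 0 < p.2 ∧ p.2 < ts}

/-- Classical subsolution of `w_t = 𝓕[w]` at the points of `Ω`. -/
def IsSubsolutionOn (n : ℕ) (w : ℝ → ℝ → ℝ) (Ω : Set (ℝ × ℝ)) : Prop :=
  ∀ p ∈ Ω, ContDiffAt ℝ 2 (fun q : ℝ × ℝ => w q.1 q.2) p ∧
    deriv (fun t => w p.1 t) p.2 ≤ opF n (fun r => w r p.2) p.1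

/-- Classical supersolution of `w_t = 𝓕[w]` at the points of `Ω`. -/
def IsSupersolutionOn (n : ℕ) (w : ℝ → ℝ → ℝ) (Ω : Set (ℝ × ℝ)) : Prop :=
  ∀ p ∈ Ω, ContDiffAt ℝ 2 (fun q : ℝ × ℝ => w q.1 q.2) p ∧
    opF n (fun r => w r p.2) p.1 ≤ deriv (fun t => w p.1 t) p.2

/-- The three pieces of `v^±_{ε,δ}` are sub- and supersolutions in their regions, the regions overlap
in the right order, and the gluing conditions hold, so that `v⁻_{ε,δ}` (resp. `v⁺_{ε,δ}`) is a
piecewise smooth subsolution with convex corners (resp. supersolution with concave corners) on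
`0 < r ≤ rs`, `0 < t < ts`. -/
structure IsGluedBarrierPair (n : ℕ) (𝔅 ℭ : ℝ → ℝ) (A B ε δ rs ts : ℝ) : Prop where
  sub_out : IsSubsolutionOn n (vOut n ε δ (-1)) (regionOut A ε rs ts)
  sub_par : IsSubsolutionOn n (vPar n A B ε δ (-1)) (regionPar A B ε ts)
  sub_in : IsSubsolutionOn n (vIn n 𝔅 ℭ A ε δ (-1)) (regionIn B ε ts)
  super_out : IsSupersolutionOn n (vOut n ε δ 1) (regionOut A ε rs ts)
  super_par : IsSupersolutionOn n (vPar n A B ε δ 1) (regionPar A B ε ts)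
  super_in : IsSupersolutionOn n (vIn n 𝔅 ℭ A ε δ 1) (regionIn B ε ts)
  order : ∀ t ∈ Ioo 0 ts, 3 * sigmaStar B ε * theta t < rhoStar A ε * Real.sqrt t ∧
    3 * rhoStar A ε * Real.sqrt t < rs
  glue_sub_out : ∀ t ∈ Ioo 0 ts,
    vOut n ε δ (-1) (rhoStar A ε * Real.sqrt t) t
      < vPar n A B ε δ (-1) (rhoStar A ε * Real.sqrt t) t ∧
    vPar n A B ε δ (-1) (3 * rhoStar A ε * Real.sqrt t) t
      < vOut n ε δ (-1) (3 * rhoStar A ε * Real.sqrt t) t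
  glue_sub_in : ∀ t ∈ Ioo 0 ts,
    vPar n A B ε δ (-1) (sigmaStar B ε * theta t) t
      < vIn n 𝔅 ℭ A ε δ (-1) (sigmaStar B ε * theta t) t ∧
    vIn n 𝔅 ℭ A ε δ (-1) (3 * sigmaStar B ε * theta t) t
      < vPar n A B ε δ (-1) (3 * sigmaStar B ε * theta t) t
  glue_super_out : ∀ t ∈ Ioo 0 ts,
    vPar n A B ε δ 1 (rhoStar A ε * Real.sqrt t) t
      < vOut n ε δ 1 (rhoStar A ε * Real.sqrt t) t ∧
    vOut n ε δ 1 (3 * rhoStar A ε * Real.sqrt t) t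
      < vPar n A B ε δ 1 (3 * rhoStar A ε * Real.sqrt t) t
  glue_super_in : ∀ t ∈ Ioo 0 ts,
    vIn n 𝔅 ℭ A ε δ 1 (sigmaStar B ε * theta t) t
      < vPar n A B ε δ 1 (sigmaStar B ε * theta t) t ∧
    vPar n A B ε δ 1 (3 * sigmaStar B ε * theta t) t
      < vIn n 𝔅 ℭ A ε δ 1 (3 * sigmaStar B ε * theta t) t

/-- The asymptotic profile of `v` as `t ↘ 0` in the outer, parabolic and inner regions. -/
structure HasNeckpinchProfile (n : ℕ) (𝔅 : ℝ → ℝ) (v : ℝ → ℝ → ℝ) : Prop where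
  outer : ∀ η > 0, ∀ c₁ > 0, ∃ c₂ > 0, ∃ t₀ > 0, ∀ t ∈ Ioo 0 t₀, ∀ r,
    c₁ * Real.sqrt t < r → r < c₂ →
      |v r t / (((n : ℝ) - 1) / (-4 * Real.log r) * (1 + 2 * ((n : ℝ) - 1) * (t / r ^ 2))) - 1|
        ≤ η
  parabolic : ∀ η > 0, ∀ c₄ > 0, ∃ c₃ > 0, ∃ t₀ > 0, ∀ t ∈ Ioo 0 t₀, ∀ ρ,
    c₃ / Real.sqrt (-Real.log t) < ρ → ρ < c₄ →
      |v (ρ * Real.sqrt t) t /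
          (((n : ℝ) - 1) / (-2 * Real.log t) * (1 + 2 * ((n : ℝ) - 1) / ρ ^ 2)) - 1| ≤ η
  inner : ∀ η > 0, ∀ c₅ > 0, ∃ t₀ > 0, ∀ t ∈ Ioo 0 t₀, ∀ σ,
    0 < σ → σ < c₅ →
      |v (σ * theta t) t / 𝔅 (σ / ((n : ℝ) - 1)) - 1| ≤ η

end RicciNeckpinch

end

noncomputable section

namespace RicciNeckpinch

section

open Set Filter Topology
open scoped ContDiff

/-! ### Calculus preliminaries -/

/-! The solution is trapped between explicit sub- and supersolutions, each glued from three pieces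
adapted to the scales $r\gg\sqrt t$, $r\sim\sqrt t$ and $r\sim\theta$. In every piece the leading
part solves the equation up to higher order in the small parameter $\kappa(\cdot)=1/(-\log\cdot)$.
The factor $1\pm\varepsilon$, or the term $\pm B^2\kappa^2\rho^{-4}$, contributes a signed gain that
beats all remaining errors (`exists_outBar_strict`, `parBar_strict`, `exists_inBar_strict`). The
constants $\gamma_\pm$ and $k_\pm$ are such that, to leading order, neighbouring pieces cross at
$\rho=2\rho_*$ and at $\sigma=\sqrt2\,\sigma_*$ (`glue_out_margin`, `eventually_glue_in`).

With $m=n-1$ and $x=\sigma^2$, the Bryant profile $f$ starts as a power series whose coefficients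
are dominated by Catalan numbers. The soliton equation has a first integral (`bryantEnergy`) that
turns it into a first order equation. The region $1/(1+x)<f<1$ is invariant for that equation, so
the series continues to the half line (`exists_bryant_global`), and the same integral gives the
decay $xf\to1$ (`exists_bryantFun`). Scaling invariance puts $p=-xf'$ in the kernel of the
linearization, so $\mathfrak C$ is found in the form $pU$ by reduction of order
(`BryantFun.exists_bryantCorr`).

The comparison is delicate because, beyond nonnegativity, nothing is assumed about $v$ near the
corner $(0,0)$: neither boundedness nor a condition at the tip. First, $v$ lies above slightly
smaller cusps (`SolData.lower_bound`), which forces $v=1$, $v_r=0$ at the tip (`SolData.tip`). Next,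
$v\le1+r^2/t$ by a self-similar supersolution (`SolData.le_one_add_sq_div`), and a moving front
improves this to a bound on $v$ near the corner (`SolData.front_bound`, `SolData.corner_bounded`).
Bounded solutions lie below every parabola $1-br^2$ near the corner (`SolData.le_one_sub_mul_sq`).

These facts order $v$ and a time translate of either barrier at some positive time. The comparison
principle for barriers with corners (`SolData.le_weakBarrier`) propagates the order, and the
translation is then sent to zero (`SolData.minus_le`, `SolData.le_plus`). The asymptotic profile is
the sandwich read with $\delta,\varepsilon$ small and $A,B$ large
(`hasNeckpinchProfile_of_sandwich`). -/

theorem deriv_deriv_eq {w w1 : ℝ → ℝ} {w2 r : ℝ}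
    (h1 : ∀ᶠ y in 𝓝 r, HasDerivAt w (w1 y) y) (h2 : HasDerivAt w1 w2 r) :
    deriv (deriv w) r = w2 := by
  have h : deriv w =ᶠ[𝓝 r] w1 := h1.mono fun y hy => hy.deriv
  rw [h.deriv_eq, h2.deriv]

theorem opF_eq {n : ℕ} {w w1 : ℝ → ℝ} {w2 r : ℝ}
    (h1 : ∀ᶠ y in 𝓝 r, HasDerivAt w (w1 y) y) (h2 : HasDerivAt w1 w2 r) :
    opF n w r = w r * w2 - (1 / 2) * (w1 r) ^ 2 + ((n : ℝ) - 1 - w r) / r * w1 r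
      + 2 * ((n : ℝ) - 1) / r ^ 2 * (w r * (1 - w r)) := by
  rw [opF, deriv_deriv_eq h1 h2, h1.self_of_nhds.deriv]

theorem opDF_eq {n : ℕ} {V V1 W W1 : ℝ → ℝ} {V2 W2 r : ℝ}
    (h1 : ∀ᶠ y in 𝓝 r, HasDerivAt V (V1 y) y) (h2 : HasDerivAt V1 V2 r)
    (k1 : ∀ᶠ y in 𝓝 r, HasDerivAt W (W1 y) y) (k2 : HasDerivAt W1 W2 r) :
    opDF n V W r = V r * W2 + (((n : ℝ) - 1 - V r) / r - V1 r) * W1 r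
      + (V2 - V1 r / r + 2 * ((n : ℝ) - 1) / r ^ 2 * (1 - 2 * V r)) * W r := by
  rw [opDF, deriv_deriv_eq h1 h2, deriv_deriv_eq k1 k2, h1.self_of_nhds.deriv,
    k1.self_of_nhds.deriv]

theorem tendsto_sq_nhds (r : ℝ) : Tendsto (fun y : ℝ => y ^ 2) (𝓝 r) (𝓝 (r ^ 2)) :=
  (continuous_pow 2).tendsto r

theorem hasDerivAt_comp_sq {f : ℝ → ℝ} {f' r : ℝ} (h : HasDerivAt f f' (r ^ 2)) :
    HasDerivAt (fun y => f (y ^ 2)) (2 * r * f') r := by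
  have h2 : HasDerivAt (fun y : ℝ => y ^ 2) (2 * r) r := by simpa using hasDerivAt_pow 2 r
  have := HasDerivAt.comp (h₂ := f) (h := fun y : ℝ => y ^ 2) r h h2
  rw [mul_comm] at this
  exact this

theorem eventually_hasDerivAt_comp_sq {f f1 : ℝ → ℝ} {r : ℝ}
    (h1 : ∀ᶠ y in 𝓝 (r ^ 2), HasDerivAt f (f1 y) y) :
    ∀ᶠ y in 𝓝 r, HasDerivAt (fun y => f (y ^ 2)) (2 * y * f1 (y ^ 2)) y :=
  ((tendsto_sq_nhds r).eventually h1).mono fun _ hy => hasDerivAt_comp_sq hy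

theorem hasDerivAt_deriv_comp_sq {f1 : ℝ → ℝ} {f2 r : ℝ} (h2 : HasDerivAt f1 f2 (r ^ 2)) :
    HasDerivAt (fun y => 2 * y * f1 (y ^ 2)) (2 * f1 (r ^ 2) + 4 * r ^ 2 * f2) r := by
  have := ((hasDerivAt_id r).const_mul 2).mul (hasDerivAt_comp_sq h2)
  refine this.congr_deriv ?_
  simp only [id]; ring

/-- The operator `opF` in the variable `x = r²`. -/
theorem opF_comp_sq {n : ℕ} {f f1 : ℝ → ℝ} {f2 r : ℝ} (hr : r ≠ 0)
    (h1 : ∀ᶠ y in 𝓝 (r ^ 2), HasDerivAt f (f1 y) y) (h2 : HasDerivAt f1 f2 (r ^ 2)) :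
    opF n (fun y => f (y ^ 2)) r = 4 * r ^ 2 * f (r ^ 2) * f2 - 2 * r ^ 2 * f1 (r ^ 2) ^ 2
      + 2 * ((n : ℝ) - 1) * f1 (r ^ 2)
      + 2 * ((n : ℝ) - 1) / r ^ 2 * (f (r ^ 2) * (1 - f (r ^ 2))) := by
  rw [opF_eq (eventually_hasDerivAt_comp_sq h1) (hasDerivAt_deriv_comp_sq h2)]
  field_simp
  ring

/-- The first variation `opDF` in the variable `x = r²`. -/
theorem opDF_comp_sq {n : ℕ} {f f1 g g1 : ℝ → ℝ} {f2 g2 r : ℝ} (hr : r ≠ 0)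
    (h1 : ∀ᶠ y in 𝓝 (r ^ 2), HasDerivAt f (f1 y) y) (h2 : HasDerivAt f1 f2 (r ^ 2))
    (k1 : ∀ᶠ y in 𝓝 (r ^ 2), HasDerivAt g (g1 y) y) (k2 : HasDerivAt g1 g2 (r ^ 2)) :
    opDF n (fun y => f (y ^ 2)) (fun y => g (y ^ 2)) r =
      4 * r ^ 2 * (f (r ^ 2) * g2 + g (r ^ 2) * f2) - 4 * r ^ 2 * f1 (r ^ 2) * g1 (r ^ 2)
      + 2 * ((n : ℝ) - 1) * g1 (r ^ 2)
      + 2 * ((n : ℝ) - 1) / r ^ 2 * (g (r ^ 2) * (1 - 2 * f (r ^ 2))) := by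
  rw [opDF_eq (eventually_hasDerivAt_comp_sq h1) (hasDerivAt_deriv_comp_sq h2)
    (eventually_hasDerivAt_comp_sq k1) (hasDerivAt_deriv_comp_sq k2)]
  field_simp
  ring

/-- Necessary second order condition at a local maximum. -/
theorem second_deriv_nonpos_of_isLocalMax {g g1 : ℝ → ℝ} {g2 x : ℝ} (h : IsLocalMax g x)
    (h1 : ∀ᶠ y in 𝓝 x, HasDerivAt g (g1 y) y) (h2 : HasDerivAt g1 g2 x) :
    g1 x = 0 ∧ g2 ≤ 0 := by
  have hz : g1 x = 0 := h.hasDerivAt_eq_zero h1.self_of_nhds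
  refine ⟨hz, ?_⟩
  by_contra! hpos
  -- A positive second derivative would make `x` a local minimum as well, hence `g` locally constant
  -- and its second derivative zero.
  have hmin : IsLocalMin g x := by
    apply isLocalMin_of_deriv_deriv_pos
    · rw [deriv_deriv_eq h1 h2]; exact hpos
    · rw [h1.self_of_nhds.deriv, hz]
    · exact h1.self_of_nhds.continuousAt
  have hconst : g =ᶠ[𝓝 x] fun _ => g x := by
    filter_upwards [h, hmin] with y hy1 hy2 using le_antisymm hy1 hy2
  have : g1 =ᶠ[𝓝 x] fun _ => 0 := by
    filter_upwards [h1, hconst.eventuallyEq_nhds] with y hy1 hy2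
    exact hy1.unique ((hasDerivAt_const y (g x)).congr_of_eventuallyEq hy2)
  have := h2.unique ((hasDerivAt_const x (0 : ℝ)).congr_of_eventuallyEq this)
  linarith

/-- A maximum over earlier times has nonnegative time derivative. -/
theorem deriv_nonneg_of_le_left {g : ℝ → ℝ} {g' t s : ℝ} (hst : s < t) (h : HasDerivAt g g' t)
    (hm : ∀ y ∈ Ioc s t, g y ≤ g t) : 0 ≤ g' := by
  have h1 : Tendsto (slope g t) (𝓝[<] t) (𝓝 g') :=
    (hasDerivAt_iff_tendsto_slope.1 h).mono_left (nhdsWithin_mono _ fun y hy => ne_of_lt hy)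
  refine ge_of_tendsto h1 ?_
  filter_upwards [Ioo_mem_nhdsLT hst] with y hy
  rw [slope_def_field]
  exact div_nonneg_of_nonpos (sub_nonpos.2 (hm y ⟨hy.1, hy.2.le⟩)) (by linarith [hy.2])

/-- A function which starts positive and has positive derivative at each of its zeros stays
positive. -/
theorem pos_of_deriv_pos_at_zeros {f f' : ℝ → ℝ} {a b : ℝ} (ha : 0 < f a)
    (hf : ContinuousOn f (Icc a b)) (hd : ∀ x ∈ Ioc a b, f x = 0 → HasDerivAt f (f' x) x)
    (hz : ∀ x ∈ Ioc a b, f x = 0 → 0 < f' x) : ∀ x ∈ Icc a b, 0 < f x := by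
  by_contra! hc
  obtain ⟨x, hx, hfx⟩ := hc
  have hcomp : IsCompact (Icc a b ∩ f ⁻¹' Iic 0) :=
    (isCompact_Icc).of_isClosed_subset (hf.preimage_isClosed_of_isClosed isClosed_Icc isClosed_Iic)
      inter_subset_left
  obtain ⟨c, hc⟩ := hcomp.exists_isLeast ⟨x, hx, hfx⟩
  have hca : a < c := by
    rcases eq_or_lt_of_le hc.1.1.1 with h | h
    · exact absurd hc.1.2 (by rw [← h]; simpa using ha)
    · exact h
  have hlt : ∀ y ∈ Ico a c, 0 < f y := by
    intro y hy
    by_contra! h0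
    exact absurd (hc.2 ⟨⟨hy.1, hy.2.le.trans hc.1.1.2⟩, h0⟩) (not_le.2 hy.2)
  have hc0 : f c = 0 := by
    refine le_antisymm hc.1.2 ?_
    have h1 : Tendsto f (𝓝[<] c) (𝓝 (f c)) := by
      have := (hf c hc.1.1).mono (Ioo_subset_Icc_self.trans (Icc_subset_Icc_right hc.1.1.2))
      rwa [ContinuousWithinAt, nhdsWithin_Ioo_eq_nhdsLT hca] at this
    refine ge_of_tendsto h1 ?_
    filter_upwards [Ioo_mem_nhdsLT hca] with y hy using (hlt y ⟨hy.1.le, hy.2⟩).le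
  have hcm : c ∈ Ioc a b := ⟨hca, hc.1.1.2⟩
  have := deriv_nonneg_of_le_left hca (hd c hcm hc0).neg
    (fun y hy => by
      rcases eq_or_lt_of_le hy.2 with h | h
      · simp [h]
      · have := hlt y ⟨hy.1.le, h⟩
        simp only [Pi.neg_apply, hc0]; linarith)
  linarith [hz c hcm hc0]

end

section

open Set Filter Topology
open scoped ContDiff

/-! ### Power series with geometrically bounded coefficients -/

/-- The sum of the power series with coefficients `a`. -/
def powerSum (a : ℕ → ℝ) (x : ℝ) : ℝ := ∑' k, a k * x ^ k

theorem summable_norm_powerSum {a : ℕ → ℝ} {C R x : ℝ} (ha : ∀ k, |a k| ≤ C * R ^ k)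
    (hR : 0 < R) (hx : |x| < 1 / R) : Summable fun k => ‖a k * x ^ k‖ := by
  have h1 : R * |x| < 1 := by rwa [lt_div_iff₀ hR, mul_comm] at hx
  refine Summable.of_nonneg_of_le (fun k => norm_nonneg _) (fun k => ?_)
    ((summable_geometric_of_lt_one (by positivity) h1).mul_left C)
  rw [norm_mul, norm_pow, Real.norm_eq_abs, Real.norm_eq_abs, mul_pow, ← mul_assoc]
  gcongr
  exact ha k

theorem powerSum_zero (a : ℕ → ℝ) : powerSum a 0 = a 0 := by
  rw [powerSum, tsum_eq_single 0]
  · simp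
  · intro k hk; simp [hk]

/-- Since $k+1\le2^k$, one differentiation costs a doubling of the geometric rate. This is why the
radii 1/8, 1/16, 1/32 appear for the profile and its derivatives. -/
theorem succ_mul_bound {a : ℕ → ℝ} {C R : ℝ} (ha : ∀ k, |a k| ≤ C * R ^ k) (k : ℕ) :
    |(k + 1 : ℝ) * a (k + 1)| ≤ C * R * (2 * R) ^ k := by
  rw [abs_mul, abs_of_nonneg (by positivity : (0 : ℝ) ≤ k + 1)]
  have h1 : (k + 1 : ℝ) ≤ 2 ^ k := by
    exact_mod_cast Nat.lt_two_pow_self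
  calc (k + 1 : ℝ) * |a (k + 1)| ≤ 2 ^ k * (C * R ^ (k + 1)) :=
        mul_le_mul h1 (ha _) (abs_nonneg _) (by positivity)
    _ = C * R * (2 * R) ^ k := by rw [mul_pow]; ring

/-- On half the radius of convergence the geometric factors combine to $2^{-k}$, and $k2^{-k}$ is a
summable majorant for termwise differentiation. -/
theorem deriv_term_bound {a : ℕ → ℝ} {C R y : ℝ} (ha : ∀ k, |a k| ≤ C * R ^ k) (hR : 0 < R)
    (hC : 0 ≤ C) (hy : |y| ≤ 1 / (2 * R)) (k : ℕ) :
    ‖a k * (k * y ^ (k - 1))‖ ≤ C * (2 * R) * ((k : ℝ) ^ 1 * (1 / 2 : ℝ) ^ k) := by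
  rcases k with _ | k
  · simp
  · rw [norm_mul, norm_mul, norm_pow, Real.norm_eq_abs, Real.norm_eq_abs, Real.norm_eq_abs,
      Nat.add_sub_cancel, Nat.abs_cast]
    have h1 : |y| ^ k ≤ (1 / (2 * R)) ^ k := pow_le_pow_left₀ (abs_nonneg _) hy k
    have h2 : R ^ k * (R⁻¹) ^ k = 1 := by rw [← mul_pow, mul_inv_cancel₀ hR.ne', one_pow]
    calc |a (k + 1)| * (((k + 1 : ℕ) : ℝ) * |y| ^ k)
        ≤ (C * R ^ (k + 1)) * (((k + 1 : ℕ) : ℝ) * (1 / (2 * R)) ^ k) :=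
          mul_le_mul (ha _) (mul_le_mul_of_nonneg_left h1 (Nat.cast_nonneg _))
            (by positivity) (by positivity)
      _ = C * (2 * R) * (((k + 1 : ℕ) : ℝ) ^ 1 * (1 / 2 : ℝ) ^ (k + 1)) := by
          rw [one_div, mul_inv, mul_pow, pow_succ R, pow_succ (1 / 2 : ℝ), one_div]
          linear_combination (C * R * ((k + 1 : ℕ) : ℝ) * (2 : ℝ)⁻¹ ^ k) * h2

theorem hasDerivAt_tsum_pow {a u : ℕ → ℝ} {R x : ℝ} (hu : Summable u) (hR : 0 < R)
    (hx : x ∈ Metric.ball (0 : ℝ) R)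
    (hb : ∀ (k : ℕ) (y : ℝ), y ∈ Metric.ball (0 : ℝ) R → ‖a k * (k * y ^ (k - 1))‖ ≤ u k)
    (h0 : Summable fun k : ℕ => a k * (0 : ℝ) ^ k) :
    HasDerivAt (fun y => ∑' k, a k * y ^ k) (∑' k, a k * (k * x ^ (k - 1))) x :=
  have hd : ∀ (k : ℕ) (y : ℝ), y ∈ Metric.ball (0 : ℝ) R →
      HasDerivAt (fun y => a k * y ^ k) (a k * (k * y ^ (k - 1))) y :=
    fun k y _ => (hasDerivAt_pow k y).const_mul _
  hasDerivAt_tsum_of_isPreconnected hu Metric.isOpen_ball (convex_ball 0 _).isPreconnected hd hb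
    (Metric.mem_ball_self hR) h0 hx

theorem hasDerivAt_powerSum {a : ℕ → ℝ} {C R x : ℝ} (ha : ∀ k, |a k| ≤ C * R ^ k) (hR : 0 < R)
    (hx : |x| < 1 / (2 * R)) :
    HasDerivAt (powerSum a) (powerSum (fun k => (k + 1 : ℝ) * a (k + 1)) x) x := by
  have hC : 0 ≤ C := by
    have := (abs_nonneg (a 0)).trans (ha 0)
    rwa [pow_zero, mul_one] at this
  have hu : Summable fun k : ℕ => C * (2 * R) * ((k : ℝ) ^ 1 * (1 / 2 : ℝ) ^ k) :=
    Summable.mul_left _ (summable_pow_mul_geometric_of_norm_lt_one (R := ℝ) 1 (r := 1 / 2)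
      (by rw [Real.norm_eq_abs, abs_of_pos] <;> norm_num))
  have h0 : Summable fun k : ℕ => a k * (0 : ℝ) ^ k :=
    summable_of_ne_finset_zero (s := {0}) fun k hk => by
      have : k ≠ 0 := by simpa using hk
      simp [this]
  have hpos : 0 < 1 / (2 * R) := by positivity
  have hb : ∀ (k : ℕ) (y : ℝ), y ∈ Metric.ball (0 : ℝ) (1 / (2 * R)) →
      ‖a k * (k * y ^ (k - 1))‖ ≤ C * (2 * R) * ((k : ℝ) ^ 1 * (1 / 2 : ℝ) ^ k) :=
    fun k y hy => deriv_term_bound ha hR hC (mem_ball_zero_iff.1 hy).le k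
  have h := hasDerivAt_tsum_pow hu hpos (mem_ball_zero_iff.2 hx) hb h0
  have hs : Summable fun k : ℕ => a k * (k * x ^ (k - 1)) := by
    rw [← summable_nat_add_iff 1]
    have := (summable_norm_powerSum (succ_mul_bound ha) (by positivity : 0 < 2 * R) hx).of_norm
    refine this.congr fun k => ?_
    push_cast; ring
  have he : ∑' k : ℕ, a k * (k * x ^ (k - 1)) = powerSum (fun k => (k + 1 : ℝ) * a (k + 1)) x := by
    rw [hs.tsum_eq_zero_add, powerSum]
    simp only [Nat.cast_zero, zero_mul, mul_zero, zero_add]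
    refine tsum_congr fun k => ?_
    push_cast; ring
  rw [← he]
  exact h

theorem hasSum_powerSum_mul {a b : ℕ → ℝ} {C R C' R' x : ℝ} (ha : ∀ k, |a k| ≤ C * R ^ k)
    (hR : 0 < R) (hx : |x| < 1 / R) (hb : ∀ k, |b k| ≤ C' * R' ^ k) (hR' : 0 < R')
    (hx' : |x| < 1 / R') :
    HasSum (fun k => (∑ p ∈ Finset.HasAntidiagonal.antidiagonal k, a p.1 * b p.2) * x ^ k)
      (powerSum a x * powerSum b x) := by
  have h1 := summable_norm_powerSum ha hR hx
  have h2 := summable_norm_powerSum hb hR' hx'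
  have h3 := (summable_norm_sum_mul_antidiagonal_of_summable_norm h1 h2).of_norm.hasSum
  rw [← tsum_mul_tsum_eq_tsum_sum_antidiagonal_of_summable_norm h1 h2] at h3
  refine HasSum.congr_fun (f := _) h3 fun k => ?_
  rw [Finset.sum_mul]
  refine Finset.sum_congr rfl fun p hp => ?_
  rw [← Finset.HasAntidiagonal.mem_antidiagonal.1 hp, pow_add]
  ring

theorem contDiffAt_powerSum {a : ℕ → ℝ} {C R x : ℝ} (ha : ∀ k, |a k| ≤ C * R ^ k) (hR : 0 < R)
    (hx : |x| < 1 / R) : ContDiffAt ℝ ∞ (powerSum a) x := by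
  set p := FormalMultilinearSeries.ofScalars ℝ a with hp
  have hrad : ENNReal.ofReal (1 / R) ≤ p.radius := by
    refine p.le_radius_of_bound C (r := (1 / R).toNNReal) fun k => ?_
    rw [hp, FormalMultilinearSeries.ofScalars_norm, Real.coe_toNNReal _ (by positivity)]
    calc ‖a k‖ * (1 / R) ^ k ≤ C * R ^ k * (1 / R) ^ k := by gcongr; exact ha k
      _ = C := by rw [mul_assoc, ← mul_pow, mul_one_div_cancel hR.ne', one_pow, mul_one]
  have hball := p.hasFPowerSeriesOnBall
    (lt_of_lt_of_le (ENNReal.ofReal_pos.2 (by positivity)) hrad)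
  have hsum : p.sum = powerSum a := by
    funext y
    simp [powerSum, FormalMultilinearSeries.sum, hp, mul_comm]
  have han : AnalyticAt ℝ p.sum x := by
    refine hball.analyticAt_of_mem ?_
    rw [Metric.mem_eball, edist_zero_right]
    refine lt_of_lt_of_le ?_ hrad
    rw [← ofReal_norm]
    exact (ENNReal.ofReal_lt_ofReal_iff (by positivity)).2 hx
  rw [← hsum]
  exact han.contDiffAt

end

section

open Set Filter Topology
open scoped ContDiff

/-! ### The Bryant profile near the origin -/

theorem nat_mul_bound {a : ℕ → ℝ} {C R : ℝ} (ha : ∀ k, |a k| ≤ C * R ^ k) (k : ℕ) :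
    |(k : ℝ) * a k| ≤ C * (2 * R) ^ k := by
  rw [abs_mul, abs_of_nonneg (by positivity : (0 : ℝ) ≤ k)]
  have h1 : (k : ℝ) ≤ 2 ^ k := by
    exact_mod_cast Nat.lt_two_pow_self.le
  calc (k : ℝ) * |a k| ≤ 2 ^ k * (C * R ^ k) :=
        mul_le_mul h1 (ha _) (abs_nonneg _) (by positivity)
    _ = C * (2 * R) ^ k := by rw [mul_pow]; ring

theorem powerSum_nat_mul {a : ℕ → ℝ} {C R x : ℝ} (ha : ∀ k, |a k| ≤ C * R ^ k) (hR : 0 < R)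
    (hx : |x| < 1 / (2 * R)) :
    powerSum (fun k => (k : ℝ) * a k) x = x * powerSum (fun k => (k + 1 : ℝ) * a (k + 1)) x := by
  have hs := (summable_norm_powerSum (nat_mul_bound ha) (by positivity : 0 < 2 * R) hx).of_norm
  rw [powerSum, hs.tsum_eq_zero_add, powerSum, ← tsum_mul_left]
  simp only [Nat.cast_zero, zero_mul, zero_add]
  refine tsum_congr fun k => ?_
  push_cast; ring

/-- Taylor coefficients of the Bryant profile minus one, as a function of `σ²`. -/
def bryantCoeff (m : ℝ) : ℕ → ℝ
  | 0 => 0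
  -- The equation leaves this coefficient free, reflecting the scaling $\sigma\mapsto k\sigma$. The
  -- value chosen makes the constant of the first integral equal to $m^2$, which yields
  -- $\sigma^2\mathfrak B\to1$.
  | 1 => -(m ^ 2 / ((m + 1) * (m + 2)))
  | k + 2 => (∑ i : Fin (k + 1),
      (-4 * ((k - i + 1 : ℕ) : ℝ) * ((k - i : ℕ) : ℝ)
        + 2 * ((i + 1 : ℕ) : ℝ) * ((k - i + 1 : ℕ) : ℝ) + 2 * m)
      * (bryantCoeff m (i + 1) * bryantCoeff m (k - i + 1)))
      / (2 * (2 * (k + 2) + m) * (k + 1))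

theorem bryantCoeff_add_two (m : ℝ) (k : ℕ) : bryantCoeff m (k + 2) = (∑ i : Fin (k + 1),
      (-4 * ((k - i + 1 : ℕ) : ℝ) * ((k - i : ℕ) : ℝ)
        + 2 * ((i + 1 : ℕ) : ℝ) * ((k - i + 1 : ℕ) : ℝ) + 2 * m)
      * (bryantCoeff m (i + 1) * bryantCoeff m (k - i + 1)))
      / (2 * (2 * (k + 2) + m) * (k + 1)) := by
  rw [bryantCoeff]

/-- The weight in the recursion is at most twice its denominator, uniformly in $m\ge1$. This ratio
is the source of the factor $2^k$ in the coefficient bound. -/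
theorem bryantCoeff_weight_bound {m i j k : ℝ} (hm : 1 ≤ m) (hi : 1 ≤ i) (hj : 1 ≤ j)
    (hk : i + j = k + 2) :
    |-4 * j * (j - 1) + 2 * i * j + 2 * m| ≤ 2 * (2 * (2 * (k + 2) + m) * (k + 1)) := by
  obtain rfl : k = i + j - 2 := by linarith
  rw [abs_le]
  constructor <;> nlinarith [mul_nonneg (sub_nonneg.2 hi) (sub_nonneg.2 hj),
    mul_nonneg (sub_nonneg.2 hi) (sub_nonneg.2 hi), mul_nonneg (sub_nonneg.2 hj) (sub_nonneg.2 hj),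
    mul_nonneg (sub_nonneg.2 hm) (sub_nonneg.2 hj), mul_nonneg (sub_nonneg.2 hm) (sub_nonneg.2 hi)]

/-- The recursion is a convolution with weights of ratio at most 2, so induction compares it with
the Catalan convolution $c_{k+1}=\sum c_ic_{k-i}$. -/
theorem abs_bryantCoeff_le_catalan {m : ℝ} (hm : 1 ≤ m) (k : ℕ) :
    |bryantCoeff m (k + 1)| ≤ 2 ^ k * catalan k := by
  induction k using Nat.strong_induction_on with
  | _ k ih =>
    rcases k with _ | k
    · simp only [zero_add, bryantCoeff, pow_zero, catalan_zero, abs_neg]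
      rw [abs_of_nonneg (by positivity), div_le_iff₀ (by positivity)]
      push_cast; nlinarith
    · have hden : 0 < 2 * (2 * ((k : ℝ) + 2) + m) * (k + 1) := by positivity
      rw [bryantCoeff_add_two, abs_div, abs_of_pos hden, div_le_iff₀ hden]
      refine (Finset.abs_sum_le_sum_abs _ _).trans ?_
      have hterm : ∀ i : Fin (k + 1), |(-4 * ((k - i + 1 : ℕ) : ℝ) * ((k - i : ℕ) : ℝ)
          + 2 * ((i + 1 : ℕ) : ℝ) * ((k - i + 1 : ℕ) : ℝ) + 2 * m)
          * (bryantCoeff m (i + 1) * bryantCoeff m (k - i + 1))|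
          ≤ (2 * (2 * (2 * ((k : ℝ) + 2) + m) * (k + 1)))
            * (2 ^ k * (catalan i * catalan (k - i) : ℕ)) := by
        intro i
        have hik : (i : ℕ) ≤ k := Nat.lt_succ_iff.1 i.2
        rw [abs_mul, abs_mul]
        have e : ((k - i : ℕ) : ℝ) = (k : ℝ) - (i : ℕ) := Nat.cast_sub hik
        refine mul_le_mul ?_ ?_ (by positivity) (by positivity)
        · have := bryantCoeff_weight_bound (m := m) (i := (i : ℕ) + 1) (j := (k : ℝ) - (i : ℕ) + 1)
            (k := k) hm (by simp) (by rw [← e]; simp) (by ring)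
          push_cast
          rw [e]
          rw [show (k : ℝ) - (i : ℕ) = (k : ℝ) - (i : ℕ) + 1 - 1 by ring]
          rw [show (k : ℝ) - (i : ℕ) + 1 - 1 + 1 = (k : ℝ) - (i : ℕ) + 1 by ring]
          exact this
        · calc |bryantCoeff m (i + 1)| * |bryantCoeff m (k - i + 1)|
              ≤ (2 ^ (i : ℕ) * catalan i) * (2 ^ (k - i) * catalan (k - i)) :=
                mul_le_mul (ih i (by omega)) (ih (k - i) (by omega)) (abs_nonneg _) (by positivity)
            _ = 2 ^ k * (catalan i * catalan (k - i) : ℕ) := by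
                have h2 : (2 : ℝ) ^ k = 2 ^ (i : ℕ) * 2 ^ (k - i) := by
                  rw [← pow_add, Nat.add_sub_cancel' hik]
                rw [h2]; push_cast; ring
      refine (Finset.sum_le_sum fun i _ => hterm i).trans ?_
      rw [← Finset.mul_sum, ← Finset.mul_sum, catalan_succ]
      push_cast
      rw [pow_succ]
      apply le_of_eq; ring

theorem catalan_le_four_pow (k : ℕ) : catalan k ≤ 4 ^ k := by
  rw [catalan_eq_centralBinom_div]
  refine (Nat.div_le_self _ _).trans ?_
  rw [Nat.centralBinom_eq_two_mul_choose, show 4 = 2 ^ 2 by norm_num, ← pow_mul]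
  exact Nat.choose_le_two_pow _ _

theorem abs_bryantCoeff_le {m : ℝ} (hm : 1 ≤ m) (k : ℕ) : |bryantCoeff m k| ≤ 1 * 8 ^ k := by
  rcases k with _ | k
  · simp [bryantCoeff]
  · refine (abs_bryantCoeff_le_catalan hm k).trans ?_
    have h : (catalan k : ℝ) ≤ 4 ^ k := by exact_mod_cast catalan_le_four_pow k
    calc (2 : ℝ) ^ k * catalan k ≤ 2 ^ k * 4 ^ k := by gcongr
      _ = 8 ^ k := by rw [← mul_pow]; norm_num
      _ ≤ 1 * 8 ^ (k + 1) := by rw [one_mul]; exact pow_le_pow_right₀ (by norm_num) (by omega)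

/-- This is the coefficient of $x^k$ in the soliton equation. The factor of the linear term vanishes
at $k=1$, where the coefficient is free; the two end terms of the convolution drop out because the
zeroth coefficient is 0. -/
theorem bryantCoeff_recursion {m : ℝ} (hm : 1 ≤ m) (k : ℕ) :
    (4 * k * (k - 1) + 2 * m * (k - 1)) * bryantCoeff m k
      + ∑ p ∈ Finset.HasAntidiagonal.antidiagonal k,
        (4 * ((p.2 : ℝ) * (p.2 - 1)) - 2 * (p.1 * p.2) - 2 * m)
          * (bryantCoeff m p.1 * bryantCoeff m p.2) = 0 := by
  rw [Finset.Nat.sum_antidiagonal_eq_sum_range_succ_mk]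
  rcases k with _ | _ | k
  · simp [bryantCoeff]
  · simp [bryantCoeff, Finset.sum_range_succ]
  · have hden : 2 * (2 * ((k : ℝ) + 2) + m) * (k + 1) ≠ 0 := by positivity
    rw [Finset.sum_range_succ, Finset.sum_range_succ']
    simp only [Nat.sub_self, bryantCoeff.eq_1, zero_mul, mul_zero, add_zero]
    rw [bryantCoeff_add_two, ← Fin.sum_univ_eq_sum_range (fun i => _) (k + 1)]
    rw [show (4 * ((k + 1 + 1 : ℕ) : ℝ) * (((k + 1 + 1 : ℕ) : ℝ) - 1)
      + 2 * m * (((k + 1 + 1 : ℕ) : ℝ) - 1)) = 2 * (2 * ((k : ℝ) + 2) + m) * (k + 1) by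
        push_cast; ring, mul_div_cancel₀ _ hden, ← Finset.sum_add_distrib]
    refine Finset.sum_eq_zero fun i _ => ?_
    have hik : (i : ℕ) ≤ k := Nat.lt_succ_iff.1 i.2
    have e : ((k - i : ℕ) : ℝ) = (k : ℝ) - (i : ℕ) := Nat.cast_sub hik
    rw [show k + 1 + 1 - ((i : ℕ) + 1) = k - i + 1 by omega]
    push_cast
    rw [e]
    ring

/-- The local Bryant profile minus one, in the variable `σ²`, with its first two derivatives. -/
def bryantH (m : ℝ) : ℝ → ℝ := powerSum (bryantCoeff m)

def bryantH1 (m : ℝ) : ℝ → ℝ := powerSum fun k => (k + 1 : ℝ) * bryantCoeff m (k + 1)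

def bryantH2 (m : ℝ) : ℝ → ℝ :=
  powerSum fun k => (k + 1 : ℝ) * (((k + 1 : ℕ) + 1 : ℝ) * bryantCoeff m (k + 1 + 1))

theorem hasDerivAt_bryantH {m x : ℝ} (hm : 1 ≤ m) (hx : |x| < 1 / 16) :
    HasDerivAt (bryantH m) (bryantH1 m x) x :=
  hasDerivAt_powerSum (abs_bryantCoeff_le hm) (by norm_num) (by norm_num at hx ⊢; exact hx)

theorem hasDerivAt_bryantH1 {m x : ℝ} (hm : 1 ≤ m) (hx : |x| < 1 / 32) :
    HasDerivAt (bryantH1 m) (bryantH2 m x) x :=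
  hasDerivAt_powerSum (succ_mul_bound (abs_bryantCoeff_le hm)) (by norm_num)
    (by norm_num at hx ⊢; exact hx)

theorem contDiffAt_bryantH {m x : ℝ} (hm : 1 ≤ m) (hx : |x| < 1 / 8) :
    ContDiffAt ℝ ∞ (bryantH m) x :=
  contDiffAt_powerSum (abs_bryantCoeff_le hm) (by norm_num) hx

theorem bryantH_zero (m : ℝ) : bryantH m 0 = 0 := by
  rw [bryantH, powerSum_zero, bryantCoeff]

theorem bryantH1_zero (m : ℝ) : bryantH1 m 0 = -(m ^ 2 / ((m + 1) * (m + 2))) := by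
  rw [bryantH1, powerSum_zero]; simp [bryantCoeff]

/-- After multiplication by $x$ the soliton equation involves only $xh'$ and $x^2h''$, which act
diagonally on coefficients as $k$ and $k(k-1)$. The identity then reduces to `bryantCoeff_recursion`
coefficient by coefficient. -/
theorem bryantH_ode {m x : ℝ} (hm : 1 ≤ m) (hx : |x| < 1 / 32) :
    4 * (1 + bryantH m x) * (x ^ 2 * bryantH2 m x) - 2 * (x * bryantH1 m x) ^ 2
      + 2 * m * (x * bryantH1 m x) - 2 * m * (bryantH m x * (1 + bryantH m x)) = 0 := by
  have b0 := abs_bryantCoeff_le hm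
  have b1 := nat_mul_bound b0
  have b1' := succ_mul_bound b0
  have b2 : ∀ k : ℕ, |(k : ℝ) * ((k - 1) * bryantCoeff m k)| ≤ 1 * 32 ^ k := by
    intro k
    have h1 := nat_mul_bound b1 k
    rcases k with _ | k
    · simp
    · refine le_trans ?_ (h1.trans (by norm_num))
      rw [abs_mul, abs_mul, abs_mul, abs_mul]
      have h0 : (0 : ℝ) ≤ ((k + 1 : ℕ) : ℝ) - 1 := by push_cast; linarith [k.cast_nonneg (α := ℝ)]
      have h2 : |((k + 1 : ℕ) : ℝ) - 1| ≤ |((k + 1 : ℕ) : ℝ)| := by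
        rw [abs_of_nonneg h0, abs_of_nonneg (by positivity)]
        linarith
      gcongr
  have hx8 : |x| < 1 / 8 := by linarith
  have hx16 : |x| < 1 / (2 * 8) := by norm_num at hx ⊢; linarith
  have e1 : powerSum (fun k => (k : ℝ) * bryantCoeff m k) x = x * bryantH1 m x :=
    powerSum_nat_mul b0 (by norm_num) hx16
  have e2 : powerSum (fun k => (k : ℝ) * ((k - 1) * bryantCoeff m k)) x
      = x ^ 2 * bryantH2 m x := by
    have h1 := powerSum_nat_mul b1' (x := x) (by norm_num) (by norm_num at hx ⊢; exact hx)
    rw [bryantH2, pow_two, mul_assoc]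
    have hs := (summable_norm_powerSum b2 (by norm_num) hx).of_norm
    rw [← h1, powerSum, hs.tsum_eq_zero_add, powerSum, ← tsum_mul_left]
    simp only [Nat.cast_zero, zero_mul, zero_add]
    refine tsum_congr fun k => ?_
    push_cast; ring
  have s0 := (summable_norm_powerSum b0 (by norm_num) hx8).of_norm.hasSum
  have s1 := (summable_norm_powerSum b1 (by norm_num) hx16).of_norm.hasSum
  have s2 := (summable_norm_powerSum b2 (by norm_num) hx).of_norm.hasSum
  have p02 := hasSum_powerSum_mul b0 (by norm_num) hx8 b2 (by norm_num) hx
  have p11 := hasSum_powerSum_mul b1 (by norm_num) hx16 b1 (by norm_num) hx16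
  have p00 := hasSum_powerSum_mul b0 (by norm_num) hx8 b0 (by norm_num) hx8
  change HasSum _ (powerSum _ x) at s0
  change HasSum _ (powerSum _ x) at s1
  change HasSum _ (powerSum _ x) at s2
  rw [e2] at p02 s2
  rw [e1] at p11 s1
  have total := ((((s2.mul_left 4).add (s1.mul_left (2 * m))).add (s0.mul_left (-(2 * m)))).add
    (p02.mul_left 4)).add ((p11.mul_left (-2)).add (p00.mul_left (-(2 * m))))
  have hz : ∀ k : ℕ, (4 * ((k : ℝ) * ((k - 1) * bryantCoeff m k) * x ^ k)
      + 2 * m * ((k : ℝ) * bryantCoeff m k * x ^ k)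
      + -(2 * m) * (bryantCoeff m k * x ^ k)
      + 4 * ((∑ p ∈ Finset.HasAntidiagonal.antidiagonal k,
          bryantCoeff m p.1 * ((p.2 : ℝ) * ((p.2 - 1) * bryantCoeff m p.2))) * x ^ k)
      + (-2 * ((∑ p ∈ Finset.HasAntidiagonal.antidiagonal k,
          ((p.1 : ℝ) * bryantCoeff m p.1) * ((p.2 : ℝ) * bryantCoeff m p.2)) * x ^ k)
        + -(2 * m) * ((∑ p ∈ Finset.HasAntidiagonal.antidiagonal k,
          bryantCoeff m p.1 * bryantCoeff m p.2) * x ^ k))) = 0 := by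
    intro k
    have hk := bryantCoeff_recursion hm k
    have hsplit : ∑ p ∈ Finset.HasAntidiagonal.antidiagonal k,
        (4 * ((p.2 : ℝ) * (p.2 - 1)) - 2 * (p.1 * p.2) - 2 * m)
          * (bryantCoeff m p.1 * bryantCoeff m p.2)
        = 4 * (∑ p ∈ Finset.HasAntidiagonal.antidiagonal k,
          bryantCoeff m p.1 * ((p.2 : ℝ) * ((p.2 - 1) * bryantCoeff m p.2)))
        - 2 * (∑ p ∈ Finset.HasAntidiagonal.antidiagonal k,
          ((p.1 : ℝ) * bryantCoeff m p.1) * ((p.2 : ℝ) * bryantCoeff m p.2))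
        - 2 * m * (∑ p ∈ Finset.HasAntidiagonal.antidiagonal k,
          bryantCoeff m p.1 * bryantCoeff m p.2) := by
      rw [Finset.mul_sum, Finset.mul_sum, Finset.mul_sum, ← Finset.sum_sub_distrib,
        ← Finset.sum_sub_distrib]
      refine Finset.sum_congr rfl fun p _ => ?_
      ring
    rw [hsplit] at hk
    linear_combination x ^ k * hk
  have hzero := total.unique ((hasSum_zero).congr_fun fun k => hz k)
  have hH : powerSum (bryantCoeff m) x = bryantH m x := rfl
  rw [hH] at hzero
  linear_combination hzero

end

section

open Set Filter Topology
open scoped ContDiff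

/-! ### First integral and global continuation of the Bryant profile -/

/-- Right-hand side of the first order equation satisfied by the Bryant profile in the variable
`x = σ²`, obtained from the conservation law for steady solitons. -/
def bryantField (m x b : ℝ) : ℝ :=
  (m + b - Real.sqrt (b * (m ^ 2 * x + m * (m + 1) + (m + 1) * b))) / x

/-- This difference decides the sign of `bryantField`: for positive $x$ and $b$, the field is
positive exactly when $mxb<(m+b)(1-b)$. -/
theorem sq_inside_diff (m x b : ℝ) : b * (m ^ 2 * x + m * (m + 1) + (m + 1) * b) - (m + b) ^ 2
    = m * (m * x * b - (m + b) * (1 - b)) := by ring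

/-- With `bryantField_inv_pos`, this says that the field points into the region $1/(1+x)<b<1$:
downwards at the upper edge, and upwards at the lower edge, which itself decreases. -/
theorem bryantField_one_neg {m x : ℝ} (hm : 1 ≤ m) (hx : 0 < x) : bryantField m x 1 < 0 := by
  apply div_neg_of_neg_of_pos _ hx
  rw [sub_neg]
  apply Real.lt_sqrt_of_sq_lt
  have := sq_inside_diff m x 1
  have h2 : 0 < m * (m * x * 1 - (m + 1) * (1 - 1)) := by simp; positivity
  linarith

theorem bryantField_inv_pos {m x : ℝ} (hm : 1 ≤ m) (hx : 0 < x) :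
    0 < bryantField m x (1 / (1 + x)) := by
  apply div_pos _ hx
  rw [sub_pos, Real.sqrt_lt' (by positivity)]
  have := sq_inside_diff m x (1 / (1 + x))
  have h2 : m * (m * x * (1 / (1 + x)) - (m + 1 / (1 + x)) * (1 - 1 / (1 + x)))
      = -(m * x / (1 + x) ^ 2) := by field_simp; ring
  have h3 : 0 < m * x / (1 + x) ^ 2 := by positivity
  linarith

theorem abs_sqrt_sub_sqrt_le {a b c : ℝ} (hc : 0 < c) (ha : c ≤ a) (hb : c ≤ b) :
    |Real.sqrt a - Real.sqrt b| ≤ |a - b| / Real.sqrt c := by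
  have hc' : 0 < Real.sqrt c := Real.sqrt_pos.2 hc
  rw [le_div_iff₀ hc']
  have h1 : Real.sqrt c ≤ Real.sqrt a + Real.sqrt b :=
    (Real.sqrt_le_sqrt ha).trans (le_add_of_nonneg_right (Real.sqrt_nonneg b))
  have h2 : a - b = (Real.sqrt a - Real.sqrt b) * (Real.sqrt a + Real.sqrt b) := by
    have e1 := Real.sq_sqrt (hc.le.trans ha)
    have e2 := Real.sq_sqrt (hc.le.trans hb)
    linear_combination -e1 + e2
  rw [h2, abs_mul, abs_of_nonneg (by positivity : 0 ≤ Real.sqrt a + Real.sqrt b)]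
  exact mul_le_mul_of_nonneg_left h1 (abs_nonneg _)

/-- The square root is Lipschitz only away from zero, so $b$ has to be bounded below; the trapping
region supplies such a bound on every compact interval. -/
theorem bryantField_lipschitz {m x₀ X c : ℝ} (hm : 1 ≤ m) (hx₀ : 0 < x₀) (hX : x₀ ≤ X)
    (hc : 0 < c) : ∃ K : NNReal, ∀ x ∈ Icc x₀ X, LipschitzOnWith K (bryantField m x) (Icc c 1) := by
  refine ⟨((1 + (m ^ 2 * X + m * (m + 1) + 2 * (m + 1)) / Real.sqrt c) / x₀).toNNReal,
    fun x hx => LipschitzOnWith.of_dist_le_mul fun a ha b hb => ?_⟩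
  have hX0 : 0 < X := hx₀.trans_le hX
  have hxp : 0 < x := hx₀.trans_le hx.1
  have hsc : 0 < Real.sqrt c := Real.sqrt_pos.2 hc
  rw [Real.coe_toNNReal _ (by positivity), Real.dist_eq, Real.dist_eq, bryantField, bryantField,
    ← sub_div, abs_div, abs_of_pos hxp, div_mul_eq_mul_div]
  have key : |m + a - Real.sqrt (a * (m ^ 2 * x + m * (m + 1) + (m + 1) * a)) -
      (m + b - Real.sqrt (b * (m ^ 2 * x + m * (m + 1) + (m + 1) * b)))|
      ≤ (1 + (m ^ 2 * X + m * (m + 1) + 2 * (m + 1)) / Real.sqrt c) * |a - b| := by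
    have hlow : ∀ b ∈ Icc c 1, c ≤ b * (m ^ 2 * x + m * (m + 1) + (m + 1) * b) := by
      intro b hb
      have hb0 : 0 < b := hc.trans_le hb.1
      have : 1 ≤ m ^ 2 * x + m * (m + 1) + (m + 1) * b := by
        have : 0 < m ^ 2 * x := by positivity
        have : 0 < (m + 1) * b := by positivity
        nlinarith
      nlinarith [hb.1]
    have h1 := abs_sqrt_sub_sqrt_le hc (hlow a ha) (hlow b hb)
    have h2 : |a * (m ^ 2 * x + m * (m + 1) + (m + 1) * a)
        - b * (m ^ 2 * x + m * (m + 1) + (m + 1) * b)|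
        ≤ (m ^ 2 * X + m * (m + 1) + 2 * (m + 1)) * |a - b| := by
      rw [show a * (m ^ 2 * x + m * (m + 1) + (m + 1) * a)
        - b * (m ^ 2 * x + m * (m + 1) + (m + 1) * b)
        = (m ^ 2 * x + m * (m + 1) + (m + 1) * (a + b)) * (a - b) by ring, abs_mul]
      have ha0 : 0 < a := hc.trans_le ha.1
      have hb0 : 0 < b := hc.trans_le hb.1
      rw [abs_of_nonneg (a := m ^ 2 * x + m * (m + 1) + (m + 1) * (a + b)) (by positivity)]
      refine mul_le_mul_of_nonneg_right ?_ (abs_nonneg _)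
      have : m ^ 2 * x ≤ m ^ 2 * X := mul_le_mul_of_nonneg_left hx.2 (by positivity)
      nlinarith [ha.2, hb.2]
    calc _ = |(a - b) - (Real.sqrt (a * (m ^ 2 * x + m * (m + 1) + (m + 1) * a)) -
          Real.sqrt (b * (m ^ 2 * x + m * (m + 1) + (m + 1) * b)))| := by ring_nf
      _ ≤ |a - b| + (m ^ 2 * X + m * (m + 1) + 2 * (m + 1)) * |a - b| / Real.sqrt c :=
        (abs_sub _ _).trans (add_le_add le_rfl (h1.trans (by gcongr)))
      _ = _ := by ring
  calc _ ≤ ((1 + (m ^ 2 * X + m * (m + 1) + 2 * (m + 1)) / Real.sqrt c) * |a - b|) / x := by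
        gcongr
    _ ≤ _ := by
        gcongr
        exact hx.1

theorem continuousOn_bryantField {m : ℝ} :
    ContinuousOn (fun p : ℝ × ℝ => bryantField m p.1 p.2) (Ioi 0 ×ˢ univ) := by
  unfold bryantField
  refine ContinuousOn.div (by fun_prop) (by fun_prop) fun p hp => ne_of_gt hp.1

/-- Clamping the unknown to $[c,1]$ makes the field globally Lipschitz, so a solution exists on the
whole interval. The inward pointing field then shows that the clamp is never active. -/
theorem exists_bryant_on_Icc {m x₀ b₀ X : ℝ} (hm : 1 ≤ m) (hx₀ : 0 < x₀) (hX : x₀ < X)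
    (hb : 1 / (1 + x₀) < b₀) (hb1 : b₀ < 1) :
    ∃ α : ℝ → ℝ, α x₀ = b₀ ∧ ContinuousOn α (Icc x₀ X) ∧
      (∀ x ∈ Ioo x₀ X, HasDerivAt α (bryantField m x (α x)) x) ∧
      (∀ x ∈ Ico x₀ X, HasDerivWithinAt α (bryantField m x (α x)) (Ici x) x) ∧
      ∀ x ∈ Icc x₀ X, 1 / (1 + x) < α x ∧ α x < 1 := by
  have hX0 : 0 < X := hx₀.trans hX
  -- Solving up to $X+1$ makes $X$ an interior point, so two-sided derivatives are available on
  -- $(x_0,X]$.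
  set c := 1 / (1 + (X + 1)) with hc
  have hc0 : 0 < c := by positivity
  have hc1 : c ≤ 1 := by rw [hc, div_le_one (by positivity)]; linarith
  obtain ⟨K, hK⟩ := bryantField_lipschitz hm hx₀ (by linarith : x₀ ≤ X + 1) hc0
  obtain ⟨L, hL⟩ : ∃ L : ℝ, ∀ p ∈ Icc x₀ (X + 1) ×ˢ Icc c 1, ‖bryantField m p.1 p.2‖ ≤ L :=
    (isCompact_Icc.prod isCompact_Icc).exists_bound_of_continuousOn
      (continuousOn_bryantField.mono fun p hp => ⟨hx₀.trans_le hp.1.1, mem_univ _⟩)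
  set cl : ℝ → ℝ := fun b => max c (min b 1) with hcl
  have hclm : ∀ b, cl b ∈ Icc c 1 := fun b => ⟨le_max_left _ _, max_le hc1 (min_le_right _ _)⟩
  have hclid : ∀ b ∈ Icc c 1, cl b = b := fun b hb => by
    rw [hcl]; simp [hb.1, hb.2]
  have hcll : LipschitzWith 1 cl :=
    (LipschitzWith.id.min_const 1).const_max c
  have hL0 : 0 ≤ L := (norm_nonneg _).trans
    (hL (x₀, c) ⟨⟨le_rfl, by linarith⟩, ⟨le_rfl, hc1⟩⟩)
  -- The clamped field is bounded by $L$ for every value of the unknown, so the ball may be given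
  -- the radius $L(X+1-x_0)$ and no smallness of the interval is needed.
  have hPL : IsPicardLindelof (fun x b => bryantField m x (cl b))
      (⟨x₀, ⟨le_rfl, by linarith⟩⟩ : Icc x₀ (X + 1)) b₀
      (L.toNNReal * (X + 1 - x₀).toNNReal) 0 L.toNNReal K := by
    refine ⟨fun x hx => ?_, fun b _ => ?_, fun x hx b _ => ?_, ?_⟩
    · have := (hK x hx).comp (hcll.lipschitzOnWith (s := univ)) (fun b _ => hclm b)
      rw [mul_one] at this
      exact this.mono (subset_univ _)
    · exact continuousOn_bryantField.comp (f := fun x => (x, cl b)) (by fun_prop)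
        fun x hx => ⟨hx₀.trans_le hx.1, mem_univ _⟩
    · rw [Real.coe_toNNReal _ hL0]
      exact hL (x, cl b) ⟨hx, hclm b⟩
    · simp only [sub_self, NNReal.coe_mul, NNReal.coe_zero, sub_zero]
      rw [Real.coe_toNNReal (X + 1 - x₀) (by linarith), max_eq_left (by linarith)]
  obtain ⟨α, hα0, hα⟩ := hPL.exists_eq_forall_mem_Icc_hasDerivWithinAt₀
  have hcont : ContinuousOn α (Icc x₀ (X + 1)) := fun x hx => (hα x hx).continuousWithinAt
  have hder : ∀ x ∈ Ioo x₀ (X + 1), HasDerivAt α (bryantField m x (cl (α x))) x := fun x hx =>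
    (hα x ⟨hx.1.le, hx.2.le⟩).hasDerivAt (Icc_mem_nhds hx.1 hx.2)
  simp only at hα0
  have hsub : Icc x₀ X ⊆ Icc x₀ (X + 1) := Icc_subset_Icc_right (by linarith)
  have hup : ∀ x ∈ Icc x₀ X, 0 < 1 - α x := by
    refine pos_of_deriv_pos_at_zeros (f' := fun x => -bryantField m x (cl (α x)))
      (by rw [hα0]; linarith)
      (continuousOn_const.sub (hcont.mono hsub)) (fun x hx _ => ?_) (fun x hx h0 => ?_)
    · exact (hder x ⟨hx.1, by linarith [hx.2]⟩).const_sub 1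
    · have : α x = 1 := by linarith
      rw [this, hclid 1 ⟨hc1, le_rfl⟩]
      exact neg_pos.2 (bryantField_one_neg hm (hx₀.trans hx.1))
  have hlo : ∀ x ∈ Icc x₀ X, 0 < α x - 1 / (1 + x) := by
    refine pos_of_deriv_pos_at_zeros
      (f' := fun x => bryantField m x (cl (α x)) - -1 / (1 + x) ^ 2)
      (by rw [hα0]; linarith)
      ((hcont.mono hsub).sub (ContinuousOn.div (by fun_prop) (by fun_prop) fun x hx => ?_))
      (fun x hx _ => ?_) (fun x hx h0 => ?_)
    · have := hx₀.trans_le hx.1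
      positivity
    · refine (hder x ⟨hx.1, by linarith [hx.2]⟩).sub ?_
      have hx0 : 0 < x := hx₀.trans hx.1
      have h1 : HasDerivAt (fun x : ℝ => 1 + x) 1 x := (hasDerivAt_id x).const_add 1
      simpa [one_div] using h1.fun_inv (by positivity)
    · have hx0 : 0 < x := hx₀.trans hx.1
      have he : α x = 1 / (1 + x) := by linarith
      have hmem : 1 / (1 + x) ∈ Icc c 1 := by
        refine ⟨?_, by rw [div_le_one (by positivity)]; linarith⟩
        rw [hc]; apply one_div_le_one_div_of_le (by positivity); linarith [hx.2]
      rw [he, hclid _ hmem]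
      have := bryantField_inv_pos hm hx0
      have h2 : 0 < 1 / (1 + x) ^ 2 := by positivity
      rw [neg_div]; linarith
  have hrange : ∀ x ∈ Icc x₀ X, cl (α x) = α x := fun x hx => by
    refine hclid _ ⟨?_, by linarith [hup x hx]⟩
    have hx0 : 0 < x := hx₀.trans_le hx.1
    have : c ≤ 1 / (1 + x) := by
      rw [hc]; apply one_div_le_one_div_of_le (by positivity); linarith [hx.2]
    linarith [hlo x hx]
  refine ⟨α, hα0, hcont.mono hsub, fun x hx => ?_, fun x hx => ?_, fun x hx =>
    ⟨by linarith [hlo x hx], by linarith [hup x hx]⟩⟩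
  · have h := hder x ⟨hx.1, by linarith [hx.2]⟩
    rwa [hrange x ⟨hx.1.le, hx.2.le⟩] at h
  · have h := hα x ⟨hx.1, by linarith [hx.2]⟩
    simp only [hrange x ⟨hx.1, hx.2.le⟩] at h
    refine h.mono_of_mem_nhdsWithin ?_
    have : Ico x (X + 1) ∈ 𝓝[≥] x := Ico_mem_nhdsGE (by linarith [hx.2])
    exact mem_of_superset this fun y hy => ⟨hx.1.trans hy.1, hy.2.le⟩

theorem bryant_unique {m x₀ X : ℝ} (hm : 1 ≤ m) (hx₀ : 0 < x₀) (hX : x₀ ≤ X) {f g : ℝ → ℝ}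
    (hf : ContinuousOn f (Icc x₀ X)) (hg : ContinuousOn g (Icc x₀ X))
    (hf' : ∀ x ∈ Ico x₀ X, HasDerivWithinAt f (bryantField m x (f x)) (Ici x) x)
    (hg' : ∀ x ∈ Ico x₀ X, HasDerivWithinAt g (bryantField m x (g x)) (Ici x) x)
    (hfb : ∀ x ∈ Icc x₀ X, 1 / (1 + x) < f x ∧ f x < 1)
    (hgb : ∀ x ∈ Icc x₀ X, 1 / (1 + x) < g x ∧ g x < 1) (h0 : f x₀ = g x₀) :
    EqOn f g (Icc x₀ X) := by
  have hX0 : 0 < X := hx₀.trans_le hX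
  obtain ⟨K, hK⟩ := bryantField_lipschitz hm hx₀ hX (by positivity : 0 < 1 / (1 + X))
  have hle : ∀ x ∈ Ico x₀ X, 1 / (1 + X) ≤ 1 / (1 + x) := fun x hx =>
    one_div_le_one_div_of_le (by linarith [hx.1]) (by linarith [hx.2])
  refine ODE_solution_unique_of_mem_Icc_right (v := bryantField m) (s := fun _ => Icc (1 / (1 + X)) 1)
    (fun x hx => hK x ⟨hx.1, hx.2.le⟩) hf hf' (fun x hx => ?_) hg hg' (fun x hx => ?_) h0
  · have := hfb x ⟨hx.1, hx.2.le⟩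
    exact ⟨(hle x hx).trans this.1.le, this.2.le⟩
  · have := hgb x ⟨hx.1, hx.2.le⟩
    exact ⟨(hle x hx).trans this.1.le, this.2.le⟩

end

/-! ### The conservation law and the global Bryant profile. -/

section

open Set Filter Topology
open scoped ContDiff

/-- The conserved quantity of the steady soliton equation, in terms of `b = 𝔅` and `p = -x b'`. -/
def bryantEnergy (m b p : ℝ) : ℝ := (p + m * (1 - b)) ^ 2 + (m + 1) * b * (2 * p + m * (1 - b))

theorem bryantEnergy_eq (m b p : ℝ) :
    bryantEnergy m b p = (p + m + b) ^ 2 - b * (m * (m + 1) + (m + 1) * b) := by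
  rw [bryantEnergy]; ring

/-- Completing the square, the conservation law determines $p+m+b$ up to sign; the nonnegative root
is the one in `bryantField`. -/
theorem field_of_energy {m x b p : ℝ} (hp : 0 ≤ p + m + b)
    (h : bryantEnergy m b p = m ^ 2 * (x * b)) : -p / x = bryantField m x b := by
  rw [bryantEnergy_eq] at h
  have : Real.sqrt (b * (m ^ 2 * x + m * (m + 1) + (m + 1) * b)) = p + m + b := by
    rw [show b * (m ^ 2 * x + m * (m + 1) + (m + 1) * b) = (p + m + b) ^ 2 by linear_combination -h]
    exact Real.sqrt_sq hp
  rw [bryantField, this]; ring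

theorem energy_of_field {m x b p : ℝ} (hm : 0 < m) (hx : 0 < x) (hb : 0 < b)
    (h : -p / x = bryantField m x b) :
    bryantEnergy m b p = m ^ 2 * (x * b) ∧ 0 < p + m + b := by
  have hS : 0 < b * (m ^ 2 * x + m * (m + 1) + (m + 1) * b) := by positivity
  have h2 : p + m + b = Real.sqrt (b * (m ^ 2 * x + m * (m + 1) + (m + 1) * b)) := by
    rw [bryantField, div_left_inj' hx.ne'] at h
    linarith
  have h3 := Real.sq_sqrt hS.le
  rw [← h2] at h3
  refine ⟨?_, by rw [h2]; exact Real.sqrt_pos.2 hS⟩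
  rw [bryantEnergy_eq]; linear_combination h3

theorem bryantH_tendsto_slope {m : ℝ} (hm : 1 ≤ m) :
    Tendsto (fun x => bryantH m x / x) (𝓝[>] 0) (𝓝 (-(m ^ 2 / ((m + 1) * (m + 2))))) := by
  have h := hasDerivAt_bryantH hm (x := 0) (by norm_num)
  rw [bryantH1_zero] at h
  have h2 := (hasDerivAt_iff_tendsto_slope.1 h).mono_left
    (nhdsWithin_mono 0 fun y (hy : 0 < y) => ne_of_gt hy)
  refine h2.congr fun x => ?_
  rw [slope_def_field, bryantH_zero]; simp

theorem bryantH1_tendsto {m : ℝ} (hm : 1 ≤ m) :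
    Tendsto (bryantH1 m) (𝓝[>] 0) (𝓝 (-(m ^ 2 / ((m + 1) * (m + 2))))) := by
  have h := (hasDerivAt_bryantH1 hm (x := 0) (by norm_num)).continuousAt
  rw [ContinuousAt, bryantH1_zero] at h
  exact h.mono_left nhdsWithin_le_nhds

theorem bryant_kappa {m : ℝ} (hm : 1 ≤ m) :
    0 < m ^ 2 / ((m + 1) * (m + 2)) ∧ m ^ 2 / ((m + 1) * (m + 2)) < 1 := by
  refine ⟨by positivity, ?_⟩
  rw [div_lt_one (by positivity)]
  nlinarith

/-- The initial slope of the profile is $-\kappa$ with $0<\kappa<1$, strictly between the slope $-1$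
of $1/(1+x)$ and the slope 0 of the constant 1. Hence the series starts inside the trapping region.
-/
theorem bryantH_local_range {m : ℝ} (hm : 1 ≤ m) : ∀ᶠ x in 𝓝[>] (0 : ℝ),
    x < 1 / 32 ∧ 1 / (1 + x) < 1 + bryantH m x ∧ 1 + bryantH m x < 1 ∧ bryantH1 m x < 0 := by
  obtain ⟨hk0, hk1⟩ := bryant_kappa hm
  set κ := m ^ 2 / ((m + 1) * (m + 2))
  have e1 := (bryantH_tendsto_slope hm).eventually (lt_mem_nhds (show -((1 + κ) / 2) < -κ by linarith))
  have e2 := (bryantH_tendsto_slope hm).eventually (gt_mem_nhds (show -κ < 0 by linarith))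
  have e3 := (bryantH1_tendsto hm).eventually (gt_mem_nhds (show -κ < 0 by linarith))
  have e4 : Tendsto (fun x : ℝ => 1 / (1 + x)) (𝓝[>] 0) (𝓝 1) := by
    have : ContinuousAt (fun x : ℝ => 1 / (1 + x)) 0 :=
      ContinuousAt.div (by fun_prop) (by fun_prop) (by norm_num)
    have := this.tendsto.mono_left (nhdsWithin_le_nhds (s := Ioi 0))
    simpa using this
  have e5 := e4.eventually (lt_mem_nhds (show (1 + κ) / 2 < 1 by linarith))
  have e6 : ∀ᶠ x : ℝ in 𝓝[>] 0, x < 1 / 32 :=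
    nhdsWithin_le_nhds (gt_mem_nhds (by norm_num))
  filter_upwards [e1, e2, e3, e5, e6, self_mem_nhdsWithin] with x h1 h2 h3 h5 h6 hx
  have hx : 0 < x := hx
  refine ⟨h6, ?_, ?_, h3⟩
  · have : -(1 / (1 + x)) < bryantH m x / x := by linarith
    rw [lt_div_iff₀ hx] at this
    have h7 : 1 / (1 + x) = 1 - 1 / (1 + x) * x := by field_simp; ring
    linarith
  · have : bryantH m x < 0 := by
      by_contra! h
      exact absurd h2 (not_lt.2 (div_nonneg h hx.le))
    linarith

/-- The derivative of energy$/(xb)$ is a multiple of the soliton equation, with $p+m+b$ acting as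
integrating factor. -/
theorem energy_derivative {m x b p b2 : ℝ} (hx : x ≠ 0)
    (hode : 4 * b * (x ^ 2 * b2) - 2 * p ^ 2 - 2 * m * p + 2 * m * ((1 - b) * b) = 0) :
    ((2 * (p + m * (1 - b)) * ((p / x - x * b2) + m * (p / x))
      + ((m + 1) * (-p / x) * (2 * p + m * (1 - b))
        + (m + 1) * b * (2 * (p / x - x * b2) + m * (p / x)))) * (x * b)
      - bryantEnergy m b p * (b + x * (-p / x))) / (x * b) ^ 2 = 0 := by
  have : ((2 * (p + m * (1 - b)) * ((p / x - x * b2) + m * (p / x))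
      + ((m + 1) * (-p / x) * (2 * p + m * (1 - b))
        + (m + 1) * b * (2 * (p / x - x * b2) + m * (p / x)))) * (x * b)
      - bryantEnergy m b p * (b + x * (-p / x))) = 0 := by
    rw [bryantEnergy]
    field_simp
    linear_combination (-(p + m + b) / 2) * hode
  rw [this, zero_div]

/-- The quotient energy$/(xb)$ is constant on the interval. As $x\to0$ it tends to
$(m+1)(m+2)\kappa$ with $-\kappa$ the first Taylor coefficient, and $\kappa$ was chosen to make this
$m^2$. -/
theorem bryantH_energy {m x₁ : ℝ} (hm : 1 ≤ m) (h32 : x₁ ≤ 1 / 32)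
    (hpos : ∀ x ∈ Ioo 0 x₁, 0 < 1 + bryantH m x) :
    ∀ x ∈ Ioo 0 x₁, bryantEnergy m (1 + bryantH m x) (-(x * bryantH1 m x))
      = m ^ 2 * (x * (1 + bryantH m x)) := by
  set Q : ℝ → ℝ := fun x => bryantEnergy m (1 + bryantH m x) (-(x * bryantH1 m x))
    / (x * (1 + bryantH m x)) with hQ
  have hQd : ∀ x ∈ Ioo 0 x₁, HasDerivAt Q 0 x := by
    intro x hx
    have hxa : |x| < 1 / 32 := by rw [abs_of_pos hx.1]; linarith [hx.2]
    have hB : HasDerivAt (fun x => 1 + bryantH m x) (bryantH1 m x) x :=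
      (hasDerivAt_bryantH hm (by linarith)).const_add 1
    have hp : HasDerivAt (fun x => -(x * bryantH1 m x)) (-(1 * bryantH1 m x + x * bryantH2 m x)) x :=
      ((hasDerivAt_id x).fun_mul (hasDerivAt_bryantH1 hm hxa)).fun_neg
    have h1B := hB.const_sub 1
    have hN := ((hp.fun_add (h1B.const_mul m)).fun_pow 2).fun_add
      ((hB.const_mul (m + 1)).fun_mul ((hp.const_mul 2).fun_add (h1B.const_mul m)))
    have hD := (hasDerivAt_id x).fun_mul hB
    have hb := hpos x hx
    have := hN.fun_div hD (mul_pos hx.1 hb).ne'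
    refine this.congr_deriv ?_
    have hode := bryantH_ode hm hxa
    have key := energy_derivative (m := m) (x := x) (b := 1 + bryantH m x)
      (p := -(x * bryantH1 m x)) (b2 := bryantH2 m x) hx.1.ne' (by linear_combination hode)
    rw [← key]
    have e : -(x * bryantH1 m x) / x = -bryantH1 m x := by field_simp [hx.1.ne']
    have e' : - -(x * bryantH1 m x) / x = bryantH1 m x := by
      rw [neg_neg]; field_simp [hx.1.ne']
    rw [e, e', bryantEnergy]
    simp only [id]
    congr 1
    ring
  have hconst : ∀ x ∈ Ioo 0 x₁, ∀ y ∈ Ioo 0 x₁, Q x = Q y := fun x hx y hy =>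
    isOpen_Ioo.is_const_of_deriv_eq_zero isPreconnected_Ioo
      (fun z hz => (hQd z hz).differentiableAt.differentiableWithinAt)
      (fun z hz => (hQd z hz).deriv) hx hy
  have hlim : Tendsto Q (𝓝[>] 0) (𝓝 (m ^ 2)) := by
    set κ := m ^ 2 / ((m + 1) * (m + 2)) with hκ
    have hB0 : Tendsto (fun x => 1 + bryantH m x) (𝓝[>] 0) (𝓝 1) := by
      have h := ((hasDerivAt_bryantH hm (x := 0) (by norm_num)).continuousAt.const_add
        (1 : ℝ)).tendsto.mono_left (nhdsWithin_le_nhds (s := Ioi 0))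
      simpa [bryantH_zero] using h
    have hx0 : Tendsto (fun x : ℝ => x) (𝓝[>] 0) (𝓝 0) := nhdsWithin_le_nhds
    have hs := bryantH_tendsto_slope hm
    have hs1 := bryantH1_tendsto hm
    have h := ((((hs1.neg.add (hs.neg.const_mul m)).pow 2).mul hx0).add
      ((hB0.const_mul (m + 1)).mul ((hs1.neg.const_mul 2).add (hs.neg.const_mul m)))).div hB0
      one_ne_zero
    have hval : ((- -κ + m * - -κ) ^ 2 * 0 + (m + 1) * 1 * (2 * - -κ + m * - -κ)) / 1 = m ^ 2 := by
      rw [hκ]; field_simp; ring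
    rw [hval] at h
    refine h.congr' ?_
    filter_upwards [self_mem_nhdsWithin] with x hx
    have hx : 0 < x := hx
    simp only [hQ, bryantEnergy, Pi.div_apply]
    by_cases hb : 1 + bryantH m x = 0
    · rw [hb]; simp
    · field_simp; ring
  intro x hx
  have hQx : Q x = m ^ 2 := by
    refine tendsto_nhds_unique ?_ hlim
    refine tendsto_const_nhds.congr' ?_
    have hx1 : 0 < x₁ := hx.1.trans hx.2
    filter_upwards [Ioo_mem_nhdsGT hx1] with y hy using hconst x hx y hy
  have hne : x * (1 + bryantH m x) ≠ 0 := (mul_pos hx.1 (hpos x hx)).ne'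
  rw [hQ] at hQx
  simp only at hQx
  rwa [div_eq_iff hne] at hQx

/-- Existence of the Bryant profile on the whole half line, as a solution of the first order
equation which is given near the origin by the convergent power series. -/
theorem exists_bryant_global {m : ℝ} (hm : 1 ≤ m) : ∃ (f : ℝ → ℝ) (x₁ : ℝ), 0 < x₁ ∧ x₁ ≤ 1 / 32 ∧
    (∀ x < x₁, f x = 1 + bryantH m x) ∧
    (∀ x ∈ Ioo 0 x₁, bryantH1 m x < 0) ∧
    (∀ x, 0 < x → HasDerivAt f (bryantField m x (f x)) x) ∧
    (∀ x, 0 < x → 1 / (1 + x) < f x ∧ f x < 1) := by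
  obtain ⟨x₂, hx₂, hloc⟩ := mem_nhdsGT_iff_exists_Ioo_subset.1 (bryantH_local_range hm)
  have hx₂ : 0 < x₂ := hx₂
  have h32 : x₂ ≤ 1 / 32 := by
    by_contra! h
    have := (hloc (show (x₂ + 1 / 32) / 2 ∈ Ioo 0 x₂ from ⟨by linarith, by linarith⟩)).1
    linarith
  have hbp : ∀ x ∈ Ioo 0 x₂, 0 < 1 + bryantH m x := fun x hx => by
    have h1 := (hloc hx).2.1
    have h2 : 0 < 1 / (1 + x) := by have := hx.1; positivity
    linarith
  have hfield : ∀ x ∈ Ioo 0 x₂, HasDerivAt (fun x => 1 + bryantH m x)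
      (bryantField m x (1 + bryantH m x)) x := by
    intro x hx
    have hxa : |x| < 1 / 16 := by rw [abs_of_pos hx.1]; linarith [hx.2]
    have hneg : 0 < -(x * bryantH1 m x) := by nlinarith [(hloc hx).2.2.2, hx.1]
    have := field_of_energy (by linarith [hbp x hx]) (bryantH_energy hm h32 hbp x hx)
    rw [neg_neg, mul_div_cancel_left₀ _ hx.1.ne'] at this
    rw [← this]
    exact (hasDerivAt_bryantH hm hxa).const_add 1
  set x₀ := x₂ / 2 with hx₀d
  have hx₀ : 0 < x₀ := by positivity
  have hx₀₂ : x₀ < x₂ := by rw [hx₀d]; linarith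
  have hl0 := hloc (show x₀ ∈ Ioo 0 x₂ from ⟨hx₀, hx₀₂⟩)
  have hex : ∀ X : ℝ, ∃ α : ℝ → ℝ, x₀ < X → α x₀ = 1 + bryantH m x₀ ∧ ContinuousOn α (Icc x₀ X) ∧
      (∀ x ∈ Ioo x₀ X, HasDerivAt α (bryantField m x (α x)) x) ∧
      (∀ x ∈ Ico x₀ X, HasDerivWithinAt α (bryantField m x (α x)) (Ici x) x) ∧
      ∀ x ∈ Icc x₀ X, 1 / (1 + x) < α x ∧ α x < 1 := by
    intro X
    by_cases hX : x₀ < X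
    · obtain ⟨α, hα⟩ := exists_bryant_on_Icc hm hx₀ hX hl0.2.1 hl0.2.2.1
      exact ⟨α, fun _ => hα⟩
    · exact ⟨0, fun h => absurd h hX⟩
  choose sol hsol using hex
  have huniq : ∀ X Y, x₀ < X → X ≤ Y → EqOn (sol X) (sol Y) (Icc x₀ X) := by
    intro X Y hX hXY
    obtain ⟨a0, a1, -, a3, a4⟩ := hsol X hX
    obtain ⟨b0, b1, -, b3, b4⟩ := hsol Y (hX.trans_le hXY)
    exact bryant_unique hm hx₀ hX.le a1 (b1.mono (Icc_subset_Icc_right hXY)) a3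
      (fun x hx => b3 x ⟨hx.1, hx.2.trans_le hXY⟩) a4 (fun x hx => b4 x ⟨hx.1, hx.2.trans hXY⟩)
      (by rw [a0, b0])
  have hagree : ∀ X Y, x₀ < X → X < x₂ → X ≤ Y →
      EqOn (fun x => 1 + bryantH m x) (sol Y) (Icc x₀ X) := by
    intro X Y hX hX2 hXY
    obtain ⟨b0, b1, -, b3, b4⟩ := hsol Y (hX.trans_le hXY)
    have hm' : ∀ x ∈ Icc x₀ X, x ∈ Ioo 0 x₂ := fun x hx => ⟨hx₀.trans_le hx.1, hx.2.trans_lt hX2⟩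
    exact bryant_unique hm hx₀ hX.le
      (fun x hx => (hfield x (hm' x hx)).continuousAt.continuousWithinAt)
      (b1.mono (Icc_subset_Icc_right hXY))
      (fun x hx => (hfield x (hm' x ⟨hx.1, hx.2.le⟩)).hasDerivWithinAt)
      (fun x hx => b3 x ⟨hx.1, hx.2.trans_le hXY⟩)
      (fun x hx => ⟨(hloc (hm' x hx)).2.1, (hloc (hm' x hx)).2.2.1⟩)
      (fun x hx => b4 x ⟨hx.1, hx.2.trans hXY⟩) b0.symm
  -- The value at $x$ is read from the solution on $[x_0,x+1]$; by uniqueness any larger right end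
  -- gives the same value. The series is kept for all $x\le x_0$, negative $x$ included, so that `f`
  -- is smooth across 0.
  set f : ℝ → ℝ := fun x => if x ≤ x₀ then 1 + bryantH m x else sol (x + 1) x with hf
  have hfs : ∀ x, x₀ < x → ∀ X, x ≤ X → f x = sol X x := by
    intro x hx X hX
    simp only [hf, if_neg (not_le.2 hx)]
    rcases le_total (x + 1) X with h | h
    · exact huniq _ _ (by linarith) h ⟨hx.le, by linarith⟩
    · exact (huniq _ _ (by linarith) h ⟨hx.le, hX⟩).symm
  have hfl : ∀ x < x₂, f x = 1 + bryantH m x := by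
    intro x hx
    rcases le_or_gt x x₀ with h | h
    · simp only [hf, if_pos h]
    · rw [hfs x h x₂ hx.le]
      exact (hagree x x₂ h hx hx.le ⟨h.le, le_rfl⟩).symm
  refine ⟨f, x₂, hx₂, h32, hfl, fun x hx => (hloc hx).2.2.2, fun x hx => ?_, fun x hx => ?_⟩
  · rcases lt_or_ge x x₂ with h | h
    · rw [hfl x h]
      refine (hfield x ⟨hx, h⟩).congr_of_eventuallyEq ?_
      filter_upwards [gt_mem_nhds h] with y hy using hfl y hy
    · have hx0 : x₀ < x := by linarith
      obtain ⟨-, -, b2, -, -⟩ := hsol (x + 1) (by linarith)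
      rw [hfs x hx0 (x + 1) (by linarith)]
      refine (b2 x ⟨hx0, by linarith⟩).congr_of_eventuallyEq ?_
      filter_upwards [Ioo_mem_nhds hx0 (lt_add_one x)] with y hy using hfs y hy.1 _ hy.2.le
  · rcases lt_or_ge x x₂ with h | h
    · rw [hfl x h]; exact ⟨(hloc ⟨hx, h⟩).2.1, (hloc ⟨hx, h⟩).2.2.1⟩
    · have hx0 : x₀ < x := by linarith
      rw [hfs x hx0 (x + 1) (by linarith)]
      exact (hsol (x + 1) (by linarith)).2.2.2.2 x ⟨hx0.le, by linarith⟩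

end

/-! ### Regularity and behaviour at infinity of the Bryant profile. -/

section

open Set Filter Topology
open scoped ContDiff

/-- The logarithmic derivative `x p'` of `p = -x b'` along the Bryant profile. -/
def bryantPd (m b p : ℝ) : ℝ := -p ^ 2 / (2 * b) + p - m / 2 * (p / b - 1 + b)

/-- The Bryant profile `f` in the variable `x = σ²`, together with `p = -x f'`. -/
structure BryantFun (m : ℝ) (f p : ℝ → ℝ) : Prop where
  contDiffAt : ∀ x, 0 ≤ x → ContDiffAt ℝ ∞ f x
  zero : f 0 = 1
  pos : ∀ x, 0 < x → 0 < f x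
  lt_one : ∀ x, 0 < x → f x < 1
  hasDerivAt : ∀ x, 0 < x → HasDerivAt f (-p x / x) x
  hasDerivAt_p : ∀ x, 0 < x → HasDerivAt p (bryantPd m (f x) (p x) / x) x
  p_pos : ∀ x, 0 < x → 0 < p x
  slope_f : Tendsto (fun x => (1 - f x) / x) (𝓝[>] 0) (𝓝 (m ^ 2 / ((m + 1) * (m + 2))))
  slope_p : Tendsto (fun x => p x / x) (𝓝[>] 0) (𝓝 (m ^ 2 / ((m + 1) * (m + 2))))
  f_atTop : Tendsto f atTop (𝓝 0)
  xf_atTop : Tendsto (fun x => x * f x) atTop (𝓝 1)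
  q_atTop : Tendsto (fun x => p x / f x) atTop (𝓝 1)

/-- While $g\ge c$, the function loses at least $\kappa$ per unit of $\log x$, so it drops below $c$
at some point. It cannot return, since its derivative is negative wherever $g=c$. All limits at
infinity of the profile and its correction come from this. -/
theorem eventually_lt_of_log_decay {g gd : ℝ → ℝ} {c κ X : ℝ} (hκ : 0 < κ) (hX : 0 < X)
    (hd : ∀ x, X ≤ x → HasDerivAt g (gd x / x) x) (hneg : ∀ x, X ≤ x → c ≤ g x → gd x ≤ -κ) :
    ∀ᶠ x in atTop, g x < c := by
  obtain ⟨x', hx', hgx'⟩ : ∃ x, X ≤ x ∧ g x < c := by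
    by_contra! hc
    have hanti : AntitoneOn (fun x => g x + κ * Real.log x) (Ici X) := by
      have hd' : ∀ x ∈ Ici X, HasDerivAt (fun x => g x + κ * Real.log x) (gd x / x + κ * x⁻¹) x :=
        fun x hx => (hd x hx).add ((Real.hasDerivAt_log (hX.trans_le hx).ne').const_mul κ)
      refine antitoneOn_of_deriv_nonpos (convex_Ici X)
        (fun x hx => (hd' x hx).continuousAt.continuousWithinAt)
        (fun x hx => (hd' x (interior_subset hx)).differentiableAt.differentiableWithinAt)
        (fun x hx => ?_)
      have hx := interior_subset hx
      rw [(hd' x hx).deriv]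
      have hx0 : 0 < x := hX.trans_le hx
      have := hneg x hx (hc x hx)
      rw [← div_eq_mul_inv, ← add_div]
      exact div_nonpos_of_nonpos_of_nonneg (by linarith) hx0.le
    have h1 := (Real.tendsto_log_atTop.const_mul_atTop hκ).eventually
      (eventually_gt_atTop (g X + κ * Real.log X - c))
    obtain ⟨x, hx1, hx2⟩ := (h1.and (eventually_ge_atTop X)).exists
    have := hanti self_mem_Ici hx2 hx2
    simp only at this
    linarith [hc x hx2]
  filter_upwards [eventually_ge_atTop x'] with x hx
  have := pos_of_deriv_pos_at_zeros (f := fun y => c - g y) (f' := fun y => -(gd y / y))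
    (a := x') (b := x) (by linarith)
    (fun y hy => ((hd y (hx'.trans hy.1)).continuousAt.continuousWithinAt).const_sub c)
    (fun y hy _ => (hd y (hx'.trans hy.1.le)).const_sub c)
    (fun y hy h0 => by
      have hy0 : 0 < y := hX.trans_le (hx'.trans hy.1.le)
      have := hneg y (hx'.trans hy.1.le) (by linarith)
      rw [neg_pos]
      exact div_neg_of_neg_of_pos (by linarith) hy0) x ⟨hx, le_rfl⟩
  linarith

/-- Bootstrap: the field is smooth where $b>0$, so each order of differentiability of $f$ passes to
$f'$. -/
theorem contDiffAt_of_field {m : ℝ} {f : ℝ → ℝ} (hm : 1 ≤ m)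
    (hd : ∀ x, 0 < x → HasDerivAt f (bryantField m x (f x)) x) (hpos : ∀ x, 0 < x → 0 < f x) :
    ContDiffOn ℝ ∞ f (Ioi 0) := by
  rw [contDiffOn_infty]
  intro k
  induction k with
  | zero => exact contDiffOn_zero.2 fun x hx => (hd x hx).continuousAt.continuousWithinAt
  | succ k ih =>
    rw [show ((k + 1 : ℕ) : WithTop ℕ∞) = (k : WithTop ℕ∞) + 1 by push_cast; rfl,
      contDiffOn_succ_iff_deriv_of_isOpen isOpen_Ioi]
    refine ⟨fun x hx => (hd x hx).differentiableAt.differentiableWithinAt, by simp, ?_⟩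
    have : ContDiffOn ℝ k (fun x => bryantField m x (f x)) (Ioi 0) := by
      unfold bryantField
      refine ContDiffOn.div (ContDiffOn.sub (contDiffOn_const.add ih) (ContDiffOn.sqrt ?_ ?_))
        contDiffOn_id fun x hx => ne_of_gt hx
      · exact ih.mul (((contDiffOn_const.mul contDiffOn_id).add contDiffOn_const).add
          (contDiffOn_const.mul ih))
      · intro x hx
        have h1 := hpos x hx
        have hx : 0 < x := hx
        positivity
    exact this.congr fun x hx => (hd x hx).deriv

/-- Differentiating $p=\Phi-m-f$, where $\Phi$ is the square root given by the first integral,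
recovers the second order soliton equation in the form $xp'=$ `bryantPd`. -/
theorem pd_of_sqrt {m x f p Φ : ℝ} (hx : x ≠ 0) (hf : f ≠ 0) (hΦ : Φ = p + m + f) (hΦ0 : Φ ≠ 0)
    (hS : Φ ^ 2 = f * (m ^ 2 * x + m * (m + 1) + (m + 1) * f)) :
    ((-p / x) * (m ^ 2 * x + m * (m + 1) + (m + 1) * f)
      + f * (m ^ 2 + (m + 1) * (-p / x))) / (2 * Φ) - -p / x = bryantPd m f p / x := by
  have h1 : m ^ 2 * x * f = Φ ^ 2 - f * (m + 1) * (m + f) := by rw [hS]; ring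
  have h2 : ((-p / x) * (m ^ 2 * x + m * (m + 1) + (m + 1) * f)
      + f * (m ^ 2 + (m + 1) * (-p / x))) = Φ * (-p * Φ / f + Φ - (m + 1) * f) / x := by
    field_simp
    have h3 : Φ * (-p * Φ + f * (Φ - f * (m + 1))) - (-(f * (p * (m ^ 2 * x + m * (m + 1) + f * (m + 1))))
        + f ^ 2 * (m ^ 2 * x - p * (m + 1))) = 0 := by
      have : p = Φ - m - f := by rw [hΦ]; ring
      subst this
      linear_combination (-(Φ - m - f) + f) * hS
    linear_combination -h3
  rw [h2, bryantPd, hΦ]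
  rw [hΦ] at hΦ0
  field_simp
  ring

theorem exists_bryantFun {m : ℝ} (hm : 1 ≤ m) : ∃ f p : ℝ → ℝ, BryantFun m f p := by
  obtain ⟨f, x₁, hx₁, h32, hloc, hneg, hd, hr⟩ := exists_bryant_global hm
  have hm0 : 0 < m := by linarith
  have hfpos : ∀ x, 0 < x → 0 < f x := fun x hx =>
    lt_trans (by positivity) (hr x hx).1
  set p : ℝ → ℝ := fun x => -(x * bryantField m x (f x)) with hp
  have hpf : ∀ x, 0 < x → -p x / x = bryantField m x (f x) := fun x hx => by
    simp only [hp, neg_neg]; field_simp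
  have hfd : ∀ x, 0 < x → HasDerivAt f (-p x / x) x := fun x hx => by
    rw [hpf x hx]; exact hd x hx
  have hen := fun x (hx : 0 < x) => energy_of_field hm0 hx (hfpos x hx) (hpf x hx)
  have hpd : ∀ x, 0 < x → HasDerivAt p (bryantPd m (f x) (p x) / x) x := by
    intro x hx
    have hS : 0 < f x * (m ^ 2 * x + m * (m + 1) + (m + 1) * f x) := by
      have := hfpos x hx; positivity
    have hΦ : Real.sqrt (f x * (m ^ 2 * x + m * (m + 1) + (m + 1) * f x)) = p x + m + f x := by
      have h1 := (hen x hx).1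
      rw [bryantEnergy_eq] at h1
      rw [← Real.sqrt_sq (hen x hx).2.le]
      congr 1
      linear_combination -h1
    have hSd : HasDerivAt (fun x => f x * (m ^ 2 * x + m * (m + 1) + (m + 1) * f x))
        ((-p x / x) * (m ^ 2 * x + m * (m + 1) + (m + 1) * f x)
          + f x * (m ^ 2 + (m + 1) * (-p x / x))) x := by
      refine (hfd x hx).fun_mul ?_
      have := (((hasDerivAt_id x).const_mul (m ^ 2)).add_const (m * (m + 1))).fun_add
        ((hfd x hx).const_mul (m + 1))
      simpa using this
    have h := (hSd.sqrt hS.ne').sub (hfd x hx)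
    have heq : p =ᶠ[𝓝 x] fun y => (Real.sqrt (f y * (m ^ 2 * y + m * (m + 1) + (m + 1) * f y)) - f y)
        - m := by
      filter_upwards [lt_mem_nhds hx] with y hy
      simp only [hp, bryantField]
      field_simp
      ring
    refine ((h.sub_const m).congr_of_eventuallyEq heq).congr_deriv ?_
    rw [← pd_of_sqrt hx.ne' (hfpos x hx).ne' hΦ (by rw [hΦ]; exact (hen x hx).2.ne')
      (Real.sq_sqrt hS.le)]
  have hploc : ∀ x ∈ Ioo 0 x₁, p x = -(x * bryantH1 m x) := by
    intro x hx
    have h1 : HasDerivAt f (bryantH1 m x) x := by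
      refine ((hasDerivAt_bryantH hm (x := x) ?_).const_add 1).congr_of_eventuallyEq ?_
      · rw [abs_of_pos hx.1]; linarith [hx.2]
      · filter_upwards [gt_mem_nhds hx.2] with y hy using hloc y hy
    rw [hp]; simp only
    rw [(hd x hx.1).unique h1]
  -- At a zero of $p$ one has $xp'=\frac m2(1-f)>0$, so $p$, which is positive near the origin,
  -- remains positive.
  have hppos : ∀ x, 0 < x → 0 < p x := by
    have hsmall : ∀ x ∈ Ioo 0 x₁, 0 < p x := fun x hx => by
      rw [hploc x hx]; nlinarith [hneg x hx, hx.1]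
    intro x hx
    rcases lt_or_ge x x₁ with h | h
    · exact hsmall x ⟨hx, h⟩
    · refine pos_of_deriv_pos_at_zeros (f' := fun x => bryantPd m (f x) (p x) / x) (a := x₁ / 2)
        (b := x) (hsmall _ ⟨by linarith, by linarith⟩)
        (fun y hy => (hpd y (by linarith [hy.1])).continuousAt.continuousWithinAt)
        (fun y hy _ => hpd y (by linarith [hy.1])) (fun y hy h0 => ?_) x ⟨by linarith, le_rfl⟩
      have hy0 : 0 < y := by linarith [hy.1]
      have : bryantPd m (f y) (p y) = m / 2 * (1 - f y) := by
        rw [bryantPd, h0]; simp; ring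
      rw [this]
      have := (hr y hy0).2
      have h2 : 0 < 1 - f y := by linarith
      positivity
  -- While $f\ge\varepsilon$ and $x\ge(m+2)^2/\varepsilon$, the first integral gives
  -- $(p+m+f)^2\ge(m+2)^2$. Hence $p\ge1$, and $f$ decreases at least at unit rate in $\log x$.
  have f0 : Tendsto f atTop (𝓝 0) := by
    rw [tendsto_order]
    refine ⟨fun a ha => ?_, fun ε hε => ?_⟩
    · filter_upwards [eventually_gt_atTop 0] with x hx using ha.trans (hfpos x hx)
    · refine eventually_lt_of_log_decay (κ := 1) one_pos (gd := fun x => -p x) (X := (m + 2) ^ 2 / ε) (by positivity)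
        (fun x hx => hfd x (lt_of_lt_of_le (by positivity) hx)) (fun x hx hc => ?_)
      have hx0 : 0 < x := lt_of_lt_of_le (by positivity) hx
      have h1 := (hen x hx0)
      rw [bryantEnergy_eq] at h1
      have hfx := hfpos x hx0
      have h2 : (m + 2) ^ 2 ≤ x * f x := by
        rw [div_le_iff₀ hε] at hx
        nlinarith
      have h3 : (m + 2) ^ 2 ≤ (p x + m + f x) ^ 2 := by
        have : 0 ≤ f x * (m * (m + 1) + (m + 1) * f x) := by positivity
        have h4 : x * f x ≤ m ^ 2 * (x * f x) := 
          le_mul_of_one_le_left (mul_pos hx0 hfx).le (one_le_pow₀ hm)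
        nlinarith [h1.1]
      have h4 := abs_le_of_sq_le_sq' h3 h1.2.le
      have := (hr x hx0).2
      linarith [h4.2]
  have hfsmall : ∀ ε > 0, ∀ᶠ x in atTop, f x < ε := fun ε hε => f0.eventually (gt_mem_nhds hε)
  -- Once $f$ is small, the term $-\frac{m}{2f}p$ dominates $xp'$ and excludes $p\ge\varepsilon$ in
  -- the long run.
  have p0 : Tendsto p atTop (𝓝 0) := by
    rw [tendsto_order]
    refine ⟨fun a ha => ?_, fun ε hε => ?_⟩
    · filter_upwards [eventually_gt_atTop 0] with x hx using ha.trans (hppos x hx)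
    · have e1 := hfsmall (m / (2 * ((m / 2 + 1) / ε + 1))) (by positivity)
      obtain ⟨X, hX⟩ := eventually_atTop.1 (e1.and (eventually_gt_atTop 0))
      refine eventually_lt_of_log_decay (κ := 1) one_pos (X := X) (hX X le_rfl).2 (fun x hx => hpd x (hX x hx).2)
        (fun x hx hc => ?_)
      obtain ⟨h1, hx0⟩ := hX x hx
      have hfx := hfpos x hx0
      have hpx := hppos x hx0
      rw [lt_div_iff₀ (by positivity)] at h1
      have h2 : (m / 2 + 1) / ε + 1 ≤ m / (2 * f x) := by
        rw [le_div_iff₀ (by positivity)]; linarith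
      have h3 : (m / 2 + 1) / ε * p x ≥ m / 2 + 1 := by
        rw [ge_iff_le, div_mul_eq_mul_div, le_div_iff₀ hε]
        exact mul_le_mul_of_nonneg_left hc (by positivity)
      have h4 : 0 ≤ p x ^ 2 / (2 * f x) := by positivity
      have h5 : bryantPd m (f x) (p x) = -(p x ^ 2 / (2 * f x)) + p x - m / (2 * f x) * p x
          + m / 2 - m / 2 * f x := by rw [bryantPd]; field_simp; ring
      rw [h5]
      have h6 : 0 ≤ m / 2 * f x := by positivity
      nlinarith [mul_le_mul_of_nonneg_right h2 hpx.le]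
  have hqd : ∀ x, 0 < x → HasDerivAt (fun x => p x / f x)
      ((((p x / f x) ^ 2 + 2 * (p x / f x) - m / f x * (p x / f x - 1 + f x)) / 2) / x) x := by
    intro x hx
    refine ((hpd x hx).div (hfd x hx) (hfpos x hx).ne').congr_deriv ?_
    have := (hfpos x hx).ne'
    rw [bryantPd]; field_simp; ring
  -- For $q=p/f$ one has $2xq'=q^2+2q-\frac mf(q-1+f)$. As $f\to0$ the last term is stiff and drives
  -- $q$ to 1; in the upper bound $q^2$ is controlled through $fq^2=qp$ and $p\to0$.
  have q1 : Tendsto (fun x => p x / f x) atTop (𝓝 1) := by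
    rw [tendsto_order]
    refine ⟨fun a ha => ?_, fun a ha => ?_⟩
    · set ε := 1 - a with hε
      have hε0 : 0 < ε := by rw [hε]; linarith
      have e1 := hfsmall (min (ε / 2) (m * ε / 4)) (by positivity)
      obtain ⟨X, hX⟩ := eventually_atTop.1 (e1.and (eventually_gt_atTop 0))
      have := eventually_lt_of_log_decay (κ := 1) one_pos (c := -a) (X := X) (hX X le_rfl).2
        (fun x hx => ((hqd x (hX x hx).2).neg).congr_deriv (neg_div _ _).symm)
        (fun x hx hc => ?_)
      · filter_upwards [this] with x hx
        simp only [Pi.neg_apply] at hx; linarith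
      · obtain ⟨h1, hx0⟩ := hX x hx
        have hfx := hfpos x hx0
        have hq0 : 0 < p x / f x := div_pos (hppos x hx0) hfx
        have h1a := h1.trans_le (min_le_left _ _)
        have h1b := h1.trans_le (min_le_right _ _)
        simp only [Pi.neg_apply] at hc
        have h2 : 2 ≤ m / f x * (ε / 2) := by
          rw [div_mul_eq_mul_div, le_div_iff₀ hfx]; linarith
        have h3 : m / f x * (p x / f x - 1 + f x) ≤ -(m / f x * (ε / 2)) := by
          rw [← mul_neg]
          exact mul_le_mul_of_nonneg_left (by rw [hε] at *; linarith) (by positivity)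
        have h4 : 0 < (p x / f x) ^ 2 := by positivity
        linarith
    · set ε := a - 1 with hε
      have hε0 : 0 < ε := by rw [hε]; linarith
      have ha0 : 0 < a := by linarith
      set d := m * ε / (8 * a) with hd'
      have hd0 : 0 < d := by positivity
      have e1 := hfsmall (min d (m * ε / 8)) (by positivity)
      have e2 := p0.eventually (gt_mem_nhds hd0)
      obtain ⟨X, hX⟩ := eventually_atTop.1 ((e1.and e2).and (eventually_gt_atTop 0))
      refine eventually_lt_of_log_decay (κ := 1) one_pos (X := X) (hX X le_rfl).2
        (fun x hx => hqd x (hX x hx).2) (fun x hx hc => ?_)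
      obtain ⟨⟨h1, h2⟩, hx0⟩ := hX x hx
      have hfx := hfpos x hx0
      have h1a := h1.trans_le (min_le_left _ _)
      have h1b := h1.trans_le (min_le_right _ _)
      set q := p x / f x with hq
      have hq0 : 0 < q := div_pos (hppos x hx0) hfx
      have hqa : q * ε ≤ a * (q - 1) := by rw [hε]; nlinarith
      have hqf : q * f x = p x := by rw [hq]; field_simp
      have hda : d * (8 * a) = m * ε := by rw [hd']; field_simp
      have key : f x * (q ^ 2 + 2 * q - m / f x * (q - 1 + f x)) ≤ -2 * f x := by
        have e : f x * (q ^ 2 + 2 * q - m / f x * (q - 1 + f x))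
            = q * p x + 2 * p x - m * (q - 1) - m * f x := by
          rw [← hqf]; field_simp; ring
        rw [e]
        have k1 : q * p x ≤ q * d := mul_le_mul_of_nonneg_left h2.le hq0.le
        have k2 : 2 * p x ≤ 2 * (q * d) := by rw [← hqf]; nlinarith
        have k3 : a * (m * (q - 1)) ≥ m * (q * ε) := by nlinarith
        have k4 : 3 * (q * d) + m * ε / 4 ≤ m * (q - 1) := by
          have : a * (3 * (q * d)) = 3 / 8 * (q * (m * ε)) := by rw [← hda]; ring
          have h6 : a * (m * ε / 4) ≤ 1 / 4 * (q * (m * ε)) := by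
            have : a * (m * ε) ≤ q * (m * ε) := mul_le_mul_of_nonneg_right hc (by positivity)
            linarith
          have h7 : 0 < q * (m * ε) := by positivity
          have h8 : a * (3 * (q * d) + m * ε / 4) ≤ a * (m * (q - 1)) := by nlinarith
          exact le_of_mul_le_mul_left h8 ha0
        nlinarith
      have : q ^ 2 + 2 * q - m / f x * (q - 1 + f x) ≤ -2 := by
        by_contra! h
        nlinarith
      linarith
  refine ⟨f, p, ?_, ?_, hfpos, fun x hx => (hr x hx).2, hfd, hpd, hppos, ?_, ?_, f0, ?_, q1⟩
  · intro x hx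
    rcases eq_or_lt_of_le hx with h | h
    · have : f =ᶠ[𝓝 x] fun y => 1 + bryantH m y := by
        filter_upwards [gt_mem_nhds (show x < x₁ by rw [← h]; exact hx₁)] with y hy using hloc y hy
      refine (contDiffAt_const.add (contDiffAt_bryantH hm ?_)).congr_of_eventuallyEq this
      rw [← h]; norm_num
    · exact (contDiffAt_of_field hm hd hfpos).contDiffAt (Ioi_mem_nhds h)
  · rw [hloc 0 hx₁, bryantH_zero, add_zero]
  · have := (bryantH_tendsto_slope hm).neg
    rw [neg_neg] at this
    refine this.congr' ?_
    filter_upwards [Ioo_mem_nhdsGT hx₁] with x hx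
    rw [hloc x hx.2]; ring
  · have := (bryantH1_tendsto hm).neg
    rw [neg_neg] at this
    refine this.congr' ?_
    filter_upwards [Ioo_mem_nhdsGT hx₁] with x hx
    have := hx.1.ne'
    rw [hploc x hx]; field_simp
  -- By the first integral $xf$ equals energy$/m^2$, and the energy tends to $m^2$ because
  -- $f,p\to0$.
  · have h1 : Tendsto (fun x => bryantEnergy m (f x) (p x) / m ^ 2) atTop (𝓝 1) := by
      have h := ((((p0.add ((f0.const_sub 1).const_mul m)).pow 2).add
        ((f0.const_mul (m + 1)).mul ((p0.const_mul 2).add ((f0.const_sub 1).const_mul m)))).div_const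
        (m ^ 2))
      have hv : ((0 + m * (1 - 0)) ^ 2 + (m + 1) * 0 * (2 * 0 + m * (1 - 0))) / m ^ 2 = 1 := by
        field_simp; ring
      rw [hv] at h
      exact h
    refine h1.congr' ?_
    filter_upwards [eventually_gt_atTop 0] with x hx
    rw [(hen x hx).1]; field_simp

end

section

open Set Filter Topology Asymptotics
open scoped ContDiff

theorem isBryantProfile_of_bryantFun {n : ℕ} {f p : ℝ → ℝ} (h : BryantFun ((n : ℝ) - 1) f p) :
    IsBryantProfile n (fun σ => f (σ ^ 2)) where
  smooth := ⟨f, fun x hx => (h.contDiffAt x hx).contDiffWithinAt, fun _ _ => rfl⟩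
  center := by simp [h.zero]
  between := fun σ hσ => ⟨h.pos _ (by positivity), h.lt_one _ (by positivity)⟩
  normalized := h.xf_atTop.comp (tendsto_pow_atTop two_ne_zero)
  stationary := by
    intro σ hσ
    have hx : 0 < σ ^ 2 := by positivity
    have h2 : HasDerivAt (fun y => -p y / y)
        ((p (σ ^ 2) - bryantPd ((n : ℝ) - 1) (f (σ ^ 2)) (p (σ ^ 2))) / (σ ^ 2) ^ 2) (σ ^ 2) := by
      refine ((h.hasDerivAt_p _ hx).fun_neg.fun_div (hasDerivAt_id _) hx.ne').congr_deriv ?_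
      simp only [id]; field_simp; ring
    rw [opF_comp_sq hσ.ne' (f1 := fun y => -p y / y)
      ((lt_mem_nhds hx).mono fun y hy => h.hasDerivAt y hy) h2, bryantPd]
    have := (h.pos _ hx).ne'
    field_simp
    ring

/-! ### The correction `ℭ` -/

/-- The logarithmic derivative of `bryantPd` along the Bryant profile. -/
def bryantPdd (m b p : ℝ) : ℝ :=
  -p * bryantPd m b p / b - p ^ 3 / (2 * b ^ 2) + bryantPd m b p
    - m / 2 * (bryantPd m b p / b + p ^ 2 / b ^ 2 - p)

/-- The correction `C` to the Bryant profile in the variable `x = σ²`, with `Cd = x C'` and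
`Cdd = x Cd'`. -/
structure BryantCorr (m : ℝ) (f p C Cd Cdd : ℝ → ℝ) : Prop where
  hasDerivAt : ∀ x, 0 < x → HasDerivAt C (Cd x / x) x
  hasDerivAt_d : ∀ x, 0 < x → HasDerivAt Cd (Cdd x / x) x
  contDiffOn : ContDiffOn ℝ ∞ C (Ioi 0)
  pos : ∀ x, 0 < x → 0 < C x
  ode : ∀ x, 0 < x → 4 * f x * (Cdd x - Cd x) + 4 * C x * (p x - bryantPd m (f x) (p x))
    + 4 * p x * Cd x + 2 * m * Cd x + 2 * m * (1 - 2 * f x) * C x = 2 * x * p x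
  slope : ∃ M, 0 < M ∧ Tendsto (fun x => C x / x) (𝓝[>] 0) (𝓝 M)
  atTop : Tendsto C atTop (𝓝 (1 / m))
  bound : ∀ Z, ∃ K, ∀ x ∈ Ioc 0 Z, |C x| ≤ K * p x ∧ |Cd x| ≤ K * p x ∧ |Cdd x| ≤ K * p x

theorem exists_bound_Ioc {h : ℝ → ℝ} (h0 : h =O[𝓝[>] 0] (fun _ => (1 : ℝ)))
    (hc : ContinuousOn h (Ioi 0)) (Z : ℝ) : ∃ K, ∀ x ∈ Ioc 0 Z, |h x| ≤ K := by
  obtain ⟨K1, hK1⟩ := h0.bound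
  obtain ⟨e, he, hsub⟩ := mem_nhdsGT_iff_exists_Ioo_subset.1 hK1
  have he : 0 < e := he
  obtain ⟨K2, hK2⟩ := (isCompact_Icc (a := e / 2) (b := Z)).exists_bound_of_continuousOn
    (hc.mono fun x hx => lt_of_lt_of_le (by positivity) hx.1)
  refine ⟨max K1 K2, fun x hx => ?_⟩
  rcases lt_or_ge x e with h | h
  · have := hsub (show x ∈ Ioo 0 e from ⟨hx.1, h⟩)
    simp only [mem_ofPred_eq, norm_one, mul_one, Real.norm_eq_abs] at this
    exact this.trans (le_max_left _ _)
  · exact (hK2 x ⟨by linarith, hx.2⟩).trans (le_max_right _ _)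

namespace BryantFun

variable {m : ℝ} {f p : ℝ → ℝ}

theorem continuousOn_f (h : BryantFun m f p) : ContinuousOn f (Ioi 0) :=
  fun x hx => (h.hasDerivAt x hx).continuousAt.continuousWithinAt

theorem continuousOn_p (h : BryantFun m f p) : ContinuousOn p (Ioi 0) :=
  fun x hx => (h.hasDerivAt_p x hx).continuousAt.continuousWithinAt

theorem hasDerivAt_pd (h : BryantFun m f p) {x : ℝ} (hx : 0 < x) :
    HasDerivAt (fun x => bryantPd m (f x) (p x)) (bryantPdd m (f x) (p x) / x) x := by
  have hf := h.hasDerivAt x hx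
  have hp := h.hasDerivAt_p x hx
  have hfx := (h.pos x hx).ne'
  have := (((hp.fun_pow 2).fun_neg.fun_div (hf.const_mul 2) (mul_ne_zero two_ne_zero hfx)).fun_add
    hp).fun_sub (((((hp.fun_div hf hfx).sub_const 1).fun_add hf)).const_mul (m / 2))
  refine this.congr_deriv ?_
  rw [bryantPdd]
  set pd := bryantPd m (f x) (p x)
  field_simp
  ring

theorem continuousOn_pd (h : BryantFun m f p) :
    ContinuousOn (fun x => bryantPd m (f x) (p x)) (Ioi 0) :=
  fun _ hx => (h.hasDerivAt_pd hx).continuousAt.continuousWithinAt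

theorem contDiffOn_f (h : BryantFun m f p) : ContDiffOn ℝ ∞ f (Ioi 0) :=
  fun x hx => (h.contDiffAt x (le_of_lt hx)).contDiffWithinAt

theorem contDiffOn_p (h : BryantFun m f p) : ContDiffOn ℝ ∞ p (Ioi 0) := by
  have h1 : ContDiffOn ℝ ∞ (fun x => -(x * deriv f x)) (Ioi 0) :=
    (contDiffOn_id.mul (h.contDiffOn_f.deriv_of_isOpen isOpen_Ioi (by simp))).neg
  refine h1.congr fun x hx => ?_
  have hx : 0 < x := hx
  rw [(h.hasDerivAt x hx).deriv]; field_simp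

theorem tendsto_f_zero (h : BryantFun m f p) : Tendsto f (𝓝[>] 0) (𝓝 1) := by
  have := (h.contDiffAt 0 le_rfl).continuousAt.tendsto
  rw [h.zero] at this
  exact this.mono_left nhdsWithin_le_nhds

theorem tendsto_ratio_zero (hm : 1 ≤ m) (h : BryantFun m f p) :
    Tendsto (fun x => (1 - f x) / p x) (𝓝[>] 0) (𝓝 1) := by
  have hk := (bryant_kappa hm).1.ne'
  have := h.slope_f.div h.slope_p hk
  rw [div_self hk] at this
  refine this.congr' ?_
  filter_upwards [self_mem_nhdsWithin] with x hx
  have hx : 0 < x := hx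
  have := (h.p_pos x hx).ne'
  simp only [Pi.div_apply]; field_simp

theorem tendsto_p_zero (h : BryantFun m f p) : Tendsto p (𝓝[>] 0) (𝓝 0) := by
  have hx0 : Tendsto (fun x : ℝ => x) (𝓝[>] 0) (𝓝 0) := nhdsWithin_le_nhds
  have := h.slope_p.mul hx0
  rw [mul_zero] at this
  refine this.congr' ?_
  filter_upwards [self_mem_nhdsWithin] with x hx
  have hx : 0 < x := hx
  field_simp

theorem pd_div_p (h : BryantFun m f p) {x : ℝ} (hx : 0 < x) :
    bryantPd m (f x) (p x) / p x
      = -p x / (2 * f x) + 1 - m / 2 * (1 / f x - (1 - f x) / p x) := by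
  have := (h.p_pos x hx).ne'
  have := (h.pos x hx).ne'
  rw [bryantPd]; field_simp; ring

theorem tendsto_pd_div_p (hm : 1 ≤ m) (h : BryantFun m f p) :
    Tendsto (fun x => bryantPd m (f x) (p x) / p x) (𝓝[>] 0) (𝓝 1) := by
  have hf := h.tendsto_f_zero
  have := (((h.tendsto_p_zero.neg).div (hf.const_mul 2) (by norm_num)).add_const 1).sub
    ((((tendsto_const_nhds (x := (1 : ℝ))).div hf one_ne_zero).sub (h.tendsto_ratio_zero hm)).const_mul (m / 2))
  have hv : (-0 / (2 * 1) + 1 - m / 2 * (1 / 1 - 1) : ℝ) = 1 := by norm_num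
  rw [hv] at this
  refine this.congr' ?_
  filter_upwards [self_mem_nhdsWithin] with x hx
  rw [h.pd_div_p hx]; rfl

theorem tendsto_p_atTop (h : BryantFun m f p) : Tendsto p atTop (𝓝 0) := by
  have := h.q_atTop.mul h.f_atTop
  rw [mul_zero] at this
  refine this.congr' ?_
  filter_upwards [eventually_gt_atTop 0] with x hx
  have := (h.pos x hx).ne'
  field_simp

theorem tendsto_xp_atTop (h : BryantFun m f p) : Tendsto (fun x => x * p x) atTop (𝓝 1) := by
  have := h.q_atTop.mul h.xf_atTop
  rw [mul_one] at this
  refine this.congr' ?_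
  filter_upwards [eventually_gt_atTop 0] with x hx
  have := (h.pos x hx).ne'
  field_simp

theorem tendsto_f_mul_pd (h : BryantFun m f p) :
    Tendsto (fun x => f x * (bryantPd m (f x) (p x) / p x)) atTop (𝓝 0) := by
  have hf := h.f_atTop
  have := ((h.tendsto_p_atTop.neg.div_const 2).add hf).sub
    ((((hf.const_sub 1).div h.q_atTop one_ne_zero).const_sub 1).const_mul (m / 2))
  have hv : (-0 / 2 + 0 - m / 2 * (1 - (1 - 0) / 1) : ℝ) = 0 := by norm_num
  rw [hv] at this
  refine this.congr' ?_
  filter_upwards [eventually_gt_atTop 0] with x hx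
  have h1 := (h.pos x hx).ne'
  have h2 := (h.p_pos x hx).ne'
  rw [h.pd_div_p hx]
  simp only [Pi.div_apply]
  field_simp

end BryantFun

end

/-! ### Reduction of order and construction of the correction. -/

section

open Set Filter Topology Asymptotics
open scoped ContDiff

theorem hasDerivAt_integral_of_continuousOn_Ioi {g : ℝ → ℝ} (hg : ContinuousOn g (Ioi 0)) {x : ℝ}
    (hx : 0 < x) : HasDerivAt (fun y => ∫ ξ in (1 : ℝ)..y, g ξ) (g x) x := by
  have hsub : uIcc 1 x ⊆ Ioi (0 : ℝ) := fun y hy =>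
    lt_of_lt_of_le (lt_min one_pos hx) hy.1
  exact intervalIntegral.integral_hasDerivAt_right (hg.mono hsub).intervalIntegrable
    (hg.stronglyMeasurableAtFilter isOpen_Ioi x hx) (hg.continuousAt (Ioi_mem_nhds hx))

theorem contDiffOn_of_hasDerivAt {g g' : ℝ → ℝ} (hd : ∀ x, 0 < x → HasDerivAt g (g' x) x)
    (hg' : ContDiffOn ℝ ∞ g' (Ioi 0)) : ContDiffOn ℝ ∞ g (Ioi 0) := by
  rw [contDiffOn_infty_iff_deriv_of_isOpen isOpen_Ioi]
  exact ⟨fun x hx => (hd x hx).differentiableAt.differentiableWithinAt,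
    hg'.congr fun x hx => (hd x hx).deriv⟩

namespace BryantFun

variable {m : ℝ} {f p : ℝ → ℝ}

/-- The integrating factor and the first integral for the linearized soliton equation after
reduction of order. -/
theorem exists_reduction (hm : 1 ≤ m) (h : BryantFun m f p) : ∃ w : ℝ → ℝ,
    ContDiffOn ℝ ∞ w (Ioi 0) ∧ (∀ x, 0 < x → 0 < w x) ∧ w =O[𝓝[>] 0] (fun _ => (1 : ℝ)) ∧
    ∀ x, 0 < x → HasDerivAt w
      ((w x * (-p x / f x - 2 * (bryantPd m (f x) (p x) / p x) - m / (2 * f x)) + 1 / (2 * f x)) / x)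
      x := by
  have hm0 : 0 < m := by linarith
  set e : ℝ → ℝ := fun ξ => m / (2 * f ξ * ξ) with he
  have hes : ContDiffOn ℝ ∞ e (Ioi 0) :=
    contDiffOn_const.div ((contDiffOn_const.mul h.contDiffOn_f).mul contDiffOn_id)
      fun x hx => by have := h.pos x hx; have hx : 0 < x := hx; simp; exact ⟨this.ne', hx.ne'⟩
  have hepos : ∀ x, 0 < x → 0 < e x := fun x hx => by have := h.pos x hx; positivity
  -- The homogeneous solution is $f/(p^2E)$: the terms $-p/f$ and $-2xp'/p$ are the logarithmic
  -- derivatives of $f$ and $p^{-2}$, and only $-m/(2f)$ needs an integral.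
  set E : ℝ → ℝ := fun x => Real.exp (∫ ξ in (1 : ℝ)..x, e ξ) with hE
  have hEpos : ∀ x, 0 < E x := fun x => Real.exp_pos _
  have hEd : ∀ x, 0 < x → HasDerivAt E (E x * e x) x := fun x hx =>
    (hasDerivAt_integral_of_continuousOn_Ioi hes.continuousOn hx).exp
  have hEs : ContDiffOn ℝ ∞ E (Ioi 0) :=
    (contDiffOn_of_hasDerivAt
      (fun x hx => hasDerivAt_integral_of_continuousOn_Ioi hes.continuousOn hx) hes).exp
  have hEmono : MonotoneOn E (Ioi 0) := by
    refine monotoneOn_of_deriv_nonneg (convex_Ioi 0) hEs.continuousOn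
      (fun x hx => (hEd x (interior_subset hx)).differentiableAt.differentiableWithinAt) fun x hx => ?_
    have hx := interior_subset hx
    rw [(hEd x hx).deriv]
    exact mul_nonneg (hEpos x).le (hepos x hx).le
  set g : ℝ → ℝ := fun ξ => p ξ ^ 2 * E ξ / (2 * f ξ ^ 2 * ξ) with hg
  have hgs : ContDiffOn ℝ ∞ g (Ioi 0) :=
    ((h.contDiffOn_p.pow 2).mul hEs).div
      ((contDiffOn_const.mul (h.contDiffOn_f.pow 2)).mul contDiffOn_id)
      fun x hx => by have := h.pos x hx; have hx : 0 < x := hx; simp; exact ⟨this.ne', hx.ne'⟩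
  have hgpos : ∀ x, 0 < x → 0 < g x := fun x hx => by
    have := h.pos x hx; have := h.p_pos x hx; have := hEpos x; positivity
  have hpx0 : Tendsto (fun x => p x ^ 2 / (2 * f x ^ 2 * x)) (𝓝[>] 0) (𝓝 0) := by
    have hx0 : Tendsto (fun x : ℝ => x) (𝓝[>] 0) (𝓝 0) := nhdsWithin_le_nhds
    have := ((h.slope_p.pow 2).mul hx0).div ((h.tendsto_f_zero.pow 2).const_mul 2) (by norm_num)
    rw [mul_zero, zero_div] at this
    refine this.congr' ?_
    filter_upwards [self_mem_nhdsWithin] with x hx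
    have hx : 0 < x := hx
    have := (h.pos x hx).ne'
    simp only [Pi.div_apply]; field_simp
  have hg0 : g 0 = 0 := by simp [hg]
  have hgc : ContinuousOn g (Ici 0) := by
    intro x hx
    rcases eq_or_lt_of_le (show 0 ≤ x from hx) with h0 | h0
    · subst h0
      rw [← Ioi_insert, continuousWithinAt_insert_self, ContinuousWithinAt, hg0]
      refine squeeze_zero' ?_ ?_ hpx0
      · filter_upwards [self_mem_nhdsWithin] with x hx using (hgpos x hx).le
      · filter_upwards [Ioo_mem_nhdsGT one_pos] with x hx
        have h1 : E x ≤ 1 := by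
          have := hEmono (mem_Ioi.2 hx.1) (mem_Ioi.2 one_pos)
            hx.2.le
          simpa [hE] using this
        have := h.pos x hx.1
        have hx0 := hx.1
        rw [hg]
        simp only
        gcongr
        exact mul_le_of_le_one_right (by positivity) h1
    · exact (hgs.continuousOn.continuousAt (Ioi_mem_nhds h0)).continuousWithinAt
  -- Integrating from 0 selects the solution that stays bounded at the origin, where the homogeneous
  -- one is singular.
  set J : ℝ → ℝ := fun x => ∫ ξ in (0 : ℝ)..x, g ξ with hJ
  have hgi : ∀ x, 0 ≤ x → IntervalIntegrable g MeasureTheory.volume 0 x := fun x hx =>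
    (hgc.mono (by rw [uIcc_of_le hx]; exact Icc_subset_Ici_self)).intervalIntegrable
  have hJd : ∀ x, 0 < x → HasDerivAt J (g x) x := fun x hx =>
    intervalIntegral.integral_hasDerivAt_right (hgi x hx.le)
      (hgs.continuousOn.stronglyMeasurableAtFilter isOpen_Ioi x hx)
      (hgs.continuousOn.continuousAt (Ioi_mem_nhds hx))
  have hJpos : ∀ x, 0 < x → 0 < J x := fun x hx =>
    intervalIntegral.intervalIntegral_pos_of_pos_on (hgi x hx.le) (fun y hy => hgpos y hy.1) hx
  have hJs : ContDiffOn ℝ ∞ J (Ioi 0) := contDiffOn_of_hasDerivAt hJd hgs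
  set w : ℝ → ℝ := fun x => f x * J x / (p x ^ 2 * E x) with hw
  have hpE : ∀ x, 0 < x → p x ^ 2 * E x ≠ 0 := fun x hx =>
    (mul_pos (pow_pos (h.p_pos x hx) 2) (hEpos x)).ne'
  refine ⟨w, ?_, ?_, ?_, ?_⟩
  · exact (h.contDiffOn_f.mul hJs).div ((h.contDiffOn_p.pow 2).mul hEs) fun x hx => hpE x hx
  · intro x hx
    have := h.pos x hx; have := h.p_pos x hx; have := hEpos x; have := hJpos x hx
    positivity
  · set κ := m ^ 2 / ((m + 1) * (m + 2)) with hκ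
    have hk : 0 < κ := (bryant_kappa hm).1
    have a1 := h.slope_p.eventually (lt_mem_nhds (show κ / 2 < κ by linarith))
    have a2 := h.slope_p.eventually (gt_mem_nhds (show κ < 2 * κ by linarith))
    have a3 := h.tendsto_f_zero.eventually (lt_mem_nhds (show (1 / 2 : ℝ) < 1 by norm_num))
    obtain ⟨e, he, hsub⟩ := mem_nhdsGT_iff_exists_Ioo_subset.1 (a1.and (a2.and a3))
    have he : 0 < e := he
    refine IsBigO.of_bound 32 ?_
    filter_upwards [Ioo_mem_nhdsGT he] with x hx
    have hx0 : 0 < x := hx.1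
    -- Near 0, $p$ lies between $\kappa\xi/2$ and $2\kappa\xi$, $f\ge1/2$, and $E$ is increasing.
    -- Hence $J\le8\kappa^2x^2E$ while $p^2E\ge\frac14\kappa^2x^2E$, which gives the bound 32.
    have hgle : ∀ ξ ∈ Ioo 0 x, g ξ ≤ 8 * κ ^ 2 * E x * x := by
      intro ξ hξ
      obtain ⟨b1, b2, b3⟩ := hsub (show ξ ∈ Ioo 0 e from ⟨hξ.1, hξ.2.trans hx.2⟩)
      have hξ0 := hξ.1
      rw [div_lt_iff₀ hξ0] at b2
      have hp0 := h.p_pos ξ hξ0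
      have hE1 : E ξ ≤ E x := hEmono hξ0 hx0 hξ.2.le
      have hEξ := hEpos ξ
      have hfξ : 1 / 4 ≤ f ξ ^ 2 := by nlinarith
      rw [hg]
      simp only
      rw [div_le_iff₀ (by positivity)]
      have c1 : p ξ ^ 2 ≤ (2 * κ * ξ) ^ 2 := by gcongr
      calc p ξ ^ 2 * E ξ ≤ (2 * κ * ξ) ^ 2 * E x := by gcongr
        _ = 4 * κ ^ 2 * E x * (ξ * ξ) := by ring
        _ ≤ 4 * κ ^ 2 * E x * (x * ξ) := by
            have := hEpos x
            have := hξ.2.le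
            gcongr
        _ = 8 * κ ^ 2 * E x * x * (2 * (1 / 4) * ξ) := by ring
        _ ≤ 8 * κ ^ 2 * E x * x * (2 * f ξ ^ 2 * ξ) := by
            have := hEpos x
            gcongr
    have hJle : J x ≤ 8 * κ ^ 2 * E x * x * x := by
      have := intervalIntegral.integral_mono_on_of_le_Ioo hx0.le (hgi x hx0.le)
        (intervalIntegrable_const (c := 8 * κ ^ 2 * E x * x)) hgle
      rw [intervalIntegral.integral_const, sub_zero, smul_eq_mul] at this
      linarith
    obtain ⟨b1, b2, b3⟩ := hsub hx
    rw [lt_div_iff₀ hx0] at b1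
    have hp0 := h.p_pos x hx0
    have hEx := hEpos x
    have hfx := h.pos x hx0
    have hJx := hJpos x hx0
    rw [norm_one, mul_one, Real.norm_eq_abs, abs_of_pos (by positivity)]
    rw [hw]; simp only
    rw [div_le_iff₀ (by positivity)]
    have c1 : (κ / 2 * x) ^ 2 ≤ p x ^ 2 := by gcongr
    calc f x * J x ≤ 1 * (8 * κ ^ 2 * E x * x * x) := by
          gcongr; exact (h.lt_one x hx0).le
      _ = 32 * ((κ / 2 * x) ^ 2 * E x) := by ring
      _ ≤ 32 * (p x ^ 2 * E x) := by gcongr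
  · intro x hx
    have hfx := (h.pos x hx).ne'
    have hpx := (h.p_pos x hx).ne'
    have hEx := (hEpos x).ne'
    refine ((((h.hasDerivAt x hx).fun_mul (hJd x hx)).fun_div
      (((h.hasDerivAt_p x hx).fun_pow 2).fun_mul (hEd x hx)) (hpE x hx))).congr_deriv ?_
    simp only [hw, hg, he]
    set pd := bryantPd m (f x) (p x)
    field_simp
    ring

/-- The family $\mathfrak B(k\sigma)$ consists of stationary solutions, so $p=-xf'$ solves the
linearized equation. Substituting $C=pU$ leaves the first order equation of `exists_reduction` for
$w=U'$. At infinity $w\to1/m$, so $U/x\to1/m$, and with $xp\to1$ this gives $C\to1/m$. -/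
theorem exists_bryantCorr (hm : 1 ≤ m) (h : BryantFun m f p) :
    ∃ C Cd Cdd : ℝ → ℝ, BryantCorr m f p C Cd Cdd := by
  have hm0 : 0 < m := by linarith
  obtain ⟨w, hws, hwpos, hwO, hwd⟩ := h.exists_reduction hm
  obtain ⟨K, hK⟩ := exists_bound_Ioc hwO hws.continuousOn 1
  have hK0 : 0 ≤ K := (abs_nonneg _).trans (hK 1 ⟨one_pos, le_rfl⟩)
  -- The additive constant contributes a multiple of the kernel element $p$ to $C$. It makes
  -- $U\ge1$, hence $C>0$ and a positive quadratic coefficient at the origin.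
  set U : ℝ → ℝ := fun x => K + 1 + ∫ ξ in (1 : ℝ)..x, w ξ with hU
  have hUd : ∀ x, 0 < x → HasDerivAt U (w x) x := fun x hx =>
    (hasDerivAt_integral_of_continuousOn_Ioi hws.continuousOn hx).const_add _
  have hUs : ContDiffOn ℝ ∞ U (Ioi 0) := contDiffOn_of_hasDerivAt hUd hws
  have hUmono : MonotoneOn U (Ioi 0) := by
    refine monotoneOn_of_deriv_nonneg (convex_Ioi 0) hUs.continuousOn
      (fun x hx => (hUd x (interior_subset hx)).differentiableAt.differentiableWithinAt) fun x hx => ?_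
    rw [(hUd x (interior_subset hx)).deriv]
    exact (hwpos x (interior_subset hx)).le
  have hU1 : ∀ x, 0 < x → 1 ≤ U x := by
    have hsm : ∀ x ∈ Ioc (0 : ℝ) 1, 1 ≤ U x := by
      intro x hx
      have h1 : ‖∫ ξ in (1 : ℝ)..x, w ξ‖ ≤ K * |x - 1| :=
        intervalIntegral.norm_integral_le_of_norm_le_const fun y hy => by
          rw [uIoc_of_ge hx.2] at hy
          exact hK y ⟨hx.1.trans hy.1, hy.2⟩
      have h2 : |x - 1| ≤ 1 := by rw [abs_le]; constructor <;> linarith [hx.1, hx.2]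
      have h3 := (abs_le.1 (h1.trans (mul_le_of_le_one_right hK0 h2))).1
      simp only [hU]; linarith
    intro x hx
    rcases le_total x 1 with h1 | h1
    · exact hsm x ⟨hx, h1⟩
    · exact (hsm 1 ⟨one_pos, le_rfl⟩).trans (hUmono (show (0 : ℝ) < 1 from one_pos) hx h1)
  have hUlim : ∃ L, 1 ≤ L ∧ Tendsto U (𝓝[>] 0) (𝓝 L) := by
    have hb : BddBelow (U '' Ioo 0 1) := ⟨1, by
      rintro _ ⟨x, hx, rfl⟩; exact hU1 x hx.1⟩
    have := (hUmono.mono (Ioo_subset_Ioi_self : Ioo (0 : ℝ) 1 ⊆ _)).tendsto_nhdsWithin_Ioo_right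
      ⟨1 / 2, by norm_num⟩ hb
    refine ⟨_, ge_of_tendsto this ?_, this⟩
    filter_upwards [self_mem_nhdsWithin] with x hx using hU1 x hx
  obtain ⟨L, hL1, hL⟩ := hUlim
  -- Here $xw'=(1-(m+o(1))w)/(2f)$ and $1/f\to\infty$, so $w$ relaxes to $1/m$.
  have hw_lim : Tendsto w atTop (𝓝 (1 / m)) := by
    have hf0 := h.f_atTop
    have herr : Tendsto (fun x => 2 * p x + 4 * (f x * (bryantPd m (f x) (p x) / p x))) atTop
        (𝓝 0) := by
      have := (h.tendsto_p_atTop.const_mul 2).add (h.tendsto_f_mul_pd.const_mul 4)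
      simpa using this
    have hform : ∀ x, 0 < x →
        w x * (-p x / f x - 2 * (bryantPd m (f x) (p x) / p x) - m / (2 * f x)) + 1 / (2 * f x)
        = (1 - (m + (2 * p x + 4 * (f x * (bryantPd m (f x) (p x) / p x)))) * w x) / (2 * f x) := by
      intro x hx
      have hfx := (h.pos x hx).ne'
      set r := bryantPd m (f x) (p x) / p x
      field_simp; ring
    rw [tendsto_order]
    refine ⟨fun a ha => ?_, fun a ha => ?_⟩
    · rcases le_or_gt a 0 with ha0 | ha0
      · filter_upwards [eventually_gt_atTop 0] with x hx using ha0.trans_lt (hwpos x hx)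
      set d := 1 - m * a with hd
      have hd0 : 0 < d := by
        rw [lt_div_iff₀ hm0] at ha; rw [hd]; linarith
      have e1 := herr.eventually (gt_mem_nhds (show 0 < d / (2 * a) by positivity))
      have e2 := hf0.eventually (gt_mem_nhds (show 0 < d / 4 by positivity))
      obtain ⟨X, hX⟩ := eventually_atTop.1 ((e1.and e2).and (eventually_gt_atTop 0))
      have := eventually_lt_of_log_decay (κ := 1) one_pos (c := -a) (hX X le_rfl).2
        (fun x hx => ((hwd x (hX x hx).2).neg).congr_deriv (neg_div _ _).symm) (fun x hx hc => ?_)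
      · filter_upwards [this] with x hx
        simp only [Pi.neg_apply] at hx; linarith
      · obtain ⟨⟨h1, h2⟩, hx0⟩ := hX x hx
        have hfx := h.pos x hx0
        have hwx := hwpos x hx0
        simp only [Pi.neg_apply] at hc
        rw [hform x hx0]
        set err := 2 * p x + 4 * (f x * (bryantPd m (f x) (p x) / p x))
        have hs : d / 2 ≤ 1 - (m + err) * w x := by
          have k1 : err * w x ≤ d / (2 * a) * w x := mul_le_mul_of_nonneg_right h1.le hwx.le
          have k2 : d / (2 * a) * w x ≤ d / (2 * a) * a :=
            mul_le_mul_of_nonneg_left (by linarith) (by positivity)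
          have k3 : d / (2 * a) * a = d / 2 := by field_simp
          have k4 : m * w x ≤ m * a := mul_le_mul_of_nonneg_left (by linarith) hm0.le
          rw [hd] at *; nlinarith
        rw [neg_le_neg_iff, le_div_iff₀ (by positivity)]
        linarith
    · have ha0 : 0 < a := lt_trans (by positivity) ha
      set d := m * a - 1 with hd
      have hd0 : 0 < d := by
        have ha' : 1 / m < a := ha
        rw [div_lt_iff₀ hm0] at ha'; rw [hd]; linarith
      have e1 := herr.eventually (lt_mem_nhds (show -(d / (2 * a)) < 0 by
        rw [neg_lt_zero]; positivity))
      have e2 := hf0.eventually (gt_mem_nhds (show 0 < d / 4 by positivity))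
      obtain ⟨X, hX⟩ := eventually_atTop.1 ((e1.and e2).and (eventually_gt_atTop 0))
      refine eventually_lt_of_log_decay (κ := 1) one_pos (hX X le_rfl).2
        (fun x hx => hwd x (hX x hx).2) (fun x hx hc => ?_)
      obtain ⟨⟨h1, h2⟩, hx0⟩ := hX x hx
      have hfx := h.pos x hx0
      have hwx := hwpos x hx0
      rw [hform x hx0]
      set err := 2 * p x + 4 * (f x * (bryantPd m (f x) (p x) / p x))
      have hs : 1 - (m + err) * w x ≤ -(d / 2) := by
        have k0 : (m - d / (2 * a)) ≤ m + err := by linarith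
        have k1 : 0 ≤ m - d / (2 * a) := by
          have : d / (2 * a) ≤ m / 2 := by
            rw [div_le_iff₀ (by positivity)]; rw [hd]; nlinarith
          linarith
        have k2 : (m - d / (2 * a)) * a ≤ (m + err) * w x := mul_le_mul k0 hc ha0.le (by linarith)
        have k3 : (m - d / (2 * a)) * a = m * a - d / 2 := by field_simp
        rw [hd] at *; linarith
      rw [div_le_iff₀ (by positivity)]
      linarith
  -- Since $x(U/x)'=w-U/x$, the average $U/x$ follows $w$ to its limit.
  have hUx : Tendsto (fun x => U x / x) atTop (𝓝 (1 / m)) := by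
    have hgd : ∀ x, 0 < x → HasDerivAt (fun x => U x / x) ((w x - U x / x) / x) x := fun x hx => by
      refine ((hUd x hx).fun_div (hasDerivAt_id x) hx.ne').congr_deriv ?_
      simp only [id]; field_simp
    rw [tendsto_order]
    refine ⟨fun a ha => ?_, fun a ha => ?_⟩
    · have e1 := hw_lim.eventually (lt_mem_nhds (show (a + 1 / m) / 2 < 1 / m by linarith))
      obtain ⟨X, hX⟩ := eventually_atTop.1 (e1.and (eventually_gt_atTop 0))
      have := eventually_lt_of_log_decay (κ := (1 / m - a) / 2) (by linarith) (c := -a)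
        (hX X le_rfl).2
        (fun x hx => ((hgd x (hX x hx).2).neg).congr_deriv (neg_div _ _).symm) (fun x hx hc => ?_)
      · filter_upwards [this] with x hx
        simp only [Pi.neg_apply] at hx; linarith
      · simp only [Pi.neg_apply] at hc
        linarith [(hX x hx).1]
    · have e1 := hw_lim.eventually (gt_mem_nhds (show 1 / m < (a + 1 / m) / 2 by linarith))
      obtain ⟨X, hX⟩ := eventually_atTop.1 (e1.and (eventually_gt_atTop 0))
      refine eventually_lt_of_log_decay (κ := (a - 1 / m) / 2) (by linarith) (hX X le_rfl).2
        (fun x hx => hgd x (hX x hx).2) (fun x hx hc => ?_)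
      linarith [(hX x hx).1]
  set ud : ℝ → ℝ := fun x => x * w x with hud
  set udd : ℝ → ℝ := fun x => ud x * (1 - p x / f x - 2 * (bryantPd m (f x) (p x) / p x)
    - m / (2 * f x)) + x / (2 * f x) with hudd
  have hudd' : ∀ x, 0 < x → HasDerivAt ud (udd x / x) x := fun x hx => by
    refine ((hasDerivAt_id x).fun_mul (hwd x hx)).congr_deriv ?_
    simp only [hudd, hud, id]
    set r := bryantPd m (f x) (p x) / p x
    have hfx := (h.pos x hx).ne'
    field_simp; ring
  set C : ℝ → ℝ := fun x => p x * U x with hC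
  set Cd : ℝ → ℝ := fun x => bryantPd m (f x) (p x) * U x + p x * ud x with hCd
  set Cdd : ℝ → ℝ := fun x => bryantPdd m (f x) (p x) * U x
    + 2 * bryantPd m (f x) (p x) * ud x + p x * udd x with hCdd
  have cf := h.continuousOn_f
  have cp := h.continuousOn_p
  have cpd := h.continuousOn_pd
  have cU := hUs.continuousOn
  have cud : ContinuousOn ud (Ioi 0) := continuousOn_id.mul hws.continuousOn
  have nf : ∀ x ∈ Ioi (0 : ℝ), f x ≠ 0 := fun x hx => (h.pos x hx).ne'
  have np : ∀ x ∈ Ioi (0 : ℝ), p x ≠ 0 := fun x hx => (h.p_pos x hx).ne'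
  have oU : U =O[𝓝[>] 0] (fun _ => (1 : ℝ)) := hL.isBigO_one ℝ
  have ox : (fun x : ℝ => x) =O[𝓝[>] 0] (fun _ => (1 : ℝ)) :=
    (show Tendsto (fun x : ℝ => x) (𝓝[>] 0) (𝓝 0) from nhdsWithin_le_nhds).isBigO_one ℝ
  have oud : ud =O[𝓝[>] 0] (fun _ => (1 : ℝ)) := by
    have := ox.mul hwO
    simp only [mul_one] at this
    exact this
  have or : (fun x => bryantPd m (f x) (p x) / p x) =O[𝓝[>] 0] (fun _ => (1 : ℝ)) :=
    (h.tendsto_pd_div_p hm).isBigO_one ℝ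
  have op : p =O[𝓝[>] 0] (fun _ => (1 : ℝ)) := h.tendsto_p_zero.isBigO_one ℝ
  have oif : (fun x => 1 / f x) =O[𝓝[>] 0] (fun _ => (1 : ℝ)) :=
    ((tendsto_const_nhds (x := (1 : ℝ))).div h.tendsto_f_zero one_ne_zero).isBigO_one ℝ
  have oc : ∀ c : ℝ, (fun _ : ℝ => c) =O[𝓝[>] 0] (fun _ => (1 : ℝ)) := fun c =>
    isBigO_const_const c one_ne_zero _
  have omul : ∀ {u v : ℝ → ℝ}, u =O[𝓝[>] 0] (fun _ => (1 : ℝ)) →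
      v =O[𝓝[>] 0] (fun _ => (1 : ℝ)) → (fun x => u x * v x) =O[𝓝[>] 0] (fun _ => (1 : ℝ)) :=
    fun hu hv => by simpa using hu.mul hv
  refine ⟨C, Cd, Cdd, ⟨fun x hx => ?_, fun x hx => ?_, h.contDiffOn_p.mul hUs, fun x hx => ?_,
    fun x hx => ?_, ?_, ?_, fun Z => ?_⟩⟩
  · refine ((h.hasDerivAt_p x hx).fun_mul (hUd x hx)).congr_deriv ?_
    simp only [hCd, hud]; field_simp
  · refine (((h.hasDerivAt_pd hx).fun_mul (hUd x hx)).fun_add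
      ((h.hasDerivAt_p x hx).fun_mul (hudd' x hx))).congr_deriv ?_
    simp only [hCdd, hud]; field_simp; ring
  · exact mul_pos (h.p_pos x hx) (by linarith [hU1 x hx])
  · have hfx := (h.pos x hx).ne'
    have hpx := (h.p_pos x hx).ne'
    simp only [hC, hCd, hCdd, hudd, bryantPdd, bryantPd]
    field_simp
    ring
  · refine ⟨m ^ 2 / ((m + 1) * (m + 2)) * L, mul_pos (bryant_kappa hm).1 (by linarith), ?_⟩
    refine (h.slope_p.mul hL).congr fun x => ?_
    simp only [hC]; ring
  · have := h.tendsto_xp_atTop.mul hUx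
    rw [one_mul] at this
    refine this.congr' ?_
    filter_upwards [eventually_gt_atTop 0] with x hx
    simp only [hC]; field_simp
  -- Each of $C$, $xC'$ and $x(xC')'$ is $p$ times a function that is bounded near 0 and continuous
  -- on $(0,\infty)$.
  · obtain ⟨K0, hK0⟩ := exists_bound_Ioc oU cU Z
    obtain ⟨K1, hK1⟩ := exists_bound_Ioc (h := fun x => bryantPd m (f x) (p x) / p x * U x + ud x)
      ((omul or oU).add oud) (((cpd.div cp np).mul cU).add cud) Z
    obtain ⟨K2, hK2⟩ := exists_bound_Ioc (h := fun x =>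
        (-(p x * (bryantPd m (f x) (p x) / p x)) * (1 / f x) - p x * p x * (1 / f x * (1 / f x)) / 2
          + bryantPd m (f x) (p x) / p x
          - m / 2 * (bryantPd m (f x) (p x) / p x * (1 / f x) + p x * (1 / f x * (1 / f x)) - 1)) * U x
        + 2 * (bryantPd m (f x) (p x) / p x) * ud x
        + (ud x * (1 - p x * (1 / f x) - 2 * (bryantPd m (f x) (p x) / p x) - m / 2 * (1 / f x))
          + x * (1 / f x) / 2))
      (by
        refine ((omul ?_ oU).add (omul (omul (oc 2) or) oud)).add ((omul oud ?_).add ?_)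
        · refine (((omul (omul op or).neg_left oif).sub ?_).add or).sub (omul (oc (m / 2)) ?_)
          · simpa [div_eq_mul_inv] using omul (omul (omul op op) (omul oif oif)) (oc (1 / 2))
          · exact ((omul or oif).add (omul op (omul oif oif))).sub (oc 1)
        · exact (((oc 1).sub (omul op oif)).sub (omul (oc 2) or)).sub (omul (oc (m / 2)) oif)
        · simpa [div_eq_mul_inv] using omul (omul ox oif) (oc (1 / 2)))
      (by
        have c1 : ContinuousOn (fun x => bryantPd m (f x) (p x) / p x) (Ioi 0) := cpd.div cp np
        have c2 : ContinuousOn (fun x => 1 / f x) (Ioi 0) := continuousOn_const.div cf nf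
        fun_prop) Z
    refine ⟨max K0 (max K1 K2), fun x hx => ?_⟩
    have hp0 := h.p_pos x hx.1
    have hfx := (h.pos x hx.1).ne'
    have key : ∀ {c K d : ℝ}, c = d * p x → |d| ≤ K → K ≤ max K0 (max K1 K2) →
        |c| ≤ max K0 (max K1 K2) * p x := by
      intro c K d hc hd hK
      rw [hc, abs_mul, abs_of_pos hp0]
      exact mul_le_mul_of_nonneg_right (hd.trans hK) hp0.le
    refine ⟨key ?_ (hK0 x hx) (le_max_left _ _),
      key ?_ (hK1 x hx) ((le_max_left _ _).trans (le_max_right _ _)),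
      key ?_ (hK2 x hx) ((le_max_right _ _).trans (le_max_right _ _))⟩
    · simp only [hC]; ring
    · simp only [hCd]; field_simp
    · simp only [hCdd, hudd, bryantPdd]
      set pd := bryantPd m (f x) (p x)
      field_simp

end BryantFun

end

section

open Set Filter Topology Asymptotics
open scoped ContDiff

/-- The properties recorded for $C$ concern $x>0$ only, so the value at the tip may be set to 0. -/
theorem BryantCorr.update_zero {m : ℝ} {f p C Cd Cdd : ℝ → ℝ} (h : BryantCorr m f p C Cd Cdd) :
    BryantCorr m f p (Function.update C 0 0) Cd Cdd := by
  have he : ∀ x : ℝ, 0 < x → Function.update C 0 0 x = C x := fun x hx =>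
    Function.update_of_ne hx.ne' _ _
  have hev : ∀ x : ℝ, 0 < x → Function.update C 0 0 =ᶠ[𝓝 x] C := fun x hx =>
    (lt_mem_nhds hx).mono he
  refine ⟨fun x hx => (h.hasDerivAt x hx).congr_of_eventuallyEq (hev x hx), h.hasDerivAt_d,
    h.contDiffOn.congr he, fun x hx => by rw [he x hx]; exact h.pos x hx,
    fun x hx => by rw [he x hx]; exact h.ode x hx, ?_, ?_, fun Z => ?_⟩
  · obtain ⟨M, hM, hs⟩ := h.slope
    refine ⟨M, hM, hs.congr' ?_⟩
    filter_upwards [self_mem_nhdsWithin] with x hx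
    rw [he x hx]
  · refine h.atTop.congr' ?_
    filter_upwards [eventually_gt_atTop 0] with x hx
    rw [he x hx]
  · obtain ⟨K, hK⟩ := h.bound Z
    exact ⟨K, fun x hx => by rw [he x hx.1]; exact hK x hx⟩

theorem BryantCorr.isBryantCorrection {n : ℕ} {f p C Cd Cdd : ℝ → ℝ}
    (hf : BryantFun ((n : ℝ) - 1) f p) (h : BryantCorr ((n : ℝ) - 1) f p C Cd Cdd)
    (h0 : C 0 = 0) : IsBryantCorrection n (fun σ => f (σ ^ 2)) (fun σ => C (σ ^ 2)) where
  zero := by simp [h0]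
  smooth := h.contDiffOn.comp (contDiff_id.pow 2).contDiffOn fun σ hσ => mem_Ioi.2 (pow_pos (mem_Ioi.1 hσ) 2)
  pos := fun σ hσ => h.pos _ (by positivity)
  at_top := h.atTop.comp (tendsto_pow_atTop two_ne_zero)
  at_zero := by
    obtain ⟨M, hM, hs⟩ := h.slope
    refine ⟨M, hM, hs.comp (f := fun σ : ℝ => σ ^ 2) ?_⟩
    refine tendsto_nhdsWithin_iff.2 ⟨?_, ?_⟩
    · simpa using (tendsto_sq_nhds 0).mono_left nhdsWithin_le_nhds
    · filter_upwards [self_mem_nhdsWithin] with σ hσ using mem_Ioi.2 (pow_pos (mem_Ioi.1 hσ) 2)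
  ode := by
    intro σ hσ
    have hx : 0 < σ ^ 2 := by positivity
    have h2 : HasDerivAt (fun y => -p y / y)
        ((p (σ ^ 2) - bryantPd ((n : ℝ) - 1) (f (σ ^ 2)) (p (σ ^ 2))) / (σ ^ 2) ^ 2) (σ ^ 2) := by
      refine ((hf.hasDerivAt_p _ hx).fun_neg.fun_div (hasDerivAt_id _) hx.ne').congr_deriv ?_
      simp only [id]; field_simp; ring
    have k2 : HasDerivAt (fun y => Cd y / y)
        ((Cdd (σ ^ 2) - Cd (σ ^ 2)) / (σ ^ 2) ^ 2) (σ ^ 2) := by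
      refine ((h.hasDerivAt_d _ hx).fun_div (hasDerivAt_id _) hx.ne').congr_deriv ?_
      simp only [id]; field_simp
    rw [opDF_comp_sq hσ.ne' (f1 := fun y => -p y / y) (g1 := fun y => Cd y / y)
      ((lt_mem_nhds hx).mono fun y hy => hf.hasDerivAt y hy) h2
      ((lt_mem_nhds hx).mono fun y hy => h.hasDerivAt y hy) k2,
      (hasDerivAt_comp_sq (hf.hasDerivAt _ hx)).deriv]
    have := h.ode _ hx
    have hσ0 := hσ.ne'
    have e : ∀ a b : ℝ, σ ^ 2 * a = σ ^ 2 * b → a = b := fun a b hab =>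
      mul_left_cancel₀ hx.ne' hab
    apply e
    have r : σ ^ 2 * -(σ * (2 * σ * (-p (σ ^ 2) / σ ^ 2))) = 2 * σ ^ 2 * p (σ ^ 2) := by
      field_simp
    rw [r, ← this]
    field_simp
    ring

theorem BryantCorr.tendsto_zero {m : ℝ} {f p C Cd Cdd : ℝ → ℝ} (h : BryantCorr m f p C Cd Cdd) :
    Tendsto C (𝓝[>] 0) (𝓝 0) := by
  obtain ⟨M, -, hs⟩ := h.slope
  have := hs.mul (show Tendsto (fun x : ℝ => x) (𝓝[>] 0) (𝓝 0) from nhdsWithin_le_nhds)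
  rw [mul_zero] at this
  refine this.congr' ?_
  filter_upwards [self_mem_nhdsWithin] with x hx
  have hx : 0 < x := hx
  field_simp

theorem BryantCorr.continuousOn {m : ℝ} {f p C Cd Cdd : ℝ → ℝ} (h : BryantCorr m f p C Cd Cdd)
    (h0 : C 0 = 0) : ContinuousOn C (Ici 0) := by
  intro x hx
  rcases eq_or_lt_of_le (mem_Ici.1 hx) with hx | hx
  · subst hx
    rw [← Ioi_insert, continuousWithinAt_insert_self, ContinuousWithinAt, h0]
    exact h.tendsto_zero
  · exact (h.hasDerivAt x hx).continuousAt.continuousWithinAt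

/-! ### The length scale `θ` -/

theorem neg_log_pos {t : ℝ} (ht : t ∈ Ioo (0 : ℝ) 1) : 0 < -Real.log t :=
  neg_pos.2 (Real.log_neg ht.1 ht.2)

theorem theta_pos {t : ℝ} (ht : t ∈ Ioo (0 : ℝ) 1) : 0 < theta t :=
  Real.sqrt_pos.2 (div_pos ht.1 (neg_log_pos ht))

theorem theta_sq {t : ℝ} (ht : t ∈ Ioo (0 : ℝ) 1) : theta t ^ 2 = t / (-Real.log t) :=
  Real.sq_sqrt (div_nonneg ht.1.le (neg_log_pos ht).le)

/-- `κ(t) = 1 / (-log t)`. -/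
def kap (t : ℝ) : ℝ := 1 / (-Real.log t)

theorem kap_pos {t : ℝ} (ht : t ∈ Ioo (0 : ℝ) 1) : 0 < kap t := one_div_pos.2 (neg_log_pos ht)

/-- The rule $t\,\kappa'=\kappa^2$ closes the calculus: in logarithmic variables the barriers and
their derivatives stay polynomial in $\kappa$. The same function is used with argument $r$ and with
argument $t$. -/
theorem hasDerivAt_kap {t : ℝ} (ht : t ∈ Ioo (0 : ℝ) 1) :
    HasDerivAt kap (kap t ^ 2 / t) t := by
  have h0 := (neg_log_pos ht).ne'
  have := ht.1.ne'
  refine ((hasDerivAt_const t (1 : ℝ)).fun_div (Real.hasDerivAt_log this).fun_neg h0).congr_deriv ?_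
  rw [kap]; field_simp; simp

theorem tendsto_kap : Tendsto kap (𝓝[>] 0) (𝓝[>] 0) := by
  refine tendsto_nhdsWithin_iff.2 ⟨?_, ?_⟩
  · have : Tendsto (fun t => -Real.log t) (𝓝[>] 0) atTop :=
      tendsto_neg_atBot_atTop.comp Real.tendsto_log_nhdsGT_zero
    refine (tendsto_inv_atTop_zero.comp this).congr fun t => ?_
    simp [kap]
  · filter_upwards [Ioo_mem_nhdsGT one_pos] with t ht using kap_pos ht

theorem theta_sq_eq {t : ℝ} (ht : t ∈ Ioo (0 : ℝ) 1) : theta t ^ 2 = t * kap t := by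
  rw [theta_sq ht, kap, mul_one_div]

theorem theta_mul_deriv {t : ℝ} (ht : t ∈ Ioo (0 : ℝ) 1) :
    theta t * deriv theta t = (kap t + kap t ^ 2) / 2 := by
  have hpos := div_pos ht.1 (neg_log_pos ht)
  have hd : HasDerivAt (fun t : ℝ => t / (-Real.log t)) (kap t + kap t ^ 2) t := by
    have h0 := (neg_log_pos ht).ne'
    have := ht.1.ne'
    refine ((hasDerivAt_id t).fun_div (Real.hasDerivAt_log this).fun_neg h0).congr_deriv ?_
    simp only [kap, id]; field_simp; ring
  have h1 : HasDerivAt theta ((kap t + kap t ^ 2) / (2 * theta t)) t := hd.sqrt hpos.ne'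
  have := (theta_pos ht).ne'
  rw [h1.deriv]; field_simp

theorem contDiffAt_kap {t : ℝ} (ht : t ∈ Ioo (0 : ℝ) 1) : ContDiffAt ℝ 2 kap t :=
  contDiffAt_const.div (Real.contDiffAt_log.2 ht.1.ne').neg (neg_log_pos ht).ne'

end

section

open Set Filter Topology Asymptotics
open scoped ContDiff

/-! ### The inner barriers -/

/-- The argument of the inner barriers, in terms of `y = r²`. -/
def inX (q y t : ℝ) : ℝ := q * y / (t * kap t)

theorem inX_pos {q y t : ℝ} (hq : 0 < q) (hy : 0 < y) (ht : t ∈ Ioo (0 : ℝ) 1) : 0 < inX q y t :=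
  div_pos (mul_pos hq hy) (mul_pos ht.1 (kap_pos ht))

theorem hasDerivAt_inX_time {q y t : ℝ} (ht : t ∈ Ioo (0 : ℝ) 1) :
    HasDerivAt (fun t => inX q y t) (-(inX q y t * (1 + kap t) / t)) t := by
  have hk := (kap_pos ht).ne'
  have h0 := ht.1.ne'
  refine ((hasDerivAt_const t (q * y)).fun_div ((hasDerivAt_id t).fun_mul (hasDerivAt_kap ht))
    (mul_ne_zero h0 hk)).congr_deriv ?_
  simp only [inX, id]; field_simp; ring

theorem hasDerivAt_comp_inX {g gd : ℝ → ℝ} (hg : ∀ x, 0 < x → HasDerivAt g (gd x / x) x)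
    {q y t : ℝ} (hq : 0 < q) (hy : 0 < y) (ht : t ∈ Ioo (0 : ℝ) 1) :
    HasDerivAt (fun y => g (inX q y t)) (gd (inX q y t) / y) y := by
  have hX := inX_pos hq hy ht
  have h1 : HasDerivAt (fun y => inX q y t) (q / (t * kap t)) y := by
    simpa [inX] using ((hasDerivAt_id y).const_mul q).div_const (t * kap t)
  refine (HasDerivAt.comp (h₂ := g) (h := fun y => inX q y t) y (hg _ hX) h1).congr_deriv ?_
  have hk := (kap_pos ht).ne'
  have h0 := ht.1.ne'
  have e : inX q y t = q / (t * kap t) * y := by rw [inX]; ring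
  rw [div_mul_eq_mul_div, div_eq_div_iff hX.ne' hy.ne', e]; ring

theorem hasDerivAt_comp_inX_time {g gd : ℝ → ℝ} (hg : ∀ x, 0 < x → HasDerivAt g (gd x / x) x)
    {q y t : ℝ} (hq : 0 < q) (hy : 0 < y) (ht : t ∈ Ioo (0 : ℝ) 1) :
    HasDerivAt (fun t => g (inX q y t)) (-(gd (inX q y t) * (1 + kap t) / t)) t := by
  have hX := inX_pos hq hy ht
  refine (HasDerivAt.comp (h₂ := g) (h := fun t => inX q y t) t (hg _ hX)
    (hasDerivAt_inX_time ht)).congr_deriv ?_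
  have h0 := ht.1.ne'
  field_simp

/-- The inner barriers with `q = k²`, in the variable `y = r²`. -/
def inBar (f C : ℝ → ℝ) (ε s q y t : ℝ) : ℝ :=
  f (inX q y t) + (1 - s * ε) * ((kap t + kap t ^ 2) / 2) * (C (inX q y t) / q)

theorem vIn_eq_inBar {n : ℕ} {f C : ℝ → ℝ} {A ε δ s r t : ℝ} (ht : t ∈ Ioo (0 : ℝ) 1) :
    vIn n (fun σ => f (σ ^ 2)) (fun σ => C (σ ^ 2)) A ε δ s r t
      = inBar f C ε s (kC n A ε δ s ^ 2) (r ^ 2) t := by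
  have e : (kC n A ε δ s * (r / theta t)) ^ 2 = inX (kC n A ε δ s ^ 2) (r ^ 2) t := by
    rw [mul_pow, div_pow, theta_sq_eq ht, inX, mul_div_assoc]
  simp only [vIn, inBar, e, theta_mul_deriv ht]

variable {n : ℕ} {f p C Cd Cdd : ℝ → ℝ}

/-- $\mathcal F$ is quadratic, so $\mathcal F[f+\eta C]$ is $\mathcal F[f]=0$, plus $\eta$ times the
linearization, plus $\eta^2$ times the quadratic part of $\mathcal F$ on $C$. The equation for $C$
turns the linear term into $(1-s\varepsilon)(\kappa+\kappa^2)p$, which is $v_t$ to leading order up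
to the factor $1-s\varepsilon$. -/
theorem opF_inBar (hf : BryantFun ((n : ℝ) - 1) f p) (hC : BryantCorr ((n : ℝ) - 1) f p C Cd Cdd)
    {ε s q r t x κ : ℝ} (hq : 0 < q) (hr : 0 < r) (ht : t ∈ Ioo (0 : ℝ) 1)
    (hx : x = inX q (r ^ 2) t) (hκ : κ = kap t) :
    opF n (fun r => inBar f C ε s q (r ^ 2) t) r = (1 / (t * κ)) *
      ((1 - s * ε) * (κ + κ ^ 2) * p x + q * ((1 - s * ε) * ((κ + κ ^ 2) / (2 * q))) ^ 2 *
        (4 * C x * (Cdd x - Cd x) - 2 * Cd x ^ 2 - 2 * ((n : ℝ) - 1) * C x ^ 2) / x) := by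
  set m : ℝ := (n : ℝ) - 1 with hm
  have hy : 0 < r ^ 2 := by positivity
  have hf1 : ∀ x, 0 < x → HasDerivAt f ((fun x => -p x) x / x) x := fun x hx => hf.hasDerivAt x hx
  have hp1 : ∀ x, 0 < x → HasDerivAt (fun x => -p x)
      ((fun x => -bryantPd m (f x) (p x)) x / x) x := fun x hx => by
    refine (hf.hasDerivAt_p x hx).fun_neg.congr_deriv ?_
    simp only; ring
  set η := (1 - s * ε) * ((κ + κ ^ 2) / (2 * q)) with hη
  have h1 : ∀ᶠ y in 𝓝 (r ^ 2), HasDerivAt (fun y => inBar f C ε s q y t)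
      ((fun y => (-p (inX q y t) + η * Cd (inX q y t)) / y) y) y := by
    filter_upwards [lt_mem_nhds hy] with y hy
    refine ((hasDerivAt_comp_inX hf1 hq hy ht).fun_add
      (((hasDerivAt_comp_inX hC.hasDerivAt hq hy ht).div_const q).const_mul
        ((1 - s * ε) * ((kap t + kap t ^ 2) / 2)))).congr_deriv ?_
    simp only [hη, hκ]; field_simp
  have h2 := ((hasDerivAt_comp_inX hp1 hq hy ht).fun_add
      ((hasDerivAt_comp_inX hC.hasDerivAt_d hq hy ht).const_mul η)).fun_div
      (hasDerivAt_id (r ^ 2)) hy.ne'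
  have hF := opF_comp_sq (n := n) hr.ne' h1 h2
  rw [hF]
  have hval : inBar f C ε s q (r ^ 2) t = f x + η * C x := by
    rw [inBar, ← hx, hη, hκ]; field_simp
  have hXp : 0 < x := hx ▸ inX_pos hq hy ht
  have hode := hC.ode x hXp
  have hfx := (hf.pos x hXp).ne'
  have hxr : r ^ 2 = x * (t * κ) / q := by
    have hk := (kap_pos ht).ne'
    have h0 := ht.1.ne'
    rw [hx, inX, hκ]; field_simp
  simp only [hval, ← hx, ← hm, id] at *
  have hk := (kap_pos ht).ne'
  rw [← hκ] at hk
  have h0 := ht.1.ne'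
  have hpd : bryantPd m (f x) (p x) * (2 * f x) = -p x ^ 2 + 2 * f x * p x
      - m * (p x - f x + f x ^ 2) := by
    rw [bryantPd]; field_simp
  set pd := bryantPd m (f x) (p x)
  have hηq : 2 * q * η = (1 - s * ε) * (κ + κ ^ 2) := by rw [hη]; field_simp
  rw [← hηq]
  have hr0 := hr.ne'
  have key : ∀ a b : ℝ, r ^ 2 * a = r ^ 2 * b → a = b := fun a b h => mul_left_cancel₀ hy.ne' h
  apply key
  have lhs : r ^ 2 * (4 * r ^ 2 * (f x + η * C x) * (((-pd / r ^ 2 + η * (Cdd x / r ^ 2)) * r ^ 2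
      - (-p x + η * Cd x) * 1) / (r ^ 2) ^ 2) - 2 * r ^ 2 * ((-p x + η * Cd x) / r ^ 2) ^ 2
      + 2 * m * ((-p x + η * Cd x) / r ^ 2)
      + 2 * m / r ^ 2 * ((f x + η * C x) * (1 - (f x + η * C x)))) =
      4 * (f x + η * C x) * ((-pd + η * Cdd x) - (-p x + η * Cd x)) - 2 * (-p x + η * Cd x) ^ 2
      + 2 * m * (-p x + η * Cd x) + 2 * m * ((f x + η * C x) * (1 - (f x + η * C x))) := by
    field_simp
  rw [lhs]
  have rhs : r ^ 2 * (1 / (t * κ) * (2 * q * η * p x + q * η ^ 2 *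
      (4 * C x * (Cdd x - Cd x) - 2 * Cd x ^ 2 - 2 * m * C x ^ 2) / x)) =
      η * (2 * x * p x) + η ^ 2 * (4 * C x * (Cdd x - Cd x) - 2 * Cd x ^ 2 - 2 * m * C x ^ 2) := by
    rw [hxr]; field_simp
  rw [rhs, ← hode]
  linear_combination (-2) * hpd

theorem hasDerivAt_inBar_time (hf : BryantFun ((n : ℝ) - 1) f p)
    (hC : BryantCorr ((n : ℝ) - 1) f p C Cd Cdd)
    {ε s q r t x κ : ℝ} (hq : 0 < q) (hr : 0 < r) (ht : t ∈ Ioo (0 : ℝ) 1)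
    (hx : x = inX q (r ^ 2) t) (hκ : κ = kap t) :
    HasDerivAt (fun t => inBar f C ε s q (r ^ 2) t) ((1 / (t * κ)) *
      ((κ + κ ^ 2) * p x - (1 - s * ε) * (κ + κ ^ 2) ^ 2 / (2 * q) * Cd x
        + (1 - s * ε) / (2 * q) * C x * (κ ^ 3 + 2 * κ ^ 4))) t := by
  have hy : 0 < r ^ 2 := by positivity
  have hf1 : ∀ x, 0 < x → HasDerivAt f ((fun x => -p x) x / x) x := fun x hx => hf.hasDerivAt x hx
  have hk := hasDerivAt_kap ht
  refine ((hasDerivAt_comp_inX_time hf1 hq hy ht).fun_add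
    ((((hk.fun_add (hk.fun_pow 2)).div_const 2).const_mul (1 - s * ε)).fun_mul
      ((hasDerivAt_comp_inX_time hC.hasDerivAt hq hy ht).div_const q))).congr_deriv ?_
  rw [← hx, ← hκ]
  have hk0 : κ ≠ 0 := hκ ▸ (kap_pos ht).ne'
  have h0 := ht.1.ne'
  field_simp
  ring

theorem contDiffAt_inBar (hf : BryantFun ((n : ℝ) - 1) f p)
    (hC : BryantCorr ((n : ℝ) - 1) f p C Cd Cdd)
    {ε s q r t : ℝ} (hq : 0 < q) (hr : 0 < r) (ht : t ∈ Ioo (0 : ℝ) 1) :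
    ContDiffAt ℝ 2 (fun z : ℝ × ℝ => inBar f C ε s q (z.1 ^ 2) z.2) (r, t) := by
  have hX := inX_pos hq (pow_pos hr 2) ht
  have hk : ContDiffAt ℝ 2 (fun z : ℝ × ℝ => kap z.2) (r, t) :=
    ContDiffAt.comp (g := kap) (r, t) (contDiffAt_kap ht) contDiffAt_snd
  have hx : ContDiffAt ℝ 2 (fun z : ℝ × ℝ => inX q (z.1 ^ 2) z.2) (r, t) :=
    (contDiffAt_const.mul (contDiffAt_fst.pow 2)).div (contDiffAt_snd.mul hk)
      (mul_ne_zero ht.1.ne' (kap_pos ht).ne')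
  have h2 : (2 : WithTop ℕ∞) ≤ ∞ := WithTop.coe_le_coe.2 (le_top : (2 : ℕ∞) ≤ ⊤)
  have hf2 : ContDiffAt ℝ 2 f (inX q (r ^ 2) t) := (hf.contDiffAt _ hX.le).of_le h2
  have hC2 : ContDiffAt ℝ 2 C (inX q (r ^ 2) t) :=
    (hC.contDiffOn.contDiffAt (Ioi_mem_nhds hX)).of_le h2
  exact (ContDiffAt.comp (g := f) (f := fun z : ℝ × ℝ => inX q (z.1 ^ 2) z.2) (r, t) hf2 hx).add
    ((contDiffAt_const.mul ((hk.add (hk.pow 2)).div_const 2)).mul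
      ((ContDiffAt.comp (g := C) (f := fun z : ℝ × ℝ => inX q (z.1 ^ 2) z.2) (r, t) hC2 hx).div_const
        q))

theorem BryantFun.exists_p_bound {m : ℝ} (h : BryantFun m f p) (Z : ℝ) :
    ∃ K, ∀ x ∈ Ioc 0 Z, p x ≤ K * x := by
  obtain ⟨K, hK⟩ := exists_bound_Ioc (h.slope_p.isBigO_one ℝ)
    (h.continuousOn_p.div continuousOn_id fun x hx => (mem_Ioi.1 hx).ne') Z
  refine ⟨K, fun x hx => ?_⟩
  have := (le_abs_self _).trans (hK x hx)
  exact (div_le_iff₀ hx.1).1 this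

/-- The inner barriers are strict sub- and supersolutions once `κ` is small. -/
theorem exists_inBar_strict (hf : BryantFun ((n : ℝ) - 1) f p)
    (hC : BryantCorr ((n : ℝ) - 1) f p C Cd Cdd) (hn : 1 ≤ (n : ℝ) - 1)
    {ε q₀ : ℝ} (hε : 0 < ε) (hε1 : ε < 1) (hq₀ : 0 < q₀) (Z : ℝ) :
    ∃ κ₀ > 0, ∀ s q r t : ℝ, s ^ 2 = 1 → q₀ ≤ q → 0 < r → t ∈ Ioo (0 : ℝ) 1 → kap t < κ₀ →
      inX q (r ^ 2) t ≤ Z →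
      0 ≤ s * (deriv (fun t => inBar f C ε s q (r ^ 2) t) t
        - opF n (fun r => inBar f C ε s q (r ^ 2) t) r) := by
  obtain ⟨K, hK⟩ := hC.bound Z
  obtain ⟨K2, hK2⟩ := hf.exists_p_bound Z
  set m : ℝ := (n : ℝ) - 1 with hm
  set K3 := (10 + 2 * m) * K ^ 2 * |K2| with hK3
  have hK30 : 0 ≤ K3 := by positivity
  -- The gain is $\varepsilon\kappa p$. The errors `T1`, `T2`, `T3` are at most $4K_3$, $4K$ and
  -- $3K$ times $\kappa^2p/q_0$. As $p$ factors out of everything, the smallness of $\kappa$ needed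
  -- is uniform up to the tip.
  refine ⟨min 1 (ε * q₀ / (4 * K3 + 7 * |K| + 1)), by positivity,
    fun s q r t hs hq hr ht hκ hxZ => ?_⟩
  have hq0 : 0 < q := hq₀.trans_le hq
  set x := inX q (r ^ 2) t with hx
  have hx0 : 0 < x := inX_pos hq0 (pow_pos hr 2) ht
  set κ := kap t with hκd
  have hκ0 : 0 < κ := kap_pos ht
  have hκ1 : κ < 1 := hκ.trans_le (min_le_left _ _)
  have hκ2 : κ * (4 * K3 + 7 * |K| + 1) ≤ ε * q₀ := by
    have := (hκ.trans_le (min_le_right _ _)).le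
    rwa [le_div_iff₀ (by positivity)] at this
  rw [(hasDerivAt_inBar_time hf hC hq0 hr ht hx hκd).deriv, opF_inBar hf hC hq0 hr ht hx hκd,
    ← mul_sub, mul_left_comm]
  refine mul_nonneg (by have := ht.1; positivity) ?_
  have hp := hf.p_pos x hx0
  obtain ⟨b0, b1, b2⟩ := hK x ⟨hx0, hxZ⟩
  have hKn : 0 ≤ K := by
    by_contra! h
    have := (abs_nonneg _).trans b0
    linarith [mul_neg_of_neg_of_pos h hp]
  rw [abs_of_nonneg hKn] at hκ2
  have hs1 : |s| = 1 := by rw [← sq_eq_sq₀ (abs_nonneg _) one_pos.le, sq_abs, hs, one_pow]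
  have hsε : |1 - s * ε| ≤ 2 := by
    have : |s * ε| ≤ 1 := by rw [abs_mul, hs1, abs_of_pos hε]; linarith
    rw [abs_le] at this ⊢; constructor <;> linarith [this.1, this.2]
  set e := κ + κ ^ 2 with he
  have he1 : κ ≤ e := by rw [he]; nlinarith
  have he2 : e ≤ 2 * κ := by rw [he]; nlinarith
  set Q := 4 * C x * (Cdd x - Cd x) - 2 * Cd x ^ 2 - 2 * m * C x ^ 2 with hQ
  have hQb : |Q| ≤ (10 + 2 * m) * K ^ 2 * p x ^ 2 := by
    set P := K * p x with hP
    have hP0 : 0 ≤ P := by positivity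
    have c1 : |C x * (Cdd x - Cd x)| ≤ P * (2 * P) := by
      rw [abs_mul]
      refine mul_le_mul b0 ((abs_sub _ _).trans (by linarith)) (abs_nonneg _) hP0
    have c2 : Cd x ^ 2 ≤ P ^ 2 := sq_le_sq' (by linarith [(abs_le.1 b1).1]) (abs_le.1 b1).2
    have c3 : C x ^ 2 ≤ P ^ 2 := sq_le_sq' (by linarith [(abs_le.1 b0).1]) (abs_le.1 b0).2
    have c4 : m * C x ^ 2 ≤ m * P ^ 2 := mul_le_mul_of_nonneg_left c3 (by linarith)
    have c5 : 0 ≤ m * C x ^ 2 := by positivity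
    have c6 : (10 + 2 * m) * K ^ 2 * p x ^ 2 = 10 * P ^ 2 + 2 * (m * P ^ 2) := by rw [hP]; ring
    rw [c6, hQ, abs_le]
    rw [abs_le] at c1
    constructor <;> linarith [sq_nonneg (Cd x), c1.1, c1.2]
  have hQx : |Q / x| ≤ K3 * p x := by
    rw [abs_div, abs_of_pos hx0, div_le_iff₀ hx0]
    refine hQb.trans ?_
    have := (hK2 x ⟨hx0, hxZ⟩).trans (mul_le_mul_of_nonneg_right (le_abs_self K2) hx0.le)
    calc (10 + 2 * m) * K ^ 2 * p x ^ 2 = (10 + 2 * m) * K ^ 2 * p x * p x := by ring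
      _ ≤ (10 + 2 * m) * K ^ 2 * p x * (|K2| * x) := by gcongr
      _ = _ := by rw [hK3]; ring
  have hsq : (1 - s * ε) ^ 2 ≤ 4 := by
    have := sq_le_sq' (abs_le.1 hsε).1 (abs_le.1 hsε).2
    linarith
  have T1 : |q * ((1 - s * ε) * (e / (2 * q))) ^ 2 * Q / x| ≤ 4 * K3 * κ ^ 2 / q₀ * p x := by
    have e1 : q * ((1 - s * ε) * (e / (2 * q))) ^ 2 * Q / x
      = (1 - s * ε) ^ 2 * e ^ 2 / (4 * q) * (Q / x) := by field_simp; ring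
    rw [e1, abs_mul, abs_of_nonneg (by positivity)]
    calc (1 - s * ε) ^ 2 * e ^ 2 / (4 * q) * |Q / x|
        ≤ 4 * (2 * κ) ^ 2 / (4 * q₀) * (K3 * p x) := by gcongr
      _ = _ := by field_simp; ring
  have T2 : |(1 - s * ε) * e ^ 2 / (2 * q) * Cd x| ≤ 4 * K * κ ^ 2 / q₀ * p x := by
    rw [abs_mul, abs_div, abs_mul, abs_of_nonneg (sq_nonneg e), abs_of_pos (by positivity : 0 < 2 * q)]
    calc |1 - s * ε| * e ^ 2 / (2 * q) * |Cd x| ≤ 2 * (2 * κ) ^ 2 / (2 * q₀) * (K * p x) := by gcongr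
      _ = _ := by field_simp; ring
  have T3 : |(1 - s * ε) / (2 * q) * C x * (κ ^ 3 + 2 * κ ^ 4)| ≤ 3 * K * κ ^ 2 / q₀ * p x := by
    have hκ3 : κ ^ 3 + 2 * κ ^ 4 ≤ 3 * κ ^ 2 := by
      have h1 : κ ^ 3 ≤ κ ^ 2 := pow_le_pow_of_le_one hκ0.le hκ1.le (by norm_num)
      have h2 : κ ^ 4 ≤ κ ^ 2 := pow_le_pow_of_le_one hκ0.le hκ1.le (by norm_num)
      linarith
    rw [abs_mul, abs_mul, abs_div, abs_of_pos (by positivity : 0 < 2 * q),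
      abs_of_pos (by positivity : 0 < κ ^ 3 + 2 * κ ^ 4)]
    calc |1 - s * ε| / (2 * q) * |C x| * (κ ^ 3 + 2 * κ ^ 4)
        ≤ 2 / (2 * q₀) * (K * p x) * (3 * κ ^ 2) := by gcongr
      _ = _ := by field_simp
  set R1 := q * ((1 - s * ε) * (e / (2 * q))) ^ 2 * Q / x
  set R2 := (1 - s * ε) * e ^ 2 / (2 * q) * Cd x
  set R3 := (1 - s * ε) / (2 * q) * C x * (κ ^ 3 + 2 * κ ^ 4)
  have hmain : (4 * K3 + 7 * K) * κ ^ 2 / q₀ * p x ≤ ε * κ * p x := by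
    refine mul_le_mul_of_nonneg_right ?_ hp.le
    rw [div_le_iff₀ hq₀]
    have := mul_le_mul_of_nonneg_left hκ2 hκ0.le
    linarith [sq_nonneg κ]
  have hfin : ∀ R : ℝ, -|R| ≤ s * R := fun R => by
    have := neg_abs_le (s * R); rwa [abs_mul, hs1, one_mul] at this
  have e4 : s * (e * p x - R2 + R3 - ((1 - s * ε) * e * p x + R1))
      = s ^ 2 * ε * e * p x + s * (-R2) + s * R3 + s * (-R1) := by ring
  rw [e4, hs]
  have f1 := hfin (-R2)
  have f2 := hfin R3
  have f3 := hfin (-R1)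
  rw [abs_neg] at f1 f3
  have e5 : (4 * K3 + 7 * K) * κ ^ 2 / q₀ * p x = 4 * K3 * κ ^ 2 / q₀ * p x
    + 4 * K * κ ^ 2 / q₀ * p x + 3 * K * κ ^ 2 / q₀ * p x := by ring
  have e6 : ε * κ * p x ≤ ε * e * p x := by gcongr
  linarith

end

section

open Set Filter Topology Asymptotics
open scoped ContDiff

/-! ### The parabolic barriers -/

/-- The parabolic barriers, in the variable `y = r²`. -/
def parBar (m a b y t : ℝ) : ℝ :=
  a * kap t * (m / 2 * (1 + 2 * m * (t / y))) + b * kap t ^ 2 * (t / y) ^ 2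

theorem vPar_eq_parBar {n : ℕ} {A B ε δ s r t : ℝ} (ht : t ∈ Ioo (0 : ℝ) 1) :
    vPar n A B ε δ s r t
      = parBar ((n : ℝ) - 1) (1 + s * gammaC n A ε δ s) (s * B ^ 2) (r ^ 2) t := by
  have e : (r / Real.sqrt t) ^ 2 = r ^ 2 / t := by rw [div_pow, Real.sq_sqrt ht.1.le]
  have e4 : (r / Real.sqrt t) ^ 4 = (r ^ 2 / t) ^ 2 := by rw [← e]; ring
  rw [vPar, W0, e, e4, parBar, kap, div_eq_mul_inv (2 * _) (r ^ 2 / t), inv_div]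
  have hl := (neg_log_pos ht).ne'
  rcases eq_or_ne r 0 with h0 | h0
  · simp [h0]; ring
  · have h0' := ht.1.ne'
    have hl' : Real.log t ≠ 0 := fun h => hl (by simp [h])
    field_simp

/-- Here $z=t/r^2=\rho^{-2}$. The linear part of $\mathcal F$ sends $\kappa W_0$ to $\kappa
m^2/r^2$, which the time derivative of $\kappa W_0$ matches at order $\kappa$; the long bracket is
the quadratic part. -/
theorem opF_parBar {n : ℕ} {m a b r t κ z : ℝ} (hr : 0 < r) (hm : m = (n : ℝ) - 1)
    (hκ : κ = kap t) (hz : z = t / r ^ 2) :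
    opF n (fun r => parBar m a b (r ^ 2) t) r = 1 / r ^ 2 * (a * κ * m ^ 2 - 2 * m * b * κ ^ 2 * z ^ 2
      + (4 * (a * κ * (m / 2 * (1 + 2 * m * z)) + b * κ ^ 2 * z ^ 2) *
          (2 * (a * κ) * m ^ 2 * z + 6 * (b * κ ^ 2 * z ^ 2))
        - 2 * (a * κ * m ^ 2 * z + 2 * (b * κ ^ 2 * z ^ 2)) ^ 2
        - 2 * m * (a * κ * (m / 2 * (1 + 2 * m * z)) + b * κ ^ 2 * z ^ 2) ^ 2)) := by
  have hy : 0 < r ^ 2 := by positivity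
  have hinv : ∀ y : ℝ, 0 < y → HasDerivAt (fun y => t / y) (-(t / y ^ 2)) y := fun y hy => by
    refine ((hasDerivAt_const y t).fun_div (hasDerivAt_id y) hy.ne').congr_deriv ?_
    simp only [id]; field_simp; simp
  have h1 : ∀ᶠ y in 𝓝 (r ^ 2), HasDerivAt (fun y => parBar m a b y t)
      ((fun y => (-(a * κ * m ^ 2) * (t / y) - 2 * (b * κ ^ 2) * (t / y) ^ 2) / y) y) y := by
    filter_upwards [lt_mem_nhds hy] with y hy
    refine (((((hinv y hy).const_mul (2 * m)).const_add 1).const_mul (m / 2)).const_mul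
      (a * kap t)).fun_add (((hinv y hy).fun_pow 2).const_mul (b * kap t ^ 2)) |>.congr_deriv ?_
    simp only [← hκ, Nat.cast_ofNat, Nat.add_one_sub_one, pow_one]; field_simp; ring
  have h2 := (((hinv _ hy).const_mul (-(a * κ * m ^ 2))).fun_sub
    (((hinv _ hy).fun_pow 2).const_mul (2 * (b * κ ^ 2)))).fun_div (hasDerivAt_id (r ^ 2)) hy.ne'
  rw [opF_comp_sq (n := n) hr.ne' h1 h2, ← hm]
  simp only [parBar, ← hκ, id]
  have ht : t = z * r ^ 2 := by rw [hz]; field_simp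
  rw [ht]
  field_simp
  ring

theorem hasDerivAt_parBar_time {m a b r t κ z : ℝ} (hr : 0 < r) (ht : t ∈ Ioo (0 : ℝ) 1)
    (hκ : κ = kap t) (hz : z = t / r ^ 2) :
    HasDerivAt (fun t => parBar m a b (r ^ 2) t) (1 / r ^ 2 *
      (a * κ ^ 2 * (m / 2 * (1 + 2 * m * z)) / z + a * κ * m ^ 2 + 2 * b * κ ^ 3 * z
        + 2 * b * κ ^ 2 * z)) t := by
  have hk := hasDerivAt_kap ht
  have h1 : HasDerivAt (fun t => t / r ^ 2) (1 / r ^ 2) t := (hasDerivAt_id t).div_const _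
  refine (((hk.const_mul a).fun_mul (((h1.const_mul (2 * m)).const_add 1).const_mul (m / 2))).fun_add
    (((hk.fun_pow 2).const_mul b).fun_mul (h1.fun_pow 2))).congr_deriv ?_
  have h0 := ht.1.ne'
  rw [← hκ, ← hz]
  have ht : t = z * r ^ 2 := by rw [hz]; field_simp
  have hz0 : z ≠ 0 := by rintro rfl; simp at ht; exact h0 ht
  rw [ht]
  field_simp
  ring

theorem contDiffAt_parBar {m a b r t : ℝ} (hr : 0 < r) (ht : t ∈ Ioo (0 : ℝ) 1) :
    ContDiffAt ℝ 2 (fun z : ℝ × ℝ => parBar m a b (z.1 ^ 2) z.2) (r, t) := by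
  have hk : ContDiffAt ℝ 2 (fun z : ℝ × ℝ => kap z.2) (r, t) :=
    ContDiffAt.comp (g := kap) (r, t) (contDiffAt_kap ht) contDiffAt_snd
  have hz : ContDiffAt ℝ 2 (fun z : ℝ × ℝ => z.2 / z.1 ^ 2) (r, t) :=
    contDiffAt_snd.div (contDiffAt_fst.pow 2) (pow_pos hr 2).ne'
  exact ((contDiffAt_const.mul hk).mul (contDiffAt_const.mul (contDiffAt_const.add
    (contDiffAt_const.mul hz)))).add ((contDiffAt_const.mul (hk.pow 2)).mul (hz.pow 2))

theorem abs_parBar_quadratic_le {m s β u w G : ℝ} (hm : 1 ≤ m) (hs1 : |s| = 1) (hβ0 : 0 ≤ β)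
    (hu0 : 0 ≤ u) (hw0 : 0 ≤ w) (huG : u ≤ G) (hwG : w ≤ G) :
    |4 * (u + s * β) * (2 * w + 6 * (s * β)) - 2 * (w + 2 * (s * β)) ^ 2
      - 2 * m * (u + s * β) ^ 2| ≤ 68 * m * G ^ 2 + 68 * m * β ^ 2 := by
  have hG0 : 0 ≤ G := hu0.trans huG
  have hsβ : |s * β| = β := by rw [abs_mul, hs1, one_mul, abs_of_nonneg hβ0]
  obtain ⟨hl, hr⟩ := abs_le.1 hsβ.le
  have a1 : |u + s * β| ≤ G + β := abs_le.2 ⟨by linarith, by linarith⟩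
  have a2 : |2 * w + 6 * (s * β)| ≤ 6 * (G + β) := abs_le.2 ⟨by linarith, by linarith⟩
  have a3 : |w + 2 * (s * β)| ≤ 2 * (G + β) := abs_le.2 ⟨by linarith, by linarith⟩
  have b1 : |(u + s * β) * (2 * w + 6 * (s * β))| ≤ (G + β) * (6 * (G + β)) := by
    rw [abs_mul]; exact mul_le_mul a1 a2 (abs_nonneg _) (by positivity)
  have b2 : (w + 2 * (s * β)) ^ 2 ≤ (2 * (G + β)) ^ 2 := by
    rw [← sq_abs]; exact pow_le_pow_left₀ (abs_nonneg _) a3 2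
  have b3 : (u + s * β) ^ 2 ≤ (G + β) ^ 2 := by
    rw [← sq_abs]; exact pow_le_pow_left₀ (abs_nonneg _) a1 2
  have b4 : m * (u + s * β) ^ 2 ≤ m * (G + β) ^ 2 := by gcongr
  have b5 : 0 ≤ m * (u + s * β) ^ 2 := by positivity
  have b6 : (G + β) ^ 2 ≤ 2 * G ^ 2 + 2 * β ^ 2 := by linarith [sq_nonneg (G - β)]
  have b7 : (G + β) ^ 2 ≤ m * (G + β) ^ 2 := le_mul_of_one_le_left (sq_nonneg _) hm
  have b8 : m * (G + β) ^ 2 ≤ m * (2 * G ^ 2 + 2 * β ^ 2) := by gcongr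
  have b9 := sq_nonneg (w + 2 * (s * β))
  rw [abs_le] at b1 ⊢
  constructor <;> linarith [b1.1, b1.2]

/-- The term $sB^2\kappa^2z^2$ contributes a gain of at least $2S$ with $S=B^2\kappa^2(z^2+z)$. The
errors that do not contain $B$ are of size $\kappa^2(1+1/z)$ and $\kappa^2(1+z)^2$, both below $S$
when $z\ge z_0$ and $B$ is large. The quadratic error of the correction itself is small because
$\kappa z\le\varepsilon/B^2$. -/
theorem parBar_error_bound {m a κ z z₀ s B ε : ℝ} (hm : 1 ≤ m) (ha0 : 0 ≤ a) (ha : a ≤ 2)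
    (hκ : 0 < κ) (hκ4 : κ ≤ 1 / 4) (hz₀ : 0 < z₀) (hz : z₀ ≤ z) (hs : s ^ 2 = 1) (hB : 1 ≤ B)
    (hε : 0 < ε) (hεm : 12 * m * ε ≤ 1)
    (hκz : κ * z ≤ ε / B ^ 2) (hBz : 2 * m ^ 2 / z₀ ^ 2 + 272 * m ^ 5 * (1 + 1 / z₀) ≤ B ^ 2) :
    0 ≤ s * ((a * κ ^ 2 * (m / 2 * (1 + 2 * m * z)) / z + a * κ * m ^ 2 + 2 * (s * B ^ 2) * κ ^ 3 * z
        + 2 * (s * B ^ 2) * κ ^ 2 * z) - (a * κ * m ^ 2 - 2 * m * (s * B ^ 2) * κ ^ 2 * z ^ 2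
      + (4 * (a * κ * (m / 2 * (1 + 2 * m * z)) + (s * B ^ 2) * κ ^ 2 * z ^ 2) *
          (2 * (a * κ) * m ^ 2 * z + 6 * ((s * B ^ 2) * κ ^ 2 * z ^ 2))
        - 2 * (a * κ * m ^ 2 * z + 2 * ((s * B ^ 2) * κ ^ 2 * z ^ 2)) ^ 2
        - 2 * m * (a * κ * (m / 2 * (1 + 2 * m * z)) + (s * B ^ 2) * κ ^ 2 * z ^ 2) ^ 2))) := by
  have hz0 : 0 < z := hz₀.trans_le hz
  set β := B ^ 2 * κ ^ 2 * z ^ 2 with hβ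
  set S := B ^ 2 * κ ^ 2 * (z ^ 2 + z) with hS
  set G := 2 * κ * m ^ 2 * (1 + z) with hG
  set u := a * κ * (m / 2 * (1 + 2 * m * z)) with hu
  set w := a * κ * m ^ 2 * z with hw
  have hβ0 : 0 ≤ β := by positivity
  have hG0 : 0 ≤ G := by positivity
  have hβS : β ≤ S := by
    rw [hβ, hS]; have : 0 ≤ B ^ 2 * κ ^ 2 * z := by positivity
    linarith
  have hu0 : 0 ≤ u := by positivity
  have hw0 : 0 ≤ w := by positivity
  have hmm : m ≤ m ^ 2 := by nlinarith
  have huG : u ≤ G := by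
    rw [hu, hG]
    calc a * κ * (m / 2 * (1 + 2 * m * z)) ≤ 2 * κ * (m ^ 2 * (1 + z)) := by
          have : m / 2 * (1 + 2 * m * z) ≤ m ^ 2 * (1 + z) := by nlinarith
          gcongr
      _ = _ := by ring
  have hwG : w ≤ G := by
    rw [hw, hG]
    gcongr; linarith
  -- Since $\beta=B^2(\kappa z)^2\le\varepsilon^2$ and both $m\varepsilon$ and $\varepsilon$ are at
  -- most $1/12$, one gets $68m\beta\le68/144<1/2$.
  have hββ : 68 * m * β ^ 2 ≤ 1 / 2 * S := by
    have h1 : β ≤ ε ^ 2 := by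
      have : β = B ^ 2 * (κ * z) ^ 2 := by rw [hβ]; ring
      rw [this]
      calc B ^ 2 * (κ * z) ^ 2 ≤ B ^ 2 * (ε / B ^ 2) ^ 2 := by gcongr
        _ = ε ^ 2 / B ^ 2 := by field_simp
        _ ≤ ε ^ 2 := div_le_self (by positivity) (by nlinarith)
    have h2 : 68 * m * β ≤ 1 / 2 := by
      have h3 : 68 * m * β ≤ 68 * m * ε ^ 2 := by gcongr
      have hε12 : ε ≤ 1 / 12 := by nlinarith
      nlinarith
    calc 68 * m * β ^ 2 = 68 * m * β * β := by ring
      _ ≤ 1 / 2 * S := by gcongr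
  have hGS : 2 * κ ^ 2 * m ^ 2 * (1 / z + 1) + 68 * m * G ^ 2 ≤ S := by
    have h1 : 1 / z + 1 ≤ (z ^ 2 + z) * (1 / z₀ ^ 2) := by
      have e : 1 / z + 1 = (z ^ 2 + z) * (1 / z ^ 2) := by field_simp; ring
      rw [e]; gcongr
    have h2 : (1 + z) ^ 2 ≤ (z ^ 2 + z) * (1 + 1 / z₀) := by
      have e : (1 + z) ^ 2 = (z ^ 2 + z) * (1 + 1 / z) := by field_simp; ring
      rw [e]; gcongr
    calc 2 * κ ^ 2 * m ^ 2 * (1 / z + 1) + 68 * m * G ^ 2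
        = 2 * κ ^ 2 * m ^ 2 * (1 / z + 1) + 272 * κ ^ 2 * m ^ 5 * (1 + z) ^ 2 := by rw [hG]; ring
      _ ≤ 2 * κ ^ 2 * m ^ 2 * ((z ^ 2 + z) * (1 / z₀ ^ 2))
          + 272 * κ ^ 2 * m ^ 5 * ((z ^ 2 + z) * (1 + 1 / z₀)) := by gcongr
      _ = (2 * m ^ 2 / z₀ ^ 2 + 272 * m ^ 5 * (1 + 1 / z₀)) * (κ ^ 2 * (z ^ 2 + z)) := by ring
      _ ≤ B ^ 2 * (κ ^ 2 * (z ^ 2 + z)) := by gcongr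
      _ = S := by rw [hS]; ring
  have hs1 : |s| = 1 := by rw [← sq_eq_sq₀ (abs_nonneg _) one_pos.le, sq_abs, hs, one_pow]
  set N := 4 * (u + s * β) * (2 * w + 6 * (s * β)) - 2 * (w + 2 * (s * β)) ^ 2
    - 2 * m * (u + s * β) ^ 2 with hN
  have hNb : |N| ≤ 68 * m * G ^ 2 + 68 * m * β ^ 2 :=
    abs_parBar_quadratic_le hm hs1 hβ0 hu0 hw0 huG hwG
  have hfin : ∀ R : ℝ, -|R| ≤ s * R := fun R => by
    have := neg_abs_le (s * R); rwa [abs_mul, hs1, one_mul] at this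
  have hA : a * κ ^ 2 * (m / 2 * (1 + 2 * m * z)) / z ≤ 2 * κ ^ 2 * m ^ 2 * (1 / z + 1) := by
    have e : a * κ ^ 2 * (m / 2 * (1 + 2 * m * z)) / z = u * κ / z := by rw [hu]; ring
    have e2 : 2 * κ ^ 2 * m ^ 2 * (1 / z + 1) = G * κ / z := by rw [hG]; field_simp
    rw [e, e2]; gcongr
  have hA0 : 0 ≤ a * κ ^ 2 * (m / 2 * (1 + 2 * m * z)) / z := by positivity
  set T := a * κ ^ 2 * (m / 2 * (1 + 2 * m * z)) / z with hT
  have e : s * (T + a * κ * m ^ 2 + 2 * (s * B ^ 2) * κ ^ 3 * z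
        + 2 * (s * B ^ 2) * κ ^ 2 * z - (a * κ * m ^ 2 - 2 * m * (s * B ^ 2) * κ ^ 2 * z ^ 2
      + (4 * (u + (s * B ^ 2) * κ ^ 2 * z ^ 2) *
          (2 * (a * κ) * m ^ 2 * z + 6 * ((s * B ^ 2) * κ ^ 2 * z ^ 2))
        - 2 * (w + 2 * ((s * B ^ 2) * κ ^ 2 * z ^ 2)) ^ 2
        - 2 * m * (u + (s * B ^ 2) * κ ^ 2 * z ^ 2) ^ 2))) =
      s * T + s ^ 2 * (2 * B ^ 2 * κ ^ 3 * z) + s ^ 2 * (2 * (B ^ 2 * κ ^ 2 * z))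
        + s ^ 2 * (2 * m * β) + s * (-N) := by rw [hN, hβ, hw]; ring
  rw [e, hs]
  have f1 := hfin T
  have f2 := hfin (-N)
  rw [abs_neg] at f2
  rw [abs_of_nonneg hA0] at f1
  have f3 : 0 ≤ B ^ 2 * κ ^ 3 * z := by positivity
  have f4 : S = β + B ^ 2 * κ ^ 2 * z := by rw [hS, hβ]; ring
  have f5 : β ≤ m * β := le_mul_of_one_le_left hβ0 hm
  linarith

/-- The parabolic barriers are sub- and supersolutions. -/
theorem parBar_strict {n : ℕ} {m a z₀ s B ε r t : ℝ} (hm : m = (n : ℝ) - 1) (hm1 : 1 ≤ m)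
    (ha0 : 0 ≤ a) (ha : a ≤ 2) (hr : 0 < r) (ht : t ∈ Ioo (0 : ℝ) 1)
    (hκ4 : kap t ≤ 1 / 4) (hz₀ : 0 < z₀) (hz : z₀ ≤ t / r ^ 2) (hs : s ^ 2 = 1) (hB : 1 ≤ B)
    (hε : 0 < ε) (hεm : 12 * m * ε ≤ 1)
    (hκz : kap t * (t / r ^ 2) ≤ ε / B ^ 2)
    (hBz : 2 * m ^ 2 / z₀ ^ 2 + 272 * m ^ 5 * (1 + 1 / z₀) ≤ B ^ 2) :
    0 ≤ s * (deriv (fun t => parBar m a (s * B ^ 2) (r ^ 2) t) t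
        - opF n (fun r => parBar m a (s * B ^ 2) (r ^ 2) t) r) := by
  rw [(hasDerivAt_parBar_time hr ht rfl rfl).deriv, opF_parBar hr hm rfl rfl, ← mul_sub,
    mul_left_comm]
  exact mul_nonneg (by positivity)
    (parBar_error_bound hm1 ha0 ha (kap_pos ht) hκ4 hz₀ hz hs hB hε hεm hκz hBz)

end

section

open Set Filter Topology Asymptotics
open scoped ContDiff

/-! ### The outer barriers -/

/-- The operator `opF` in terms of the logarithmic derivatives `D1 = r w'`, `D2 = r D1'`. -/
theorem opF_log {n : ℕ} {w D1 : ℝ → ℝ} {D2 r : ℝ} (hr : r ≠ 0)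
    (h1 : ∀ᶠ y in 𝓝 r, HasDerivAt w (D1 y / y) y) (h2 : HasDerivAt D1 (D2 / r) r) :
    opF n w r = 1 / r ^ 2 * (w r * D2 - 2 * w r * D1 r - 1 / 2 * D1 r ^ 2
      + ((n : ℝ) - 1) * D1 r + 2 * ((n : ℝ) - 1) * (w r * (1 - w r))) := by
  rw [opF_eq h1 (h2.fun_div (hasDerivAt_id r) hr)]
  field_simp
  ring

theorem hasDerivAt_comp_kap {g : ℝ → ℝ} {g' r : ℝ} (hr : r ∈ Ioo (0 : ℝ) 1)
    (hg : HasDerivAt g g' (kap r)) : HasDerivAt (fun r => g (kap r)) (kap r ^ 2 * g' / r) r := by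
  refine (HasDerivAt.comp (h₂ := g) (h := kap) r hg (hasDerivAt_kap hr)).congr_deriv ?_
  ring

theorem v0_eq {n : ℕ} (r : ℝ) : v0 n r = ((n : ℝ) - 1) / 4 * kap r := by
  rw [v0, kap, mul_one_div]

/-- `r² 𝓕[c / (-log r)]` as a polynomial in `ℓ = 1 / (-log r)`. -/
def outP (m c l : ℝ) : ℝ :=
  2 * m * c * l + (m * c - 2 * m * c ^ 2) * l ^ 2 - 2 * c ^ 2 * l ^ 3 + 3 / 2 * c ^ 2 * l ^ 4

/-- The derivative of `outP`. -/
def outP' (m c l : ℝ) : ℝ :=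
  2 * m * c + 2 * (m * c - 2 * m * c ^ 2) * l - 6 * c ^ 2 * l ^ 2 + 6 * c ^ 2 * l ^ 3

/-- The second derivative of `outP`. -/
def outP'' (m c l : ℝ) : ℝ :=
  2 * (m * c - 2 * m * c ^ 2) - 12 * c ^ 2 * l + 18 * c ^ 2 * l ^ 2

theorem hasDerivAt_outP (m c l : ℝ) : HasDerivAt (outP m c) (outP' m c l) l := by
  have hp := fun k : ℕ => hasDerivAt_pow k l
  refine (((((hasDerivAt_id l).const_mul (2 * m * c)).fun_add
    ((hp 2).const_mul (m * c - 2 * m * c ^ 2))).fun_sub ((hp 3).const_mul (2 * c ^ 2))).fun_add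
    ((hp 4).const_mul (3 / 2 * c ^ 2))).congr_deriv ?_
  rw [outP']; norm_num; ring

theorem hasDerivAt_outP' (m c l : ℝ) : HasDerivAt (outP' m c) (outP'' m c l) l := by
  have hp := fun k : ℕ => hasDerivAt_pow k l
  refine (((((hasDerivAt_id l).const_mul (2 * (m * c - 2 * m * c ^ 2))).const_add
    (2 * m * c)).fun_sub ((hp 2).const_mul (6 * c ^ 2))).fun_add
    ((hp 3).const_mul (6 * c ^ 2))).congr_deriv ?_
  rw [outP'']; norm_num; ring

theorem opF_mul_kap {n : ℕ} {m c r : ℝ} (hm : m = (n : ℝ) - 1) (hr : r ∈ Ioo (0 : ℝ) 1) :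
    opF n (fun r => c * kap r) r = 1 / r ^ 2 * outP m c (kap r) := by
  have h1 : ∀ᶠ y in 𝓝 r, HasDerivAt (fun r => c * kap r) ((fun y => c * kap y ^ 2) y / y) y := by
    filter_upwards [Ioo_mem_nhds hr.1 hr.2] with y hy
    refine ((hasDerivAt_kap hy).const_mul c).congr_deriv ?_
    ring
  have h2 : HasDerivAt (fun y => c * kap y ^ 2) (2 * c * kap r ^ 3 / r) r := by
    refine (((hasDerivAt_kap hr).fun_pow 2).const_mul c).congr_deriv ?_
    norm_num; ring
  rw [opF_log hr.1.ne' h1 h2, outP, ← hm]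
  ring

/-- The outer barriers; `e = 1 ± ε`, `c = (1 ± δ)(n-1)/4`. -/
def outBar (m c e r t : ℝ) : ℝ := c * kap r + e * (t / r ^ 2) * outP m c (kap r)

theorem vOut_eq_outBar {n : ℕ} {ε δ s r t : ℝ} (hr : r ∈ Ioo (0 : ℝ) 1) :
    vOut n ε δ s r t = outBar ((n : ℝ) - 1) ((1 + s * δ) * (((n : ℝ) - 1) / 4)) (1 + s * ε) r t := by
  have e : (fun x => (1 + s * δ) * v0 n x)
    = fun x => ((1 + s * δ) * (((n : ℝ) - 1) / 4)) * kap x := by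
    funext x; rw [v0_eq]; ring
  rw [vOut, e, opF_mul_kap rfl hr, v0_eq, outBar]
  ring

/-- The remainder in the equation for the outer barriers. -/
def outR (m c l X : ℝ) : ℝ :=
  (c * (l ^ 3 * outP'' m c l + 2 * l ^ 2 * outP' m c l - 4 * l * outP' m c l
        + 4 * (2 * m * c + (m * c - 2 * m * c ^ 2) * l - 2 * c ^ 2 * l ^ 2 + 3 / 2 * c ^ 2 * l ^ 3))
    + 2 * c * l ^ 2 *
        (2 * m * c + (m * c - 2 * m * c ^ 2) * l - 2 * c ^ 2 * l ^ 2 + 3 / 2 * c ^ 2 * l ^ 3)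
    - (2 * c + c * l) * (l * outP' m c l
        - 2 * (2 * m * c + (m * c - 2 * m * c ^ 2) * l - 2 * c ^ 2 * l ^ 2 + 3 / 2 * c ^ 2 * l ^ 3))
    - (2 * c * l + 4 * m * c) *
        (2 * m * c + (m * c - 2 * m * c ^ 2) * l - 2 * c ^ 2 * l ^ 2 + 3 / 2 * c ^ 2 * l ^ 3)
    + m * outP' m c l)
  + X * ((2 * m * c + (m * c - 2 * m * c ^ 2) * l - 2 * c ^ 2 * l ^ 2 + 3 / 2 * c ^ 2 * l ^ 3) *
      (l ^ 3 * outP'' m c l + 2 * l ^ 2 * outP' m c l - 4 * l * outP' m c l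
        + 4 * (2 * m * c + (m * c - 2 * m * c ^ 2) * l - 2 * c ^ 2 * l ^ 2 + 3 / 2 * c ^ 2 * l ^ 3))
    - 2 * (2 * m * c + (m * c - 2 * m * c ^ 2) * l - 2 * c ^ 2 * l ^ 2 + 3 / 2 * c ^ 2 * l ^ 3) *
      (l * outP' m c l
        - 2 * (2 * m * c + (m * c - 2 * m * c ^ 2) * l - 2 * c ^ 2 * l ^ 2 + 3 / 2 * c ^ 2 * l ^ 3))
    - 1 / 2 * (l * outP' m c l
        - 2 * (2 * m * c + (m * c - 2 * m * c ^ 2) * l - 2 * c ^ 2 * l ^ 2 + 3 / 2 * c ^ 2 * l ^ 3)) ^ 2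
    - 2 * m *
      (2 * m * c + (m * c - 2 * m * c ^ 2) * l - 2 * c ^ 2 * l ^ 2 + 3 / 2 * c ^ 2 * l ^ 3) ^ 2)

/-- The linear part $r^{-2}(mrw_r+2mw)$ annihilates $r^{-2}$, so in the terms containing $X$ the
contribution linear in $l$ cancels. This is why a factor $l^2$ comes out of the remainder. -/
theorem opF_outBar {n : ℕ} {m c e r t l X : ℝ} (hm : m = (n : ℝ) - 1) (hr : r ∈ Ioo (0 : ℝ) 1)
    (hl : l = kap r) (hX : X = e * (t / r ^ 2)) :
    opF n (fun r => outBar m c e r t) r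
      = 1 / r ^ 2 * (outP m c l + X * l ^ 2 * outR m c l X) := by
  have hX1 : ∀ y : ℝ, 0 < y → HasDerivAt (fun y => e * (t / y ^ 2)) (-2 * (e * (t / y ^ 2)) / y) y :=
    fun y hy => by
      refine (((hasDerivAt_const y t).fun_div (hasDerivAt_pow 2 y) (pow_pos hy 2).ne').const_mul
        e).congr_deriv ?_
      norm_num; field_simp
  have h1 : ∀ᶠ y in 𝓝 r, HasDerivAt (fun r => outBar m c e r t)
      ((fun y => c * kap y ^ 2 + e * (t / y ^ 2) *
        (kap y ^ 2 * outP' m c (kap y) - 2 * outP m c (kap y))) y / y) y := by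
    filter_upwards [Ioo_mem_nhds hr.1 hr.2] with y hy
    refine (((hasDerivAt_kap hy).const_mul c).fun_add ((hX1 y hy.1).fun_mul
      (hasDerivAt_comp_kap hy (hasDerivAt_outP m c _)))).congr_deriv ?_
    ring
  have hk := hasDerivAt_kap hr
  have h2 : HasDerivAt (fun y => c * kap y ^ 2 + e * (t / y ^ 2) *
        (kap y ^ 2 * outP' m c (kap y) - 2 * outP m c (kap y)))
      ((2 * c * l ^ 3 + X * (l ^ 2 * (l ^ 2 * outP'' m c l + 2 * l * outP' m c l - 2 * outP' m c l)
        - 2 * (l ^ 2 * outP' m c l - 2 * outP m c l))) / r) r := by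
    refine (((hk.fun_pow 2).const_mul c).fun_add ((hX1 r hr.1).fun_mul
      (((hk.fun_pow 2).fun_mul (hasDerivAt_comp_kap hr (hasDerivAt_outP' m c _))).fun_sub
      ((hasDerivAt_comp_kap hr (hasDerivAt_outP m c _)).const_mul 2)))).congr_deriv ?_
    simp only [← hl, ← hX]; norm_num; ring
  rw [opF_log hr.1.ne' h1 h2, ← hm]
  simp only [outBar, ← hl, ← hX]
  congr 1
  simp only [outR, outP, outP', outP'']
  ring

theorem deriv_outBar_time {m c e r t : ℝ} :
    deriv (fun t => outBar m c e r t) t = 1 / r ^ 2 * (e * outP m c (kap r)) := by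
  have : HasDerivAt (fun t => outBar m c e r t) (1 / r ^ 2 * (e * outP m c (kap r))) t := by
    refine (((((hasDerivAt_id t).div_const (r ^ 2)).const_mul e).mul_const
      (outP m c (kap r))).const_add (c * kap r)).congr_deriv ?_
    ring
  exact this.deriv

theorem contDiffAt_outBar {m c e r t : ℝ} (hr : r ∈ Ioo (0 : ℝ) 1) :
    ContDiffAt ℝ 2 (fun z : ℝ × ℝ => outBar m c e z.1 z.2) (r, t) := by
  have hk : ContDiffAt ℝ 2 (fun z : ℝ × ℝ => kap z.1) (r, t) :=
    ContDiffAt.comp (g := kap) (r, t) (contDiffAt_kap hr) contDiffAt_fst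
  have hz : ContDiffAt ℝ 2 (fun z : ℝ × ℝ => z.2 / z.1 ^ 2) (r, t) :=
    contDiffAt_snd.div (contDiffAt_fst.pow 2) (pow_pos hr.1 2).ne'
  have hP : ContDiffAt ℝ 2 (fun z : ℝ × ℝ => outP m c (kap z.1)) (r, t) :=
    (((contDiffAt_const.mul hk).add (contDiffAt_const.mul (hk.pow 2))).sub
      (contDiffAt_const.mul (hk.pow 3))).add (contDiffAt_const.mul (hk.pow 4))
  exact (contDiffAt_const.mul hk).add ((contDiffAt_const.mul hz).mul hP)

theorem exists_outR_bound (m : ℝ) : ∃ K > 0, ∀ c ∈ Icc 0 m, ∀ l ∈ Icc (0 : ℝ) 1,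
    ∀ X ∈ Icc (0 : ℝ) 1, |outR m c l X| ≤ K := by
  have hc : Continuous fun z : ℝ × ℝ × ℝ => outR m z.1 z.2.1 z.2.2 := by
    unfold outR outP' outP''; fun_prop
  obtain ⟨K, hK⟩ := ((isCompact_Icc (a := (0 : ℝ)) (b := m)).prod ((isCompact_Icc (a := (0 : ℝ))
    (b := 1)).prod (isCompact_Icc (a := (0 : ℝ)) (b := 1)))).exists_bound_of_continuousOn
    hc.continuousOn
  exact ⟨|K| + 1, by positivity, fun c hc l hl X hX =>
    (hK (c, l, X) ⟨hc, hl, hX⟩).trans ((le_abs_self K).trans (by linarith))⟩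

theorem outP_lower {m c l : ℝ} (hm : 1 ≤ m) (hc : 0 ≤ c) (hcm : c ≤ m) (hl : 0 ≤ l)
    (hlm : 4 * m * l ≤ 1) : m * c * l ≤ outP m c l := by
  have h1 : 4 * c * l ≤ 1 := le_trans (by gcongr) hlm
  have hl1 : l ≤ 1 := by nlinarith
  have h2 : 2 * c ^ 2 * l ^ 3 ≤ 2 * m * c ^ 2 * l ^ 2 := by
    have : c ^ 2 * l ^ 2 * l ≤ c ^ 2 * l ^ 2 * m := by gcongr; linarith
    linarith
  have h3 : m * c * l * (4 * c * l) ≤ m * c * l * 1 := by gcongr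
  have h4 : 0 ≤ m * c * l ^ 2 := by positivity
  have h5 : 0 ≤ c ^ 2 * l ^ 4 := by positivity
  rw [outP]
  linarith

/-- The outer barriers are sub- and supersolutions. -/
theorem exists_outBar_strict {n : ℕ} {m : ℝ} (hm : m = (n : ℝ) - 1) (hm1 : 1 ≤ m) :
    ∃ l₀ > 0, ∀ c ε s r t : ℝ, m / 8 ≤ c → c ≤ m → 0 < ε → ε ≤ 1 / 2 → s ^ 2 = 1 →
      r ∈ Ioo (0 : ℝ) 1 → kap r ≤ l₀ → 0 < t → t / r ^ 2 ≤ ε →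
      0 ≤ s * (deriv (fun t => outBar m c (1 + s * ε) r t) t
        - opF n (fun r => outBar m c (1 + s * ε) r t) r) := by
  obtain ⟨K, hK0, hK⟩ := exists_outR_bound m
  -- The gain $\varepsilon\,$`outP`$\,\ge\varepsilon mcl\ge\varepsilon m^2l/8$ faces an error of at
  -- most $2\varepsilon Kl^2$. Both carry the factor $\varepsilon$, so the threshold for $l$, and
  -- with it $r_*$, depends on $n$ alone.
  refine ⟨min (1 / (4 * m)) (m ^ 2 / (16 * K)), by positivity,
    fun c ε s r t hc hcm hε hε2 hs hr hlr ht hz => ?_⟩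
  set l := kap r with hl
  have hl0 : 0 < l := kap_pos hr
  have hl1 : 4 * m * l ≤ 1 := by
    have := hlr.trans (min_le_left _ _)
    rw [le_div_iff₀ (by positivity)] at this; linarith
  have hl2 : 16 * K * l ≤ m ^ 2 := by
    have := hlr.trans (min_le_right _ _)
    rw [le_div_iff₀ (by positivity)] at this; linarith
  have hs1 : |s| = 1 := by rw [← sq_eq_sq₀ (abs_nonneg _) one_pos.le, sq_abs, hs, one_pow]
  obtain ⟨hsl, hsr⟩ := abs_le.1 hs1.le
  set X := (1 + s * ε) * (t / r ^ 2) with hX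
  have hz0 : 0 < t / r ^ 2 := div_pos ht (pow_pos hr.1 2)
  have he0 : 0 ≤ 1 + s * ε := by nlinarith
  have he2 : 1 + s * ε ≤ 2 := by nlinarith
  have hX0 : 0 ≤ X := mul_nonneg he0 hz0.le
  have hX2 : X ≤ 2 * ε := mul_le_mul he2 hz hz0.le (by norm_num)
  have hc0 : 0 ≤ c := le_trans (by positivity) hc
  rw [deriv_outBar_time, opF_outBar hm hr hl hX, ← mul_sub, mul_left_comm]
  refine mul_nonneg (by positivity) ?_
  have hR := hK c ⟨hc0, hcm⟩ l ⟨hl0.le, by nlinarith⟩ X ⟨hX0, by linarith⟩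
  have hP := outP_lower hm1 hc0 hcm hl0.le hl1
  rw [← hl]
  set R := outR m c l X
  have e : s * ((1 + s * ε) * outP m c l - (outP m c l + X * l ^ 2 * R))
      = s ^ 2 * ε * outP m c l - X * l ^ 2 * (s * R) := by ring
  rw [e, hs]
  have hsR : s * R ≤ K := by
    have := le_abs_self (s * R); rw [abs_mul, hs1, one_mul] at this; exact this.trans hR
  have f1 : X * l ^ 2 * (s * R) ≤ 2 * ε * l ^ 2 * K := by
    calc X * l ^ 2 * (s * R) ≤ X * l ^ 2 * K := by gcongr
      _ ≤ 2 * ε * l ^ 2 * K := by gcongr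
  have f2 : ε * (m * c * l) ≤ ε * outP m c l := by gcongr
  have f3 : ε * l * (16 * K * l) ≤ ε * l * m ^ 2 := by gcongr
  have f4 : ε * l * m * (m / 8) ≤ ε * l * m * c := by gcongr
  linarith

end

section

open Set Filter Topology Asymptotics
open scoped ContDiff

/-! ### Gluing -/

/-- Because $-\log(\rho\sqrt t)=\frac12(-\log t)-\log\rho$, one has $\kappa(\rho\sqrt
t)\approx2\kappa(t)$. This reconciles the outer factor $\frac{n-1}{-4\log r}$ with the parabolic
factor $\frac{n-1}{-2\log t}$. -/
theorem kap_mul_sqrt {ρ t : ℝ} (hρ : 0 < ρ) (ht : t ∈ Ioo (0 : ℝ) 1) :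
    kap (ρ * Real.sqrt t) = kap t * (1 / (1 / 2 - kap t * Real.log ρ)) := by
  have hl := (neg_log_pos ht).ne'
  have e : 1 / 2 - kap t * Real.log ρ = kap t * -Real.log (ρ * Real.sqrt t) := by
    rw [Real.log_mul hρ.ne' (Real.sqrt_pos.2 ht.1).ne', Real.log_sqrt ht.1.le, kap]
    have : Real.log t ≠ 0 := fun h => hl (by simp [h])
    field_simp
    ring
  have hk := (kap_pos ht).ne'
  rw [e, one_div, mul_inv, mul_inv_cancel_left₀ hk, kap, one_div]

/-- Divided by $\kappa(t)$, the difference is a function of $(\kappa,d)$ that is continuous at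
$\kappa=0$, where it is a positive multiple of the assumed margin. Compactness in $d=1\pm\delta$
makes the time threshold independent of $\delta$. The sign $\tau$ selects the direction of the
inequality. -/
theorem eventually_glue_out {m ε g ρ s τ b : ℝ} (hm : 1 ≤ m) (hρ : 0 < ρ) (hs : s ^ 2 = 1)
    (hpos : 0 < τ * (ε * (2 * m / ρ ^ 2) - g * (1 + 2 * m / ρ ^ 2))) :
    ∀ᶠ t in 𝓝[>] (0 : ℝ), ∀ d ∈ Icc (1 / 2 : ℝ) (3 / 2),
      0 < τ * s * (outBar m (d * (m / 4)) (1 + s * ε) (ρ * Real.sqrt t) t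
        - parBar m (d * (1 + s * g)) b ((ρ * Real.sqrt t) ^ 2) t) := by
  set G : ℝ → ℝ → ℝ := fun κ d => τ * s * ((d * (m / 4) * (1 / (1 / 2 - κ * Real.log ρ))
    + (1 + s * ε) / ρ ^ 2 * ((1 / (1 / 2 - κ * Real.log ρ)) * (2 * m * (d * (m / 4))
      + (m * (d * (m / 4)) - 2 * m * (d * (m / 4)) ^ 2) * (κ * (1 / (1 / 2 - κ * Real.log ρ)))
      - 2 * (d * (m / 4)) ^ 2 * (κ * (1 / (1 / 2 - κ * Real.log ρ))) ^ 2
      + 3 / 2 * (d * (m / 4)) ^ 2 * (κ * (1 / (1 / 2 - κ * Real.log ρ))) ^ 3)))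
    - (d * (1 + s * g) * (m / 2 * (1 + 2 * m / ρ ^ 2)) + b * κ / ρ ^ 4)) with hG
  have hev : ∀ᶠ κ in 𝓝 (0 : ℝ), ∀ d ∈ Icc (1 / 2 : ℝ) (3 / 2), 0 < G κ d := by
    refine isCompact_Icc.eventually_forall_of_forall_eventually fun d hd => ?_
    have hc : ContinuousAt (fun z : ℝ × ℝ => G z.1 z.2) (0, d) := by
      have hΛ : ContinuousAt (fun z : ℝ × ℝ => 1 / (1 / 2 - z.1 * Real.log ρ)) (0, d) := by
        refine ContinuousAt.div (by fun_prop) (by fun_prop) (by norm_num)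
      simp only [hG]
      fun_prop
    refine hc.eventually_const_lt ?_
    have e : G 0 d = s ^ 2 * (d * (m / 2)) *
        (τ * (ε * (2 * m / ρ ^ 2) - g * (1 + 2 * m / ρ ^ 2))) := by
      simp only [hG]; field_simp; ring
    change 0 < G 0 d
    rw [e, hs]
    have := hd.1
    have : 0 < d := by linarith
    positivity
  have hk := tendsto_kap.mono_right nhdsWithin_le_nhds |>.eventually hev
  filter_upwards [hk, Ioo_mem_nhdsGT one_pos] with t ht ht1 d hd
  have hκ := kap_pos ht1
  have := mul_pos hκ (ht d hd)
  refine lt_of_lt_of_eq this ?_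
  have h0 := ht1.1.ne'
  have e1 : t / (ρ * Real.sqrt t) ^ 2 = 1 / ρ ^ 2 := by
    rw [mul_pow, Real.sq_sqrt ht1.1.le]; field_simp
  simp only [hG, outBar, parBar, outP, e1, kap_mul_sqrt hρ ht1]
  set Λ := 1 / (1 / 2 - kap t * Real.log ρ)
  field_simp

theorem parBar_at_scale {m a b σ t : ℝ} (hσ : 0 < σ) (ht : t ∈ Ioo (0 : ℝ) 1) :
    parBar m a b ((σ * theta t) ^ 2) t = a * kap t * (m / 2) + a * m ^ 2 / σ ^ 2 + b / σ ^ 4 := by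
  have hk := (kap_pos ht).ne'
  have h0 := ht.1.ne'
  rw [parBar, mul_pow, theta_sq_eq ht]
  field_simp

theorem inX_at_scale {q σ t : ℝ} (ht : t ∈ Ioo (0 : ℝ) 1) :
    inX q ((σ * theta t) ^ 2) t = q * σ ^ 2 := by
  have hk := (kap_pos ht).ne'
  have h0 := ht.1.ne'
  rw [inX, mul_pow, theta_sq_eq ht]
  field_simp

set_option maxHeartbeats 800000 in
-- At $r=\sigma\theta$ with $\sigma$ large, the inner barrier is about
-- $1/(q\sigma^2)=(m^2a+s\varepsilon/2)/\sigma^2$ and the parabolic one is about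
-- $am^2/\sigma^2+sb/\sigma^4$. Their difference is $s(\varepsilon/2-b/\sigma^2)/\sigma^2$ up to
-- terms that vanish with $\kappa$ and the error of the tail $f\approx1/x$, controlled by `hfar`.
theorem eventually_glue_in {m : ℝ} {f p C Cd Cdd : ℝ → ℝ} (hf : BryantFun m f p)
    (hC : BryantCorr m f p C Cd Cdd) (hm : 1 ≤ m) {ε s τ σ b : ℝ} (hε : 0 < ε) (hε1 : ε < 1)
    (hs : s ^ 2 = 1) (hτ : τ ^ 2 = 1) (hσ : 0 < σ)
    (hfar : ∀ x, 2 / (3 * m ^ 2) * σ ^ 2 ≤ x → |x * f x - 1| ≤ ε / (16 * m ^ 2))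
    (hb : ε / 4 ≤ τ * (ε / 2 - b / σ ^ 2)) :
    ∀ᶠ t in 𝓝[>] (0 : ℝ), ∀ a ∈ Icc (1 / 2 : ℝ) (3 / 2), ∀ q ∈ Icc (2 / (3 * m ^ 2)) (2 / m ^ 2),
      1 / q = m ^ 2 * a + s * ε / 2 →
      0 < τ * s * (inBar f C ε s q ((σ * theta t) ^ 2) t
        - parBar m a (s * b) ((σ * theta t) ^ 2) t) := by
  obtain ⟨K, hK⟩ := hC.bound (2 / m ^ 2 * σ ^ 2)
  obtain ⟨K2, hK2⟩ := hf.exists_p_bound (2 / m ^ 2 * σ ^ 2)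
  set K3 := |K| * (|K2| * (2 / m ^ 2 * σ ^ 2)) with hK3
  have hK30 : 0 ≤ K3 := by positivity
  have hk := tendsto_kap.mono_right nhdsWithin_le_nhds |>.eventually
    (gt_mem_nhds (show 0 < min 1 (ε / (16 * σ ^ 2) / (2 * (m + 3 * m ^ 2 * K3))) by positivity))
  filter_upwards [hk, Ioo_mem_nhdsGT one_pos] with t hκ ht a ha q hq hqa
  have hκ0 := kap_pos ht
  have hκ1 : kap t < 1 := hκ.trans_le (min_le_left _ _)
  have hκ2 : kap t * (2 * (m + 3 * m ^ 2 * K3)) ≤ ε / (16 * σ ^ 2) := by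
    have := (hκ.trans_le (min_le_right _ _)).le
    rwa [le_div_iff₀ (by positivity)] at this
  have hq0 : 0 < q := lt_of_lt_of_le (by positivity) hq.1
  rw [inBar, inX_at_scale ht, parBar_at_scale hσ ht]
  set x := q * σ ^ 2 with hx
  have hx0 : 0 < x := by positivity
  have hxZ : x ∈ Ioc 0 (2 / m ^ 2 * σ ^ 2) := ⟨hx0, by rw [hx]; gcongr; exact hq.2⟩
  have hCx : |C x| ≤ K3 := by
    have hp := (hf.p_pos x hx0).le
    calc |C x| ≤ K * p x := (hK x hxZ).1
      _ ≤ |K| * (|K2| * (2 / m ^ 2 * σ ^ 2)) := by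
        have : p x ≤ |K2| * (2 / m ^ 2 * σ ^ 2) := (hK2 x hxZ).trans
          (mul_le_mul (le_abs_self _) hxZ.2 hx0.le (abs_nonneg _))
        exact mul_le_mul (le_abs_self _) this hp (abs_nonneg _)
  have hs1 : |s| = 1 := by rw [← sq_eq_sq₀ (abs_nonneg _) one_pos.le, sq_abs, hs, one_pow]
  have hτ1 : |τ| = 1 := by rw [← sq_eq_sq₀ (abs_nonneg _) one_pos.le, sq_abs, hτ, one_pow]
  obtain ⟨hsl, hsr⟩ := abs_lt.1 (show |s * ε| < 1 by rwa [abs_mul, hs1, one_mul, abs_of_pos hε])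
  set η := x * f x - 1 with hη
  have hη1 := hfar x (by rw [hx]; gcongr; exact hq.1)
  have hfx : f x = (m ^ 2 * a + s * ε / 2) / σ ^ 2 * (1 + η) := by
    have : f x = (1 + η) / x := by rw [hη]; field_simp; ring
    rw [this, ← hqa, hx]; field_simp
  have hη2 : |(m ^ 2 * a + s * ε / 2) * η| ≤ ε / 8 := by
    have h1 : |m ^ 2 * a + s * ε / 2| ≤ 2 * m ^ 2 := by
      have h2 : m ^ 2 * a ≤ m ^ 2 * (3 / 2) := by gcongr; exact ha.2
      have h3 : 0 ≤ m ^ 2 * a := mul_nonneg (sq_nonneg _) (by linarith [ha.1])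
      have h4 : 1 ≤ m ^ 2 := one_le_pow₀ hm
      rw [abs_le]; constructor <;> linarith
    rw [abs_mul]
    calc |m ^ 2 * a + s * ε / 2| * |η| ≤ 2 * m ^ 2 * (ε / (16 * m ^ 2)) := by gcongr
      _ = ε / 8 := by field_simp; norm_num
  set D1 := (m ^ 2 * a + s * ε / 2) * η with hD1
  set D2 := (1 - s * ε) * ((kap t + kap t ^ 2) / 2) * (C x / q) with hD2
  set D3 := a * kap t * (m / 2) with hD3
  have hD3b : |D3| ≤ m * kap t := by
    have ha1 := ha.1
    have ha2 := ha.2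
    have : 0 < a := by linarith
    rw [hD3, abs_of_pos (by positivity)]
    calc a * kap t * (m / 2) ≤ 2 * kap t * (m / 2) := by gcongr; linarith
      _ = _ := by ring
  have hD2b : |D2| ≤ 3 * m ^ 2 * K3 * kap t := by
    have h1 : |1 - s * ε| ≤ 2 := by rw [abs_le]; constructor <;> linarith
    have h2 : (kap t + kap t ^ 2) / 2 ≤ kap t := by
      have : kap t ^ 2 ≤ kap t := by
        rw [sq]; exact mul_le_of_le_one_left hκ0.le hκ1.le
      linarith
    have h3 : |C x / q| ≤ K3 * (3 * m ^ 2 / 2) := by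
      rw [abs_div, abs_of_pos hq0, div_le_iff₀ hq0]
      have : 1 ≤ 3 * m ^ 2 / 2 * q := by
        have := hq.1; rw [div_le_iff₀ (by positivity)] at this; linarith
      calc |C x| ≤ K3 * 1 := by rw [mul_one]; exact hCx
        _ ≤ K3 * (3 * m ^ 2 / 2 * q) := by gcongr
        _ = _ := by ring
    rw [hD2, abs_mul, abs_mul, abs_of_pos (by positivity : 0 < (kap t + kap t ^ 2) / 2)]
    calc |1 - s * ε| * ((kap t + kap t ^ 2) / 2) * |C x / q|
        ≤ 2 * kap t * (K3 * (3 * m ^ 2 / 2)) := by gcongr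
      _ = _ := by ring
  have e : τ * s * (f x + D2 - (D3 + a * m ^ 2 / σ ^ 2 + s * b / σ ^ 4)) =
      1 / σ ^ 2 * (s ^ 2 * (τ * (ε / 2 - b / σ ^ 2)) + τ * s * D1) + τ * s * (D2 - D3) := by
    rw [hfx, hD1]; field_simp; ring
  have hts : |τ * s| = 1 := by rw [abs_mul, hs1, hτ1, one_mul]
  have f1 : -(ε / 8) ≤ τ * s * D1 := by
    have := neg_abs_le (τ * s * D1); rw [abs_mul, hts, one_mul] at this; linarith
  have f2 : -(ε / (16 * σ ^ 2)) ≤ τ * s * (D2 - D3) := by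
    have h1 := neg_abs_le (τ * s * (D2 - D3))
    rw [abs_mul, hts, one_mul] at h1
    have h2 := abs_sub D2 D3
    have h3 : 0 ≤ m * kap t := by positivity
    have h4 : 0 ≤ m ^ 2 * K3 * kap t := by positivity
    linarith
  rw [e, hs]
  have f3 : 1 / σ ^ 2 * (ε / 8) ≤
      1 / σ ^ 2 * (1 * (τ * (ε / 2 - b / σ ^ 2)) + τ * s * D1) := by gcongr; linarith
  have f4 : 1 / σ ^ 2 * (ε / 8) = 2 * (ε / (16 * σ ^ 2)) := by field_simp; norm_num
  have f5 : 0 < ε / (16 * σ ^ 2) := by positivity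
  linarith

end

/-! ### Signed barriers and admissible parameters. -/

section

open Set Filter Topology Asymptotics
open scoped ContDiff

theorem opF_congr {n : ℕ} {w w' : ℝ → ℝ} {r : ℝ} (h : w =ᶠ[𝓝 r] w') : opF n w r = opF n w' r := by
  rw [opF, opF, h.eq_of_nhds, h.deriv_eq, h.deriv.deriv_eq]

theorem abs_eq_one_of_sq_eq_one {s : ℝ} (hs : s ^ 2 = 1) : |s| = 1 := by
  rw [← sq_eq_sq₀ (abs_nonneg _) one_pos.le, sq_abs, hs, one_pow]

/-- `w` is twice continuously differentiable and satisfies `0 ≤ s (w_t - 𝓕[w])` on `Ω`; for `s = 1`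
these are supersolutions, for `s = -1` subsolutions. -/
def IsSignedBarrierOn (n : ℕ) (s : ℝ) (w : ℝ → ℝ → ℝ) (Ω : Set (ℝ × ℝ)) : Prop :=
  ∀ p ∈ Ω, ContDiffAt ℝ 2 (fun q : ℝ × ℝ => w q.1 q.2) p ∧
    0 ≤ s * (deriv (fun t => w p.1 t) p.2 - opF n (fun r => w r p.2) p.1)

theorem IsSignedBarrierOn.sub {n : ℕ} {w : ℝ → ℝ → ℝ} {Ω : Set (ℝ × ℝ)}
    (h : IsSignedBarrierOn n (-1) w Ω) : IsSubsolutionOn n w Ω := fun p hp =>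
  ⟨(h p hp).1, by linarith [(h p hp).2]⟩

theorem IsSignedBarrierOn.super {n : ℕ} {w : ℝ → ℝ → ℝ} {Ω : Set (ℝ × ℝ)}
    (h : IsSignedBarrierOn n 1 w Ω) : IsSupersolutionOn n w Ω := fun p hp =>
  ⟨(h p hp).1, by linarith [(h p hp).2]⟩

theorem isSignedBarrierOn_of_eventuallyEq {n : ℕ} {s : ℝ} {w : ℝ → ℝ → ℝ} {Ω : Set (ℝ × ℝ)}
    (h : ∀ r t, (r, t) ∈ Ω → ∃ w' : ℝ → ℝ → ℝ,
      (∀ᶠ q : ℝ × ℝ in 𝓝 (r, t), w q.1 q.2 = w' q.1 q.2) ∧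
      ContDiffAt ℝ 2 (fun q : ℝ × ℝ => w' q.1 q.2) (r, t) ∧
      0 ≤ s * (deriv (fun t => w' r t) t - opF n (fun r => w' r t) r)) :
    IsSignedBarrierOn n s w Ω := by
  rintro ⟨r, t⟩ hp
  obtain ⟨w', he, hc, hi⟩ := h r t hp
  refine ⟨hc.congr_of_eventuallyEq he, ?_⟩
  have h1 : (fun t => w r t) =ᶠ[𝓝 t] fun t => w' r t :=
    (show Tendsto (fun t => (r, t)) (𝓝 t) (𝓝 (r, t)) by
      exact (Continuous.prodMk_right r).tendsto t).eventually he
  have h2 : (fun r => w r t) =ᶠ[𝓝 r] fun r => w' r t :=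
    (show Tendsto (fun r => (r, t)) (𝓝 r) (𝓝 (r, t)) by
      exact (Continuous.prodMk_left t).tendsto r).eventually he
  change 0 ≤ s * (deriv (fun t => w r t) t - opF n (fun r => w r t) r)
  rw [h1.deriv_eq, opF_congr h2]
  exact hi

/-- The constant `ε² / (ε + 2A²/(n-1))` occurring in `γ_±`. -/
def gammaG (m A ε : ℝ) : ℝ := ε ^ 2 / (ε + 2 * A ^ 2 / m)

section Params

variable {n : ℕ} {m A ε δ s : ℝ}

theorem gammaG_nonneg (hm : 1 ≤ m) (hε : 0 < ε) : 0 ≤ gammaG m A ε := by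
  unfold gammaG; positivity

theorem gammaG_le (hm : 1 ≤ m) (hε : 0 < ε) : gammaG m A ε ≤ ε := by
  have : 0 ≤ 2 * A ^ 2 / m := by positivity
  rw [gammaG, div_le_iff₀ (by positivity)]
  nlinarith

/-- Through this factorization $\delta$ enters the outer and the parabolic barrier by the same
factor $1\pm\delta$, so it drops out of the leading order comparison at $\rho_*$ and $3\rho_*$. -/
theorem one_add_gammaC (hm : m = (n : ℝ) - 1) :
    1 + s * gammaC n A ε δ s = (1 + s * δ) * (1 + s * gammaG m A ε) := by
  rw [gammaC, gammaG, ← hm]; ring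

theorem one_add_mul_delta_mem (hs : s ^ 2 = 1) (hδ : 0 < δ) (hδ1 : δ ≤ 1 / 8) :
    1 + s * δ ∈ Icc (7 / 8 : ℝ) (9 / 8) := by
  have h1 : |s * δ| ≤ 1 / 8 := by rwa [abs_mul, abs_eq_one_of_sq_eq_one hs, one_mul, abs_of_pos hδ]
  rw [abs_le] at h1
  constructor <;> linarith [h1.1, h1.2]

theorem one_add_gammaC_mem (hm : m = (n : ℝ) - 1) (hm1 : 1 ≤ m) (hs : s ^ 2 = 1) (hε : 0 < ε)
    (hε1 : ε ≤ 1 / 8) (hδ : 0 < δ) (hδ1 : δ ≤ 1 / 8) :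
    1 + s * gammaC n A ε δ s ∈ Icc (49 / 64 : ℝ) (81 / 64) := by
  rw [one_add_gammaC hm]
  obtain ⟨h1, h2⟩ := one_add_mul_delta_mem hs hδ hδ1
  have hg0 := gammaG_nonneg (A := A) hm1 hε
  have hg1 := gammaG_le (A := A) hm1 hε
  have h3 : |s * gammaG m A ε| ≤ 1 / 8 := by
    rw [abs_mul, abs_eq_one_of_sq_eq_one hs, one_mul, abs_of_nonneg hg0]; linarith
  obtain ⟨h4, h5⟩ := abs_le.1 h3
  constructor <;> nlinarith

/-- The last identity is the reason for the form of $k_\pm$: the tail of the inner barrier exceeds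
the $\sigma^{-2}$ term of the parabolic one by exactly $\pm\varepsilon/(2\sigma^2)$. -/
theorem kC_sq (hm : m = (n : ℝ) - 1) (hm1 : 1 ≤ m) (hs : s ^ 2 = 1) (hε : 0 < ε)
    (hε1 : ε ≤ 1 / 8) (hδ : 0 < δ) (hδ1 : δ ≤ 1 / 8) :
    kC n A ε δ s ^ 2 ∈ Icc (2 / (3 * m ^ 2)) (2 / m ^ 2) ∧ 0 < kC n A ε δ s ∧
      1 / kC n A ε δ s ^ 2 = m ^ 2 * (1 + s * gammaC n A ε δ s) + s * ε / 2 := by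
  obtain ⟨h1, h2⟩ := one_add_gammaC_mem (A := A) hm hm1 hs hε hε1 hδ hδ1
  have h3 : |s * (ε / (2 * m ^ 2))| ≤ 1 / 16 := by
    rw [abs_mul, abs_eq_one_of_sq_eq_one hs, one_mul, abs_of_pos (by positivity),
      div_le_iff₀ (by positivity)]
    nlinarith
  obtain ⟨h4, h5⟩ := abs_le.1 h3
  have hk : kC n A ε δ s = 1 / m * (1 / Real.sqrt (1 + s * gammaC n A ε δ s
      + s * (ε / (2 * m ^ 2)))) := by rw [kC, ← hm]
  set w := 1 + s * gammaC n A ε δ s + s * (ε / (2 * m ^ 2)) with hw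
  have hw0 : 0 < w := by linarith
  have hsq : kC n A ε δ s ^ 2 = 1 / (m ^ 2 * w) := by
    rw [hk, mul_pow, div_pow, div_pow, Real.sq_sqrt hw0.le]; field_simp
  refine ⟨?_, ?_, ?_⟩
  · rw [hsq]
    constructor
    · rw [div_le_div_iff₀ (by positivity) (by positivity)]
      nlinarith [sq_nonneg m]
    · rw [div_le_div_iff₀ (by positivity) (by positivity)]
      nlinarith [sq_nonneg m]
  · rw [hk]; have := Real.sqrt_pos.2 hw0; positivity
  · rw [hsq, one_div_one_div, hw]; field_simp

end Params

theorem rhoStar_sq {A ε : ℝ} (hε : 0 < ε) : rhoStar A ε ^ 2 = A ^ 2 / ε := by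
  rw [rhoStar, div_pow, Real.sq_sqrt hε.le]

theorem sigmaStar_sq {B ε : ℝ} (hε : 0 < ε) : sigmaStar B ε ^ 2 = B ^ 2 / ε := by
  rw [sigmaStar, div_pow, Real.sq_sqrt hε.le]

theorem rhoStar_pos {A ε : ℝ} (hA : 0 < A) (hε : 0 < ε) : 0 < rhoStar A ε :=
  div_pos hA (Real.sqrt_pos.2 hε)

theorem sigmaStar_pos {B ε : ℝ} (hB : 0 < B) (hε : 0 < ε) : 0 < sigmaStar B ε :=
  div_pos hB (Real.sqrt_pos.2 hε)

/-- The constant `gammaG` equals $2m\varepsilon/(4\rho_*^2+2m)$, the value for which the margin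
vanishes at $\rho=2\rho_*$. It therefore has opposite signs at $\rho_*$ and $3\rho_*$. -/
theorem glue_out_margin {m A ε : ℝ} (hm : 1 ≤ m) (hA : 0 < A) (hε : 0 < ε) :
    0 < 1 * (ε * (2 * m / rhoStar A ε ^ 2)
      - gammaG m A ε * (1 + 2 * m / rhoStar A ε ^ 2)) ∧
    0 < -1 * (ε * (2 * m / (3 * rhoStar A ε) ^ 2)
      - gammaG m A ε * (1 + 2 * m / (3 * rhoStar A ε) ^ 2)) := by
  rw [mul_pow, rhoStar_sq hε, gammaG]
  have hd : 0 < ε * m + 2 * A ^ 2 := by positivity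
  constructor
  · have : 1 * (ε * (2 * m / (A ^ 2 / ε)) - ε ^ 2 / (ε + 2 * A ^ 2 / m) * (1 + 2 * m / (A ^ 2 / ε)))
      = ε ^ 2 * m * (3 * A ^ 2) / (A ^ 2 * (ε * m + 2 * A ^ 2)) := by field_simp; ring
    rw [this]; positivity
  · have : -1 * (ε * (2 * m / (3 ^ 2 * (A ^ 2 / ε)))
        - ε ^ 2 / (ε + 2 * A ^ 2 / m) * (1 + 2 * m / (3 ^ 2 * (A ^ 2 / ε))))
      = ε ^ 2 * m * (5 * A ^ 2) / (9 * A ^ 2 * (ε * m + 2 * A ^ 2)) := by field_simp; ring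
    rw [this]; positivity

theorem kap_mono {r r' : ℝ} (hr : 0 < r) (hrr : r ≤ r') (hr' : r' < 1) : kap r ≤ kap r' := by
  rw [kap, kap]
  have h1 := neg_log_pos ⟨hr.trans_le hrr, hr'⟩
  have := Real.log_le_log hr hrr
  gcongr

theorem exists_kap_le {l : ℝ} (hl : 0 < l) : ∃ r₀ ∈ Ioo (0 : ℝ) 1, ∀ r, 0 < r → r ≤ r₀ →
    kap r ≤ l := by
  have h := tendsto_kap.mono_right nhdsWithin_le_nhds |>.eventually (gt_mem_nhds hl)
  obtain ⟨r₀, h1, h2⟩ := (h.and (Ioo_mem_nhdsGT one_pos)).exists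
  exact ⟨r₀, h2, fun r hr hrr => (kap_mono hr hrr h2.2).trans h1.le⟩

variable {n : ℕ} {f p C Cd Cdd : ℝ → ℝ}

theorem isSignedBarrierOn_vOut {m l₀ A ε δ s rs ts : ℝ} (hm : m = (n : ℝ) - 1) (hm1 : 1 ≤ m)
    (H : ∀ c ε s r t : ℝ, m / 8 ≤ c → c ≤ m → 0 < ε → ε ≤ 1 / 2 → s ^ 2 = 1 →
      r ∈ Ioo (0 : ℝ) 1 → kap r ≤ l₀ → 0 < t → t / r ^ 2 ≤ ε →
      0 ≤ s * (deriv (fun t => outBar m c (1 + s * ε) r t) t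
        - opF n (fun r => outBar m c (1 + s * ε) r t) r))
    (hrs1 : rs < 1) (hrs : ∀ r, 0 < r → r ≤ rs → kap r ≤ l₀)
    (hA : 1 ≤ A) (hs : s ^ 2 = 1) (hε : 0 < ε) (hε1 : ε ≤ 1 / 8) (hδ : 0 < δ) (hδ1 : δ ≤ 1 / 8) :
    IsSignedBarrierOn n s (vOut n ε δ s) (regionOut A ε rs ts) := by
  refine isSignedBarrierOn_of_eventuallyEq ?_
  rintro r t ⟨h1, h2, h3, -⟩
  simp only at h1 h2 h3
  have hρ := rhoStar_pos (by linarith : 0 < A) hε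
  have hr0 : 0 < r := lt_of_lt_of_le (mul_pos hρ (Real.sqrt_pos.2 h3)) h1
  have hr : r ∈ Ioo (0 : ℝ) 1 := ⟨hr0, h2.trans_lt hrs1⟩
  obtain ⟨d1, d2⟩ := one_add_mul_delta_mem hs hδ hδ1
  refine ⟨outBar m ((1 + s * δ) * (m / 4)) (1 + s * ε), ?_, contDiffAt_outBar hr,
    H _ _ _ _ _ ?_ ?_ hε (by linarith) hs hr (hrs r hr0 h2) h3 ?_⟩
  · have : ∀ᶠ q : ℝ × ℝ in 𝓝 (r, t), q.1 ∈ Ioo (0 : ℝ) 1 :=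
      continuousAt_fst.eventually (Ioo_mem_nhds hr.1 hr.2)
    filter_upwards [this] with q hq
    rw [vOut_eq_outBar hq, hm]
  · nlinarith
  · nlinarith
  · have h4 : (rhoStar A ε * Real.sqrt t) ^ 2 ≤ r ^ 2 := by gcongr
    rw [mul_pow, rhoStar_sq hε, Real.sq_sqrt h3.le] at h4
    have hA2 : 1 ≤ A ^ 2 := one_le_pow₀ hA
    rw [div_le_iff₀ (by positivity)]
    have h5 : t ≤ A ^ 2 * t := le_mul_of_one_le_left h3.le hA2
    have h6 : A ^ 2 / ε * t = A ^ 2 * t / ε := by ring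
    rw [h6, div_le_iff₀ hε] at h4
    linarith

theorem isSignedBarrierOn_vPar {m A B ε δ s ts : ℝ} (hm : m = (n : ℝ) - 1) (hm1 : 1 ≤ m)
    (hA : 1 ≤ A) (hs : s ^ 2 = 1) (hε : 0 < ε) (hε1 : ε ≤ 1 / 8) (hεm : 12 * m * ε ≤ 1)
    (hδ : 0 < δ) (hδ1 : δ ≤ 1 / 8) (hB : 1 ≤ B)
    (hBz : 2 * m ^ 2 / (ε / (9 * A ^ 2)) ^ 2 + 272 * m ^ 5 * (1 + 1 / (ε / (9 * A ^ 2))) ≤ B ^ 2)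
    (hts1 : ts < 1) (hts : ∀ t ∈ Ioo 0 ts, kap t ≤ 1 / 4) :
    IsSignedBarrierOn n s (vPar n A B ε δ s) (regionPar A B ε ts) := by
  refine isSignedBarrierOn_of_eventuallyEq ?_
  rintro r t ⟨h1, h2, h3, h4⟩
  simp only at h1 h2 h3 h4
  have ht : t ∈ Ioo (0 : ℝ) 1 := ⟨h3, h4.trans hts1⟩
  have hρ := rhoStar_pos (by linarith : 0 < A) hε
  have hσ := sigmaStar_pos (by linarith : 0 < B) hε
  have hr0 : 0 < r := lt_of_lt_of_le (mul_pos hσ (theta_pos ht)) h1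
  obtain ⟨d1, d2⟩ := one_add_gammaC_mem (A := A) hm hm1 hs hε hε1 hδ hδ1
  refine ⟨fun r t => parBar m (1 + s * gammaC n A ε δ s) (s * B ^ 2) (r ^ 2) t, ?_,
    contDiffAt_parBar hr0 ht, parBar_strict hm hm1 (by linarith) (by linarith) hr0 ht
    (hts t ⟨h3, h4⟩) (by positivity) ?_ hs hB hε hεm ?_ hBz⟩
  · have : ∀ᶠ q : ℝ × ℝ in 𝓝 (r, t), q.2 ∈ Ioo (0 : ℝ) 1 :=
      continuousAt_snd.eventually (Ioo_mem_nhds ht.1 ht.2)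
    filter_upwards [this] with q hq
    rw [vPar_eq_parBar hq, hm]
  · have h5 : r ^ 2 ≤ (3 * rhoStar A ε * Real.sqrt t) ^ 2 := by gcongr
    rw [mul_pow, mul_pow, rhoStar_sq hε, Real.sq_sqrt h3.le] at h5
    rw [div_le_div_iff₀ (by positivity) (by positivity)]
    have h6 : 3 ^ 2 * (A ^ 2 / ε) * t = 9 * A ^ 2 * t / ε := by ring
    rw [h6, le_div_iff₀ hε] at h5
    linarith
  · have h5 : (sigmaStar B ε * theta t) ^ 2 ≤ r ^ 2 := by have := theta_pos ht; gcongr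
    rw [mul_pow, sigmaStar_sq hε, theta_sq_eq ht] at h5
    rw [← mul_div_assoc, div_le_div_iff₀ (by positivity) (by positivity)]
    have h6 : B ^ 2 / ε * (t * kap t) = B ^ 2 * (t * kap t) / ε := by ring
    rw [h6, div_le_iff₀ hε] at h5
    linarith

theorem isSignedBarrierOn_vIn {m A B ε δ s ts κ₀ : ℝ} (hf : BryantFun m f p)
    (hC : BryantCorr m f p C Cd Cdd) (hm : m = (n : ℝ) - 1) (hm1 : 1 ≤ m)
    (H : ∀ s q r t : ℝ, s ^ 2 = 1 → 2 / (3 * m ^ 2) ≤ q → 0 < r → t ∈ Ioo (0 : ℝ) 1 → kap t < κ₀ →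
      inX q (r ^ 2) t ≤ 2 / m ^ 2 * (9 * (B ^ 2 / ε)) →
      0 ≤ s * (deriv (fun t => inBar f C ε s q (r ^ 2) t) t
        - opF n (fun r => inBar f C ε s q (r ^ 2) t) r))
    (hs : s ^ 2 = 1) (hε : 0 < ε) (hε1 : ε ≤ 1 / 8) (hδ : 0 < δ) (hδ1 : δ ≤ 1 / 8)
    (hts1 : ts < 1) (hts : ∀ t ∈ Ioo 0 ts, kap t < κ₀) :
    IsSignedBarrierOn n s (vIn n (fun σ => f (σ ^ 2)) (fun σ => C (σ ^ 2)) A ε δ s)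
      (regionIn B ε ts) := by
  refine isSignedBarrierOn_of_eventuallyEq ?_
  rintro r t ⟨h1, h2, h3, h4⟩
  simp only at h1 h2 h3 h4
  have ht : t ∈ Ioo (0 : ℝ) 1 := ⟨h3, h4.trans hts1⟩
  obtain ⟨hq, hk, -⟩ := kC_sq (A := A) hm hm1 hs hε hε1 hδ hδ1
  set q := kC n A ε δ s ^ 2 with hqd
  have hq0 : 0 < q := by positivity
  subst hm
  refine ⟨fun r t => inBar f C ε s q (r ^ 2) t, ?_, contDiffAt_inBar hf hC hq0 h1 ht,
    H s q r t hs hq.1 h1 ht (hts t ⟨h3, h4⟩) ?_⟩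
  · have : ∀ᶠ q : ℝ × ℝ in 𝓝 (r, t), q.2 ∈ Ioo (0 : ℝ) 1 :=
      continuousAt_snd.eventually (Ioo_mem_nhds ht.1 ht.2)
    filter_upwards [this] with q hq
    rw [vIn_eq_inBar hq]
  · have h5 : r ^ 2 ≤ (3 * sigmaStar B ε * theta t) ^ 2 := by gcongr
    rw [mul_pow, mul_pow, sigmaStar_sq hε, theta_sq_eq ht] at h5
    have hκ := kap_pos ht
    rw [inX, div_le_iff₀ (by positivity)]
    calc q * r ^ 2 ≤ 2 / ((n : ℝ) - 1) ^ 2 * (3 ^ 2 * (B ^ 2 / ε) * (t * kap t)) := by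
          gcongr; exact hq.2
      _ = _ := by ring

end

/-! ### Assembling the pair of glued barriers. -/

section

open Set Filter Topology Asymptotics
open scoped ContDiff

variable {n : ℕ} {f p C Cd Cdd : ℝ → ℝ}

theorem theta_eq_sqrt {t : ℝ} (ht : t ∈ Ioo (0 : ℝ) 1) :
    theta t = Real.sqrt t * Real.sqrt (kap t) := by
  rw [theta, ← Real.sqrt_mul ht.1.le, kap, mul_one_div]

theorem eventually_order {A B ε rs : ℝ} (hA : 1 ≤ A) (hε : 0 < ε) (hrs : 0 < rs) :
    ∀ᶠ t in 𝓝[>] (0 : ℝ), 3 * sigmaStar B ε * theta t < rhoStar A ε * Real.sqrt t ∧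
      3 * rhoStar A ε * Real.sqrt t < rs := by
  have h1 : Tendsto (fun t => 3 * B * Real.sqrt (kap t)) (𝓝[>] 0) (𝓝 0) := by
    have := (Real.continuous_sqrt.tendsto 0).comp (tendsto_kap.mono_right nhdsWithin_le_nhds)
    simpa using this.const_mul (3 * B)
  have h2 : Tendsto (fun t => 3 * rhoStar A ε * Real.sqrt t) (𝓝[>] 0) (𝓝 0) := by
    have := (Real.continuous_sqrt.tendsto 0).mono_left (nhdsWithin_le_nhds (s := Ioi 0))
    simpa using this.const_mul (3 * rhoStar A ε)
  filter_upwards [h1.eventually (gt_mem_nhds (by linarith : 0 < A)), h2.eventually (gt_mem_nhds hrs),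
    Ioo_mem_nhdsGT one_pos] with t ht1 ht2 ht
  refine ⟨?_, ht2⟩
  rw [theta_eq_sqrt ht, sigmaStar, rhoStar]
  have e := Real.sqrt_pos.2 hε
  have e' := Real.sqrt_pos.2 ht.1
  calc 3 * (B / Real.sqrt ε) * (Real.sqrt t * Real.sqrt (kap t))
      = (3 * B * Real.sqrt (kap t)) * (Real.sqrt t / Real.sqrt ε) := by ring
    _ < A * (Real.sqrt t / Real.sqrt ε) := by gcongr
    _ = _ := by ring

/-- The order of choices is essential: `rs` comes from the outer error bound and depends on $n$
only, `B` is large in terms of $A$ and $\varepsilon$, and `ts` is small in terms of all three. Every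
estimate is uniform in $\delta<1/8$, which therefore comes last. -/
theorem exists_gluedBarrierPair {m : ℝ} (hm : m = (n : ℝ) - 1) (hm1 : 1 ≤ m)
    (hf : BryantFun m f p) (hC : BryantCorr m f p C Cd Cdd) :
    ∃ rs > 0, rs < 1 ∧ ∀ A ≥ 1, ∀ ε : ℝ, 0 < ε → ε < 1 / (24 * m) →
      ∃ B₀ ≥ 1, ∀ B ≥ B₀, ∀ᶠ ts in 𝓝[>] (0 : ℝ), ∀ δ : ℝ, 0 < δ → δ < 1 / 8 →
        IsGluedBarrierPair n (fun σ => f (σ ^ 2)) (fun σ => C (σ ^ 2)) A B ε δ rs ts := by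
  obtain ⟨l₀, hl₀, Hout⟩ := exists_outBar_strict hm hm1
  obtain ⟨rs, hrs, hrsl⟩ := exists_kap_le hl₀
  refine ⟨rs, hrs.1, hrs.2, fun A hA ε hε hε0 => ?_⟩
  have hεm : 24 * m * ε < 1 := by rw [lt_div_iff₀ (by positivity)] at hε0; linarith
  have hε1 : ε ≤ 1 / 8 := by nlinarith
  have hA0 : 0 < A := by linarith
  obtain ⟨X₀, hX₀⟩ : ∃ X₀, ∀ x, X₀ ≤ x → |x * f x - 1| ≤ ε / (16 * m ^ 2) := by
    have := (tendsto_order.1 ((hf.xf_atTop.sub_const 1).abs)).2 (ε / (16 * m ^ 2))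
      (by simp; positivity)
    obtain ⟨X₀, h⟩ := eventually_atTop.1 this
    exact ⟨X₀, fun x hx => (h x hx).le⟩
  -- This is $t/r^2$ at $r=3\rho_*\sqrt t$, its least value in the parabolic region.
  set z₀ := ε / (9 * A ^ 2) with hz₀
  set Bz := 2 * m ^ 2 / z₀ ^ 2 + 272 * m ^ 5 * (1 + 1 / z₀) with hBz
  -- The middle summand pushes the matching points into the range $x\ge X_0$ where $f$ has its $1/x$
  -- tail; `Bz` absorbs the parabolic errors.
  refine ⟨1 + |X₀| * (3 * m ^ 2) + Bz, by
    have : 0 ≤ |X₀| * (3 * m ^ 2) + Bz := by positivity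
    show (1 : ℝ) ≤ _
    linarith, fun B hB => ?_⟩
  have hBz0 : 0 ≤ Bz := by positivity
  have hXm : 0 ≤ |X₀| * (3 * m ^ 2) := by positivity
  have hB : 1 + |X₀| * (3 * m ^ 2) + Bz ≤ B := hB
  have hB1 : 1 ≤ B := by linarith
  have hB2 : B ≤ B ^ 2 := by nlinarith
  have hB0 : 0 < B := by linarith
  obtain ⟨κ₀, hκ₀, Hin⟩ := exists_inBar_strict (n := n) (by rw [← hm]; exact hf)
    (by rw [← hm]; exact hC) (by rw [← hm]; exact hm1) hε (by linarith)
    (q₀ := 2 / (3 * m ^ 2)) (by positivity) (2 / m ^ 2 * (9 * (B ^ 2 / ε)))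
  have hρ := rhoStar_pos hA0 hε
  have hσ := sigmaStar_pos hB0 hε
  obtain ⟨mg1, mg3⟩ := glue_out_margin hm1 hA0 hε
  have hs1 : (1 : ℝ) ^ 2 = 1 := by norm_num
  have hsm : (-1 : ℝ) ^ 2 = 1 := by norm_num
  have hσ1 : sigmaStar B ε ^ 2 = B ^ 2 / ε := sigmaStar_sq hε
  have hσ3 : (3 * sigmaStar B ε) ^ 2 = 9 * (B ^ 2 / ε) := by rw [mul_pow, hσ1]; norm_num
  have hXσ : X₀ ≤ 2 / (3 * m ^ 2) * sigmaStar B ε ^ 2 := by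
    rw [hσ1, div_mul_div_comm, le_div_iff₀ (by positivity)]
    have h1 : X₀ * (3 * m ^ 2 * ε) ≤ |X₀| * (3 * m ^ 2) * 1 := by
      rw [← mul_assoc]
      refine mul_le_mul ?_ (by linarith) hε.le hXm
      gcongr; exact le_abs_self _
    linarith
  have hfar1 : ∀ x, 2 / (3 * m ^ 2) * sigmaStar B ε ^ 2 ≤ x → |x * f x - 1| ≤ ε / (16 * m ^ 2) :=
    fun x hx => hX₀ x (hXσ.trans hx)
  have hfar3 : ∀ x, 2 / (3 * m ^ 2) * (3 * sigmaStar B ε) ^ 2 ≤ x →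
      |x * f x - 1| ≤ ε / (16 * m ^ 2) := fun x hx => hfar1 x (le_trans (by
        gcongr; linarith) hx)
  have hb1 : ε / 4 ≤ -1 * (ε / 2 - B ^ 2 / sigmaStar B ε ^ 2) := by
    rw [hσ1]; field_simp; linarith
  have hb3 : ε / 4 ≤ 1 * (ε / 2 - B ^ 2 / (3 * sigmaStar B ε) ^ 2) := by
    rw [hσ3]; field_simp; linarith
  have key : ∀ᶠ t in 𝓝[>] (0 : ℝ), kap t < κ₀ ∧ kap t ≤ 1 / 4 ∧ t < 1 ∧
      (3 * sigmaStar B ε * theta t < rhoStar A ε * Real.sqrt t ∧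
        3 * rhoStar A ε * Real.sqrt t < rs) ∧
      ∀ s : ℝ, s = 1 ∨ s = -1 → ∀ δ : ℝ, 0 < δ → δ < 1 / 8 →
        0 < s * (vOut n ε δ s (rhoStar A ε * Real.sqrt t) t
          - vPar n A B ε δ s (rhoStar A ε * Real.sqrt t) t) ∧
        s * (vOut n ε δ s (3 * rhoStar A ε * Real.sqrt t) t
          - vPar n A B ε δ s (3 * rhoStar A ε * Real.sqrt t) t) < 0 ∧
        s * (vIn n (fun σ => f (σ ^ 2)) (fun σ => C (σ ^ 2)) A ε δ s (sigmaStar B ε * theta t) t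
          - vPar n A B ε δ s (sigmaStar B ε * theta t) t) < 0 ∧
        0 < s * (vIn n (fun σ => f (σ ^ 2)) (fun σ => C (σ ^ 2)) A ε δ s
            (3 * sigmaStar B ε * theta t) t
          - vPar n A B ε δ s (3 * sigmaStar B ε * theta t) t) := by
    have hκ := tendsto_kap.mono_right nhdsWithin_le_nhds
    have hG : ∀ s : ℝ, s = 1 ∨ s = -1 → ∀ᶠ t in 𝓝[>] (0 : ℝ), ∀ δ : ℝ, 0 < δ → δ < 1 / 8 →
        0 < s * (vOut n ε δ s (rhoStar A ε * Real.sqrt t) t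
          - vPar n A B ε δ s (rhoStar A ε * Real.sqrt t) t) ∧
        s * (vOut n ε δ s (3 * rhoStar A ε * Real.sqrt t) t
          - vPar n A B ε δ s (3 * rhoStar A ε * Real.sqrt t) t) < 0 ∧
        s * (vIn n (fun σ => f (σ ^ 2)) (fun σ => C (σ ^ 2)) A ε δ s (sigmaStar B ε * theta t) t
          - vPar n A B ε δ s (sigmaStar B ε * theta t) t) < 0 ∧
        0 < s * (vIn n (fun σ => f (σ ^ 2)) (fun σ => C (σ ^ 2)) A ε δ s
            (3 * sigmaStar B ε * theta t) t
          - vPar n A B ε δ s (3 * sigmaStar B ε * theta t) t) := by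
      intro s hs'
      have hs : s ^ 2 = 1 := by rcases hs' with h | h <;> rw [h] <;> norm_num
      filter_upwards [eventually_glue_out (b := s * B ^ 2) hm1 hρ hs mg1,
        eventually_glue_out (b := s * B ^ 2) hm1 (by positivity : 0 < 3 * rhoStar A ε) hs mg3,
        eventually_glue_in hf hC hm1 hε (by linarith) hs hsm hσ hfar1 hb1,
        eventually_glue_in hf hC hm1 hε (by linarith) hs hs1
          (by positivity : 0 < 3 * sigmaStar B ε) hfar3 hb3,
        eventually_order (B := B) hA hε hrs.1, Ioo_mem_nhdsGT one_pos] with t g1 g2 g3 g4 ho ht δ hδ hδ1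
      have hδ8 : δ ≤ 1 / 8 := hδ1.le
      obtain ⟨d1, d2⟩ := one_add_mul_delta_mem hs hδ hδ8
      obtain ⟨a1, a2⟩ := one_add_gammaC_mem (A := A) hm hm1 hs hε hε1 hδ hδ8
      obtain ⟨hq, -, hqa⟩ := kC_sq (A := A) hm hm1 hs hε hε1 hδ hδ8
      have hst := Real.sqrt_pos.2 ht.1
      have r1 : rhoStar A ε * Real.sqrt t ∈ Ioo (0 : ℝ) 1 := ⟨by positivity, by
        have := hrs.2; have := mul_pos hρ hst; linarith [ho.2]⟩
      have r3 : 3 * rhoStar A ε * Real.sqrt t ∈ Ioo (0 : ℝ) 1 := ⟨by positivity, ho.2.trans hrs.2⟩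
      have k1 := g1 (1 + s * δ) ⟨by linarith, by linarith⟩
      have k2 := g2 (1 + s * δ) ⟨by linarith, by linarith⟩
      have k3 := g3 _ ⟨by linarith, by linarith⟩ _ hq hqa
      have k4 := g4 _ ⟨by linarith, by linarith⟩ _ hq hqa
      rw [← one_add_gammaC hm] at k1 k2
      rw [vOut_eq_outBar r1, vOut_eq_outBar r3, vPar_eq_parBar ht, vPar_eq_parBar ht,
        vPar_eq_parBar ht, vPar_eq_parBar ht, vIn_eq_inBar ht, vIn_eq_inBar ht, ← hm]
      refine ⟨by linarith, by linarith, by linarith, by linarith⟩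
    filter_upwards [hκ.eventually (gt_mem_nhds hκ₀), hκ.eventually
      (gt_mem_nhds (by norm_num : (0 : ℝ) < 1 / 4)), Ioo_mem_nhdsGT one_pos,
      eventually_order (B := B) hA hε hrs.1, hG 1 (Or.inl rfl), hG (-1) (Or.inr rfl)]
      with t k1 k2 k3 k4 k5 k6
    exact ⟨k1, k2.le, k3.2, k4, fun s hs => by rcases hs with h | h <;> rw [h] <;> assumption⟩
  obtain ⟨T, hT, hTs⟩ := mem_nhdsGT_iff_exists_Ioo_subset.1 key
  have hT : 0 < T := hT
  filter_upwards [Ioo_mem_nhdsGT (lt_min hT one_pos)] with ts hts δ hδ hδ1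
  have hts1 : ts < 1 := hts.2.trans_le (min_le_right _ _)
  have hkey : ∀ t ∈ Ioo 0 ts, _ := fun t ht =>
    hTs (show t ∈ Ioo 0 T from ⟨ht.1, ht.2.trans (hts.2.trans_le (min_le_left _ _))⟩)
  have hδ8 := hδ1.le
  have sOut : ∀ s : ℝ, s ^ 2 = 1 → IsSignedBarrierOn n s (vOut n ε δ s) (regionOut A ε rs ts) :=
    fun s hs => isSignedBarrierOn_vOut hm hm1 Hout hrs.2 hrsl hA hs hε hε1 hδ hδ8
  have sPar : ∀ s : ℝ, s ^ 2 = 1 →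
      IsSignedBarrierOn n s (vPar n A B ε δ s) (regionPar A B ε ts) := fun s hs =>
    isSignedBarrierOn_vPar hm hm1 hA hs hε hε1 (by nlinarith) hδ hδ8 hB1 (show Bz ≤ B ^ 2 by linarith) hts1
      fun t ht => (hkey t ht).2.1
  have sIn : ∀ s : ℝ, s ^ 2 = 1 → IsSignedBarrierOn n s
      (vIn n (fun σ => f (σ ^ 2)) (fun σ => C (σ ^ 2)) A ε δ s) (regionIn B ε ts) := fun s hs =>
    isSignedBarrierOn_vIn hf hC hm hm1 Hin hs hε hε1 hδ hδ8 hts1 fun t ht => (hkey t ht).1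
  exact {
    sub_out := (sOut _ hsm).sub
    sub_par := (sPar _ hsm).sub
    sub_in := (sIn _ hsm).sub
    super_out := (sOut _ hs1).super
    super_par := (sPar _ hs1).super
    super_in := (sIn _ hs1).super
    order := fun t ht => (hkey t ht).2.2.2.1
    glue_sub_out := fun t ht => by
      obtain ⟨h1, h2, -, -⟩ := (hkey t ht).2.2.2.2 (-1) (Or.inr rfl) δ hδ hδ1
      constructor <;> linarith
    glue_sub_in := fun t ht => by
      obtain ⟨-, -, h1, h2⟩ := (hkey t ht).2.2.2.2 (-1) (Or.inr rfl) δ hδ hδ1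
      constructor <;> linarith
    glue_super_out := fun t ht => by
      obtain ⟨h1, h2, -, -⟩ := (hkey t ht).2.2.2.2 1 (Or.inl rfl) δ hδ hδ1
      constructor <;> linarith
    glue_super_in := fun t ht => by
      obtain ⟨-, -, h1, h2⟩ := (hkey t ht).2.2.2.2 1 (Or.inl rfl) δ hδ hδ1
      constructor <;> linarith }

end

section

open Set Filter Topology
open scoped ContDiff

/-! ### Solutions and their derivatives -/

/-- A solution of `v_t = 𝓕[v]` together with its derivatives `v1 = v_r`, `v2 = v_rr`, `vt = v_t`,
which are continuous up to the tip `r = 0` for positive times. -/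
structure SolData (m r₁ t₁ : ℝ) (v v1 v2 vt : ℝ → ℝ → ℝ) : Prop where
  nonneg : ∀ r ∈ Ico 0 r₁, ∀ t ∈ Ico 0 t₁, 0 ≤ v r t
  hasDerivWithinAt : ∀ r ∈ Ico 0 r₁, ∀ t ∈ Ioo 0 t₁,
    HasDerivWithinAt (fun x => v x t) (v1 r t) (Ico 0 r₁) r
  hasDerivWithinAt_v1 : ∀ r ∈ Ico 0 r₁, ∀ t ∈ Ioo 0 t₁,
    HasDerivWithinAt (fun x => v1 x t) (v2 r t) (Ico 0 r₁) r
  hasDerivAt_time : ∀ r ∈ Ico 0 r₁, ∀ t ∈ Ioo 0 t₁, HasDerivAt (fun s => v r s) (vt r t) t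
  cont_initial : ContinuousOn (fun p : ℝ × ℝ => v p.1 p.2) (Ioo 0 r₁ ×ˢ Ico 0 t₁)
  cont : ContinuousOn (fun p : ℝ × ℝ => v p.1 p.2) (Ico 0 r₁ ×ˢ Ioo 0 t₁)
  cont_v2 : ContinuousOn (fun p : ℝ × ℝ => v2 p.1 p.2) (Ico 0 r₁ ×ˢ Ioo 0 t₁)
  cont_vt : ContinuousOn (fun p : ℝ × ℝ => vt p.1 p.2) (Ico 0 r₁ ×ˢ Ioo 0 t₁)
  pde : ∀ r ∈ Ioo 0 r₁, ∀ t ∈ Ioo 0 t₁, vt r t = v r t * v2 r t - 1 / 2 * v1 r t ^ 2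
    + (m - v r t) / r * v1 r t + 2 * m / r ^ 2 * (v r t * (1 - v r t))

theorem SolData.eventually_hasDerivAt {m r₁ t₁ : ℝ} {v v1 v2 vt : ℝ → ℝ → ℝ}
    (h : SolData m r₁ t₁ v v1 v2 vt) {r t : ℝ} (hr : r ∈ Ioo 0 r₁) (ht : t ∈ Ioo 0 t₁) :
    ∀ᶠ y in 𝓝 r, HasDerivAt (fun x => v x t) (v1 y t) y := by
  filter_upwards [Ioo_mem_nhds hr.1 hr.2] with y hy
  exact (h.hasDerivWithinAt y ⟨hy.1.le, hy.2⟩ t ht).hasDerivAt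
    (mem_of_superset (Ioo_mem_nhds hy.1 hy.2) Ioo_subset_Ico_self)

theorem SolData.hasDerivAt_v1 {m r₁ t₁ : ℝ} {v v1 v2 vt : ℝ → ℝ → ℝ}
    (h : SolData m r₁ t₁ v v1 v2 vt) {r t : ℝ} (hr : r ∈ Ioo 0 r₁) (ht : t ∈ Ioo 0 t₁) :
    HasDerivAt (fun x => v1 x t) (v2 r t) r :=
  (h.hasDerivWithinAt_v1 r ⟨hr.1.le, hr.2⟩ t ht).hasDerivAt
    (mem_of_superset (Ioo_mem_nhds hr.1 hr.2) Ioo_subset_Ico_self)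

theorem hasDerivWithinAt_line {g : ℝ × ℝ → ℝ} {r₁ t₁ : ℝ} {r t : ℝ}
    (hg : DifferentiableOn ℝ g (Ico 0 r₁ ×ˢ Ioo 0 t₁)) (hr : r ∈ Ico 0 r₁) (ht : t ∈ Ioo 0 t₁) :
    HasDerivWithinAt (fun x => g (x, t)) (fderivWithin ℝ g (Ico 0 r₁ ×ˢ Ioo 0 t₁) (r, t) (1, 0))
      (Ico 0 r₁) r := by
  have h1 := (hg (r, t) ⟨hr, ht⟩).hasFDerivWithinAt
  have h2 : HasDerivWithinAt (fun x : ℝ => (x, t)) ((1 : ℝ), (0 : ℝ)) (Ico 0 r₁) r :=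
    (hasDerivWithinAt_id r _).prodMk (hasDerivWithinAt_const r _ t)
  have hm : MapsTo (fun x : ℝ => (x, t)) (Ico 0 r₁) (Ico 0 r₁ ×ˢ Ioo 0 t₁) := fun x hx => ⟨hx, ht⟩
  exact h1.comp_hasDerivWithinAt r h2 hm

theorem hasDerivAt_line_time {g : ℝ × ℝ → ℝ} {r₁ t₁ : ℝ} {r t : ℝ}
    (hg : DifferentiableOn ℝ g (Ico 0 r₁ ×ˢ Ioo 0 t₁)) (hr : r ∈ Ico 0 r₁) (ht : t ∈ Ioo 0 t₁) :
    HasDerivAt (fun s => g (r, s)) (fderivWithin ℝ g (Ico 0 r₁ ×ˢ Ioo 0 t₁) (r, t) (0, 1)) t := by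
  have h1 := (hg (r, t) ⟨hr, ht⟩).hasFDerivWithinAt
  have h2 : HasDerivWithinAt (fun s : ℝ => (r, s)) ((0 : ℝ), (1 : ℝ)) (Ioo 0 t₁) t :=
    (hasDerivWithinAt_const t _ r).prodMk (hasDerivWithinAt_id t _)
  have hm : MapsTo (fun s : ℝ => (r, s)) (Ioo 0 t₁) (Ico 0 r₁ ×ˢ Ioo 0 t₁) := fun x hx => ⟨hr, hx⟩
  have : HasDerivWithinAt (fun s => g (r, s))
      (fderivWithin ℝ g (Ico 0 r₁ ×ˢ Ioo 0 t₁) (r, t) (0, 1)) (Ioo 0 t₁) t :=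
    h1.comp_hasDerivWithinAt t h2 hm
  exact this.hasDerivAt (Ioo_mem_nhds ht.1 ht.2)

/-- Derivatives are taken within the half-open domain, so that they are continuous up to the tip,
where only one-sided derivatives in $r$ exist. -/
theorem IsSmoothSolution.exists_solData {n : ℕ} {vInit : ℝ → ℝ} {r₁ t₁ : ℝ} {v : ℝ → ℝ → ℝ}
    (h : IsSmoothSolution n vInit r₁ t₁ v) :
    ∃ v1 v2 vt : ℝ → ℝ → ℝ, SolData ((n : ℝ) - 1) r₁ t₁ v v1 v2 vt := by
  set S : Set (ℝ × ℝ) := Ico 0 r₁ ×ˢ Ioo 0 t₁ with hS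
  set g : ℝ × ℝ → ℝ := fun p => v p.1 p.2 with hg
  have hU : UniqueDiffOn ℝ S := (uniqueDiffOn_Ico 0 r₁).prod (uniqueDiffOn_Ioo 0 t₁)
  have hsm : ContDiffOn ℝ ∞ g S := h.smooth
  have hfd : ∀ {g : ℝ × ℝ → ℝ}, ContDiffOn ℝ ∞ g S → ∀ e : ℝ × ℝ,
      ContDiffOn ℝ ∞ (fun p => fderivWithin ℝ g S p e) S := fun {g} hg e =>
    (hg.fderivWithin hU (by simp)).clm_apply contDiffOn_const
  have hd : ∀ {g : ℝ × ℝ → ℝ}, ContDiffOn ℝ ∞ g S → DifferentiableOn ℝ g S := fun {g} hg =>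
    hg.differentiableOn (by simp)
  have h1 := hfd hsm (1, 0)
  have ht := hfd hsm (0, 1)
  have h2 := hfd h1 (1, 0)
  have D : SolData ((n : ℝ) - 1) r₁ t₁ v (fun r t => fderivWithin ℝ g S (r, t) (1, 0))
    (fun r t => fderivWithin ℝ (fun p => fderivWithin ℝ g S p (1, 0)) S (r, t) (1, 0))
    (fun r t => fderivWithin ℝ g S (r, t) (0, 1)) := by
    have e1 : ∀ r ∈ Ico 0 r₁, ∀ t ∈ Ioo 0 t₁, HasDerivWithinAt (fun x => v x t)
        (fderivWithin ℝ g S (r, t) (1, 0)) (Ico 0 r₁) r :=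
      fun r hr t ht => hasDerivWithinAt_line (hd hsm) hr ht
    have e2 : ∀ r ∈ Ico 0 r₁, ∀ t ∈ Ioo 0 t₁,
        HasDerivWithinAt (fun x => fderivWithin ℝ g S (x, t) (1, 0))
        (fderivWithin ℝ (fun p => fderivWithin ℝ g S p (1, 0)) S (r, t) (1, 0)) (Ico 0 r₁) r :=
      fun r hr t ht => hasDerivWithinAt_line (hd h1) hr ht
    have et : ∀ r ∈ Ico 0 r₁, ∀ t ∈ Ioo 0 t₁,
        HasDerivAt (fun s => v r s) (fderivWithin ℝ g S (r, t) (0, 1)) t :=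
      fun r hr t ht => hasDerivAt_line_time (hd hsm) hr ht
    refine ⟨h.nonneg, e1, e2, et, h.cont, hsm.continuousOn, h2.continuousOn, ht.continuousOn, ?_⟩
    intro r hr t ht
    have hr' : r ∈ Ico 0 r₁ := ⟨hr.1.le, hr.2⟩
    have hn : ∀ y ∈ Ioo 0 r₁, Ico 0 r₁ ∈ 𝓝 y := fun y hy =>
      mem_of_superset (Ioo_mem_nhds hy.1 hy.2) Ioo_subset_Ico_self
    have := h.pde r hr t ht
    rw [(et r hr' t ht).deriv, opF_eq (w1 := fun r => fderivWithin ℝ g S (r, t) (1, 0))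
      (by filter_upwards [Ioo_mem_nhds hr.1 hr.2] with y hy
          exact (e1 y ⟨hy.1.le, hy.2⟩ t ht).hasDerivAt (hn y hy))
      ((e2 r hr' t ht).hasDerivAt (hn r hr))] at this
    exact this
  exact ⟨_, _, _, D⟩

/-! ### Touching -/

/-- If `s (v - φ)` has at `(r,t)` a local maximum in `r` and a maximum over earlier times in `t`,
then the equation for `v` gives a differential inequality for `φ`, in two forms. -/
theorem SolData.touch {m r₁ t₁ : ℝ} {v v1 v2 vt : ℝ → ℝ → ℝ}
    (h : SolData m r₁ t₁ v v1 v2 vt) {r t t₀ s φt φrr : ℝ} {φ φr : ℝ → ℝ} {φ' : ℝ → ℝ}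
    (hr : r ∈ Ioo 0 r₁) (ht : t ∈ Ioo 0 t₁) (ht₀ : t₀ < t)
    (h1 : ∀ᶠ y in 𝓝 r, HasDerivAt φ (φr y) y) (h2 : HasDerivAt φr φrr r)
    (h3 : HasDerivAt φ' φt t)
    (hmr : ∀ᶠ y in 𝓝 r, s * (v y t - φ y) ≤ s * (v r t - φ r))
    (hmt : ∀ τ ∈ Ioc t₀ t, s * (v r τ - φ' τ) ≤ s * (v r t - φ' t)) :
    s * φt ≤ s * vt r t ∧ s * v2 r t ≤ s * φrr ∧ (s ≠ 0 → v1 r t = φr r) := by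
  have ev := h.eventually_hasDerivAt hr ht
  obtain ⟨e1, e2⟩ := second_deriv_nonpos_of_isLocalMax (g := fun y => s * (v y t - φ y))
    (g1 := fun y => s * (v1 y t - φr y)) (g2 := s * (v2 r t - φrr)) (x := r) hmr
    (by filter_upwards [ev, h1] with y hy1 hy2 using (hy1.fun_sub hy2).const_mul s)
    (((h.hasDerivAt_v1 hr ht).fun_sub h2).const_mul s)
  have e3 := deriv_nonneg_of_le_left ht₀
    (((h.hasDerivAt_time r ⟨hr.1.le, hr.2⟩ t ht).fun_sub h3).const_mul s) hmt
  refine ⟨by linarith, by linarith, fun hs => ?_⟩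
  have := (mul_eq_zero.1 e1).resolve_left hs
  linarith

/-- A function on a rectangle which is positive on the parabolic boundary, and whose first zero is
excluded, is positive. -/
theorem pos_of_no_first_touch {g : ℝ → ℝ → ℝ} {a b t₀ T : ℝ}
    (hc : ContinuousOn (fun p : ℝ × ℝ => g p.1 p.2) (Icc a b ×ˢ Icc t₀ T))
    (hinit : ∀ r ∈ Icc a b, 0 < g r t₀)
    (hlat : ∀ t ∈ Icc t₀ T, 0 < g a t ∧ 0 < g b t)
    (hno : ∀ r ∈ Ioo a b, ∀ t ∈ Ioc t₀ T, g r t = 0 → (∀ y ∈ Icc a b, 0 ≤ g y t) →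
      (∀ τ ∈ Icc t₀ t, 0 ≤ g r τ) → False) :
    ∀ r ∈ Icc a b, ∀ t ∈ Icc t₀ T, 0 < g r t := by
  by_contra! hcon
  obtain ⟨r', hr', t', ht', hneg⟩ := hcon
  have hcomp : IsCompact ((Icc a b ×ˢ Icc t₀ T) ∩ (fun p : ℝ × ℝ => g p.1 p.2) ⁻¹' Iic 0) :=
    (isCompact_Icc.prod isCompact_Icc).of_isClosed_subset
      (hc.preimage_isClosed_of_isClosed (isClosed_Icc.prod isClosed_Icc) isClosed_Iic)
      inter_subset_left
  obtain ⟨⟨r, t⟩, ⟨⟨hr, ht⟩, hle⟩, hmin⟩ := hcomp.exists_isMinOn ⟨(r', t'), ⟨hr', ht'⟩, hneg⟩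
    continuous_snd.continuousOn
  simp only at hr ht
  have hle : g r t ≤ 0 := hle
  have hbefore : ∀ y ∈ Icc a b, ∀ τ ∈ Ico t₀ t, 0 < g y τ := by
    intro y hy τ hτ
    by_contra! hc0
    have := hmin (show (y, τ) ∈ _ from ⟨⟨hy, ⟨hτ.1, hτ.2.le.trans ht.2⟩⟩, hc0⟩)
    simp only [mem_ofPred_eq] at this
    exact absurd hτ.2 (not_lt.2 this)
  have htpos : t₀ < t := by
    rcases eq_or_lt_of_le ht.1 with h | h
    · exact absurd (hinit r hr) (not_lt.2 (h ▸ hle))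
    · exact h
  have hnow : ∀ y ∈ Icc a b, 0 ≤ g y t := by
    intro y hy
    have h1 : ContinuousWithinAt (fun τ => g y τ) (Ico t₀ t) t := by
      have := (hc (y, t) ⟨hy, ht⟩).comp (f := fun τ : ℝ => (y, τ)) (s := Ico t₀ t) (x := t)
        (by fun_prop) fun τ hτ => ⟨hy, ⟨hτ.1, hτ.2.le.trans ht.2⟩⟩
      exact this
    have hne : (𝓝[Ico t₀ t] t).NeBot := by
      rw [nhdsWithin_Ico_eq_nhdsLT htpos]; infer_instance
    refine ge_of_tendsto h1 ?_
    filter_upwards [self_mem_nhdsWithin] with τ hτ using (hbefore y hy τ hτ).le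
  have hrI : r ∈ Ioo a b := by
    refine ⟨lt_of_le_of_ne hr.1 ?_, lt_of_le_of_ne hr.2 ?_⟩
    · rintro rfl; exact absurd (hlat t ht).1 (not_lt.2 hle)
    · rintro rfl; exact absurd (hlat t ht).2 (not_lt.2 hle)
  refine hno r hrI t ⟨htpos, ht.2⟩ (le_antisymm hle (hnow r hr)) hnow fun τ hτ => ?_
  rcases eq_or_lt_of_le hτ.2 with h | h
  · rw [h]; exact hnow r hr
  · exact (hbefore r hr τ ⟨hτ.1, h⟩).le

/-- Comparison of a solution with a barrier which cannot be touched: `s = 1` for barriers from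
above, `s = -1` for barriers from below. -/
theorem SolData.compare {m r₁ t₁ : ℝ} {v v1 v2 vt : ℝ → ℝ → ℝ}
    (h : SolData m r₁ t₁ v v1 v2 vt) {φ : ℝ → ℝ → ℝ} {a b t₀ T s : ℝ} (hs : s ^ 2 = 1)
    (ha : 0 ≤ a) (hb : b < r₁) (ht₀ : 0 ≤ t₀) (hT : T < t₁)
    (hcv : ContinuousOn (fun p : ℝ × ℝ => v p.1 p.2) (Icc a b ×ˢ Icc t₀ T))
    (hcφ : ContinuousOn (fun p : ℝ × ℝ => φ p.1 p.2) (Icc a b ×ˢ Icc t₀ T))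
    (hinit : ∀ r ∈ Icc a b, 0 < s * (φ r t₀ - v r t₀))
    (hlat : ∀ t ∈ Icc t₀ T, 0 < s * (φ a t - v a t) ∧ 0 < s * (φ b t - v b t))
    (hno : ∀ r ∈ Ioo a b, ∀ t ∈ Ioc t₀ T, v r t = φ r t →
      ∃ (w wr : ℝ → ℝ) (wrr : ℝ) (w' : ℝ → ℝ) (wt : ℝ), w r = φ r t ∧ w' t = φ r t ∧
        (∀ᶠ y in 𝓝 r, s * φ y t ≤ s * w y) ∧ (∀ᶠ τ in 𝓝 t, s * φ r τ ≤ s * w' τ) ∧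
        (∀ᶠ y in 𝓝 r, HasDerivAt w (wr y) y) ∧ HasDerivAt wr wrr r ∧ HasDerivAt w' wt t ∧
        (s * wt ≤ s * vt r t → s * v2 r t ≤ s * wrr → v1 r t = wr r → False)) :
    ∀ r ∈ Icc a b, ∀ t ∈ Icc t₀ T, 0 < s * (φ r t - v r t) := by
  refine pos_of_no_first_touch (g := fun r t => s * (φ r t - v r t))
    (continuousOn_const.mul (hcφ.sub hcv)) hinit hlat ?_
  intro r hr t ht h0 hsp htm
  have hs0 : s ≠ 0 := by rintro rfl; norm_num at hs
  have hv : v r t = φ r t := by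
    have := (mul_eq_zero.1 h0).resolve_left hs0; linarith
  obtain ⟨w, wr, wrr, w', wt, e1, e2, e3, e4, e5, e6, e7, hF⟩ := hno r hr t ht hv
  obtain ⟨l, hl, hlt⟩ := (mem_nhdsLE_iff_exists_Ioc_subset' ht.1).1 (nhdsWithin_le_nhds e4)
  have hl1 : t₀ ≤ max t₀ l := le_max_left _ _
  obtain ⟨k1, k2, k3⟩ := h.touch (s := s) (t₀ := max t₀ l) ⟨ha.trans_lt hr.1, hr.2.trans hb⟩
    ⟨ht₀.trans_lt ht.1, ht.2.trans_lt hT⟩ (max_lt ht.1 hl) e5 e6 e7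
    (by
      filter_upwards [e3, Ioo_mem_nhds hr.1 hr.2] with y hy hyI
      have := hsp y ⟨hyI.1.le, hyI.2.le⟩
      rw [e1, hv, sub_self, mul_zero]
      linarith)
    (by
      intro τ hτ
      have := htm τ ⟨hl1.trans hτ.1.le, hτ.2⟩
      have h4 : s * φ r τ ≤ s * w' τ := hlt ⟨(le_max_right _ _).trans_lt hτ.1, hτ.2⟩
      rw [e2, hv, sub_self, mul_zero]
      linarith)
  exact hF k1 k2 (k3 hs0)

/-- Comparison with a smooth strict barrier. -/
theorem SolData.compare_strict {m r₁ t₁ : ℝ} {v v1 v2 vt : ℝ → ℝ → ℝ}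
    (h : SolData m r₁ t₁ v v1 v2 vt) {φ φr φrr φt : ℝ → ℝ → ℝ} {a b t₀ T s : ℝ} (hs : s ^ 2 = 1)
    (ha : 0 ≤ a) (hb : b < r₁) (ht₀ : 0 ≤ t₀) (hT : T < t₁)
    (hcv : ContinuousOn (fun p : ℝ × ℝ => v p.1 p.2) (Icc a b ×ˢ Icc t₀ T))
    (hcφ : ContinuousOn (fun p : ℝ × ℝ => φ p.1 p.2) (Icc a b ×ˢ Icc t₀ T))
    (hinit : ∀ r ∈ Icc a b, 0 < s * (φ r t₀ - v r t₀))
    (hlat : ∀ t ∈ Icc t₀ T, 0 < s * (φ a t - v a t) ∧ 0 < s * (φ b t - v b t))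
    (hd1 : ∀ r ∈ Ioo a b, ∀ t ∈ Ioc t₀ T, HasDerivAt (fun y => φ y t) (φr r t) r)
    (hd2 : ∀ r ∈ Ioo a b, ∀ t ∈ Ioc t₀ T, HasDerivAt (fun y => φr y t) (φrr r t) r)
    (hdt : ∀ r ∈ Ioo a b, ∀ t ∈ Ioc t₀ T, HasDerivAt (fun τ => φ r τ) (φt r t) t)
    (hstrict : ∀ r ∈ Ioo a b, ∀ t ∈ Ioc t₀ T, 0 ≤ φ r t → φ r t = v r t →
      s * (φ r t * φrr r t - 1 / 2 * φr r t ^ 2 + (m - φ r t) / r * φr r t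
        + 2 * m / r ^ 2 * (φ r t * (1 - φ r t))) < s * φt r t) :
    ∀ r ∈ Icc a b, ∀ t ∈ Icc t₀ T, 0 < s * (φ r t - v r t) := by
  refine h.compare hs ha hb ht₀ hT hcv hcφ hinit hlat fun r hr t ht hv =>
    ⟨fun y => φ y t, fun y => φr y t, φrr r t, fun τ => φ r τ, φt r t, rfl, rfl,
      Eventually.of_forall fun _ => le_rfl, Eventually.of_forall fun _ => le_rfl,
      ?_, hd2 r hr t ht, hdt r hr t ht, fun k1 k2 k3 => ?_⟩
  · filter_upwards [Ioo_mem_nhds hr.1 hr.2] with y hy using hd1 y hy t ht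
  · have hr' : r ∈ Ioo 0 r₁ := ⟨ha.trans_lt hr.1, hr.2.trans hb⟩
    have ht' : t ∈ Ioo 0 t₁ := ⟨ht₀.trans_lt ht.1, ht.2.trans_lt hT⟩
    have hv0 := h.nonneg r ⟨hr'.1.le, hr'.2⟩ t ⟨ht'.1.le, ht'.2⟩
    have h1 := hstrict r hr t ht (hv ▸ hv0) hv.symm
    have h2 := h.pde r hr' t ht'
    rw [k3, hv] at h2
    have h3 := mul_le_mul_of_nonneg_left k2 (hv ▸ hv0)
    rw [h2] at k1
    linarith

end

/-! ### Cusp initial data and the lower bound. -/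

section

open Set Filter Topology
open scoped ContDiff

variable {m r₁ t₁ : ℝ} {v v1 v2 vt : ℝ → ℝ → ℝ}

theorem tendsto_kap_zero : Tendsto kap (𝓝[>] 0) (𝓝 0) := tendsto_kap.mono_right nhdsWithin_le_nhds

/-- The initial data are close to the model cusp. -/
def IsCuspInitial (m : ℝ) (u : ℝ → ℝ) : Prop :=
  ∀ δ > 0, ∃ R > 0, ∀ r ∈ Ioc 0 R, (1 - δ) * (m / 4) * kap r < u r ∧ u r < (1 + δ) * (m / 4) * kap r

theorem IsNeckpinchData.isCuspInitial {n : ℕ} {u : ℝ → ℝ} (hm : 0 < (n : ℝ) - 1)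
    (h : IsNeckpinchData n u) : IsCuspInitial ((n : ℝ) - 1) u := by
  intro δ hδ
  have h1 := h.asymp.eventually (Ioo_mem_nhds (show 1 - δ < 1 by linarith) (show 1 < 1 + δ by linarith))
  obtain ⟨R, hR, hsub⟩ := mem_nhdsGT_iff_exists_Ioo_subset.1 (h1.and (Ioo_mem_nhdsGT one_pos))
  have hR : 0 < R := hR
  refine ⟨R / 2, by positivity, fun r hr => ?_⟩
  obtain ⟨⟨h2, h3⟩, h4⟩ := hsub (show r ∈ Ioo 0 R from ⟨hr.1, by linarith [hr.2]⟩)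
  have hv : 0 < v0 n r := by rw [v0_eq]; have := kap_pos h4; positivity
  rw [lt_div_iff₀ hv, v0_eq] at h2
  rw [div_lt_iff₀ hv, v0_eq] at h3
  constructor <;> linarith

theorem SolData.continuousOn_time (h : SolData m r₁ t₁ v v1 v2 vt) {R : ℝ} (hR : R ∈ Ioo 0 r₁) :
    ContinuousOn (fun t => v R t) (Ico 0 t₁) := fun t ht =>
  (h.cont_initial (R, t) ⟨hR, ht⟩).comp (f := fun t : ℝ => (R, t)) (s := Ico 0 t₁) (x := t)
    (by fun_prop) fun _ hτ => ⟨hR, hτ⟩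

/-- Strict inequalities for `v (R, ·)` at time zero persist for a short time. -/
theorem SolData.exists_time (h : SolData m r₁ t₁ v v1 v2 vt) (ht₁ : 0 < t₁) {R : ℝ}
    (hR : R ∈ Ioo 0 r₁) {lo hi : ℝ} (h0 : v R 0 ∈ Ioo lo hi) :
    ∃ T ∈ Ioo 0 t₁, ∀ t ∈ Icc 0 T, v R t ∈ Ioo lo hi := by
  have h1 : ∀ᶠ t in 𝓝[Ico 0 t₁] 0, v R t ∈ Ioo lo hi :=
    (h.continuousOn_time hR 0 ⟨le_rfl, ht₁⟩).eventually (Ioo_mem_nhds h0.1 h0.2)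
  rw [nhdsWithin_Ico_eq_nhdsGE ht₁] at h1
  obtain ⟨u, hu, hsub⟩ := mem_nhdsGE_iff_exists_Ico_subset.1 h1
  have hu : 0 < u := hu
  refine ⟨min (u / 2) (t₁ / 2), ⟨by positivity, by
    have := min_le_right (u / 2) (t₁ / 2); linarith⟩, fun t ht => hsub ⟨ht.1, ?_⟩⟩
  have := ht.2.trans (min_le_left _ _)
  linarith

theorem SolData.continuousOn_rect (h : SolData m r₁ t₁ v v1 v2 vt) {a b T : ℝ} (ha : 0 < a)
    (hb : b < r₁) (hT : T < t₁) :
    ContinuousOn (fun p : ℝ × ℝ => v p.1 p.2) (Icc a b ×ˢ Icc 0 T) :=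
  h.cont_initial.mono (prod_mono (fun _ hx => ⟨ha.trans_le hx.1, hx.2.trans_lt hb⟩)
    fun _ hx => ⟨hx.1, hx.2.trans_lt hT⟩)

theorem SolData.continuousOn_rect' (h : SolData m r₁ t₁ v v1 v2 vt) {b t₀ T : ℝ} (ht₀ : 0 < t₀)
    (hb : b < r₁) (hT : T < t₁) :
    ContinuousOn (fun p : ℝ × ℝ => v p.1 p.2) (Icc 0 b ×ˢ Icc t₀ T) :=
  h.cont.mono (prod_mono (fun _ hx => ⟨hx.1, hx.2.trans_lt hb⟩)
    fun _ hx => ⟨ht₀.trans_le hx.1, hx.2.trans_lt hT⟩)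

/-- Solutions lie above slightly smaller cusps for a short time. -/
theorem SolData.lower_bound (h : SolData m r₁ t₁ v v1 v2 vt) (hm : 1 ≤ m) (hr₁ : 0 < r₁)
    (ht₁ : 0 < t₁) (hi : IsCuspInitial m (fun r => v r 0)) {δ : ℝ} (hδ : 0 < δ) (hδ1 : δ < 1) :
    ∃ R₀ ∈ Ioo 0 r₁, R₀ < 1 ∧ ∀ R ∈ Ioc 0 R₀, ∃ T ∈ Ioo 0 t₁, ∀ r ∈ Ioc 0 R, ∀ t ∈ Icc 0 T,
      (1 - δ) * (m / 4) * kap r ≤ v r t := by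
  obtain ⟨Ri, hRi, hRiv⟩ := hi (δ / 2) (by positivity)
  obtain ⟨Rk, hRk, hRkv⟩ := exists_kap_le (l := 1 / m) (by positivity)
  set R₀ := min (min Ri Rk) (r₁ / 2) with hR₀
  have hR₀0 : 0 < R₀ := lt_min (lt_min hRi hRk.1) (by positivity)
  have hR₀i : R₀ ≤ Ri := (min_le_left _ _).trans (min_le_left _ _)
  have hR₀k : R₀ ≤ Rk := (min_le_left _ _).trans (min_le_right _ _)
  have hR₀r : R₀ < r₁ := (min_le_right _ _).trans_lt (by linarith)
  have hR₀1 : R₀ < 1 := hR₀k.trans_lt hRk.2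
  refine ⟨R₀, ⟨hR₀0, hR₀r⟩, hR₀1, fun R hR => ?_⟩
  set c := (1 - δ) * (m / 4) with hc
  have hc0 : 0 < c := mul_pos (by linarith) (by positivity)
  have hcm : c ≤ m / 4 := by rw [hc]; nlinarith
  have hunit : ∀ r ∈ Ioc 0 R, r ∈ Ioo (0 : ℝ) 1 := fun r hr =>
    ⟨hr.1, (hr.2.trans hR.2).trans_lt hR₀1⟩
  have hinit : ∀ r ∈ Ioc 0 R, c * kap r < v r 0 := fun r hr => by
    have h1 := (hRiv r ⟨hr.1, (hr.2.trans hR.2).trans hR₀i⟩).1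
    refine lt_of_le_of_lt ?_ h1
    have := kap_pos (hunit r hr)
    gcongr
    rw [hc]; gcongr; linarith
  obtain ⟨T, hT, hTv⟩ := h.exists_time ht₁ (R := R) ⟨hR.1, hR.2.trans_lt hR₀r⟩
    (lo := c * kap R) (hi := v R 0 + 1) ⟨hinit R ⟨hR.1, le_rfl⟩, by linarith⟩
  refine ⟨T, hT, fun r hr t ht => ?_⟩
  refine le_of_forall_pos_le_add fun η hη => ?_
  -- Subtracting $\eta$ makes the stationary subsolution $c\kappa-\eta$ negative at $r=a$, where
  -- $v\ge0$ is all that is known. As $\eta$ is arbitrary nothing is lost.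
  obtain ⟨a, ha1, ha2, haI⟩ := ((tendsto_kap_zero.const_mul c).eventually
    (gt_mem_nhds (show c * 0 < η by simpa using hη)) |>.and
    ((Ioo_mem_nhdsGT hr.1 : ∀ᶠ a in 𝓝[>] (0:ℝ), a ∈ Ioo 0 r))).exists
  have hIcc : ∀ y ∈ Icc a R, y ∈ Ioc 0 R := fun y hy => ⟨ha2.trans_le hy.1, hy.2⟩
  have key := h.compare_strict (φ := fun r _ => c * kap r - η) (φr := fun r _ => c * kap r ^ 2 / r)
    (φrr := fun r _ => (2 * c * kap r ^ 3 - c * kap r ^ 2) / r ^ 2) (φt := fun _ _ => 0)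
    (s := -1) (a := a) (b := R) (t₀ := 0) (T := T) (by norm_num) ha2.le (hR.2.trans_lt hR₀r) le_rfl
    hT.2 (h.continuousOn_rect ha2 (hR.2.trans_lt hR₀r) hT.2) ?_ ?_ ?_ ?_ ?_ ?_ ?_
  · have := key r ⟨haI.le, hr.2⟩ t ht
    linarith
  · refine ((ContinuousOn.mul continuousOn_const ?_).sub continuousOn_const)
    refine ContinuousOn.comp (t := Ioo (0 : ℝ) 1) (g := kap) ?_ continuous_fst.continuousOn ?_
    · exact fun y hy => (hasDerivAt_kap hy).continuousAt.continuousWithinAt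
    · exact fun p hp => hunit _ (hIcc _ hp.1)
  · intro y hy
    have := hinit y (hIcc y hy)
    linarith
  · intro τ hτ
    have h1 := h.nonneg a ⟨ha2.le, (haI.trans_le hr.2).trans (hR.2.trans_lt hR₀r)⟩ τ
      ⟨hτ.1, hτ.2.trans_lt hT.2⟩
    have h2 := (hTv τ hτ).1
    constructor <;> linarith
  · intro y hy τ hτ
    refine (((hasDerivAt_kap (hunit y (hIcc y ⟨hy.1.le, hy.2.le⟩))).const_mul c).sub_const
      η).congr_deriv ?_
    ring
  · intro y hy τ hτ
    have hy0 : y ≠ 0 := (ha2.trans hy.1).ne'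
    refine ((((hasDerivAt_kap (hunit y (hIcc y ⟨hy.1.le, hy.2.le⟩))).fun_pow 2).const_mul c).fun_div
      (hasDerivAt_id y) hy0).congr_deriv ?_
    norm_num
    field_simp
  · intro y hy τ hτ
    exact hasDerivAt_const _ _
  · intro y hy τ hτ hφ0 _
    have hyI := hIcc y ⟨hy.1.le, hy.2.le⟩
    have hl0 := kap_pos (hunit y hyI)
    have hl1 : kap y ≤ 1 / m := hRkv y hyI.1 ((hyI.2.trans hR.2).trans hR₀k)
    rw [le_div_iff₀ (by positivity)] at hl1
    set l := kap y
    set w := c * l - η with hw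
    have hwl : w ≤ 1 / 4 := by
      have : c * l ≤ m / 4 * l := by gcongr
      rw [hw]; linarith
    have hlle : l ≤ 1 := by nlinarith
    have hcl : c * l ^ 2 ≤ m / 4 := by
      calc c * l ^ 2 ≤ m / 4 * 1 := by
            gcongr; exact pow_le_one₀ hl0.le hlle
        _ = _ := mul_one _
    have hy0 : 0 < y := hyI.1
    have e : w * ((2 * c * l ^ 3 - c * l ^ 2) / y ^ 2) - 1 / 2 * (c * l ^ 2 / y) ^ 2
        + (m - w) / y * (c * l ^ 2 / y) + 2 * m / y ^ 2 * (w * (1 - w)) =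
        1 / y ^ 2 * (2 * c * l ^ 3 * w + 2 * w * (m * (1 - w) - c * l ^ 2)
          + c * l ^ 2 * (m - c * l ^ 2 / 2)) := by field_simp; ring
    have p1 : 0 < 1 / y ^ 2 * (2 * c * l ^ 3 * w + 2 * w * (m * (1 - w) - c * l ^ 2)
          + c * l ^ 2 * (m - c * l ^ 2 / 2)) := by
      refine mul_pos (by positivity) ?_
      have q1 : 0 ≤ 2 * c * l ^ 3 * w := by positivity
      have q2 : 0 ≤ m * (1 - w) - c * l ^ 2 := by nlinarith
      have q3 : 0 < c * l ^ 2 * (m - c * l ^ 2 / 2) := mul_pos (by positivity) (by linarith)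
      have q4 := mul_nonneg (mul_nonneg zero_le_two hφ0) q2
      linarith
    rw [e]; linarith

end

/-! ### The tip of the solution. -/

section

open Set Filter Topology
open scoped ContDiff

variable {m r₁ t₁ : ℝ} {v v1 v2 vt : ℝ → ℝ → ℝ}

theorem tendsto_mul_log_zero : Tendsto (fun r : ℝ => r * -Real.log r) (𝓝[>] 0) (𝓝 0) := by
  have h := (Real.continuous_mul_log.tendsto 0).mono_left (nhdsWithin_le_nhds (s := Ioi 0))
  simp only [zero_mul] at h
  simpa using h.neg

/-- A solution above a cusp satisfies `v = 1` and `v_r = 0` at the tip. -/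
theorem SolData.tip (h : SolData m r₁ t₁ v v1 v2 vt) (hm : 1 ≤ m) (hr₁ : 0 < r₁) {t c R : ℝ}
    (ht : t ∈ Ioo 0 t₁) (hc : 0 < c) (hR : 0 < R) (hlow : ∀ r ∈ Ioc 0 R, c * kap r ≤ v r t) :
    v 0 t = 1 ∧ v1 0 t = 0 := by
  have h0 : (0 : ℝ) ∈ Ico 0 r₁ := ⟨le_rfl, hr₁⟩
  have hev : ∀ᶠ r in 𝓝[>] (0 : ℝ), r ∈ Ioo 0 r₁ := Ioo_mem_nhdsGT hr₁
  have hle : 𝓝[>] (0 : ℝ) ≤ 𝓝[Ico 0 r₁] 0 := by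
    rw [nhdsWithin_Ico_eq_nhdsGE hr₁]; exact nhdsWithin_mono _ Ioi_subset_Ici_self
  have tv : Tendsto (fun r => v r t) (𝓝[>] 0) (𝓝 (v 0 t)) :=
    (h.hasDerivWithinAt 0 h0 t ht).continuousWithinAt.tendsto.mono_left hle
  have tv1 : Tendsto (fun r => v1 r t) (𝓝[>] 0) (𝓝 (v1 0 t)) :=
    (h.hasDerivWithinAt_v1 0 h0 t ht).continuousWithinAt.tendsto.mono_left hle
  have hline : ContinuousWithinAt (fun r : ℝ => (r, t)) (Ico 0 r₁) 0 := by fun_prop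
  have hmaps : MapsTo (fun r : ℝ => (r, t)) (Ico 0 r₁) (Ico 0 r₁ ×ˢ Ioo 0 t₁) := fun r hr => ⟨hr, ht⟩
  have tv2 : Tendsto (fun r => v2 r t) (𝓝[>] 0) (𝓝 (v2 0 t)) :=
    (ContinuousWithinAt.comp (f := fun r : ℝ => (r, t)) (x := 0) (h.cont_v2 (0, t) ⟨h0, ht⟩) hline hmaps).tendsto.mono_left hle
  have tvt : Tendsto (fun r => vt r t) (𝓝[>] 0) (𝓝 (vt 0 t)) :=
    (ContinuousWithinAt.comp (f := fun r : ℝ => (r, t)) (x := 0) (h.cont_vt (0, t) ⟨h0, ht⟩) hline hmaps).tendsto.mono_left hle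
  have tr : Tendsto (fun r : ℝ => r) (𝓝[>] 0) (𝓝 0) := nhdsWithin_le_nhds
  have tq : Tendsto (fun r => (v r t - v 0 t) / r) (𝓝[>] 0) (𝓝 (v1 0 t)) := by
    have := hasDerivWithinAt_iff_tendsto_slope.1 (h.hasDerivWithinAt 0 h0 t ht)
    have h2 : Tendsto (slope (fun x => v x t) 0) (𝓝[>] 0) (𝓝 (v1 0 t)) := by
      refine this.mono_left (le_inf (nhdsWithin_le_nhds) (le_principal_iff.2 ?_))
      filter_upwards [Ioo_mem_nhdsGT hr₁] with r hr
      exact ⟨⟨hr.1.le, hr.2⟩, hr.1.ne'⟩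
    refine h2.congr fun r => ?_
    rw [slope_def_field, sub_zero]
  -- Multiply the equation by $r^2$ and let $r\to0$.
  have hprod : 2 * m * (v 0 t * (1 - v 0 t)) = 0 := by
    have l1 : Tendsto (fun r => 2 * m * (v r t * (1 - v r t))) (𝓝[>] 0)
        (𝓝 (2 * m * (v 0 t * (1 - v 0 t)))) := (tv.mul (tv.const_sub 1)).const_mul _
    have l2 : Tendsto (fun r => r ^ 2 * vt r t - r ^ 2 * (v r t * v2 r t)
        + 1 / 2 * (r ^ 2 * v1 r t ^ 2) - r * ((m - v r t) * v1 r t)) (𝓝[>] 0)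
        (𝓝 (0 ^ 2 * vt 0 t - 0 ^ 2 * (v 0 t * v2 0 t)
        + 1 / 2 * (0 ^ 2 * v1 0 t ^ 2) - 0 * ((m - v 0 t) * v1 0 t))) :=
      ((((tr.pow 2).mul tvt).sub ((tr.pow 2).mul (tv.mul tv2))).add
        (((tr.pow 2).mul (tv1.pow 2)).const_mul _)).sub (tr.mul ((tv.const_sub m).mul tv1))
    have l3 := l2.congr' (f₂ := fun r => 2 * m * (v r t * (1 - v r t))) (by
      filter_upwards [hev] with r hr
      have := hr.1.ne'
      rw [h.pde r hr t ht]; field_simp; ring)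
    rw [tendsto_nhds_unique l1 l3]; ring
  -- If $v$ vanished at the tip, differentiability would give $v=O(r)$, contradicting $v\ge c/(-\log
  -- r)$.
  have hne : v 0 t ≠ 0 := by
    intro hz
    rw [hz] at tq
    have b1 := tq.eventually (gt_mem_nhds (show v1 0 t < |v1 0 t| + 1 by
      linarith [le_abs_self (v1 0 t)]))
    have b2 := (tendsto_mul_log_zero.const_mul (|v1 0 t| + 1)).eventually
      (gt_mem_nhds (show (|v1 0 t| + 1) * 0 < c by simpa using hc))
    obtain ⟨r, ⟨⟨c1, c2⟩, c3⟩, c4⟩ := (((b1.and b2).and (Ioo_mem_nhdsGT hR)).and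
      (Ioo_mem_nhdsGT one_pos)).exists
    have hl := hlow r ⟨c3.1, c3.2.le⟩
    have hlp := neg_log_pos c4
    have hr0 := c3.1
    rw [sub_zero, div_lt_iff₀ hr0] at c1
    rw [kap, mul_one_div, div_le_iff₀ hlp] at hl
    have : v r t * -Real.log r < (|v1 0 t| + 1) * r * -Real.log r := by gcongr
    linarith
  have h1 : v 0 t = 1 := by
    rcases mul_eq_zero.1 hprod with h2 | h2
    · linarith
    · rcases mul_eq_zero.1 h2 with h3 | h3
      · exact absurd h3 hne
      · linarith
  refine ⟨h1, ?_⟩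
  rw [h1] at tq tv
  -- With $v=1$ at the tip, multiplying the equation by $r$ gives $(m-1)v_r-2mv_r=0$ there.
  have l1 : Tendsto (fun r => (m - v r t) * v1 r t - 2 * m * (v r t * ((v r t - 1) / r))) (𝓝[>] 0)
      (𝓝 ((m - 1) * v1 0 t - 2 * m * (1 * v1 0 t))) :=
    ((tv.const_sub m).mul tv1).sub ((tv.mul tq).const_mul _)
  have l2 : Tendsto (fun r => r * vt r t - r * (v r t * v2 r t) + 1 / 2 * (r * v1 r t ^ 2)) (𝓝[>] 0)
      (𝓝 (0 * vt 0 t - 0 * (1 * v2 0 t) + 1 / 2 * (0 * v1 0 t ^ 2))) :=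
    ((tr.mul tvt).sub (tr.mul (tv.mul tv2))).add ((tr.mul (tv1.pow 2)).const_mul _)
  have l3 := l2.congr' (f₂ := fun r => (m - v r t) * v1 r t
      - 2 * m * (v r t * ((v r t - 1) / r))) (by
    filter_upwards [hev] with r hr
    have := hr.1.ne'
    rw [h.pde r hr t ht]; field_simp; ring)
  have := tendsto_nhds_unique l1 l3
  have h4 : (m + 1) * v1 0 t = 0 := by linarith
  exact (mul_eq_zero.1 h4).resolve_left (by positivity)

/-- Uniform Taylor bounds at the tip on compact time intervals. -/
theorem SolData.exists_taylor_bound (h : SolData m r₁ t₁ v v1 v2 vt) {R t₀ T : ℝ}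
    (hR : R < r₁) (ht₀ : 0 < t₀) (hT : T < t₁)
    (htip : ∀ t ∈ Icc t₀ T, v 0 t = 1 ∧ v1 0 t = 0) :
    ∃ K ≥ 0, ∀ r ∈ Icc 0 R, ∀ t ∈ Icc t₀ T, |v2 r t| ≤ K ∧ |v1 r t| ≤ K * r ∧
      |v r t - 1| ≤ K * r ^ 2 := by
  have hsub : Icc 0 R ⊆ Ico 0 r₁ := fun x hx => ⟨hx.1, hx.2.trans_lt hR⟩
  have htsub : Icc t₀ T ⊆ Ioo 0 t₁ := fun x hx => ⟨ht₀.trans_le hx.1, hx.2.trans_lt hT⟩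
  obtain ⟨K, hK⟩ := ((isCompact_Icc (a := (0 : ℝ)) (b := R)).prod
    (isCompact_Icc (a := t₀) (b := T))).exists_bound_of_continuousOn
    (h.cont_v2.mono (prod_mono hsub htsub))
  refine ⟨|K|, abs_nonneg K, fun r hr t ht => ?_⟩
  have hK' : ∀ y ∈ Icc 0 r, |v2 y t| ≤ |K| := fun y hy =>
    (hK (y, t) ⟨⟨hy.1, hy.2.trans hr.2⟩, ht⟩).trans (le_abs_self K)
  have hsubr : Icc 0 r ⊆ Ico 0 r₁ := (Icc_subset_Icc_right hr.2).trans hsub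
  have b1 : ∀ y ∈ Icc 0 r, |v1 y t| ≤ |K| * y := fun y hy => by
    have := (convex_Icc 0 r).norm_image_sub_le_of_norm_hasDerivWithin_le
      (f := fun x => v1 x t) (f' := fun x => v2 x t) (C := |K|) (x := 0) (y := y)
      (fun x hx => (h.hasDerivWithinAt_v1 x (hsubr hx) t (htsub ht)).mono hsubr) hK'
      ⟨le_rfl, hr.1⟩ hy
    simpa [(htip t ht).2, abs_of_nonneg hy.1] using this
  refine ⟨hK' r ⟨hr.1, le_rfl⟩, b1 r ⟨hr.1, le_rfl⟩, ?_⟩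
  have := (convex_Icc 0 r).norm_image_sub_le_of_norm_hasDerivWithin_le
      (f := fun x => v x t) (f' := fun x => v1 x t) (C := |K| * r) (x := 0) (y := r)
      (fun x hx => (h.hasDerivWithinAt x (hsubr hx) t (htsub ht)).mono hsubr)
      (fun x hx => (b1 x hx).trans (by have := hx.2; gcongr)) ⟨le_rfl, hr.1⟩ ⟨hr.1, le_rfl⟩
  simp only [(htip t ht).1, Real.norm_eq_abs, sub_zero, abs_of_nonneg hr.1] at this
  linarith

end

/-! ### Upper bounds near the corner. -/

section

open Set Filter Topology
open scoped ContDiff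

variable {m r₁ t₁ : ℝ} {v v1 v2 vt : ℝ → ℝ → ℝ}

/-- Solutions are dominated by self-similar expanding cones. -/
theorem SolData.le_one_add_sq_div (h : SolData m r₁ t₁ v v1 v2 vt) (hm : 1 ≤ m) {R T : ℝ}
    (hR : R ∈ Ioo 0 r₁) (hT : T < t₁) (htip : ∀ t ∈ Ioc 0 T, v 0 t = 1 ∧ v1 0 t = 0)
    (hlat : ∀ t ∈ Icc 0 T, v R t < 1) :
    ∀ r ∈ Icc 0 R, ∀ t ∈ Ioc 0 T, v r t ≤ 1 + r ^ 2 / t := by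
  intro r hr t ht
  -- Delaying the cone by $s$ and raising it by $s$ gives a strict supersolution that can be started
  -- at a positive time; then $s\to0$.
  have hlim : Tendsto (fun s => 1 + s + r ^ 2 / (t - s)) (𝓝[>] 0) (𝓝 (1 + 0 + r ^ 2 / (t - 0))) := by
    have hc : ContinuousAt (fun s => 1 + s + r ^ 2 / (t - s)) 0 :=
      (by fun_prop : ContinuousAt (fun s : ℝ => 1 + s) 0).add
        (continuousAt_const.div (by fun_prop) (by simpa using ht.1.ne'))
    exact hc.tendsto.mono_left nhdsWithin_le_nhds
  rw [add_zero, sub_zero] at hlim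
  refine ge_of_tendsto hlim ?_
  filter_upwards [Ioo_mem_nhdsGT ht.1] with s hs
  obtain ⟨K, hK0, hK⟩ := h.exists_taylor_bound hR.2 hs.1 hT
    fun τ hτ => htip τ ⟨hs.1.trans_le hτ.1, hτ.2⟩
  -- At time $s+e$ the barrier opens like $r^2/e$ with $1/e>K$, which beats the Taylor bound
  -- $v\le1+Kr^2$.
  set e := min (t - s) (1 / (K + 1)) with he
  have he0 : 0 < e := lt_min (by linarith [hs.2]) (by positivity)
  have het : s + e ≤ t := by linarith [min_le_left (t - s) (1 / (K + 1))]
  have heK : K * e < 1 := by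
    have h1 : e ≤ 1 / (K + 1) := min_le_right _ _
    rw [le_div_iff₀ (by positivity)] at h1
    nlinarith
  have key := h.compare_strict (φ := fun r t => 1 + s + r ^ 2 / (t - s))
    (φr := fun r t => 2 * r / (t - s)) (φrr := fun _ t => 2 / (t - s))
    (φt := fun r t => -(r ^ 2 / (t - s) ^ 2)) (s := 1) (a := 0) (b := R) (t₀ := s + e) (T := T)
    (by norm_num) le_rfl hR.2 (by linarith [hs.1]) hT
    (h.continuousOn_rect' (by linarith [hs.1]) hR.2 hT) ?_ ?_ ?_ ?_ ?_ ?_ ?_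
  · have := key r hr t ⟨het, ht.2⟩
    linarith
  · refine continuousOn_const.add (ContinuousOn.div (by fun_prop) (by fun_prop) ?_)
    rintro ⟨y, τ⟩ ⟨-, hτ⟩
    have := hτ.1
    simp only at this ⊢
    linarith
  · intro y hy
    have h1 := (abs_le.1 (hK y hy (s + e) ⟨by linarith, het.trans ht.2⟩).2.2).2
    have h2 : K * y ^ 2 ≤ y ^ 2 / (s + e - s) := by
      rw [add_sub_cancel_left, le_div_iff₀ he0]
      nlinarith [sq_nonneg y]
    have := hs.1
    linarith
  · intro τ hτ
    have h0 : 0 < τ := by linarith [hs.1, hτ.1]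
    have h1 : 0 ≤ R ^ 2 / (τ - s) := div_nonneg (sq_nonneg _) (by linarith [hτ.1])
    have h2 := hlat τ ⟨h0.le, hτ.2⟩
    have h3 := (htip τ ⟨h0, hτ.2⟩).1
    have := hs.1
    constructor
    · rw [h3]; simp; linarith
    · linarith
  · intro y hy τ hτ
    refine (((hasDerivAt_pow 2 y).div_const (τ - s)).const_add (1 + s)).congr_deriv ?_
    norm_num
  · intro y hy τ hτ
    refine (((hasDerivAt_id y).const_mul 2).div_const (τ - s)).congr_deriv ?_
    norm_num
  · intro y hy τ hτ
    have : τ - s ≠ 0 := by have := hτ.1; linarith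
    refine (((hasDerivAt_const τ (y ^ 2)).fun_div ((hasDerivAt_id τ).sub_const s) this).const_add
      (1 + s)).congr_deriv ?_
    simp only [id]; ring
  · intro y hy τ hτ _ _
    have hz : 0 < τ - s := by have := hτ.1; linarith
    have hy0 : 0 < y := hy.1
    set z := τ - s
    set P := y ^ 2 / z with hP
    have hP0 : 0 < P := by positivity
    have e1 : (1 + s + P) * (2 / z) - 1 / 2 * (2 * y / z) ^ 2 + (m - (1 + s + P)) / y * (2 * y / z)
        + 2 * m / y ^ 2 * ((1 + s + P) * (1 - (1 + s + P))) =
        1 / y ^ 2 * (2 * m * P - 2 * P ^ 2 - 2 * m * ((1 + s + P) * (s + P))) := by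
      have : y ^ 2 = P * z := by rw [hP]; field_simp
      have h2 : z = y ^ 2 / P := by rw [hP]; field_simp
      rw [h2]; field_simp; ring
    have e2 : -(y ^ 2 / z ^ 2) = 1 / y ^ 2 * (-P ^ 2) := by
      rw [hP]; field_simp
    rw [e1, e2, one_mul, one_mul]
    refine mul_lt_mul_of_pos_left ?_ (by positivity)
    have hs0 := hs.1
    have q1 : P + P ^ 2 ≤ (1 + s + P) * (s + P) := by nlinarith
    have q2 : m * (P + P ^ 2) ≤ m * ((1 + s + P) * (s + P)) := by gcongr
    have q3 : 0 < P ^ 2 := by positivity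
    have q4 : P ^ 2 ≤ m * P ^ 2 := le_mul_of_one_le_left q3.le hm
    nlinarith

/-- A strict inequality at time zero, uniform on a compact interval, persists for a short time. -/
theorem exists_time_uniform {G : ℝ → ℝ → ℝ} {a b T : ℝ} (hab : a ≤ b) (hT : 0 < T)
    (hc : ContinuousOn (fun p : ℝ × ℝ => G p.1 p.2) (Icc a b ×ˢ Icc 0 T))
    (h0 : ∀ r ∈ Icc a b, G r 0 < 0) : ∃ τ ∈ Ioc 0 T, ∀ r ∈ Icc a b, ∀ t ∈ Icc 0 τ, G r t < 0 := by
  -- Clamping both arguments to the rectangle extends `G` continuously to the plane, so that full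
  -- neighbourhoods of $t=0$ can be used.
  have hc' : Continuous fun p : ℝ × ℝ => G (max a (min p.2 b)) (max 0 (min p.1 T)) :=
    hc.comp_continuous (f := fun p : ℝ × ℝ => (max a (min p.2 b), max 0 (min p.1 T))) (by fun_prop)
      fun p => ⟨⟨le_max_left _ _, max_le hab (min_le_right _ _)⟩,
        ⟨le_max_left _ _, max_le hT.le (min_le_right _ _)⟩⟩
  have hev : ∀ᶠ t in 𝓝 (0 : ℝ), ∀ r ∈ Icc a b, G (max a (min r b)) (max 0 (min t T)) < 0 := by
    refine isCompact_Icc.eventually_forall_of_forall_eventually fun r hr => ?_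
    refine hc'.continuousAt.eventually_lt_const ?_
    simp only [min_eq_left hr.2, max_eq_right hr.1, min_eq_left hT.le, max_self]
    exact h0 r hr
  obtain ⟨e, he, hball⟩ := Metric.eventually_nhds_iff.1 hev
  refine ⟨min (e / 2) T, ⟨by positivity, min_le_right _ _⟩, fun r hr t ht => ?_⟩
  have h1 := ht.2.trans (min_le_left _ _)
  have := hball (y := t) (by rw [Real.dist_eq, sub_zero, abs_of_nonneg ht.1]; linarith) r hr
  rwa [min_eq_left hr.2, max_eq_right hr.1, min_eq_left (ht.2.trans (min_le_right _ _)),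
    max_eq_right ht.1] at this

/-- Near the corner bounded solutions are below every downward parabola `1 - b r²`. -/
theorem SolData.le_one_sub_mul_sq (h : SolData m r₁ t₁ v v1 v2 vt) (hm : 1 ≤ m) {R T M : ℝ}
    (hR : R ∈ Ioo 0 r₁) (hT : T ∈ Ioo 0 t₁) (hi : IsCuspInitial m (fun r => v r 0))
    (hM : ∀ r ∈ Ioc 0 R, ∀ t ∈ Icc 0 T, v r t ≤ M) {b : ℝ} (hb : 0 < b) :
    ∃ Rb ∈ Ioc 0 R, ∃ Tb ∈ Ioc 0 T, ∀ r ∈ Ioc 0 Rb, ∀ t ∈ Icc 0 Tb, v r t ≤ 1 - b * r ^ 2 := by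
  obtain ⟨Ri, hRi, hRiv⟩ := hi 1 one_pos
  have hev : ∀ᶠ r in 𝓝[>] (0 : ℝ), (∀ y ∈ Ioc 0 r, v y 0 < 1 / 2) ∧
      (∀ y ∈ Ioc 0 r, 1 ≤ -Real.log y ∧ b * y ^ 2 * (2 * -Real.log y) ≤ 1 ∧ b * y ^ 2 ≤ 1 / 2) ∧
      r < R := by
    have k1 : ∀ᶠ r in 𝓝[>] (0 : ℝ), 2 * (m / 4) * kap r < 1 / 2 :=
      (tendsto_kap_zero.const_mul (2 * (m / 4))).eventually (gt_mem_nhds (by norm_num))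
    have k2 : ∀ᶠ r in 𝓝[>] (0 : ℝ), (2 * b) * (r * -Real.log r) < 1 :=
      (tendsto_mul_log_zero.const_mul (2 * b)).eventually (gt_mem_nhds (by norm_num))
    have k3 : ∀ᶠ r in 𝓝[>] (0 : ℝ), kap r < 1 := tendsto_kap_zero.eventually (gt_mem_nhds one_pos)
    have tr : Tendsto (fun r : ℝ => r) (𝓝[>] 0) (𝓝 0) := nhdsWithin_le_nhds
    have k4 : ∀ᶠ r in 𝓝[>] (0 : ℝ), b * r ^ 2 < 1 / 2 :=
      ((tr.pow 2).const_mul b).eventually (gt_mem_nhds (by norm_num))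
    obtain ⟨e, he, hsub⟩ := mem_nhdsGT_iff_exists_Ioo_subset.1
      ((((k1.and k2).and k3).and k4).and (Ioo_mem_nhdsGT (lt_min hRi one_pos)))
    filter_upwards [Ioo_mem_nhdsGT (lt_min (mem_Ioi.1 he) hR.1)] with r hr
    have hin : ∀ y ∈ Ioc 0 r, y ∈ Ioo 0 e := fun y hy =>
      ⟨hy.1, hy.2.trans_lt (hr.2.trans_le (min_le_left _ _))⟩
    refine ⟨fun y hy => ?_, fun y hy => ?_, hr.2.trans_le (min_le_right _ _)⟩
    · obtain ⟨⟨⟨⟨h1, -⟩, -⟩, -⟩, h5⟩ := hsub (hin y hy)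
      have := (hRiv y ⟨hy.1, h5.2.le.trans (min_le_left _ _)⟩).2
      linarith
    · obtain ⟨⟨⟨⟨-, h2⟩, h3⟩, h4⟩, h5⟩ := hsub (hin y hy)
      have hy1 : y < 1 := h5.2.trans_le (min_le_right _ _)
      have hlp := neg_log_pos ⟨hy.1, hy1⟩
      refine ⟨?_, ?_, h4.le⟩
      · rw [kap, div_lt_one hlp] at h3; exact h3.le
      · have : b * y ^ 2 * (2 * -Real.log y) = y * ((2 * b) * (y * -Real.log y)) := by ring
        rw [this]
        have h6 : 0 ≤ (2 * b) * (y * -Real.log y) := by have := hy.1; positivity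
        nlinarith [hy.1]
  obtain ⟨Rb, ⟨hinit, hlog, hRbR⟩, hRb0⟩ := (hev.and self_mem_nhdsWithin).exists
  have hRb0 : 0 < Rb := hRb0
  have hRbr : Rb < r₁ := hRbR.trans hR.2
  have hv0 : v Rb 0 < 1 / 2 := hinit Rb ⟨hRb0, le_rfl⟩
  obtain ⟨T', hT', hT'v⟩ := h.exists_time (hT.1.trans hT.2) (R := Rb) ⟨hRb0, hRbr⟩ (lo := v Rb 0 - 1)
    (hi := 1 / 2) ⟨by linarith, hv0⟩
  refine ⟨Rb, ⟨hRb0, hRbR.le⟩, min T T', ⟨lt_min hT.1 hT'.1, min_le_left _ _⟩, fun r hr t ht => ?_⟩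
  have htT : min T T' < t₁ := (min_le_left _ _).trans_lt hT.2
  -- The stationary strict supersolution $1-br^2+2\eta(-\log r)$ blows up at the origin and so
  -- exceeds the bound $M$ at some small $a$. No information at the tip is needed, and $\eta\to0$ at
  -- the end.
  have hlim : Tendsto (fun η : ℝ => 1 - b * r ^ 2 + η * (2 * -Real.log r)) (𝓝[>] 0)
      (𝓝 (1 - b * r ^ 2 + 0 * (2 * -Real.log r))) :=
    ((by fun_prop : Continuous fun η : ℝ => 1 - b * r ^ 2 + η * (2 * -Real.log r)).tendsto
      0).mono_left nhdsWithin_le_nhds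
  rw [zero_mul, add_zero] at hlim
  refine ge_of_tendsto hlim ?_
  filter_upwards [self_mem_nhdsWithin] with η hη
  have hη : 0 < η := hη
  obtain ⟨a, ha1, ha2⟩ : ∃ a ∈ Ioo 0 r, M < η * (2 * -Real.log a) := by
    have : Tendsto (fun a => η * (2 * -Real.log a)) (𝓝[>] 0) atTop :=
      ((tendsto_neg_atBot_atTop.comp Real.tendsto_log_nhdsGT_zero).const_mul_atTop
        (zero_lt_two)).const_mul_atTop hη
    obtain ⟨a, h1, h2⟩ := ((this.eventually_gt_atTop M).and (Ioo_mem_nhdsGT hr.1)).exists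
    exact ⟨a, h2, h1⟩
  have hIcc : ∀ y ∈ Icc a Rb, y ∈ Ioc 0 Rb := fun y hy => ⟨ha1.1.trans_le hy.1, hy.2⟩
  have hlow : ∀ y ∈ Icc a Rb, 1 / 2 ≤ 1 - b * y ^ 2 + η * (2 * -Real.log y) ∧
      η * (2 * -Real.log y) ≤ 1 - b * y ^ 2 + η * (2 * -Real.log y) := fun y hy => by
    obtain ⟨k1, k2, k3⟩ := hlog y (hIcc y hy)
    have : 0 ≤ η * (2 * -Real.log y) := mul_nonneg hη.le (by linarith)
    constructor <;> linarith
  have key := h.compare_strict (φ := fun r _ => 1 - b * r ^ 2 + η * (2 * -Real.log r))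
    (φr := fun r _ => -(2 * b * r) - 2 * η / r) (φrr := fun r _ => -(2 * b) + 2 * η / r ^ 2)
    (φt := fun _ _ => 0) (s := 1) (a := a) (b := Rb) (t₀ := 0) (T := min T T')
    (by norm_num) ha1.1.le hRbr le_rfl htT (h.continuousOn_rect ha1.1 hRbr htT) ?_ ?_ ?_ ?_ ?_ ?_ ?_
  · have := key r ⟨ha1.2.le, hr.2⟩ t ht
    linarith
  · have : ∀ p ∈ Icc a Rb ×ˢ Icc 0 (min T T'), p.1 ≠ 0 := fun p hp => (hIcc _ hp.1).1.ne'
    exact (continuousOn_const.sub (continuousOn_const.mul (continuousOn_fst.pow 2))).add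
      (continuousOn_const.mul (continuousOn_const.mul (continuousOn_fst.log this).neg))
  · intro y hy
    have h1 := hinit y (hIcc y hy)
    have h2 := (hlow y hy).1
    linarith
  · intro τ hτ
    have h1 := hM a ⟨ha1.1, (ha1.2.le.trans hr.2).trans hRbR.le⟩ τ ⟨hτ.1, hτ.2.trans (min_le_left _ _)⟩
    have h2 := (hlow a ⟨le_rfl, (ha1.2.le.trans hr.2)⟩).2
    have h3 := (hT'v τ ⟨hτ.1, hτ.2.trans (min_le_right _ _)⟩).2
    have h4 := (hlow Rb ⟨(ha1.2.le.trans hr.2), le_rfl⟩).1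
    constructor <;> linarith
  · intro y hy τ hτ
    have hy0 : y ≠ 0 := (ha1.1.trans hy.1).ne'
    refine ((((hasDerivAt_pow 2 y).const_mul b).const_sub 1).fun_add
      (((Real.hasDerivAt_log hy0).fun_neg.const_mul 2).const_mul η)).congr_deriv ?_
    norm_num; field_simp; ring
  · intro y hy τ hτ
    have hy0 : y ≠ 0 := (ha1.1.trans hy.1).ne'
    refine ((((hasDerivAt_id y).const_mul (2 * b)).fun_neg).fun_sub
      ((hasDerivAt_const y (2 * η)).fun_div (hasDerivAt_id y) hy0)).congr_deriv ?_
    simp only [id]; field_simp; ring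
  · intro y hy τ hτ
    exact hasDerivAt_const _ _
  · intro y hy τ hτ hφ0 _
    have hyI := hIcc y ⟨hy.1.le, hy.2.le⟩
    obtain ⟨k1, k2, k3⟩ := hlog y hyI
    have hy0 : 0 < y := hyI.1
    set L := 2 * -Real.log y with hL
    set w := 1 - b * y ^ 2 + η * L with hw
    have e : w * (-(2 * b) + 2 * η / y ^ 2) - 1 / 2 * (-(2 * b * y) - 2 * η / y) ^ 2
        + (m - w) / y * (-(2 * b * y) - 2 * η / y) + 2 * m / y ^ 2 * (w * (1 - w)) =
        1 / y ^ 2 * (w * (η * (4 - 2 * m * L)) - 2 * (b * y ^ 2 + η) ^ 2 - 2 * m * (b * y ^ 2) ^ 2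
          + 2 * m * η * (b * y ^ 2 * L - 1)) := by
      have e1 : w * (-(2 * b) + 2 * η / y ^ 2) - 1 / 2 * (-(2 * b * y) - 2 * η / y) ^ 2
        + (m - w) / y * (-(2 * b * y) - 2 * η / y) + 2 * m / y ^ 2 * (w * (1 - w)) =
        1 / y ^ 2 * (4 * η * w - 2 * (b * y ^ 2 + η) ^ 2 - 2 * m * (b * y ^ 2 + η)
          + 2 * m * (w * (1 - w))) := by field_simp; ring
      rw [e1, hw]; ring
    rw [e, one_mul, mul_zero]
    refine mul_neg_of_pos_of_neg (by positivity) ?_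
    have p1 : w * (η * (4 - 2 * m * L)) ≤ 0 := by
      refine mul_nonpos_of_nonneg_of_nonpos hφ0 (mul_nonpos_of_nonneg_of_nonpos hη.le ?_)
      nlinarith
    have p2 : 0 < (b * y ^ 2 + η) ^ 2 := by positivity
    have p3 : 0 ≤ m * (b * y ^ 2) ^ 2 := by positivity
    have p4 : m * η * (b * y ^ 2 * L - 1) ≤ 0 :=
      mul_nonpos_of_nonneg_of_nonpos (by positivity) (by linarith)
    linarith

end

section

open Set Filter Topology
open scoped ContDiff

variable {m r₁ t₁ : ℝ} {v v1 v2 vt : ℝ → ℝ → ℝ}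

/-! ### A front barrier -/

/-- `g(y) = y + √(1 + y²)`. -/
def hypG (y : ℝ) : ℝ := y + Real.sqrt (1 + y ^ 2)

theorem one_le_sqrt_one_add_sq (y : ℝ) : 1 ≤ Real.sqrt (1 + y ^ 2) :=
  Real.one_le_sqrt.2 (by linarith [sq_nonneg y])

theorem sq_sqrt_one_add_sq (y : ℝ) : Real.sqrt (1 + y ^ 2) ^ 2 = 1 + y ^ 2 :=
  Real.sq_sqrt (by positivity)

theorem abs_lt_sqrt_one_add_sq (y : ℝ) : |y| < Real.sqrt (1 + y ^ 2) :=
  (Real.lt_sqrt (abs_nonneg y)).2 (by rw [sq_abs]; linarith)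

theorem hypG_pos (y : ℝ) : 0 < hypG y := by
  have := (abs_lt.1 (abs_lt_sqrt_one_add_sq y)).1
  rw [hypG]; linarith

theorem hasDerivAt_sqrt_one_add_sq (y : ℝ) :
    HasDerivAt (fun y => Real.sqrt (1 + y ^ 2)) (y / Real.sqrt (1 + y ^ 2)) y := by
  refine (((hasDerivAt_pow 2 y).const_add 1).sqrt (by positivity)).congr_deriv ?_
  have := one_le_sqrt_one_add_sq y
  norm_num; field_simp

theorem hasDerivAt_hypG (y : ℝ) : HasDerivAt hypG (hypG y / Real.sqrt (1 + y ^ 2)) y := by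
  refine ((hasDerivAt_id y).fun_add (hasDerivAt_sqrt_one_add_sq y)).congr_deriv ?_
  have := one_le_sqrt_one_add_sq y
  rw [hypG]; field_simp; ring

/-- The profile `1 + g(y)²` of the front barrier and its derivatives. -/
theorem hasDerivAt_front (y : ℝ) : HasDerivAt (fun y => 1 + hypG y ^ 2)
    (2 * hypG y ^ 2 / Real.sqrt (1 + y ^ 2)) y := by
  refine (((hasDerivAt_hypG y).fun_pow 2).const_add 1).congr_deriv ?_
  norm_num; ring

theorem hasDerivAt_front' (y : ℝ) : HasDerivAt (fun y => 2 * hypG y ^ 2 / Real.sqrt (1 + y ^ 2))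
    (4 * hypG y ^ 2 / Real.sqrt (1 + y ^ 2) ^ 2 - 2 * hypG y ^ 2 * y / Real.sqrt (1 + y ^ 2) ^ 3)
    y := by
  have := one_le_sqrt_one_add_sq y
  refine ((((hasDerivAt_hypG y).fun_pow 2).const_mul 2).fun_div (hasDerivAt_sqrt_one_add_sq y)
    (by linarith)).congr_deriv ?_
  norm_num; field_simp; ring

/-- For this $g$ one has $1+g^2=2gR$ and $g(R-y)=1$, which collapse the second order part of the
operator to $6g^2/R^2$. That is small enough to be beaten by the motion of the front. -/
theorem front_identity {y g R : ℝ} (hR : 1 ≤ R) (hR2 : R ^ 2 = 1 + y ^ 2) (hg : g = y + R) :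
    (1 + g ^ 2) * (4 * g ^ 2 / R ^ 2 - 2 * g ^ 2 * y / R ^ 3) - 1 / 2 * (2 * g ^ 2 / R) ^ 2
      = 6 * g ^ 2 / R ^ 2 := by
  have e1 : 1 + g ^ 2 = 2 * g * R := by rw [hg]; linear_combination (-1) * hR2
  have e2 : g * (R - y) = 1 := by rw [hg]; linear_combination hR2
  rw [e1]
  field_simp
  linear_combination (6 * g ^ 2) * e2 + (-2) * g ^ 3 * hg

/-- The rescaled time variable `μ = (t / q₀)^{1/4}`. -/
def frontMu (q₀ t : ℝ) : ℝ := Real.sqrt (Real.sqrt (t / q₀))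

theorem frontMu_pow_four {q₀ t : ℝ} (hq : 0 < q₀) (ht : 0 < t) : frontMu q₀ t ^ 4 = t / q₀ := by
  have : frontMu q₀ t ^ 4 = (frontMu q₀ t ^ 2) ^ 2 := by ring
  rw [this, frontMu, Real.sq_sqrt (Real.sqrt_nonneg _), Real.sq_sqrt (by positivity)]

theorem frontMu_pos {q₀ t : ℝ} (hq : 0 < q₀) (ht : 0 < t) : 0 < frontMu q₀ t :=
  Real.sqrt_pos.2 (Real.sqrt_pos.2 (by positivity))

theorem frontMu_le_one {q₀ t : ℝ} (hq : 0 < q₀) (ht : t ≤ q₀) : frontMu q₀ t ≤ 1 := by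
  have h1 : t / q₀ ≤ 1 := (div_le_one hq).2 ht
  have h2 : Real.sqrt (t / q₀) ≤ 1 := Real.sqrt_le_iff.2 ⟨zero_le_one, by rwa [one_pow]⟩
  exact Real.sqrt_le_iff.2 ⟨zero_le_one, by rwa [one_pow]⟩

theorem hasDerivAt_frontMu {q₀ t : ℝ} (hq : 0 < q₀) (ht : 0 < t) :
    HasDerivAt (frontMu q₀) (frontMu q₀ t / (4 * t)) t := by
  have h0 : 0 < t / q₀ := by positivity
  have h1 := Real.sqrt_pos.2 h0
  refine ((((hasDerivAt_id t).div_const q₀).sqrt (by simpa using h0.ne')).sqrt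
    (by simpa using h1.ne')).congr_deriv ?_
  have h4 := frontMu_pow_four hq ht
  have hμ := frontMu_pos hq ht
  have h2 : Real.sqrt (t / q₀) = frontMu q₀ t ^ 2 := by
    rw [frontMu, Real.sq_sqrt h1.le]
  have h3 : Real.sqrt (Real.sqrt (t / q₀)) = frontMu q₀ t := rfl
  simp only [id]
  rw [h3, h2]
  have h5 : t = q₀ * frontMu q₀ t ^ 4 := by rw [h4]; field_simp
  set μ := frontMu q₀ t
  rw [h5]
  field_simp
  norm_num

/-- The similarity variable of the front barrier. -/
def frontY (q₀ r t : ℝ) : ℝ :=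
  (q₀ * (1 + 400000 * frontMu q₀ t) - r ^ 2) / (200 * q₀ * frontMu q₀ t ^ 3)

theorem hasDerivAt_frontY {q₀ r t : ℝ} :
    HasDerivAt (fun r => frontY q₀ r t) (-(2 * r) / (200 * q₀ * frontMu q₀ t ^ 3)) r := by
  refine (((hasDerivAt_pow 2 r).const_sub _).div_const _).congr_deriv ?_
  norm_num

theorem hasDerivAt_frontY_time {q₀ r t : ℝ} (hq : 0 < q₀) (ht : 0 < t) :
    HasDerivAt (fun t => frontY q₀ r t) ((2000 - 3 * frontY q₀ r t * frontMu q₀ t ^ 2)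
      / (4 * q₀ * frontMu q₀ t ^ 6)) t := by
  have hμ := frontMu_pos hq ht
  have h1 := hasDerivAt_frontMu hq ht
  refine (((((h1.const_mul 400000).const_add 1).const_mul q₀).sub_const (r ^ 2)).fun_div
    ((h1.fun_pow 3).const_mul (200 * q₀)) (by positivity)).congr_deriv ?_
  have h4 := frontMu_pow_four hq ht
  have h5 : t = q₀ * frontMu q₀ t ^ 4 := by rw [h4]; field_simp
  rw [frontY]
  set μ := frontMu q₀ t
  rw [h5]
  norm_num
  field_simp
  ring

/-- Behind the front ($y>0$) one has $X<400001$, and the self-similar bound gives $2y\mu^2<640$, so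
the drift factor is at least 52000. Ahead of it ($y\le0$) the drift factor is at least 100000, and
$X$ is large only if $|y|\le R$ is. -/
theorem front_inequality {X μ y R : ℝ} (hμ : 0 < μ) (hμ1 : μ ≤ 1)
    (hy : y = (1 + 400000 * μ - X) / (200 * μ ^ 3)) (hR1 : 1 ≤ R) (hRy : |y| ≤ R)
    (hg : (y + R) ^ 2 ≤ X / μ ^ 4) : 12 * X / 200 < R * (100000 - 150 * y * μ ^ 2) := by
  have hyX : y * (200 * μ ^ 3) = 1 + 400000 * μ - X := by rw [hy]; field_simp
  have hμ3 : μ ^ 3 ≤ 1 := pow_le_one₀ hμ.le hμ1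
  rcases lt_or_ge 0 y with h | h
  · have hX1 : X < 400001 := by
      have : 0 < y * (200 * μ ^ 3) := by positivity
      linarith
    have hyR := (le_abs_self y).trans hRy
    have h1 : (2 * y) ^ 2 ≤ X / μ ^ 4 := le_trans (by gcongr; linarith) hg
    rw [le_div_iff₀ (by positivity)] at h1
    have h2 : 2 * y * μ ^ 2 < 640 := by
      refine lt_of_pow_lt_pow_left₀ 2 (by norm_num) ?_
      have : (2 * y * μ ^ 2) ^ 2 = (2 * y) ^ 2 * μ ^ 4 := by ring
      rw [this]; linarith
    have h3 : 52000 ≤ 100000 - 150 * y * μ ^ 2 := by linarith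
    nlinarith
  · have h1 : 100000 ≤ 100000 - 150 * y * μ ^ 2 := by nlinarith [sq_nonneg μ]
    have h2 : R * 100000 ≤ R * (100000 - 150 * y * μ ^ 2) := by gcongr
    refine lt_of_lt_of_le ?_ h2
    rcases le_or_gt X 800002 with hX2 | hX2
    · linarith
    · have h3 := (neg_le_abs y).trans hRy
      have h4 : -y * (200 * μ ^ 3) ≤ R * 200 := by
        have : -y * (200 * μ ^ 3) ≤ -y * (200 * 1) := by
          gcongr; linarith
        linarith
      linarith

/-- A solution below `1 + r²/t` whose initial data are less than `1` cannot be large at points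
`r² ≥ C t`. -/
theorem SolData.front_bound (h : SolData m r₁ t₁ v v1 v2 vt) (hm : 1 ≤ m) {R T : ℝ}
    (hR : R ∈ Ioo 0 r₁) (hT : T ∈ Ioo 0 t₁) (hinit : ∀ r ∈ Ioc 0 R, v r 0 < 1)
    (hlat : ∀ t ∈ Icc 0 T, v R t < 1)
    (hself : ∀ r ∈ Icc 0 R, ∀ t ∈ Ioc 0 T, v r t ≤ 1 + r ^ 2 / t) :
    ∀ r ∈ Ioc 0 R, ∀ t ∈ Ioc 0 T, 400001 * t ≤ r ^ 2 → r ^ 2 ≤ 400001 * T → v r t ≤ 2 := by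
  intro r hr t ht hrt hrT
  -- The front sits at $r^2=q_0(1+400000\mu)$, so it reaches the given radius exactly at $\mu=1$,
  -- that is, at time $q_0\ge t$.
  set q₀ := r ^ 2 / 400001 with hq₀
  have hr0 := hr.1
  have hq0 : 0 < q₀ := by positivity
  have hrq : r ^ 2 = 400001 * q₀ := by rw [hq₀]; field_simp
  have htq : t ≤ q₀ := by linarith
  have hqT : q₀ ≤ T := by linarith
  set a := Real.sqrt (q₀ / 2) with ha
  have ha2 : a ^ 2 = q₀ / 2 := Real.sq_sqrt (by positivity)
  have ha0 : 0 < a := Real.sqrt_pos.2 (by positivity)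
  have har : a < r := lt_of_pow_lt_pow_left₀ 2 hr0.le (by rw [ha2, hrq]; linarith)
  have haR : a ≤ R := har.le.trans hr.2
  obtain ⟨τ₀, hτ₀, hτv⟩ := exists_time_uniform (G := fun r t => v r t - 1) haR hT.1
    ((h.continuousOn_rect ha0 hR.2 hT.2).sub continuousOn_const)
    (fun y hy => by have := hinit y ⟨ha0.trans_le hy.1, hy.2⟩; linarith)
  set t₀ := min τ₀ t with ht₀
  have ht₀0 : 0 < t₀ := lt_min hτ₀.1 ht.1
  have ht₀t : t₀ ≤ t := min_le_right _ _
  have hpos : ∀ τ ∈ Icc t₀ q₀, 0 < τ := fun τ hτ => ht₀0.trans_le hτ.1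
  have key := h.compare_strict (φ := fun r t => 1 + hypG (frontY q₀ r t) ^ 2)
    (φr := fun r t => 2 * hypG (frontY q₀ r t) ^ 2 / Real.sqrt (1 + frontY q₀ r t ^ 2)
      * (-(2 * r) / (200 * q₀ * frontMu q₀ t ^ 3)))
    (φrr := fun r t => (4 * hypG (frontY q₀ r t) ^ 2 / Real.sqrt (1 + frontY q₀ r t ^ 2) ^ 2
        - 2 * hypG (frontY q₀ r t) ^ 2 * frontY q₀ r t / Real.sqrt (1 + frontY q₀ r t ^ 2) ^ 3)
        * (-(2 * r) / (200 * q₀ * frontMu q₀ t ^ 3)) * (-(2 * r) / (200 * q₀ * frontMu q₀ t ^ 3))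
      + 2 * hypG (frontY q₀ r t) ^ 2 / Real.sqrt (1 + frontY q₀ r t ^ 2)
        * (-2 / (200 * q₀ * frontMu q₀ t ^ 3)))
    (φt := fun r t => 2 * hypG (frontY q₀ r t) ^ 2 / Real.sqrt (1 + frontY q₀ r t ^ 2)
      * ((2000 - 3 * frontY q₀ r t * frontMu q₀ t ^ 2) / (4 * q₀ * frontMu q₀ t ^ 6)))
    (s := 1) (a := a) (b := R) (t₀ := t₀) (T := q₀) (by norm_num) ha0.le hR.2 ht₀0.le
    (hqT.trans_lt hT.2) ((h.continuousOn_rect ha0 hR.2 (hqT.trans_lt hT.2)).mono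
      (prod_mono le_rfl (Icc_subset_Icc_left ht₀0.le))) ?_ ?_ ?_ ?_ ?_ ?_ ?_
  · have h1 := key r ⟨har.le, hr.2⟩ t ⟨ht₀t, htq⟩
    have hμ := frontMu_pos hq0 ht.1
    have hμ1 := frontMu_le_one hq0 htq
    -- The front has not yet passed $r$, so $g(y)\le1$ and the barrier is at most 2.
    have hy : frontY q₀ r t ≤ 0 := by
      rw [frontY]
      refine div_nonpos_of_nonpos_of_nonneg ?_ (by positivity)
      rw [hrq]; nlinarith
    have hg : hypG (frontY q₀ r t) ≤ 1 := by
      set y := frontY q₀ r t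
      have h2 : Real.sqrt (1 + y ^ 2) ≤ 1 - y :=
        Real.sqrt_le_iff.2 ⟨by linarith, by nlinarith⟩
      rw [hypG]; linarith
    have hg2 : hypG (frontY q₀ r t) ^ 2 ≤ 1 := pow_le_one₀ (hypG_pos _).le hg
    linarith
  · have hcμ : Continuous fun p : ℝ × ℝ => frontMu q₀ p.2 := by unfold frontMu; fun_prop
    have hcY : ContinuousOn (fun p : ℝ × ℝ => frontY q₀ p.1 p.2) (Icc a R ×ˢ Icc t₀ q₀) := by
      refine ContinuousOn.div ((continuous_const.mul (continuous_const.add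
        (continuous_const.mul hcμ))).sub (continuous_fst.pow 2)).continuousOn
        (continuous_const.mul (hcμ.pow 3)).continuousOn ?_
      rintro ⟨y, τ⟩ ⟨-, hτ⟩
      have := frontMu_pos hq0 (hpos τ hτ)
      positivity
    have hcg : Continuous hypG := by unfold hypG; fun_prop
    exact continuousOn_const.add ((hcg.comp_continuousOn hcY).pow 2)
  · intro y hy
    have h1 := hτv y hy t₀ ⟨ht₀0.le, min_le_left _ _⟩
    have := pow_pos (hypG_pos (frontY q₀ y t₀)) 2
    linarith
  · intro τ hτ
    have hτ0 := hpos τ hτ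
    have h1 := hself a ⟨ha0.le, haR⟩ τ ⟨hτ0, hτ.2.trans hqT⟩
    have h2 := hlat τ ⟨hτ0.le, hτ.2.trans hqT⟩
    have h3 := pow_pos (hypG_pos (frontY q₀ R τ)) 2
    refine ⟨?_, by linarith⟩
    have hμ := frontMu_pos hq0 hτ0
    have h4 := frontMu_pow_four hq0 hτ0
    set μ := frontMu q₀ τ
    -- At the inner edge $a^2=q_0/2$ the point is far behind the front. The barrier there is at
    -- least $4000000/\mu^4$, well above $a^2/\tau=\frac1{2\mu^4}$ from the self-similar bound.
    have hyl : 2000 / μ ^ 2 ≤ frontY q₀ a τ := by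
      rw [frontY, div_le_div_iff₀ (by positivity) (by positivity), ha2]
      have : 0 < q₀ * μ ^ 2 := by positivity
      change 2000 * (200 * q₀ * μ ^ 3) ≤ (q₀ * (1 + 400000 * μ) - q₀ / 2) * μ ^ 2
      linarith
    have hgl : 2000 / μ ^ 2 ≤ hypG (frontY q₀ a τ) := by
      have := one_le_sqrt_one_add_sq (frontY q₀ a τ)
      rw [hypG]; linarith
    have h5 : (2000 / μ ^ 2) ^ 2 ≤ hypG (frontY q₀ a τ) ^ 2 := by gcongr
    have h6 : (2000 / μ ^ 2) ^ 2 = 4000000 / μ ^ 4 := by field_simp; norm_num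
    have h7 : a ^ 2 / τ = (1 / 2) / μ ^ 4 := by rw [ha2, h4]; field_simp
    have h8 : (1 / 2) / μ ^ 4 < 4000000 / μ ^ 4 := by gcongr; norm_num
    linarith
  · intro y hy τ hτ
    exact HasDerivAt.comp (h₂ := fun y => 1 + hypG y ^ 2) (h := fun y => frontY q₀ y τ) y
      (hasDerivAt_front _) hasDerivAt_frontY
  · intro y hy τ hτ
    have h1 := HasDerivAt.comp (h₂ := fun y => 2 * hypG y ^ 2 / Real.sqrt (1 + y ^ 2))
      (h := fun y => frontY q₀ y τ) y (hasDerivAt_front' _) hasDerivAt_frontY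
    have h2 : HasDerivAt (fun y : ℝ => -(2 * y) / (200 * q₀ * frontMu q₀ τ ^ 3))
        (-2 / (200 * q₀ * frontMu q₀ τ ^ 3)) y := by
      refine ((((hasDerivAt_id y).const_mul 2).fun_neg).div_const _).congr_deriv ?_
      norm_num
    exact h1.mul h2
  · intro y hy τ hτ
    exact HasDerivAt.comp (h₂ := fun y => 1 + hypG y ^ 2) (h := fun t => frontY q₀ y t) τ
      (hasDerivAt_front _) (hasDerivAt_frontY_time hq0 (ht₀0.trans hτ.1))
  · intro r hr' τ hτ _ hv
    have hτ0 : 0 < τ := ht₀0.trans hτ.1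
    have hr0 : 0 < r := ha0.trans hr'.1
    have hμ := frontMu_pos hq0 hτ0
    have hμ1 := frontMu_le_one hq0 hτ.2
    have h4 := frontMu_pow_four hq0 hτ0
    -- The barrier need not be a supersolution everywhere: at a touching point it equals $v$, so the
    -- self-similar bound gives $g^2\le r^2/\tau$.
    have hs := hself r ⟨hr0.le, hr'.2.le⟩ τ ⟨hτ0, hτ.2.trans hqT⟩
    rw [← hv] at hs
    have hgp := hypG_pos (frontY q₀ r τ)
    have hRi := front_identity (one_le_sqrt_one_add_sq (frontY q₀ r τ))
      (sq_sqrt_one_add_sq _) (rfl : hypG (frontY q₀ r τ) = _)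
    have hR1 := one_le_sqrt_one_add_sq (frontY q₀ r τ)
    have hRy := (abs_lt_sqrt_one_add_sq (frontY q₀ r τ)).le
    have hgd : hypG (frontY q₀ r τ) = frontY q₀ r τ + Real.sqrt (1 + frontY q₀ r τ ^ 2) := rfl
    have hyd : frontY q₀ r τ = (1 + 400000 * frontMu q₀ τ - r ^ 2 / q₀) / (200 * frontMu q₀ τ ^ 3) := by
      rw [frontY]; field_simp
    set y := frontY q₀ r τ
    set μ := frontMu q₀ τ
    set g := hypG y
    set P := Real.sqrt (1 + y ^ 2)
    set X := r ^ 2 / q₀ with hX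
    have hX0 : 0 < X := by positivity
    have hrX : r ^ 2 = q₀ * X := by rw [hX]; field_simp
    have hg2 : (y + P) ^ 2 ≤ X / μ ^ 4 := by
      have e : X / μ ^ 4 = r ^ 2 / τ := by rw [h4, hX]; field_simp
      rw [e, ← hgd]; linarith
    have hmain := front_inequality hμ hμ1 hyd hR1 hRy hg2
    set d := 200 * q₀ * μ ^ 3 with hd
    have hd0 : 0 < d := by positivity
    have e1 : (1 + g ^ 2) * ((4 * g ^ 2 / P ^ 2 - 2 * g ^ 2 * y / P ^ 3) * (-(2 * r) / d)
          * (-(2 * r) / d) + 2 * g ^ 2 / P * (-2 / d))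
        - 1 / 2 * (2 * g ^ 2 / P * (-(2 * r) / d)) ^ 2
        + (m - (1 + g ^ 2)) / r * (2 * g ^ 2 / P * (-(2 * r) / d))
        + 2 * m / r ^ 2 * ((1 + g ^ 2) * (1 - (1 + g ^ 2))) =
        4 * r ^ 2 / d ^ 2 * ((1 + g ^ 2) * (4 * g ^ 2 / P ^ 2 - 2 * g ^ 2 * y / P ^ 3)
          - 1 / 2 * (2 * g ^ 2 / P) ^ 2)
        - 2 * m * (2 * g ^ 2 / P) / d - 2 * m / r ^ 2 * ((1 + g ^ 2) * g ^ 2) := by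
      field_simp; ring
    rw [one_mul, one_mul, e1, hRi]
    have n1 : 0 ≤ 2 * m * (2 * g ^ 2 / P) / d := by positivity
    have n2 : 0 ≤ 2 * m / r ^ 2 * ((1 + g ^ 2) * g ^ 2) := by positivity
    have e2 : 4 * r ^ 2 / d ^ 2 * (6 * g ^ 2 / P ^ 2)
        = 2 * g ^ 2 / (200 * 4 * q₀ * μ ^ 6 * P ^ 2) * (4 * (12 * X / 200)) := by
      rw [hrX, hd]; field_simp; norm_num
    have e3 : 2 * g ^ 2 / P * ((2000 - 3 * y * μ ^ 2) / (4 * q₀ * μ ^ 6))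
        = 2 * g ^ 2 / (200 * 4 * q₀ * μ ^ 6 * P ^ 2) * (4 * (P * (100000 - 150 * y * μ ^ 2))) := by
      field_simp; ring
    have n3 : 2 * g ^ 2 / (200 * 4 * q₀ * μ ^ 6 * P ^ 2) * (4 * (12 * X / 200))
        < 2 * g ^ 2 / (200 * 4 * q₀ * μ ^ 6 * P ^ 2) * (4 * (P * (100000 - 150 * y * μ ^ 2))) := by
      gcongr
    rw [e2, e3]
    linarith

/-- Solutions are bounded near the corner `(0,0)`. -/
theorem SolData.corner_bounded (h : SolData m r₁ t₁ v v1 v2 vt) (hm : 1 ≤ m) {R T : ℝ}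
    (hR : R ∈ Ioo 0 r₁) (hT : T ∈ Ioo 0 t₁) (hinit : ∀ r ∈ Ioc 0 R, v r 0 < 1)
    (hlat : ∀ t ∈ Icc 0 T, v R t < 1) (htip : ∀ t ∈ Ioc 0 T, v 0 t = 1 ∧ v1 0 t = 0) :
    ∀ r ∈ Ioc 0 R, r ^ 2 ≤ 400001 * T → ∀ t ∈ Icc 0 T, v r t ≤ 400002 := by
  have hself := h.le_one_add_sq_div hm hR hT.2 htip hlat
  intro r hr hrT t ht
  rcases eq_or_lt_of_le ht.1 with h0 | h0
  · rw [← h0]; linarith [hinit r hr]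
  · rcases le_total (400001 * t) (r ^ 2) with h1 | h1
    · linarith [h.front_bound hm hR hT hinit hlat hself r hr t ⟨h0, ht.2⟩ h1 hrT]
    · have h2 := hself r ⟨hr.1.le, hr.2⟩ t ⟨h0, ht.2⟩
      have h3 : r ^ 2 / t ≤ 400001 := by rw [div_le_iff₀ h0]; exact h1
      linarith

end

section

open Set Filter Topology
open scoped ContDiff

/-! ### Glued barriers -/

/-- `W` is given by the pieces `i`, `p`, `o` between the thresholds `a < b < c < d`, and by the minimum
(for `s = 1`) or maximum (for `s = -1`) of two pieces on the overlaps. -/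
structure IsGluing (s : ℝ) (W i p o : ℝ → ℝ → ℝ) (a b c d : ℝ → ℝ) (t : ℝ) : Prop where
  eq_i : ∀ r, r < a t → W r t = i r t
  eq_ip : ∀ r, a t ≤ r → r < b t → s * W r t = min (s * i r t) (s * p r t)
  eq_p : ∀ r, b t ≤ r → r < c t → W r t = p r t
  eq_po : ∀ r, c t ≤ r → r < d t → s * W r t = min (s * p r t) (s * o r t)
  eq_o : ∀ r, d t ≤ r → W r t = o r t
  ab : a t < b t
  bc : b t < c t
  cd : c t < d t
  glue_a : s * i (a t) t < s * p (a t) t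
  glue_b : s * p (b t) t < s * i (b t) t
  glue_c : s * p (c t) t < s * o (c t) t
  glue_d : s * o (d t) t < s * p (d t) t

/-- `w` is a barrier at the point `(r, t)`. -/
def IsSignedBarrierAt (n : ℕ) (s : ℝ) (w : ℝ → ℝ → ℝ) (r t : ℝ) : Prop :=
  ContDiffAt ℝ 2 (fun q : ℝ × ℝ => w q.1 q.2) (r, t) ∧
    0 ≤ s * (deriv (fun τ => w r τ) t - opF n (fun y => w y t) r)

/-- Near every point a glued barrier is one barrier or the minimum of two. -/
theorem IsGluing.exists_local {n : ℕ} {s : ℝ} {W i p o : ℝ → ℝ → ℝ}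
    {a b c d : ℝ → ℝ} {r t : ℝ} (h : ∀ᶠ τ in 𝓝 t, IsGluing s W i p o a b c d τ)
    (ha : ContinuousAt a t) (hb : ContinuousAt b t) (hc : ContinuousAt c t) (hd : ContinuousAt d t)
    (hi : r ≤ b t → IsSignedBarrierAt n s i r t)
    (hp : a t ≤ r → r ≤ d t → IsSignedBarrierAt n s p r t)
    (ho : c t ≤ r → IsSignedBarrierAt n s o r t) :
    ∃ w₁ w₂, IsSignedBarrierAt n s w₁ r t ∧ IsSignedBarrierAt n s w₂ r t ∧
      ∀ᶠ q : ℝ × ℝ in 𝓝 (r, t), s * W q.1 q.2 = min (s * w₁ q.1 q.2) (s * w₂ q.1 q.2) := by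
  have h0 := h.self_of_nhds
  have hq : ∀ᶠ q : ℝ × ℝ in 𝓝 (r, t), IsGluing s W i p o a b c d q.2 :=
    (continuous_snd.tendsto (r, t)).eventually h
  have lt_ev : ∀ {g : ℝ → ℝ}, ContinuousAt g t → r < g t → ∀ᶠ q : ℝ × ℝ in 𝓝 (r, t), q.1 < g q.2 :=
    fun hg hlt => continuousAt_fst.eventually_lt (hg.comp continuousAt_snd) hlt
  have gt_ev : ∀ {g : ℝ → ℝ}, ContinuousAt g t → g t < r → ∀ᶠ q : ℝ × ℝ in 𝓝 (r, t), g q.2 < q.1 :=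
    fun hg hlt => (hg.comp continuousAt_snd).eventually_lt continuousAt_fst hlt
  have le_ev : ∀ {u w : ℝ → ℝ → ℝ}, IsSignedBarrierAt n s u r t → IsSignedBarrierAt n s w r t →
      s * u r t < s * w r t → ∀ᶠ q : ℝ × ℝ in 𝓝 (r, t), s * u q.1 q.2 ≤ s * w q.1 q.2 :=
    fun hu hw hlt => ((continuousAt_const.mul hu.1.continuousAt).eventually_lt
      (continuousAt_const.mul hw.1.continuousAt) hlt).mono fun _ => le_of_lt
  have ab := h0.ab
  have bc := h0.bc
  have cd := h0.cd
  rcases lt_trichotomy r (a t) with h1 | h1 | h1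
  · refine ⟨i, i, hi (by linarith), hi (by linarith), ?_⟩
    filter_upwards [hq, lt_ev ha h1] with q g1 g2
    rw [min_self, g1.eq_i _ g2]
  -- At a threshold the strict gluing inequality persists nearby, so one piece is active on a whole
  -- neighbourhood although the formula changes there. The other three thresholds are treated alike.
  · have hi' := hi (by linarith)
    have hp' := hp h1.ge (by linarith)
    refine ⟨i, i, hi', hi', ?_⟩
    filter_upwards [hq, lt_ev hb (by linarith), le_ev hi' hp' (by rw [h1]; exact h0.glue_a)]
      with q g1 g2 g3
    rw [min_self]
    rcases lt_or_ge q.1 (a q.2) with g4 | g4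
    · rw [g1.eq_i _ g4]
    · rw [g1.eq_ip _ g4 g2, min_eq_left g3]
  rcases lt_trichotomy r (b t) with h2 | h2 | h2
  · refine ⟨i, p, hi h2.le, hp h1.le (by linarith), ?_⟩
    filter_upwards [hq, gt_ev ha h1, lt_ev hb h2] with q g1 g2 g3
    rw [g1.eq_ip _ g2.le g3]
  · have hi' := hi h2.le
    have hp' := hp h1.le (by linarith)
    refine ⟨p, p, hp', hp', ?_⟩
    filter_upwards [hq, gt_ev ha h1, lt_ev hc (by linarith),
      le_ev hp' hi' (by rw [h2]; exact h0.glue_b)] with q g1 g2 g3 g4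
    rw [min_self]
    rcases lt_or_ge q.1 (b q.2) with g5 | g5
    · rw [g1.eq_ip _ g2.le g5, min_eq_right g4]
    · rw [g1.eq_p _ g5 g3]
  rcases lt_trichotomy r (c t) with h3 | h3 | h3
  · have hp' := hp h1.le (by linarith)
    refine ⟨p, p, hp', hp', ?_⟩
    filter_upwards [hq, gt_ev hb h2, lt_ev hc h3] with q g1 g2 g3
    rw [min_self, g1.eq_p _ g2.le g3]
  · have hp' := hp h1.le (by linarith)
    have ho' := ho h3.ge
    refine ⟨p, p, hp', hp', ?_⟩
    filter_upwards [hq, gt_ev hb h2, lt_ev hd (by linarith),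
      le_ev hp' ho' (by rw [h3]; exact h0.glue_c)] with q g1 g2 g3 g4
    rw [min_self]
    rcases lt_or_ge q.1 (c q.2) with g5 | g5
    · rw [g1.eq_p _ g2.le g5]
    · rw [g1.eq_po _ g5 g3, min_eq_left g4]
  have ho' := ho h3.le
  rcases lt_trichotomy r (d t) with h4 | h4 | h4
  · refine ⟨p, o, hp h1.le h4.le, ho', ?_⟩
    filter_upwards [hq, gt_ev hc h3, lt_ev hd h4] with q g1 g2 g3
    rw [g1.eq_po _ g2.le g3]
  · have hp' := hp h1.le h4.le
    refine ⟨o, o, ho', ho', ?_⟩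
    filter_upwards [hq, gt_ev hc h3, le_ev ho' hp' (by rw [h4]; exact h0.glue_d)] with q g1 g2 g3
    rw [min_self]
    rcases lt_or_ge q.1 (d q.2) with g4 | g4
    · rw [g1.eq_po _ g2.le g4, min_eq_right g3]
    · rw [g1.eq_o _ g4]
  · refine ⟨o, o, ho', ho', ?_⟩
    filter_upwards [hq, gt_ev hd h4] with q g1 g2
    rw [min_self, g1.eq_o _ g2.le]

/-- A continuous barrier in the sense of smooth test functions on `0 ≤ r ≤ rs`, `0 < t < ts`. -/
structure IsWeakBarrier (n : ℕ) (s : ℝ) (W : ℝ → ℝ → ℝ) (rs ts : ℝ) : Prop where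
  cont : ContinuousOn (fun q : ℝ × ℝ => W q.1 q.2) (Icc 0 rs ×ˢ Ioo 0 ts)
  test : ∀ r ∈ Ioc 0 rs, ∀ t ∈ Ioo 0 ts, ∃ w, IsSignedBarrierAt n s w r t ∧ w r t = W r t ∧
    ∀ᶠ q : ℝ × ℝ in 𝓝 (r, t), s * W q.1 q.2 ≤ s * w q.1 q.2
  tip : ∀ t ∈ Ioo 0 ts, W 0 t = 1

/-- The piece that attains the minimum at the point touches the glued function there and bounds it
from the correct side nearby, so corners never obstruct a comparison. -/
theorem exists_test_of_local_min {n : ℕ} {s : ℝ} (hs : s ^ 2 = 1) {W : ℝ → ℝ → ℝ} {r t : ℝ}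
    (h : ∃ w₁ w₂, IsSignedBarrierAt n s w₁ r t ∧ IsSignedBarrierAt n s w₂ r t ∧
      ∀ᶠ q : ℝ × ℝ in 𝓝 (r, t), s * W q.1 q.2 = min (s * w₁ q.1 q.2) (s * w₂ q.1 q.2)) :
    ContinuousAt (fun q : ℝ × ℝ => W q.1 q.2) (r, t) ∧
    ∃ w, IsSignedBarrierAt n s w r t ∧ w r t = W r t ∧
      ∀ᶠ q : ℝ × ℝ in 𝓝 (r, t), s * W q.1 q.2 ≤ s * w q.1 q.2 := by
  obtain ⟨w₁, w₂, h₁, h₂, he⟩ := h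
  have hs0 : s ≠ 0 := by rintro rfl; norm_num at hs
  constructor
  · have h1 : ContinuousAt (fun q : ℝ × ℝ => s * min (s * w₁ q.1 q.2) (s * w₂ q.1 q.2)) (r, t) :=
      continuousAt_const.mul ((continuousAt_const.mul h₁.1.continuousAt).min
        (continuousAt_const.mul h₂.1.continuousAt))
    refine h1.congr ?_
    filter_upwards [he] with q hq
    rw [← hq, ← mul_assoc, ← sq, hs, one_mul]
  · have h0 := he.self_of_nhds
    rcases le_total (s * w₁ r t) (s * w₂ r t) with hle | hle
    · rw [min_eq_left hle] at h0
      exact ⟨w₁, h₁, (mul_left_cancel₀ hs0 h0).symm, he.mono fun q hq => hq.trans_le (min_le_left _ _)⟩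
    · rw [min_eq_right hle] at h0
      exact ⟨w₂, h₂, (mul_left_cancel₀ hs0 h0).symm, he.mono fun q hq => hq.trans_le (min_le_right _ _)⟩

theorem theta_continuousAt {t : ℝ} (ht : t ∈ Ioo (0 : ℝ) 1) : ContinuousAt theta t :=
  (Real.continuous_sqrt.continuousAt).comp
    (continuousAt_id.div (Real.continuousAt_log ht.1.ne').neg (neg_log_pos ht).ne')

variable {n : ℕ} {f p C Cd Cdd : ℝ → ℝ} {A B ε δ rs ts : ℝ}

/-- The glued barrier with sign `s`. -/
def vGlue (n : ℕ) (f C : ℝ → ℝ) (A B ε δ s : ℝ) : ℝ → ℝ → ℝ :=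
  if s = 1 then vPlus n (fun σ => f (σ ^ 2)) (fun σ => C (σ ^ 2)) A B ε δ
  else vMinus n (fun σ => f (σ ^ 2)) (fun σ => C (σ ^ 2)) A B ε δ

theorem IsGluedBarrierPair.isGluing {s : ℝ} (hs : s ^ 2 = 1) (hA : 0 < A) (hB : 0 < B) (hε : 0 < ε)
    (hts : ts ≤ 1)
    (h : IsGluedBarrierPair n (fun σ => f (σ ^ 2)) (fun σ => C (σ ^ 2)) A B ε δ rs ts) :
    ∀ t ∈ Ioo 0 ts, IsGluing s (vGlue n f C A B ε δ s)
      (vIn n (fun σ => f (σ ^ 2)) (fun σ => C (σ ^ 2)) A ε δ s) (vPar n A B ε δ s) (vOut n ε δ s)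
      (fun t => sigmaStar B ε * theta t) (fun t => 3 * sigmaStar B ε * theta t)
      (fun t => rhoStar A ε * Real.sqrt t) (fun t => 3 * rhoStar A ε * Real.sqrt t) t := by
  intro t ht
  have h1 : 0 < sigmaStar B ε * theta t :=
    mul_pos (sigmaStar_pos hB hε) (theta_pos ⟨ht.1, ht.2.trans_le hts⟩)
  have h2 : 0 < rhoStar A ε * Real.sqrt t := mul_pos (rhoStar_pos hA hε) (Real.sqrt_pos.2 ht.1)
  have h3 := (h.order t ht).1
  have g1 := h.glue_sub_out t ht
  have g2 := h.glue_sub_in t ht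
  have g3 := h.glue_super_out t ht
  have g4 := h.glue_super_in t ht
  have e1 : 3 * sigmaStar B ε * theta t = 3 * (sigmaStar B ε * theta t) := by ring
  have e2 : 3 * rhoStar A ε * Real.sqrt t = 3 * (rhoStar A ε * Real.sqrt t) := by ring
  rcases sq_eq_one_iff.1 hs with rfl | rfl
  · have hW : vGlue n f C A B ε δ 1
      = vPlus n (fun σ => f (σ ^ 2)) (fun σ => C (σ ^ 2)) A B ε δ := if_pos rfl
    rw [hW]
    constructor
    · intro r hr
      simp only [vPlus]
      rw [if_neg (by linarith), if_neg (by linarith), if_neg (by linarith), if_neg (by linarith)]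
    · intro r hr hr'
      simp only [vPlus, one_mul]
      rw [if_neg (by linarith), if_neg (by linarith), if_neg (by linarith), if_pos (by linarith)]
    · intro r hr hr'
      simp only [vPlus]
      rw [if_neg (by linarith), if_neg (by linarith), if_pos (by linarith)]
    · intro r hr hr'
      simp only [vPlus, one_mul]
      rw [if_neg (by linarith), if_pos (by linarith), min_comm]
    · intro r hr
      simp only [vPlus]
      rw [if_pos (by linarith)]
    all_goals linarith
  · have hW : vGlue n f C A B ε δ (-1)
      = vMinus n (fun σ => f (σ ^ 2)) (fun σ => C (σ ^ 2)) A B ε δ := if_neg (by norm_num)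
    rw [hW]
    have hmn : ∀ x y : ℝ, -1 * max x y = min (-1 * x) (-1 * y) := fun x y => by
      rw [neg_one_mul, neg_one_mul, neg_one_mul, min_neg_neg]
    constructor
    · intro r hr
      simp only [vMinus]
      rw [if_neg (by linarith), if_neg (by linarith), if_neg (by linarith), if_neg (by linarith)]
    · intro r hr hr'
      simp only [vMinus]
      rw [if_neg (by linarith), if_neg (by linarith), if_neg (by linarith), if_pos (by linarith), hmn]
    · intro r hr hr'
      simp only [vMinus]
      rw [if_neg (by linarith), if_neg (by linarith), if_pos (by linarith)]
    · intro r hr hr'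
      simp only [vMinus]
      rw [if_neg (by linarith), if_pos (by linarith), hmn, min_comm]
    · intro r hr
      simp only [vMinus]
      rw [if_pos (by linarith)]
    all_goals linarith

theorem continuousAt_inBar_sq {m : ℝ} (hf : BryantFun m f p) (hC : BryantCorr m f p C Cd Cdd)
    (hC0 : C 0 = 0) {s q r t : ℝ} (hq : 0 ≤ q) (ht : t ∈ Ioo (0 : ℝ) 1) :
    ContinuousAt (fun z : ℝ × ℝ => inBar f C ε s q (z.1 ^ 2) z.2) (r, t) := by
  have hk : ContinuousAt (fun z : ℝ × ℝ => kap z.2) (r, t) :=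
    ContinuousAt.comp (g := kap) (x := (r, t)) (contDiffAt_kap ht).continuousAt continuousAt_snd
  have hX : ContinuousAt (fun z : ℝ × ℝ => inX q (z.1 ^ 2) z.2) (r, t) :=
    ContinuousAt.div (by fun_prop) (continuousAt_snd.mul hk)
      (mul_pos ht.1 (kap_pos ht)).ne'
  have hXn : ∀ z : ℝ × ℝ, z.2 ∈ Ioo (0 : ℝ) 1 → 0 ≤ inX q (z.1 ^ 2) z.2 := fun z hz =>
    div_nonneg (mul_nonneg hq (sq_nonneg _)) (mul_pos hz.1 (kap_pos hz)).le
  have hfX : ContinuousAt (fun z : ℝ × ℝ => f (inX q (z.1 ^ 2) z.2)) (r, t) :=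
    ContinuousAt.comp (g := f) (f := fun z : ℝ × ℝ => inX q (z.1 ^ 2) z.2) (x := (r, t))
      (hf.contDiffAt _ (hXn _ ht)).continuousAt hX
  have hCX : ContinuousAt (fun z : ℝ × ℝ => C (inX q (z.1 ^ 2) z.2)) (r, t) := by
    have h1 := (hC.continuousOn hC0 _ (mem_Ici.2 (hXn (r, t) ht))).tendsto
    refine h1.comp (tendsto_nhdsWithin_iff.2 ⟨hX, ?_⟩)
    filter_upwards [continuousAt_snd.eventually (Ioo_mem_nhds ht.1 ht.2)] with z hz
    exact mem_Ici.2 (hXn z hz)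
  exact hfX.add ((continuousAt_const.mul ((hk.add (hk.pow 2)).div_const 2)).mul (hCX.div_const q))

/-- Away from the tip this is the local description as a minimum of two barriers. Near $r=0$ only
the inner piece is active, and it takes the value $f(0)=1$ at the tip because $C(0)=0$. -/
theorem IsGluedBarrierPair.isWeakBarrier {m : ℝ} (hf : BryantFun m f p)
    (hC : BryantCorr m f p C Cd Cdd) (hC0 : C 0 = 0) {s : ℝ} (hs : s ^ 2 = 1) (hA : 0 < A)
    (hB : 0 < B) (hε : 0 < ε) (hts : ts ≤ 1)
    (h : IsGluedBarrierPair n (fun σ => f (σ ^ 2)) (fun σ => C (σ ^ 2)) A B ε δ rs ts) :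
    IsWeakBarrier n s (vGlue n f C A B ε δ s) rs ts := by
  have hglue := h.isGluing hs hA hB hε hts
  have hloc : ∀ r ∈ Ioc 0 rs, ∀ t ∈ Ioo 0 ts, _ := fun r hr t ht =>
    exists_test_of_local_min hs (W := vGlue n f C A B ε δ s) (IsGluing.exists_local (n := n)
      (r := r) (t := t) (by filter_upwards [Ioo_mem_nhds ht.1 ht.2] with τ hτ using hglue τ hτ)
      (continuousAt_const.mul (theta_continuousAt ⟨ht.1, ht.2.trans_le hts⟩))
      (continuousAt_const.mul (theta_continuousAt ⟨ht.1, ht.2.trans_le hts⟩))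
      (continuousAt_const.mul Real.continuous_sqrt.continuousAt)
      (continuousAt_const.mul Real.continuous_sqrt.continuousAt)
      (by
        intro hle
        have hmem : (r, t) ∈ regionIn B ε ts := ⟨hr.1, hle, ht.1, ht.2⟩
        rcases sq_eq_one_iff.1 hs with rfl | rfl
        · exact ⟨(h.super_in _ hmem).1, by linarith [(h.super_in _ hmem).2]⟩
        · exact ⟨(h.sub_in _ hmem).1, by linarith [(h.sub_in _ hmem).2]⟩)
      (by
        intro hle hle'
        have hmem : (r, t) ∈ regionPar A B ε ts := ⟨hle, hle', ht.1, ht.2⟩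
        rcases sq_eq_one_iff.1 hs with rfl | rfl
        · exact ⟨(h.super_par _ hmem).1, by linarith [(h.super_par _ hmem).2]⟩
        · exact ⟨(h.sub_par _ hmem).1, by linarith [(h.sub_par _ hmem).2]⟩)
      (by
        intro hle
        have hmem : (r, t) ∈ regionOut A ε rs ts := ⟨hle, hr.2, ht.1, ht.2⟩
        rcases sq_eq_one_iff.1 hs with rfl | rfl
        · exact ⟨(h.super_out _ hmem).1, by linarith [(h.super_out _ hmem).2]⟩
        · exact ⟨(h.sub_out _ hmem).1, by linarith [(h.sub_out _ hmem).2]⟩))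
  have h1 : ∀ t ∈ Ioo 0 ts, 0 < sigmaStar B ε * theta t := fun t ht =>
    mul_pos (sigmaStar_pos hB hε) (theta_pos ⟨ht.1, ht.2.trans_le hts⟩)
  refine ⟨?_, fun r hr t ht => (hloc r hr t ht).2, ?_⟩
  · rintro ⟨r, t⟩ ⟨hr, ht⟩
    simp only at hr ht
    have ht' : t ∈ Ioo (0 : ℝ) 1 := ⟨ht.1, ht.2.trans_le hts⟩
    rcases eq_or_lt_of_le hr.1 with h0 | h0
    · subst h0
      refine ContinuousAt.continuousWithinAt ?_
      refine (continuousAt_inBar_sq hf hC hC0 (s := s) (ε := ε) (r := 0)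
        (sq_nonneg (kC n A ε δ s)) ht').congr ?_
      have hlt : ∀ᶠ q : ℝ × ℝ in 𝓝 (0, t), q.1 < sigmaStar B ε * theta q.2 :=
        continuousAt_fst.eventually_lt (continuousAt_const.mul
          (ContinuousAt.comp (g := theta) (f := Prod.snd) (x := ((0 : ℝ), t)) (theta_continuousAt ht')
            continuousAt_snd)) (h1 t ht)
      filter_upwards [hlt, continuousAt_snd.eventually (Ioo_mem_nhds ht.1 ht.2)] with q hq hq2
      rw [(hglue q.2 hq2).eq_i _ hq, vIn_eq_inBar ⟨hq2.1, hq2.2.trans_le hts⟩]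
    · exact (hloc r ⟨h0, hr.2⟩ t ht).1.continuousWithinAt
  · intro t ht
    rw [(hglue t ht).eq_i _ (h1 t ht), vIn_eq_inBar ⟨ht.1, ht.2.trans_le hts⟩]
    simp [inBar, inX, hf.zero, hC0]

end

section

open Set Filter Topology
open scoped ContDiff

/-! ### Comparison with weak barriers -/

theorem ContDiffAt.hasDerivAt_two {g : ℝ → ℝ} {x : ℝ} (h : ContDiffAt ℝ 2 g x) :
    (∀ᶠ y in 𝓝 x, HasDerivAt g (deriv g y) y) ∧ HasDerivAt (deriv g) (deriv (deriv g) x) x := by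
  have h1 : ContDiffAt ℝ 1 (deriv g) x := by
    exact h.derivWithin (by norm_num)
  refine ⟨?_, (h1.differentiableAt (by norm_num)).hasDerivAt⟩
  filter_upwards [h.eventually (by norm_num)] with y hy
  exact (hy.differentiableAt (by norm_num)).hasDerivAt

variable {n : ℕ} {m r₁ t₁ : ℝ} {v v1 v2 vt : ℝ → ℝ → ℝ}

/-- The algebra at a touching point. -/
theorem touching_inequality {m s r E v w v1 v2 wrr K : ℝ} (hs : s ^ 2 = 1) (hm : 0 ≤ m) (hr : 0 < r)
    (hE : 0 ≤ E) (hw : 0 ≤ w) (hv : v = w + s * E) (hv2 : s * v2 ≤ s * wrr) (hK2 : |v2| ≤ K)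
    (hK1 : |v1| ≤ K * r) (hK0 : |v - 1| ≤ K * r ^ 2) :
    s * (v * v2 - 1 / 2 * v1 ^ 2 + (m - v) / r * v1 + 2 * m / r ^ 2 * (v * (1 - v)))
      - s * (w * wrr - 1 / 2 * v1 ^ 2 + (m - w) / r * v1 + 2 * m / r ^ 2 * (w * (1 - w)))
      ≤ E * (2 * K + 2 * m * K) := by
  -- Apart from the signed second order term, the difference is $E$ times
  -- $v_{rr}-v_r/r+2m(1-v-w)/r^2$. With $w\ge0$ this is bounded above by the Taylor bounds for $v$
  -- alone, so no regularity of the barrier at the tip is used.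
  have e : s * (v * v2 - 1 / 2 * v1 ^ 2 + (m - v) / r * v1 + 2 * m / r ^ 2 * (v * (1 - v)))
      - s * (w * wrr - 1 / 2 * v1 ^ 2 + (m - w) / r * v1 + 2 * m / r ^ 2 * (w * (1 - w)))
      = w * (s * v2 - s * wrr) + s ^ 2 * E * (v2 - v1 / r + 2 * m * ((1 - v - w) / r ^ 2)) := by
    rw [hv]; field_simp; ring
  rw [e, hs, one_mul]
  have h1 : w * (s * v2 - s * wrr) ≤ 0 := mul_nonpos_of_nonneg_of_nonpos hw (by linarith)
  have h2 : v2 ≤ K := (abs_le.1 hK2).2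
  have h3 : -(v1 / r) ≤ K := by
    rw [← neg_div, div_le_iff₀ hr]; linarith [(abs_le.1 hK1).1]
  have h4 : (1 - v - w) / r ^ 2 ≤ K := by
    rw [div_le_iff₀ (by positivity)]; linarith [(abs_le.1 hK0).1]
  have h5 : 2 * m * ((1 - v - w) / r ^ 2) ≤ 2 * m * K := by gcongr
  have h6 : E * (v2 - v1 / r + 2 * m * ((1 - v - w) / r ^ 2)) ≤ E * (2 * K + 2 * m * K) := by
    refine mul_le_mul_of_nonneg_left ?_ hE
    linarith
  linarith

/-- Comparison of a solution with a time translate of a weak barrier. -/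
theorem SolData.le_weakBarrier (h : SolData m r₁ t₁ v v1 v2 vt) (hm : m = (n : ℝ) - 1) (hm0 : 0 ≤ m)
    {s : ℝ} (hs : s ^ 2 = 1) {W : ℝ → ℝ → ℝ} {rs ts : ℝ} (hW : IsWeakBarrier n s W rs ts)
    {R t₀ T ξ : ℝ} (hR : R < r₁) (hRs : R ≤ rs) (ht₀ : 0 < t₀) (hT : T < t₁)
    (hξ : 0 < t₀ + ξ) (hξT : T + ξ < ts)
    (hnn : s = 1 → ∀ r ∈ Icc 0 R, ∀ t ∈ Icc t₀ T, 0 ≤ W r (t + ξ))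
    (htip : ∀ t ∈ Icc t₀ T, v 0 t = 1 ∧ v1 0 t = 0)
    (hinit : ∀ r ∈ Icc 0 R, 0 ≤ s * (W r (t₀ + ξ) - v r t₀))
    (hlat : ∀ t ∈ Icc t₀ T, 0 ≤ s * (W R (t + ξ) - v R t)) :
    ∀ r ∈ Icc 0 R, ∀ t ∈ Icc t₀ T, 0 ≤ s * (W r (t + ξ) - v r t) := by
  obtain ⟨K, hK0, hK⟩ := h.exists_taylor_bound hR ht₀ hT htip
  -- The rate exceeds the zeroth order coefficient in `touching_inequality`, so adding $\eta e^{lt}$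
  -- makes the barrier strict; $\eta\to0$ afterwards.
  set l := 2 * K + 2 * m * K + 1 with hl
  have hts : ∀ t ∈ Icc t₀ T, t + ξ ∈ Ioo 0 ts := fun t ht => ⟨by linarith [ht.1], by linarith [ht.2]⟩
  have key : ∀ η > 0, ∀ r ∈ Icc 0 R, ∀ t ∈ Icc t₀ T,
      0 < s * (W r (t + ξ) - v r t) + η * Real.exp (l * t) := by
    intro η hη
    have hse : ∀ x y z : ℝ, s * (x + s * z - y) = s * (x - y) + z := fun x y z => by
      linear_combination z * hs
    have hEpos : ∀ t, 0 < η * Real.exp (l * t) := fun t => mul_pos hη (Real.exp_pos _)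
    have hmain := h.compare (φ := fun r t => W r (t + ξ) + s * (η * Real.exp (l * t)))
      (a := 0) (b := R) (t₀ := t₀) (T := T) hs le_rfl hR ht₀.le hT
      (h.continuousOn_rect' ht₀ hR hT) ?_ ?_ ?_ ?_
    · intro r hr t ht
      have := hmain r hr t ht
      rwa [hse] at this
    · refine ContinuousOn.add ?_ (by fun_prop)
      exact hW.cont.comp (f := fun q : ℝ × ℝ => (q.1, q.2 + ξ)) (by fun_prop)
        fun q hq => ⟨⟨hq.1.1, hq.1.2.trans hRs⟩, hts _ hq.2⟩
    · intro r hr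
      rw [hse]; have := hinit r hr; have := hEpos t₀; linarith
    · intro t ht
      rw [hse, hse]
      have h1 := hlat t ht
      have h2 := hEpos t
      refine ⟨?_, by linarith⟩
      rw [hW.tip _ (hts t ht), (htip t ht).1, sub_self, mul_zero, zero_add]
      exact h2
    · intro r hr t ht hv
      have ht' : t ∈ Icc t₀ T := ⟨ht.1.le, ht.2⟩
      have hr' : r ∈ Icc 0 R := ⟨hr.1.le, hr.2.le⟩
      obtain ⟨w, ⟨hwc, hwb⟩, hwv, hwl⟩ := hW.test r ⟨hr.1, hr.2.le.trans hRs⟩ (t + ξ) (hts t ht')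
      have hy : ContDiffAt ℝ 2 (fun y => w y (t + ξ)) r :=
        ContDiffAt.comp (g := fun q : ℝ × ℝ => w q.1 q.2) (f := fun y => (y, t + ξ)) r hwc
          (contDiffAt_id.prodMk contDiffAt_const)
      have hτ : DifferentiableAt ℝ (fun τ => w r τ) (t + ξ) :=
        (ContDiffAt.comp (g := fun q : ℝ × ℝ => w q.1 q.2) (f := fun τ => (r, τ)) (t + ξ) hwc
          (contDiffAt_const.prodMk contDiffAt_id)).differentiableAt (by norm_num : (2 : WithTop ℕ∞) ≠ 0)
      obtain ⟨d1, d2⟩ := ContDiffAt.hasDerivAt_two hy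
      have dE : HasDerivAt (fun τ => s * (η * Real.exp (l * τ)))
          (s * (η * (Real.exp (l * t) * l))) t := by
        refine HasDerivAt.const_mul _ (HasDerivAt.const_mul _ ?_)
        refine ((hasDerivAt_id t).const_mul l).exp.congr_deriv ?_
        simp
      refine ⟨fun y => w y (t + ξ) + s * (η * Real.exp (l * t)), deriv fun y => w y (t + ξ),
        deriv (deriv fun y => w y (t + ξ)) r, fun τ => w r (τ + ξ) + s * (η * Real.exp (l * τ)),
        deriv (fun τ => w r τ) (t + ξ) + s * (η * (Real.exp (l * t) * l)),
        by simp only [hwv], by simp only [hwv], ?_, ?_, ?_, d2, ?_, ?_⟩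
      · have : Tendsto (fun y : ℝ => (y, t + ξ)) (𝓝 r) (𝓝 (r, t + ξ)) :=
          (Continuous.prodMk_left (t + ξ)).tendsto r
        filter_upwards [this.eventually hwl] with y hy
        rw [mul_add, mul_add]; linarith
      · have : Tendsto (fun τ : ℝ => (r, τ + ξ)) (𝓝 t) (𝓝 (r, t + ξ)) :=
          (by fun_prop : Continuous fun τ : ℝ => (r, τ + ξ)).tendsto t
        filter_upwards [this.eventually hwl] with y hy
        rw [mul_add, mul_add]; linarith
      · filter_upwards [d1] with y hy using hy.add_const _
      · exact (hτ.hasDerivAt.comp_add_const t ξ).fun_add dE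
      · intro k1 k2 k3
        have ht1 : t ∈ Ioo 0 t₁ := ⟨ht₀.trans ht.1, ht.2.trans_lt hT⟩
        have hr1 : r ∈ Ioo 0 r₁ := ⟨hr.1, hr.2.trans hR⟩
        have hpde := h.pde r hr1 t ht1
        rw [opF_eq d1 d2, ← k3, ← hm] at hwb
        set E := η * Real.exp (l * t) with hE
        have hE0 : 0 < E := hEpos t
        have hvw : v r t = w r (t + ξ) + s * E := by rw [hv, hwv]
        -- From above this is the assumed sign of the barrier; from below, $w=v+E$ at the touching
        -- point.
        have hw0 : 0 ≤ w r (t + ξ) := by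
          rcases sq_eq_one_iff.1 hs with h1 | h1
          · rw [hwv]; exact hnn h1 r hr' t ht'
          · have := h.nonneg r ⟨hr1.1.le, hr1.2⟩ t ⟨ht1.1.le, ht1.2⟩
            rw [hvw, h1] at this; linarith
        obtain ⟨b2, b1, b0⟩ := hK r hr' t ht'
        have hin := touching_inequality hs hm0 hr.1 hE0.le hw0 hvw k2 b2 b1 b0
        rw [← hpde] at hin
        have e1 : s * (deriv (fun τ => w r τ) (t + ξ) + s * (η * (Real.exp (l * t) * l)))
            = s * deriv (fun τ => w r τ) (t + ξ) + E * l := by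
          rw [hE]; linear_combination (η * Real.exp (l * t) * l) * hs
        rw [e1] at k1
        rw [mul_sub] at hwb
        have e2 : E * l = E * (2 * K + 2 * m * K) + E := by rw [hl]; ring
        linarith
  intro r hr t ht
  refine le_of_forall_pos_lt_add fun η hη => ?_
  have := key (η / Real.exp (l * t)) (by positivity) r hr t ht
  rwa [div_mul_cancel₀ _ (Real.exp_pos _).ne'] at this

end

section

open Set Filter Topology
open scoped ContDiff

/-! ### Bounds for the glued barriers -/

section Profiles

variable {m : ℝ} {f p C Cd Cdd : ℝ → ℝ}

theorem BryantFun.continuousOn_Ici (h : BryantFun m f p) : ContinuousOn f (Ici 0) := fun x hx =>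
  (h.contDiffAt x hx).continuousAt.continuousWithinAt

theorem BryantFun.exists_pos_le (h : BryantFun m f p) (X : ℝ) : ∃ c > 0, ∀ x ∈ Icc 0 X, c ≤ f x := by
  rcases lt_or_ge X 0 with hX | hX
  · exact ⟨1, one_pos, fun x hx => absurd (hx.1.trans hx.2) (not_le.2 hX)⟩
  obtain ⟨x₀, hx₀, hmin⟩ := (isCompact_Icc (a := (0 : ℝ)) (b := X)).exists_isMinOn ⟨0, le_rfl, hX⟩
    (h.continuousOn_Ici.mono Icc_subset_Ici_self)
  refine ⟨f x₀, ?_, fun x hx => hmin hx⟩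
  rcases eq_or_lt_of_le hx₀.1 with h0 | h0
  · rw [← h0, h.zero]; exact one_pos
  · exact h.pos _ h0

theorem BryantFun.exists_one_sub_le (h : BryantFun m f p) :
    ∃ L > 0, ∀ x, 0 ≤ x → 1 - f x ≤ L * x := by
  obtain ⟨e, he, hsub⟩ := mem_nhdsGT_iff_exists_Ioo_subset.1
    (h.slope_f.eventually (gt_mem_nhds (lt_add_one _)))
  have he : 0 < e := he
  set k := m ^ 2 / ((m + 1) * (m + 2)) + 1
  refine ⟨max (max k (1 / e)) 1, by positivity, fun x hx => ?_⟩
  have h1 : k ≤ max (max k (1 / e)) 1 := (le_max_left _ _).trans (le_max_left _ _)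
  have h2 : 1 / e ≤ max (max k (1 / e)) 1 := (le_max_right _ _).trans (le_max_left _ _)
  rcases eq_or_lt_of_le hx with h0 | h0
  · rw [← h0, h.zero]; simp
  rcases lt_or_ge x e with hxe | hxe
  · have : (1 - f x) / x < k := hsub ⟨h0, hxe⟩
    rw [div_lt_iff₀ h0] at this
    exact this.le.trans (by gcongr)
  · have h3 := h.pos x h0
    have h4 : 1 ≤ 1 / e * x := by rw [one_div_mul_eq_div, le_div_iff₀ he]; linarith
    have h5 : 1 / e * x ≤ max (max k (1 / e)) 1 * x := by gcongr
    linarith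

/-- The negative slope at the origin and $f<1$ on compact sets give a linear gap. It is what pushes
the inner lower barrier below prescribed parabolas. -/
theorem BryantFun.exists_le_one_sub (h : BryantFun m f p) (hm : 1 ≤ m) (X : ℝ) :
    ∃ c > 0, ∀ x ∈ Icc 0 X, c * x ≤ 1 - f x := by
  have hk := (bryant_kappa hm).1
  obtain ⟨e, he, hsub⟩ := mem_nhdsGT_iff_exists_Ioo_subset.1
    (h.slope_f.eventually (lt_mem_nhds (half_lt_self hk)))
  have he : 0 < e := he
  set k := m ^ 2 / ((m + 1) * (m + 2))
  obtain ⟨c, hc, hcX⟩ : ∃ c > 0, ∀ x ∈ Icc e X, c ≤ 1 - f x := by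
    rcases lt_or_ge X e with hX | hX
    · exact ⟨1, one_pos, fun x hx => absurd (hx.1.trans hx.2) (not_le.2 hX)⟩
    obtain ⟨x₀, hx₀, hmin⟩ := (isCompact_Icc (a := e) (b := X)).exists_isMinOn ⟨e, le_rfl, hX⟩
      (continuousOn_const.sub (h.continuousOn_Ici.mono fun x hx => mem_Ici.2 (he.le.trans hx.1)) :
        ContinuousOn (fun x => 1 - f x) _)
    exact ⟨1 - f x₀, by linarith [h.lt_one x₀ (he.trans_le hx₀.1)], fun x hx => hmin hx⟩
  set Y := max X 1
  have hY : 0 < Y := lt_max_of_lt_right one_pos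
  refine ⟨min (k / 2) (c / Y), by positivity, fun x hx => ?_⟩
  rcases eq_or_lt_of_le hx.1 with h0 | h0
  · rw [← h0, h.zero]; simp
  rcases lt_or_ge x e with hxe | hxe
  · have : k / 2 < (1 - f x) / x := hsub ⟨h0, hxe⟩
    rw [lt_div_iff₀ h0] at this
    refine le_trans ?_ this.le
    gcongr; exact min_le_left _ _
  · refine le_trans ?_ (hcX x ⟨hxe, hx.2⟩)
    calc min (k / 2) (c / Y) * x ≤ c / Y * Y := by
          gcongr
          · exact min_le_right _ _
          · exact hx.2.trans (le_max_left _ _)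
      _ = c := by field_simp

theorem BryantCorr.exists_le_mul (hf : BryantFun m f p) (h : BryantCorr m f p C Cd Cdd)
    (hC0 : C 0 = 0) (X : ℝ) : ∃ L > 0, ∀ x ∈ Icc 0 X, |C x| ≤ L * x := by
  obtain ⟨K, hK⟩ := h.bound X
  obtain ⟨K', hK'⟩ := hf.exists_p_bound X
  refine ⟨|K| * |K'| + 1, by positivity, fun x hx => ?_⟩
  rcases eq_or_lt_of_le hx.1 with h0 | h0
  · rw [← h0, hC0]; simp
  have h1 := (hK x ⟨h0, hx.2⟩).1
  have h2 := hK' x ⟨h0, hx.2⟩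
  have h3 := hf.p_pos x h0
  calc |C x| ≤ K * p x := h1
    _ ≤ |K| * p x := by gcongr; exact le_abs_self K
    _ ≤ |K| * (|K'| * x) := by
        gcongr; exact h2.trans (by gcongr; exact le_abs_self K')
    _ ≤ (|K| * |K'| + 1) * x := by linarith

end Profiles

theorem outP_upper {m c l : ℝ} (hm : 0 ≤ m) (hc : 0 ≤ c) (hl : 0 ≤ l) (hl1 : l ≤ 1) :
    outP m c l ≤ 3 * m * c * l := by
  have h1 : m * c * l * l ≤ m * c * l * 1 := by gcongr
  have h2 : 0 ≤ m * c ^ 2 * l ^ 2 := by positivity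
  have h3 : c ^ 2 * l ^ 3 * l ≤ c ^ 2 * l ^ 3 * 1 := by gcongr
  have h4 : 0 ≤ c ^ 2 * l ^ 3 := by positivity
  rw [outP]
  linarith

/-- The ratio `κ(ρ√t) / κ(t)` tends to `2`. -/
theorem tendsto_kap_ratio (ρ : ℝ) :
    Tendsto (fun t => 1 / (1 / 2 - kap t * Real.log ρ)) (𝓝[>] 0) (𝓝 2) := by
  have h1 : Tendsto (fun t => 1 / 2 - kap t * Real.log ρ) (𝓝[>] 0) (𝓝 (1 / 2)) := by
    have := (tendsto_kap_zero.mul_const (Real.log ρ)).const_sub (1 / 2)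
    rwa [zero_mul, sub_zero] at this
  have h2 := h1.inv₀ (by norm_num : (1 / 2 : ℝ) ≠ 0)
  simpa only [one_div, inv_inv] using h2

theorem tendsto_kap_mul_sqrt {ρ : ℝ} (hρ : 0 < ρ) :
    Tendsto (fun t => kap (ρ * Real.sqrt t)) (𝓝[>] 0) (𝓝 0) := by
  have h := tendsto_kap_zero.mul (tendsto_kap_ratio ρ)
  rw [zero_mul] at h
  refine h.congr' ?_
  filter_upwards [Ioo_mem_nhdsGT one_pos] with t ht
  rw [kap_mul_sqrt hρ ht]

/-- Admissible parameters, profiles and domains for the glued barriers. -/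
structure BarrierSetup (n : ℕ) (m : ℝ) (f p C Cd Cdd : ℝ → ℝ) (A B ε δ rs ts : ℝ) : Prop where
  hm : m = (n : ℝ) - 1
  hm1 : 1 ≤ m
  hf : BryantFun m f p
  hC : BryantCorr m f p C Cd Cdd
  hC0 : C 0 = 0
  hA : 1 ≤ A
  hB : 1 ≤ B
  hBm : m ≤ B
  hε : 0 < ε
  hε1 : 24 * m * ε < 1
  hδ : 0 < δ
  hδ1 : δ < 1 / 8
  hrs0 : 0 < rs
  hts : ts < 1
  hts0 : 0 < ts
  pair : IsGluedBarrierPair n (fun σ => f (σ ^ 2)) (fun σ => C (σ ^ 2)) A B ε δ rs ts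

namespace BarrierSetup

variable {n : ℕ} {m : ℝ} {f p C Cd Cdd : ℝ → ℝ} {A B ε δ rs ts : ℝ}

theorem eps_le (h : BarrierSetup n m f p C Cd Cdd A B ε δ rs ts) : ε ≤ 1 / 24 := by
  have h1 := h.hm1
  have h2 := h.hε1
  have h3 := h.hε
  have : 24 * 1 * ε ≤ 24 * m * ε := by gcongr
  linarith

theorem rho_pos (h : BarrierSetup n m f p C Cd Cdd A B ε δ rs ts) : 0 < rhoStar A ε :=
  rhoStar_pos (by linarith [h.hA]) h.hε

theorem sigma_pos (h : BarrierSetup n m f p C Cd Cdd A B ε δ rs ts) : 0 < sigmaStar B ε :=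
  sigmaStar_pos (by linarith [h.hB]) h.hε

theorem kC_spec (h : BarrierSetup n m f p C Cd Cdd A B ε δ rs ts) {s : ℝ} (hs : s ^ 2 = 1) :
    kC n A ε δ s ^ 2 ∈ Icc (2 / (3 * m ^ 2)) (2 / m ^ 2) ∧ 0 < kC n A ε δ s ∧
      1 / kC n A ε δ s ^ 2 = m ^ 2 * (1 + s * gammaC n A ε δ s) + s * ε / 2 :=
  kC_sq h.hm h.hm1 hs h.hε (by linarith [h.eps_le]) h.hδ h.hδ1.le

theorem isGluing (h : BarrierSetup n m f p C Cd Cdd A B ε δ rs ts) {s : ℝ} (hs : s ^ 2 = 1) {t : ℝ}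
    (ht : t ∈ Ioo 0 ts) : IsGluing s (vGlue n f C A B ε δ s)
      (vIn n (fun σ => f (σ ^ 2)) (fun σ => C (σ ^ 2)) A ε δ s) (vPar n A B ε δ s) (vOut n ε δ s)
      (fun t => sigmaStar B ε * theta t) (fun t => 3 * sigmaStar B ε * theta t)
      (fun t => rhoStar A ε * Real.sqrt t) (fun t => 3 * rhoStar A ε * Real.sqrt t) t :=
  h.pair.isGluing hs (by linarith [h.hA]) (by linarith [h.hB]) h.hε h.hts.le t ht

theorem isWeakBarrier (h : BarrierSetup n m f p C Cd Cdd A B ε δ rs ts) {s : ℝ} (hs : s ^ 2 = 1) :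
    IsWeakBarrier n s (vGlue n f C A B ε δ s) rs ts :=
  h.pair.isWeakBarrier h.hf h.hC h.hC0 hs (by linarith [h.hA]) (by linarith [h.hB]) h.hε h.hts.le

theorem inX_le (h : BarrierSetup n m f p C Cd Cdd A B ε δ rs ts) {s : ℝ} (hs : s ^ 2 = 1) {σ r t : ℝ}
    (hr : 0 ≤ r) (ht : t ∈ Ioo 0 ts) (hrσ : r ≤ σ * theta t) :
    inX (kC n A ε δ s ^ 2) (r ^ 2) t ∈ Icc 0 (2 / m ^ 2 * σ ^ 2) := by
  have ht1 : t ∈ Ioo (0 : ℝ) 1 := ⟨ht.1, ht.2.trans h.hts⟩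
  obtain ⟨hq, hk, -⟩ := h.kC_spec hs
  have hd : 0 < t * kap t := mul_pos ht.1 (kap_pos ht1)
  refine ⟨div_nonneg (by positivity) hd.le, ?_⟩
  have h1 : inX (kC n A ε δ s ^ 2) (r ^ 2) t ≤ inX (kC n A ε δ s ^ 2) ((σ * theta t) ^ 2) t := by
    rw [inX, inX]; gcongr
  refine h1.trans ?_
  rw [inX_at_scale ht1]
  gcongr
  exact hq.2

theorem le_vOut_plus (h : BarrierSetup n m f p C Cd Cdd A B ε δ rs ts) {r t : ℝ}
    (hr : r ∈ Ioo (0 : ℝ) 1) (hk : 4 * m * kap r ≤ 1) (ht : 0 ≤ t) :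
    (1 + δ) * (m / 4) * kap r ≤ vOut n ε δ 1 r t := by
  have hm1 := h.hm1
  have hδ := h.hδ
  have hε := h.hε
  have hδ1 := h.hδ1
  have hκ := kap_pos hr
  have h1 := outP_lower (m := m) (c := (1 + δ) * (m / 4)) (l := kap r) hm1 (by positivity)
    (by nlinarith) hκ.le hk
  have h2 : 0 ≤ outP m ((1 + δ) * (m / 4)) (kap r) := le_trans (by positivity) h1
  rw [vOut_eq_outBar hr, ← h.hm, one_mul, one_mul, outBar]
  have h3 : 0 ≤ (1 + ε) * (t / r ^ 2) * outP m ((1 + δ) * (m / 4)) (kap r) := by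
    have := hr.1
    positivity
  linarith

/-- For $r\le\rho\sqrt t$ one has $\kappa(r)\le\kappa(\rho\sqrt t)\approx2\kappa(t)$, and the term
$2m/\rho^2$ in $W_0$ leaves room for the approximation. -/
theorem eventually_le_vPar_plus (h : BarrierSetup n m f p C Cd Cdd A B ε δ rs ts) :
    ∀ᶠ t in 𝓝[>] (0 : ℝ), ∀ r, 0 < r → r ≤ 3 * rhoStar A ε * Real.sqrt t →
      (1 + δ) * (m / 4) * kap r ≤ vPar n A B ε δ 1 r t := by
  have hm1 := h.hm1
  have hδ := h.hδ
  have hε := h.hε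
  have hρ := h.rho_pos
  set ρ := 3 * rhoStar A ε with hρd
  have hρ0 : 0 < ρ := by positivity
  have h2 : (2 : ℝ) < 2 * (1 + 2 * m / ρ ^ 2) := by
    have : 0 < 2 * m / ρ ^ 2 := by positivity
    linarith
  have hlim : Tendsto (fun t => ρ * Real.sqrt t) (𝓝[>] 0) (𝓝 0) := by
    have := (Real.continuous_sqrt.tendsto 0).mono_left (nhdsWithin_le_nhds (s := Ioi 0))
    simpa using this.const_mul ρ
  filter_upwards [(tendsto_kap_ratio ρ).eventually (gt_mem_nhds h2), Ioo_mem_nhdsGT one_pos,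
    hlim.eventually (gt_mem_nhds one_pos)] with t ht1 ht ht2 r hr hrρ
  have hκ := kap_pos ht
  have hκr : kap r ≤ kap t * (2 * (1 + 2 * m / ρ ^ 2)) := by
    refine (kap_mono hr hrρ ht2).trans ?_
    rw [kap_mul_sqrt hρ0 ht]; gcongr
  have hz : 1 / ρ ^ 2 ≤ t / r ^ 2 := by
    rw [div_le_div_iff₀ (by positivity) (by positivity), one_mul]
    calc r ^ 2 ≤ (ρ * Real.sqrt t) ^ 2 := by gcongr
      _ = t * ρ ^ 2 := by rw [mul_pow, Real.sq_sqrt ht.1.le]; ring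
  rw [vPar_eq_parBar ht, ← h.hm, one_add_gammaC h.hm, one_mul, one_mul, one_mul, parBar]
  have hg := gammaG_nonneg (A := A) hm1 hε
  have h3 : (1 + δ) * (m / 4) * kap r ≤ (1 + δ) * (m / 4) * (kap t * (2 * (1 + 2 * m / ρ ^ 2))) := by
    gcongr
  have h4 : (1 + δ) * 1 * kap t * (m / 2 * (1 + 2 * m * (1 / ρ ^ 2)))
      ≤ (1 + δ) * (1 + gammaG m A ε) * kap t * (m / 2 * (1 + 2 * m * (t / r ^ 2))) := by
    gcongr; linarith
  have h5 : 0 ≤ B ^ 2 * kap t ^ 2 * (t / r ^ 2) ^ 2 := by positivity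
  have e : (1 + δ) * (m / 4) * (kap t * (2 * (1 + 2 * m / ρ ^ 2)))
      = (1 + δ) * 1 * kap t * (m / 2 * (1 + 2 * m * (1 / ρ ^ 2))) := by ring
  linarith

theorem le_vIn (h : BarrierSetup n m f p C Cd Cdd A B ε δ rs ts) {s r t : ℝ} (hs : s ^ 2 = 1)
    (ht : t ∈ Ioo 0 ts) : f (inX (kC n A ε δ s ^ 2) (r ^ 2) t)
      ≤ vIn n (fun σ => f (σ ^ 2)) (fun σ => C (σ ^ 2)) A ε δ s r t := by
  have ht1 : t ∈ Ioo (0 : ℝ) 1 := ⟨ht.1, ht.2.trans h.hts⟩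
  obtain ⟨-, hk, -⟩ := h.kC_spec hs
  have hκ := kap_pos ht1
  rw [vIn_eq_inBar ht1, inBar]
  have hX : 0 ≤ inX (kC n A ε δ s ^ 2) (r ^ 2) t :=
    div_nonneg (by positivity) (mul_pos ht.1 hκ).le
  have hCn : 0 ≤ C (inX (kC n A ε δ s ^ 2) (r ^ 2) t) := by
    rcases eq_or_lt_of_le hX with h0 | h0
    · rw [← h0, h.hC0]
    · exact (h.hC.pos _ h0).le
  have hse : 0 ≤ 1 - s * ε := by
    have := h.eps_le
    have := h.hε
    rcases sq_eq_one_iff.1 hs with rfl | rfl <;> linarith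
  have : 0 ≤ (1 - s * ε) * ((kap t + kap t ^ 2) / 2) *
      (C (inX (kC n A ε δ s ^ 2) (r ^ 2) t) / kC n A ε δ s ^ 2) := by positivity
  linarith

/-- The upper barrier lies above `(1 + δ) v₀`. -/
theorem eventually_le_plus (h : BarrierSetup n m f p C Cd Cdd A B ε δ rs ts) {R : ℝ} (hR1 : R < 1)
    (hR : ∀ r ∈ Ioc 0 R, 4 * m * kap r ≤ 1) :
    ∀ᶠ t in 𝓝[>] (0 : ℝ), ∀ r ∈ Ioc 0 R, (1 + δ) * (m / 4) * kap r ≤ vGlue n f C A B ε δ 1 r t := by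
  have hm1 := h.hm1
  have hδ := h.hδ
  have hs : (1 : ℝ) ^ 2 = 1 := one_pow 2
  obtain ⟨c, hc, hcf⟩ := h.hf.exists_pos_le (2 / m ^ 2 * (3 * sigmaStar B ε) ^ 2)
  have hρ := h.rho_pos
  have hlim : Tendsto (fun t => rhoStar A ε * Real.sqrt t) (𝓝[>] 0) (𝓝 0) := by
    have := (Real.continuous_sqrt.tendsto 0).mono_left (nhdsWithin_le_nhds (s := Ioi 0))
    simpa using this.const_mul (rhoStar A ε)
  have hkl : Tendsto (fun t => (1 + δ) * (m / 4) * kap (rhoStar A ε * Real.sqrt t)) (𝓝[>] 0) (𝓝 0) := by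
    simpa using (tendsto_kap_mul_sqrt hρ).const_mul ((1 + δ) * (m / 4))
  filter_upwards [h.eventually_le_vPar_plus, hkl.eventually (gt_mem_nhds hc),
    hlim.eventually (gt_mem_nhds one_pos), Ioo_mem_nhdsGT h.hts0] with t hp hk hl ht r hr
  have hg := h.isGluing hs ht
  have bi : r ≤ 3 * sigmaStar B ε * theta t → (1 + δ) * (m / 4) * kap r
      ≤ vIn n (fun σ => f (σ ^ 2)) (fun σ => C (σ ^ 2)) A ε δ 1 r t := fun hle => by
    have h1 := hcf _ (h.inX_le hs hr.1.le ht hle)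
    have h2 : kap r ≤ kap (rhoStar A ε * Real.sqrt t) := kap_mono hr.1 (hle.trans hg.bc.le) hl
    have h3 : (1 + δ) * (m / 4) * kap r ≤ (1 + δ) * (m / 4) * kap (rhoStar A ε * Real.sqrt t) := by
      gcongr
    exact (h3.trans hk.le).trans (h1.trans (h.le_vIn hs ht))
  have bp := fun hle => hp r hr.1 hle
  have bo := h.le_vOut_plus (t := t) ⟨hr.1, hr.2.trans_lt hR1⟩ (hR r hr) ht.1.le
  have ab := hg.ab
  have bc := hg.bc
  have cd := hg.cd
  rcases lt_or_ge r (sigmaStar B ε * theta t) with h1 | h1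
  · rw [hg.eq_i _ h1]; exact bi (by linarith)
  rcases lt_or_ge r (3 * sigmaStar B ε * theta t) with h2 | h2
  · have := hg.eq_ip _ h1 h2
    rw [one_mul, one_mul, one_mul] at this
    rw [this]; exact le_min (bi h2.le) (bp (by linarith))
  rcases lt_or_ge r (rhoStar A ε * Real.sqrt t) with h3 | h3
  · rw [hg.eq_p _ h2 h3]; exact bp (by linarith)
  rcases lt_or_ge r (3 * rhoStar A ε * Real.sqrt t) with h4 | h4
  · have := hg.eq_po _ h3 h4
    rw [one_mul, one_mul, one_mul] at this
    rw [this]; exact le_min (bp h4.le) bo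
  · rw [hg.eq_o _ h4]; exact bo

/-- Near the tip the upper barrier is bounded from below by a parabola, uniformly in time. -/
theorem exists_parabola_le_plus (h : BarrierSetup n m f p C Cd Cdd A B ε δ rs ts) {t₀ : ℝ}
    (ht₀ : t₀ ∈ Ioo 0 ts) : ∃ b > 0, ∃ r₀ > 0, ∀ r ∈ Icc 0 r₀, ∀ t ∈ Ico t₀ ts,
      1 - b * r ^ 2 ≤ vGlue n f C A B ε δ 1 r t := by
  have hs : (1 : ℝ) ^ 2 = 1 := one_pow 2
  obtain ⟨L, hL, hLf⟩ := h.hf.exists_one_sub_le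
  obtain ⟨-, hk, -⟩ := h.kC_spec hs
  have ht₀1 : t₀ ∈ Ioo (0 : ℝ) 1 := ⟨ht₀.1, ht₀.2.trans h.hts⟩
  have hd : 0 < t₀ * kap t₀ := mul_pos ht₀.1 (kap_pos ht₀1)
  have hσ := h.sigma_pos
  refine ⟨L * (kC n A ε δ 1 ^ 2 / (t₀ * kap t₀)), by positivity, sigmaStar B ε * theta t₀ / 2,
    by have := theta_pos ht₀1; positivity, fun r hr t ht => ?_⟩
  have ht' : t ∈ Ioo 0 ts := ⟨ht₀.1.trans_le ht.1, ht.2⟩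
  have ht1 : t ∈ Ioo (0 : ℝ) 1 := ⟨ht'.1, ht.2.trans h.hts⟩
  have hκ := kap_mono ht₀.1 ht.1 ht1.2
  have hκ0 := kap_pos ht₀1
  have hdd : t₀ * kap t₀ ≤ t * kap t := by
    have := ht.1
    have := ht'.1
    gcongr
  have hθ : theta t₀ ≤ theta t := by
    refine le_of_pow_le_pow_left₀ two_ne_zero (theta_pos ht1).le ?_
    rw [theta_sq_eq ht₀1, theta_sq_eq ht1]; exact hdd
  have hlt : r < sigmaStar B ε * theta t := by
    have h1 : sigmaStar B ε * theta t₀ ≤ sigmaStar B ε * theta t := by gcongr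
    have h2 : 0 < sigmaStar B ε * theta t₀ := mul_pos hσ (theta_pos ht₀1)
    linarith [hr.2]
  rw [(h.isGluing hs ht').eq_i _ hlt]
  refine le_trans ?_ (h.le_vIn hs ht')
  have hX : 0 ≤ inX (kC n A ε δ 1 ^ 2) (r ^ 2) t :=
    div_nonneg (by positivity) (hd.le.trans hdd)
  have h1 := hLf _ hX
  have h2 : L * inX (kC n A ε δ 1 ^ 2) (r ^ 2) t ≤ L * (kC n A ε δ 1 ^ 2 / (t₀ * kap t₀)) * r ^ 2 := by
    rw [inX, mul_assoc]
    gcongr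
    rw [div_mul_eq_mul_div]
    gcongr
  linarith

end BarrierSetup

end

/-! ### Upper bounds for the lower barrier. -/

section

open Set Filter Topology
open scoped ContDiff

namespace BarrierSetup

variable {n : ℕ} {m : ℝ} {f p C Cd Cdd : ℝ → ℝ} {A B ε δ rs ts : ℝ}

theorem vOut_minus_le (h : BarrierSetup n m f p C Cd Cdd A B ε δ rs ts) {r t : ℝ}
    (hr : r ∈ Ioo (0 : ℝ) 1) (hk : 4 * m * kap r ≤ 1) (ht : 0 ≤ t) :
    vOut n ε δ (-1) r t ≤ (1 - δ) * (m / 4) * kap r * (1 + 3 * m * (t / r ^ 2)) := by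
  have hm1 := h.hm1
  have hδ := h.hδ
  have hε := h.hε
  have hε1 := h.eps_le
  have hδ1 := h.hδ1
  have hκ := kap_pos hr
  have hc : 0 ≤ (1 - δ) * (m / 4) := mul_nonneg (by linarith) (by linarith)
  have h1 := outP_upper (m := m) (l := kap r) (by linarith) hc hκ.le (by nlinarith)
  rw [vOut_eq_outBar hr, ← h.hm, outBar]
  have hr0 := hr.1
  have h2 : (1 + -1 * ε) * (t / r ^ 2) * outP m ((1 - δ) * (m / 4)) (kap r)
      ≤ (1 + -1 * ε) * (t / r ^ 2) * (3 * m * ((1 - δ) * (m / 4)) * kap r) := by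
    have : 0 ≤ (1 + -1 * ε) * (t / r ^ 2) := mul_nonneg (by linarith) (by positivity)
    gcongr
  have h3 : (1 + -1 * ε) * (t / r ^ 2) * (3 * m * ((1 - δ) * (m / 4)) * kap r)
      ≤ 1 * (t / r ^ 2) * (3 * m * ((1 - δ) * (m / 4)) * kap r) := by
    gcongr; linarith
  have e : 1 + -1 * δ = 1 - δ := by ring
  rw [e]
  linarith

/-- From $r\ge\sigma_*\theta$ follows $\kappa t/r^2\le\varepsilon/B^2$; with $m\le B$ the singular
part $m^2\kappa t/r^2$ of the barrier is then at most $\varepsilon$. -/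
theorem vPar_minus_le (h : BarrierSetup n m f p C Cd Cdd A B ε δ rs ts) {r t : ℝ}
    (ht : t ∈ Ioo 0 ts) (hr : sigmaStar B ε * theta t ≤ r) (hk : 4 * m * kap t ≤ 1) :
    vPar n A B ε δ (-1) r t ≤ 1 / 2 := by
  have hm1 := h.hm1
  have hε := h.hε
  have hB := h.hB
  have ht1 : t ∈ Ioo (0 : ℝ) 1 := ⟨ht.1, ht.2.trans h.hts⟩
  have hκ := kap_pos ht1
  have hσ := h.sigma_pos
  have hr0 : 0 < r := lt_of_lt_of_le (mul_pos hσ (theta_pos ht1)) hr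
  obtain ⟨a1, a2⟩ := one_add_gammaC_mem (A := A) (s := -1) h.hm hm1 (by norm_num) hε
    (by linarith [h.eps_le]) h.hδ h.hδ1.le
  rw [vPar_eq_parBar ht1, ← h.hm, parBar]
  set a := 1 + -1 * gammaC n A ε δ (-1)
  have hz : kap t * (t / r ^ 2) ≤ ε / B ^ 2 := by
    have h1 : (sigmaStar B ε * theta t) ^ 2 ≤ r ^ 2 := by
      have := theta_pos ht1
      gcongr
    rw [mul_pow, sigmaStar_sq hε, theta_sq_eq ht1] at h1
    rw [← mul_div_assoc, div_le_div_iff₀ (by positivity) (by positivity)]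
    rw [div_mul_eq_mul_div, div_le_iff₀ hε] at h1
    linarith
  have h2 : m ^ 2 * (ε / B ^ 2) ≤ ε := by
    rw [← mul_div_assoc, div_le_iff₀ (by positivity), mul_comm]
    have := h.hBm
    gcongr
  have h3 : m ^ 2 * (kap t * (t / r ^ 2)) ≤ 1 / 24 := by
    have : m ^ 2 * (kap t * (t / r ^ 2)) ≤ m ^ 2 * (ε / B ^ 2) := by gcongr
    linarith [h.eps_le]
  have h4 : 0 ≤ B ^ 2 * kap t ^ 2 * (t / r ^ 2) ^ 2 := by positivity
  have e : a * kap t * (m / 2 * (1 + 2 * m * (t / r ^ 2)))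
      = a * (m * kap t / 2 + m ^ 2 * (kap t * (t / r ^ 2))) := by ring
  have h5 : a * (m * kap t / 2 + m ^ 2 * (kap t * (t / r ^ 2))) ≤ 81 / 64 * (1 / 8 + 1 / 24) := by
    have := ht.1
    have : m * kap t / 2 ≤ 1 / 8 := by linarith
    gcongr
  rw [e]
  linarith

/-- In the inner variable $X=qr^2/(t\kappa)$ the gap $1-f\ge cX$ has coefficient
$cq/(t\kappa)\to\infty$ in $r^2$, while the correction term costs only $O(\kappa X)$. -/
theorem eventually_vIn_minus_le (h : BarrierSetup n m f p C Cd Cdd A B ε δ rs ts) (K : ℝ) :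
    ∀ᶠ t in 𝓝[>] (0 : ℝ), ∀ r, 0 ≤ r → r ≤ 3 * sigmaStar B ε * theta t →
      vIn n (fun σ => f (σ ^ 2)) (fun σ => C (σ ^ 2)) A ε δ (-1) r t ≤ 1 - K * r ^ 2 := by
  have hm1 := h.hm1
  have hs : (-1 : ℝ) ^ 2 = 1 := by norm_num
  obtain ⟨c, hc, hcf⟩ := h.hf.exists_le_one_sub hm1 (2 / m ^ 2 * (3 * sigmaStar B ε) ^ 2)
  obtain ⟨L, hL, hLC⟩ := h.hC.exists_le_mul h.hf h.hC0 (2 / m ^ 2 * (3 * sigmaStar B ε) ^ 2)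
  obtain ⟨-, hk, -⟩ := h.kC_spec hs
  set q := kC n A ε δ (-1) ^ 2 with hq
  have hq0 : 0 < q := by positivity
  have l1 : Tendsto (fun t => 2 * (L / q) * kap t) (𝓝[>] 0) (𝓝 0) := by
    simpa using tendsto_kap_zero.const_mul (2 * (L / q))
  have l2 : Tendsto (fun t => 2 * |K| * (t * kap t)) (𝓝[>] 0) (𝓝 0) := by
    have : Tendsto (fun t : ℝ => t) (𝓝[>] 0) (𝓝 0) := nhdsWithin_le_nhds
    simpa using (this.mul tendsto_kap_zero).const_mul (2 * |K|)
  filter_upwards [l1.eventually (gt_mem_nhds (half_pos hc)),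
    l2.eventually (gt_mem_nhds (mul_pos hc hq0)), tendsto_kap_zero.eventually (gt_mem_nhds one_pos),
    Ioo_mem_nhdsGT h.hts0] with t e1 e2 e3 ht r hr hrσ
  have ht1 : t ∈ Ioo (0 : ℝ) 1 := ⟨ht.1, ht.2.trans h.hts⟩
  have hκ := kap_pos ht1
  have hXm := h.inX_le hs hr ht hrσ
  rw [vIn_eq_inBar ht1, inBar, ← hq]
  rw [← hq] at hXm
  have hXd : inX q (r ^ 2) t = q * r ^ 2 / (t * kap t) := rfl
  set X := inX q (r ^ 2) t
  have h1 := hcf X hXm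
  have h2 := (le_abs_self _).trans (hLC X hXm)
  have hX0 := hXm.1
  have h3 : (1 - -1 * ε) * ((kap t + kap t ^ 2) / 2) * (C X / q) ≤ 2 * kap t * (L * X / q) := by
    have hε1 := h.eps_le
    have hε := h.hε
    have k1 : kap t ^ 2 ≤ kap t := by nlinarith
    have k2 : (1 - -1 * ε) * ((kap t + kap t ^ 2) / 2) ≤ 2 * kap t := by nlinarith
    have k3 : 0 ≤ (1 - -1 * ε) * ((kap t + kap t ^ 2) / 2) :=
      mul_nonneg (by linarith) (by positivity)
    calc (1 - -1 * ε) * ((kap t + kap t ^ 2) / 2) * (C X / q)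
        ≤ (1 - -1 * ε) * ((kap t + kap t ^ 2) / 2) * (L * X / q) := by gcongr
      _ ≤ 2 * kap t * (L * X / q) := by gcongr
  have h4 : 2 * kap t * (L * X / q) ≤ c / 2 * X := by
    have : 2 * (L / q) * kap t * X ≤ c / 2 * X := by gcongr
    have e : 2 * kap t * (L * X / q) = 2 * (L / q) * kap t * X := by ring
    linarith
  have h5 : K * r ^ 2 ≤ c / 2 * X := by
    have hd : 0 < t * kap t := mul_pos ht.1 hκ
    have h6 : |K| * (t * kap t) * r ^ 2 ≤ c * q / 2 * r ^ 2 := by gcongr; linarith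
    have h7 : |K| * r ^ 2 ≤ c / 2 * X := by
      rw [hXd, ← mul_div_assoc, le_div_iff₀ hd]; linarith
    have : K * r ^ 2 ≤ |K| * r ^ 2 := by gcongr; exact le_abs_self K
    linarith
  linarith

/-- Away from the tip the lower barrier lies below `(1 - δ/2) v₀` for small times. -/
theorem eventually_minus_le (h : BarrierSetup n m f p C Cd Cdd A B ε δ rs ts) {a R : ℝ} (ha : 0 < a)
    (hR1 : R < 1) (hR : ∀ r ∈ Ioc 0 R, 4 * m * kap r ≤ 1) :
    ∀ᶠ t in 𝓝[>] (0 : ℝ), ∀ r ∈ Icc a R,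
      vGlue n f C A B ε δ (-1) r t ≤ (1 - δ / 2) * (m / 4) * kap r := by
  have hm1 := h.hm1
  have hδ := h.hδ
  have hδ1 := h.hδ1
  have hlim : Tendsto (fun t => 3 * rhoStar A ε * Real.sqrt t) (𝓝[>] 0) (𝓝 0) := by
    have := (Real.continuous_sqrt.tendsto 0).mono_left (nhdsWithin_le_nhds (s := Ioi 0))
    simpa using this.const_mul (3 * rhoStar A ε)
  have l2 : Tendsto (fun t => 3 * m * (t / a ^ 2)) (𝓝[>] 0) (𝓝 0) := by
    have : Tendsto (fun t : ℝ => t) (𝓝[>] 0) (𝓝 0) := nhdsWithin_le_nhds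
    simpa using (this.div_const (a ^ 2)).const_mul (3 * m)
  filter_upwards [hlim.eventually (gt_mem_nhds ha), l2.eventually (gt_mem_nhds (half_pos hδ)),
    Ioo_mem_nhdsGT h.hts0] with t e1 e2 ht r hr
  have hr0 : 0 < r := ha.trans_le hr.1
  have hr1 : r ∈ Ioo (0 : ℝ) 1 := ⟨hr0, hr.2.trans_lt hR1⟩
  have hκ := kap_pos hr1
  have ht0 := ht.1
  rw [(h.isGluing (by norm_num) ht).eq_o r (e1.le.trans hr.1)]
  refine (h.vOut_minus_le hr1 (hR r ⟨hr0, hr.2⟩) ht.1.le).trans ?_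
  have h1 : 3 * m * (t / r ^ 2) ≤ δ / 2 := by
    refine le_trans ?_ e2.le
    gcongr; exact hr.1
  have h2 : (1 - δ) * (m / 4) * kap r * (1 + 3 * m * (t / r ^ 2))
      ≤ (1 - δ) * (m / 4) * kap r * (1 + δ / 2) := by
    have : 0 ≤ (1 - δ) * (m / 4) * kap r :=
      mul_nonneg (mul_nonneg (by linarith) (by linarith)) hκ.le
    gcongr
  refine h2.trans ?_
  have h3 : 0 ≤ m / 4 * kap r := by positivity
  have h4 : (1 - δ) * (1 + δ / 2) ≤ 1 - δ / 2 := by nlinarith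
  calc (1 - δ) * (m / 4) * kap r * (1 + δ / 2) = (1 - δ) * (1 + δ / 2) * (m / 4 * kap r) := by ring
    _ ≤ (1 - δ / 2) * (m / 4 * kap r) := by gcongr
    _ = _ := by ring

/-- For small times the lower barrier lies below any given parabola near the tip. -/
theorem eventually_minus_le_parabola (h : BarrierSetup n m f p C Cd Cdd A B ε δ rs ts) {R : ℝ}
    (hR1 : R < 1) (hR : ∀ r ∈ Ioc 0 R, 4 * m * kap r ≤ 1) (K : ℝ) :
    ∀ᶠ t in 𝓝[>] (0 : ℝ), ∀ r ∈ Icc 0 R,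
      vGlue n f C A B ε δ (-1) r t ≤ max (1 - K * r ^ 2) (1 / 2) := by
  have hm1 := h.hm1
  have hs : (-1 : ℝ) ^ 2 = 1 := by norm_num
  have l1 : Tendsto (fun t => 4 * m * kap t) (𝓝[>] 0) (𝓝 0) := by
    simpa using tendsto_kap_zero.const_mul (4 * m)
  filter_upwards [h.eventually_vIn_minus_le K, l1.eventually (gt_mem_nhds one_pos),
    Ioo_mem_nhdsGT h.hts0] with t bi e1 ht r hr
  have hg := h.isGluing hs ht
  have ht1 : t ∈ Ioo (0 : ℝ) 1 := ⟨ht.1, ht.2.trans h.hts⟩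
  have bi' := fun hle => (bi r hr.1 hle).trans (le_max_left _ (1 / 2))
  have bp := fun hle => (h.vPar_minus_le (r := r) ht hle e1.le).trans
    (le_max_right (1 - K * r ^ 2) _)
  have bo : rhoStar A ε * Real.sqrt t ≤ r → vOut n ε δ (-1) r t ≤ max (1 - K * r ^ 2) (1 / 2) := by
    intro hle
    refine le_trans ?_ (le_max_right _ _)
    have hρ : 0 < rhoStar A ε * Real.sqrt t := mul_pos h.rho_pos (Real.sqrt_pos.2 ht.1)
    have hr0 : 0 < r := hρ.trans_le hle
    have hr1 : r ∈ Ioo (0 : ℝ) 1 := ⟨hr0, hr.2.trans_lt hR1⟩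
    have hκ := kap_pos hr1
    have hk := hR r ⟨hr0, hr.2⟩
    refine (h.vOut_minus_le hr1 hk ht.1.le).trans ?_
    have h1 : t / r ^ 2 ≤ ε := by
      have h2 : (rhoStar A ε * Real.sqrt t) ^ 2 ≤ r ^ 2 := by gcongr
      rw [mul_pow, rhoStar_sq h.hε, Real.sq_sqrt ht.1.le, div_mul_eq_mul_div, div_le_iff₀ h.hε] at h2
      rw [div_le_iff₀ (by positivity)]
      have hA := h.hA
      have h3 : 1 * t ≤ A ^ 2 * t := by
        have := ht.1
        gcongr
        exact one_le_pow₀ hA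
      linarith
    have h2 : 3 * m * (t / r ^ 2) ≤ 1 := by
      have : 3 * m * (t / r ^ 2) ≤ 3 * m * ε := by gcongr
      linarith [h.hε1, mul_pos (by linarith : 0 < m) h.hε]
    have h3 : (1 - δ) * (m / 4) * kap r ≤ 1 / 16 := by
      have : (1 - δ) * (m / 4 * kap r) ≤ 1 * (m / 4 * kap r) := by
        gcongr; linarith [h.hδ]
      linarith
    have h4 : 0 ≤ 1 + 3 * m * (t / r ^ 2) := by
      have := ht.1
      positivity
    calc (1 - δ) * (m / 4) * kap r * (1 + 3 * m * (t / r ^ 2)) ≤ 1 / 16 * (1 + 1) := by gcongr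
      _ ≤ 1 / 2 := by norm_num
  have ab := hg.ab
  have bc := hg.bc
  have cd := hg.cd
  have hmn : ∀ {x y z w : ℝ}, -1 * x = min (-1 * y) (-1 * z) → y ≤ w → z ≤ w → x ≤ w := by
    intro x y z w hx hy hz
    have : -w ≤ min (-1 * y) (-1 * z) := le_min (by linarith) (by linarith)
    linarith
  rcases lt_or_ge r (sigmaStar B ε * theta t) with h1 | h1
  · rw [hg.eq_i _ h1]; exact bi' (by linarith)
  rcases lt_or_ge r (3 * sigmaStar B ε * theta t) with h2 | h2
  · exact hmn (hg.eq_ip _ h1 h2) (bi' h2.le) (bp h1)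
  rcases lt_or_ge r (rhoStar A ε * Real.sqrt t) with h3 | h3
  · rw [hg.eq_p _ h2 h3]; exact bp h1
  rcases lt_or_ge r (3 * rhoStar A ε * Real.sqrt t) with h4 | h4
  · exact hmn (hg.eq_po _ h3 h4) (bp h1) (bo h3)
  · rw [hg.eq_o _ h4]; exact bo h3

end BarrierSetup

end

section

open Set Filter Topology
open scoped ContDiff

/-! ### Solutions lie between the glued barriers -/

section Bounds

variable {n : ℕ} {m : ℝ} {f p C Cd Cdd : ℝ → ℝ} {A B ε δ rs ts : ℝ}
variable {r₁ t₁ : ℝ} {v v1 v2 vt : ℝ → ℝ → ℝ}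

theorem exists_Ioo_of_eventually {P : ℝ → Prop} (h : ∀ᶠ t in 𝓝[>] (0 : ℝ), P t) :
    ∃ u > 0, ∀ t ∈ Ioo 0 u, P t := by
  obtain ⟨u, hu, hsub⟩ := mem_nhdsGT_iff_exists_Ioo_subset.1 h
  exact ⟨u, hu, fun t ht => hsub ht⟩

theorem IsWeakBarrier.tendsto_time {s : ℝ} {W : ℝ → ℝ → ℝ} (hW : IsWeakBarrier n s W rs ts) {r t c : ℝ}
    (hr : r ∈ Icc 0 rs) (ht : t ∈ Ioo 0 ts) :
    Tendsto (fun ξ => W r (t + c * ξ)) (𝓝[>] 0) (𝓝 (W r t)) := by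
  have h1 : Tendsto (fun ξ : ℝ => t + c * ξ) (𝓝[>] 0) (𝓝 t) := by
    have : Tendsto (fun ξ : ℝ => ξ) (𝓝[>] 0) (𝓝 0) := nhdsWithin_le_nhds
    simpa using (this.const_mul c).const_add t
  have h2 : ∀ᶠ ξ in 𝓝[>] (0 : ℝ), t + c * ξ ∈ Ioo 0 ts := h1.eventually (Ioo_mem_nhds ht.1 ht.2)
  exact (hW.cont (r, t) ⟨hr, ht⟩).tendsto.comp (tendsto_nhdsWithin_iff.2
    ⟨(tendsto_const_nhds (x := r)).prodMk_nhds h1, h2.mono fun ξ hξ => ⟨hr, hξ⟩⟩)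

/-- Compare $v$ with the barrier delayed by $\xi$. At time $\xi+\tau$ the delayed barrier has age
$\tau\to0$, so near the tip it lies below the Taylor parabola $1-Kr^2$ of $v$, and elsewhere below
$(1-\delta/2)v_0\le v$. Letting $\xi\to0$ removes the delay. -/
theorem SolData.minus_le (h : SolData m r₁ t₁ v v1 v2 vt)
    (hb : BarrierSetup n m f p C Cd Cdd A B ε δ rs ts) (hr₁ : 0 < r₁) (ht₁ : 0 < t₁)
    (hi : IsCuspInitial m (fun r => v r 0)) :
    ∃ R₀ > 0, ∀ R ∈ Ioc 0 R₀, ∃ T > 0, ∀ r ∈ Icc 0 R, ∀ t ∈ Ioc 0 T,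
      vGlue n f C A B ε δ (-1) r t ≤ v r t := by
  have hm1 := hb.hm1
  have hδ := hb.hδ
  have hδ1 := hb.hδ1
  have hs : (-1 : ℝ) ^ 2 = 1 := by norm_num
  have hW := hb.isWeakBarrier hs
  obtain ⟨R₁, hR₁, -, hlow⟩ := h.lower_bound hm1 hr₁ ht₁ hi (δ := δ / 2) (by linarith) (by linarith)
  obtain ⟨Rk, hRk, hRkv⟩ := exists_kap_le (l := 1 / (4 * m)) (by positivity)
  refine ⟨min R₁ (min Rk rs), lt_min hR₁.1 (lt_min hRk.1 hb.hrs0), fun R hR => ?_⟩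
  have hRR₁ : R ≤ R₁ := hR.2.trans (min_le_left _ _)
  have hRRk : R ≤ Rk := hR.2.trans ((min_le_right _ _).trans (min_le_left _ _))
  have hRrs : R ≤ rs := hR.2.trans ((min_le_right _ _).trans (min_le_right _ _))
  have hR1 : R < 1 := hRRk.trans_lt hRk.2
  have hRr₁ : R < r₁ := hRR₁.trans_lt hR₁.2
  have hRκ : ∀ r ∈ Ioc 0 R, 4 * m * kap r ≤ 1 := fun r hr => by
    have := hRkv r hr.1 (hr.2.trans hRRk)
    rw [le_div_iff₀ (by positivity)] at this
    linarith
  obtain ⟨T₁, hT₁, hT₁v⟩ := hlow R ⟨hR.1, hRR₁⟩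
  obtain ⟨u, hu, huv⟩ := exists_Ioo_of_eventually (hb.eventually_minus_le hR.1 hR1 hRκ)
  set T := min T₁ (min (u / 2) (ts / 2)) with hT
  have hT0 : 0 < T := lt_min hT₁.1 (lt_min (by linarith) (by linarith [hb.hts0]))
  have hTT₁ : T ≤ T₁ := min_le_left _ _
  have hTu : T ≤ u / 2 := (min_le_right _ _).trans (min_le_left _ _)
  have hTts : T ≤ ts / 2 := (min_le_right _ _).trans (min_le_right _ _)
  have hTt₁ : T < t₁ := hTT₁.trans_lt hT₁.2
  have hts0 := hb.hts0
  have htip : ∀ t ∈ Ioc 0 T, v 0 t = 1 ∧ v1 0 t = 0 := fun t ht =>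
    h.tip hm1 hr₁ (c := (1 - δ / 2) * (m / 4)) (R := R) ⟨ht.1, ht.2.trans_lt hTt₁⟩
      (mul_pos (by linarith) (by linarith)) hR.1
      fun r hr => hT₁v r hr t ⟨ht.1.le, ht.2.trans hTT₁⟩
  have key : ∀ ξ ∈ Ioo 0 T, ∀ r ∈ Icc 0 R, ∀ t ∈ Ioc ξ T,
      vGlue n f C A B ε δ (-1) r (t - ξ) ≤ v r t := by
    intro ξ hξ r hr t ht
    obtain ⟨K, hK0, hK⟩ := h.exists_taylor_bound (R := R) (t₀ := ξ) (T := T) hRr₁ hξ.1 hTt₁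
      fun t ht => htip t ⟨hξ.1.trans_le ht.1, ht.2⟩
    -- For $y\le a$ one has $Ky^2\le1/2$, so the maximum in `eventually_minus_le_parabola` is the
    -- parabola itself.
    set a := 1 / (2 * K + 2) with ha
    have ha0 : 0 < a := by positivity
    have ha1 : a ≤ 1 := by rw [ha, div_le_one (by positivity)]; linarith
    have hKa : K * a ≤ 1 / 2 := by
      rw [ha, mul_one_div, div_le_div_iff₀ (by positivity) (by norm_num)]; linarith
    obtain ⟨τ, ⟨e1, e2⟩, e3⟩ := ((hb.eventually_minus_le ha0 hR1 hRκ).and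
      (hb.eventually_minus_le_parabola hR1 hRκ K)).and
        (Ioo_mem_nhdsGT (show 0 < t - ξ by linarith [ht.1])) |>.exists
    have hτT : ξ + τ ≤ T := by linarith [e3.2, ht.2]
    have e4 : ξ + τ + -ξ = τ := by ring
    have hmain := h.le_weakBarrier hb.hm (by linarith) hs hW (R := R) (t₀ := ξ + τ) (T := T) (ξ := -ξ)
      hRr₁ hRrs (by linarith [hξ.1, e3.1]) hTt₁ (by rw [e4]; exact e3.1) (by linarith [hξ.1])
      (fun h1 => absurd h1 (by norm_num))
      (fun t ht => htip t ⟨by linarith [hξ.1, e3.1, ht.1], ht.2⟩) ?_ ?_ r hr t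
      ⟨by linarith [e3.2], ht.2⟩
    · rw [← sub_eq_add_neg] at hmain
      linarith
    · intro y hy
      rw [e4]
      have hTl : ξ + τ ∈ Icc ξ T := ⟨by linarith [e3.1], hτT⟩
      rcases le_total y a with hya | hya
      · have k1 := e2 y hy
        have k2 := (abs_le.1 (hK y hy _ hTl).2.2).1
        have k3 : K * y ^ 2 ≤ 1 / 2 := by
          have hy0 := hy.1
          calc K * y ^ 2 ≤ K * a ^ 2 := by gcongr
            _ ≤ K * a := by
                rw [sq]; gcongr; nlinarith
            _ ≤ _ := hKa
        rw [max_eq_left (by linarith)] at k1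
        linarith
      · have k1 := e1 y ⟨hya, hy.2⟩
        have k2 := hT₁v y ⟨ha0.trans_le hya, hy.2⟩ (ξ + τ)
          ⟨by linarith [hξ.1, e3.1], hτT.trans hTT₁⟩
        linarith
    · intro t' ht'
      have k1 := huv (t' + -ξ) ⟨by linarith [ht'.1, e3.1], by linarith [ht'.2, hξ.1]⟩ R
        ⟨le_rfl, le_rfl⟩
      have k2 := hT₁v R ⟨hR.1, le_rfl⟩ t' ⟨by linarith [ht'.1, e3.1, hξ.1], ht'.2.trans hTT₁⟩
      linarith
  refine ⟨T, hT0, fun r hr t ht => ?_⟩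
  have hlim := hW.tendsto_time (c := -1) (r := r) (t := t) ⟨hr.1, hr.2.trans hRrs⟩
    ⟨ht.1, by linarith [ht.2]⟩
  refine le_of_tendsto hlim ?_
  filter_upwards [Ioo_mem_nhdsGT ht.1] with ξ hξ
  have := key ξ ⟨hξ.1, hξ.2.trans_le ht.2⟩ r hr t ⟨hξ.2, ht.2⟩
  rwa [neg_one_mul, ← sub_eq_add_neg]

/-- Compare $v$ with the barrier advanced by $\xi$, which lies above some parabola $1-br^2$ near the
tip, uniformly in time. The solution lies below that parabola near the corner by
`le_one_sub_mul_sq`, and away from the tip it starts below $(1+\delta)v_0$, itself below the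
barrier. Letting $\xi\to0$ finishes. -/
theorem SolData.le_plus (h : SolData m r₁ t₁ v v1 v2 vt)
    (hb : BarrierSetup n m f p C Cd Cdd A B ε δ rs ts) (hr₁ : 0 < r₁) (ht₁ : 0 < t₁)
    (hi : IsCuspInitial m (fun r => v r 0)) :
    ∃ R₀ > 0, ∀ R ∈ Ioc 0 R₀, ∃ T > 0, ∀ r ∈ Icc 0 R, ∀ t ∈ Ioc 0 T,
      v r t ≤ vGlue n f C A B ε δ 1 r t := by
  have hm1 := hb.hm1
  have hδ := hb.hδ
  have hδ1 := hb.hδ1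
  have hs : (1 : ℝ) ^ 2 = 1 := by norm_num
  have hW := hb.isWeakBarrier hs
  obtain ⟨R₁, hR₁, -, hlow⟩ := h.lower_bound hm1 hr₁ ht₁ hi (δ := 1 / 2) (by norm_num) (by norm_num)
  obtain ⟨Rk, hRk, hRkv⟩ := exists_kap_le (l := 1 / (4 * m)) (by positivity)
  obtain ⟨Ri, hRi, hRiv⟩ := hi (δ / 2) (by linarith)
  refine ⟨min (min R₁ Ri) (min Rk rs), lt_min (lt_min hR₁.1 hRi) (lt_min hRk.1 hb.hrs0),
    fun R hR => ?_⟩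
  have hRR₁ : R ≤ R₁ := hR.2.trans ((min_le_left _ _).trans (min_le_left _ _))
  have hRRi : R ≤ Ri := hR.2.trans ((min_le_left _ _).trans (min_le_right _ _))
  have hRRk : R ≤ Rk := hR.2.trans ((min_le_right _ _).trans (min_le_left _ _))
  have hRrs : R ≤ rs := hR.2.trans ((min_le_right _ _).trans (min_le_right _ _))
  have hR1 : R < 1 := hRRk.trans_lt hRk.2
  have hRr₁ : R < r₁ := hRR₁.trans_lt hR₁.2
  have hκ0 : ∀ r ∈ Ioc 0 R, 0 < kap r := fun r hr => kap_pos ⟨hr.1, hr.2.trans_lt hR1⟩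
  have hRκ : ∀ r ∈ Ioc 0 R, 4 * m * kap r ≤ 1 := fun r hr => by
    have := hRkv r hr.1 (hr.2.trans hRRk)
    rw [le_div_iff₀ (by positivity)] at this
    linarith
  have hbig : ∀ r ∈ Ioc 0 R, (1 + δ) * (m / 4) * kap r < 1 := fun r hr => by
    have h1 := hRκ r hr
    have h2 := hκ0 r hr
    have : (1 + δ) * (m / 4 * kap r) ≤ 2 * (m / 4 * kap r) := by gcongr; linarith
    linarith
  have hinit : ∀ r ∈ Ioc 0 R, v r 0 < (1 + δ) * (m / 4) * kap r := fun r hr => by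
    have h1 := (hRiv r ⟨hr.1, hr.2.trans hRRi⟩).2
    have h2 := hκ0 r hr
    have : (1 + δ / 2) * (m / 4 * kap r) ≤ (1 + δ) * (m / 4 * kap r) := by gcongr; linarith
    linarith
  obtain ⟨T₁, hT₁, hT₁v⟩ := hlow R ⟨hR.1, hRR₁⟩
  obtain ⟨T₂, hT₂, hT₂v⟩ := h.exists_time ht₁ (R := R) ⟨hR.1, hRr₁⟩ (lo := v R 0 - 1)
    (hi := (1 + δ) * (m / 4) * kap R) ⟨by linarith, hinit R ⟨hR.1, le_rfl⟩⟩
  obtain ⟨u, hu, huv⟩ := exists_Ioo_of_eventually (hb.eventually_le_plus hR1 hRκ)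
  have hts0 := hb.hts0
  set T := min (min T₁ T₂) (min (u / 2) (ts / 2)) with hT
  have hT0 : 0 < T := lt_min (lt_min hT₁.1 hT₂.1) (lt_min (by linarith) (by linarith))
  have hTT₁ : T ≤ T₁ := (min_le_left _ _).trans (min_le_left _ _)
  have hTT₂ : T ≤ T₂ := (min_le_left _ _).trans (min_le_right _ _)
  have hTu : T ≤ u / 2 := (min_le_right _ _).trans (min_le_left _ _)
  have hTts : T ≤ ts / 2 := (min_le_right _ _).trans (min_le_right _ _)
  have hTt₁ : T < t₁ := hTT₁.trans_lt hT₁.2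
  have htip : ∀ t ∈ Ioc 0 T, v 0 t = 1 ∧ v1 0 t = 0 := fun t ht =>
    h.tip hm1 hr₁ (c := (1 - 1 / 2) * (m / 4)) (R := R) ⟨ht.1, ht.2.trans_lt hTt₁⟩
      (mul_pos (by linarith) (by linarith)) hR.1
      fun r hr => hT₁v r hr t ⟨ht.1.le, ht.2.trans hTT₁⟩
  have hlatv : ∀ t ∈ Icc 0 T, v R t < (1 + δ) * (m / 4) * kap R := fun t ht =>
    (hT₂v t ⟨ht.1, ht.2.trans hTT₂⟩).2
  have hcorner := h.corner_bounded hm1 ⟨hR.1, hRr₁⟩ ⟨hT0, hTt₁⟩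
    (fun r hr => (hinit r hr).trans (hbig r hr))
    (fun t ht => (hlatv t ht).trans (hbig R ⟨hR.1, le_rfl⟩)) htip
  -- The bound near the corner requires $r^2\le400001\,T$; $r^2\le T$ is more than enough.
  set R' := min R (Real.sqrt T) with hR'
  have hR'0 : 0 < R' := lt_min hR.1 (Real.sqrt_pos.2 hT0)
  have hR'R : R' ≤ R := min_le_left _ _
  have hR'T : R' ^ 2 ≤ T := by
    calc R' ^ 2 ≤ Real.sqrt T ^ 2 := by gcongr; exact min_le_right _ _
      _ = T := Real.sq_sqrt hT0.le
  have hM : ∀ r ∈ Ioc 0 R', ∀ t ∈ Icc 0 T, v r t ≤ 400002 := fun r hr t ht =>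
    hcorner r ⟨hr.1, hr.2.trans hR'R⟩ (by
      have : r ^ 2 ≤ R' ^ 2 := by have := hr.1; gcongr; exact hr.2
      linarith) t ht
  have key : ∀ ξ ∈ Ioo 0 T, ∀ r ∈ Icc 0 R, ∀ t ∈ Ioc 0 T,
      v r t ≤ vGlue n f C A B ε δ 1 r (t + ξ) := by
    intro ξ hξ r hr t ht
    obtain ⟨b, hb0, r₀, hr₀, hpar⟩ := hb.exists_parabola_le_plus (t₀ := ξ)
      ⟨hξ.1, by linarith [hξ.2]⟩
    obtain ⟨Rb, hRb, Tb, hTb, hbv⟩ := h.le_one_sub_mul_sq hm1 ⟨hR'0, hR'R.trans_lt hRr₁⟩ ⟨hT0, hTt₁⟩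
      hi hM hb0
    set a := min Rb r₀ with ha
    have ha0 : 0 < a := lt_min hRb.1 hr₀
    have haR : a ≤ R := (min_le_left _ _).trans (hRb.2.trans hR'R)
    have hκc : ContinuousOn (fun q : ℝ × ℝ => (1 + δ) * (m / 4) * kap q.1) (Icc a R ×ˢ Icc 0 T) :=
      continuousOn_const.mul (ContinuousOn.comp (g := kap) (t := Icc a R) (fun x hx =>
        (contDiffAt_kap ⟨ha0.trans_le hx.1, hx.2.trans_lt hR1⟩).continuousAt.continuousWithinAt)
        continuousOn_fst fun q hq => hq.1)
    obtain ⟨τ, hτ, hτv⟩ := exists_time_uniform (G := fun r t => v r t - (1 + δ) * (m / 4) * kap r)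
      haR hT0 ((h.continuousOn_rect ha0 hRr₁ hTt₁).sub hκc)
      fun y hy => by have := hinit y ⟨ha0.trans_le hy.1, hy.2⟩; linarith
    -- A starting time at which both initial comparisons hold: below the parabola for $y\le a$ and
    -- below $(1+\delta)v_0$ for $y\ge a$.
    set t₀ := min (min Tb τ) t with ht₀
    have ht₀0 : 0 < t₀ := lt_min (lt_min hTb.1 hτ.1) ht.1
    have ht₀b : t₀ ≤ Tb := (min_le_left _ _).trans (min_le_left _ _)
    have ht₀τ : t₀ ≤ τ := (min_le_left _ _).trans (min_le_right _ _)
    have ht₀t : t₀ ≤ t := min_le_right _ _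
    have hplus : ∀ y ∈ Ioc 0 R, ∀ t ∈ Icc t₀ T,
        (1 + δ) * (m / 4) * kap y ≤ vGlue n f C A B ε δ 1 y (t + ξ) := fun y hy t ht =>
      huv (t + ξ) ⟨by linarith [ht.1, hξ.1], by linarith [ht.2, hξ.2]⟩ y hy
    have htipW : ∀ t ∈ Icc t₀ T, vGlue n f C A B ε δ 1 0 (t + ξ) = 1 := fun t ht =>
      hW.tip _ ⟨by linarith [ht.1, hξ.1], by linarith [ht.2, hξ.2]⟩
    have ht₀T : t₀ ∈ Icc t₀ T := ⟨le_rfl, ht₀t.trans ht.2⟩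
    have hmain := h.le_weakBarrier hb.hm (by linarith) hs hW (R := R) (t₀ := t₀) (T := T) (ξ := ξ)
      hRr₁ hRrs ht₀0 hTt₁ (by linarith [hξ.1]) (by linarith [hξ.2])
      (fun _ y hy t ht => ?_) (fun t ht => htip t ⟨ht₀0.trans_le ht.1, ht.2⟩) ?_ ?_ r hr t
      ⟨ht₀t, ht.2⟩
    · linarith
    · rcases eq_or_lt_of_le hy.1 with h0 | h0
      · rw [← h0, htipW t ht]; exact zero_le_one
      · refine le_trans ?_ (hplus y ⟨h0, hy.2⟩ t ht)
        have := hκ0 y ⟨h0, hy.2⟩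
        positivity
    · intro y hy
      rw [one_mul, sub_nonneg]
      rcases eq_or_lt_of_le hy.1 with h0 | h0
      · rw [← h0, htipW t₀ ht₀T, (htip t₀ ⟨ht₀0, ht₀t.trans ht.2⟩).1]
      rcases le_total y a with hya | hya
      · exact (hbv y ⟨h0, hya.trans (min_le_left _ _)⟩ t₀ ⟨ht₀0.le, ht₀b⟩).trans
          (hpar y ⟨h0.le, hya.trans (min_le_right _ _)⟩ (t₀ + ξ)
            ⟨by linarith, by linarith [ht₀T.2, hξ.2]⟩)
      · have k1 := hτv y ⟨hya, hy.2⟩ t₀ ⟨ht₀0.le, ht₀τ⟩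
        have k2 := hplus y ⟨h0, hy.2⟩ t₀ ht₀T
        linarith
    · intro t' ht'
      have k1 := hlatv t' ⟨ht₀0.le.trans ht'.1, ht'.2⟩
      have k2 := hplus R ⟨hR.1, le_rfl⟩ t' ht'
      linarith
  refine ⟨T, hT0, fun r hr t ht => ?_⟩
  have hlim := hW.tendsto_time (c := 1) (r := r) (t := t) ⟨hr.1, hr.2.trans hRrs⟩
    ⟨ht.1, by linarith [ht.2]⟩
  refine ge_of_tendsto hlim ?_
  filter_upwards [Ioo_mem_nhdsGT hT0] with ξ hξ
  have := key ξ hξ r hr t ht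
  rwa [one_mul]

/-- Solutions with cusp initial data lie between the glued barriers near `(0,0)`. -/
theorem SolData.barrier_bounds (h : SolData m r₁ t₁ v v1 v2 vt)
    (hb : BarrierSetup n m f p C Cd Cdd A B ε δ rs ts) (hr₁ : 0 < r₁) (ht₁ : 0 < t₁)
    (hi : IsCuspInitial m (fun r => v r 0)) (h00 : v 0 0 = 0) :
    ∃ rbar > 0, ∃ tbar > 0, rbar < r₁ ∧ rbar ≤ rs ∧ tbar < t₁ ∧ tbar < ts ∧
      ∀ r ∈ Icc 0 rbar, ∀ t ∈ Icc 0 tbar,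
        vMinus n (fun σ => f (σ ^ 2)) (fun σ => C (σ ^ 2)) A B ε δ r t ≤ v r t ∧
        v r t ≤ vPlus n (fun σ => f (σ ^ 2)) (fun σ => C (σ ^ 2)) A B ε δ r t := by
  obtain ⟨R₁, hR₁, H₁⟩ := h.minus_le hb hr₁ ht₁ hi
  obtain ⟨R₂, hR₂, H₂⟩ := h.le_plus hb hr₁ ht₁ hi
  obtain ⟨Ri, hRi, hRiv⟩ := hi δ hb.hδ
  have hrs0 := hb.hrs0
  have hts0 := hb.hts0
  set R := min (min (min R₁ R₂) Ri) (min (r₁ / 2) rs) with hR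
  have hR0 : 0 < R := lt_min (lt_min (lt_min hR₁ hR₂) hRi) (lt_min (by linarith) hrs0)
  have k1 : R ≤ R₁ := (min_le_left _ _).trans ((min_le_left _ _).trans (min_le_left _ _))
  have k2 : R ≤ R₂ := (min_le_left _ _).trans ((min_le_left _ _).trans (min_le_right _ _))
  have k3 : R ≤ Ri := (min_le_left _ _).trans (min_le_right _ _)
  have k4 : R ≤ r₁ / 2 := (min_le_right _ _).trans (min_le_left _ _)
  have k5 : R ≤ rs := (min_le_right _ _).trans (min_le_right _ _)
  obtain ⟨T₁, hT₁, H₁⟩ := H₁ R ⟨hR0, k1⟩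
  obtain ⟨T₂, hT₂, H₂⟩ := H₂ R ⟨hR0, k2⟩
  set T := min (min T₁ T₂) (min (t₁ / 2) (ts / 2)) with hT
  have hT0 : 0 < T := lt_min (lt_min hT₁ hT₂) (lt_min (by linarith) (by linarith))
  have l1 : T ≤ T₁ := (min_le_left _ _).trans (min_le_left _ _)
  have l2 : T ≤ T₂ := (min_le_left _ _).trans (min_le_right _ _)
  have l3 : T ≤ t₁ / 2 := (min_le_right _ _).trans (min_le_left _ _)
  have l4 : T ≤ ts / 2 := (min_le_right _ _).trans (min_le_right _ _)
  refine ⟨R, hR0, T, hT0, by linarith, k5, by linarith, by linarith, fun r hr t ht => ?_⟩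
  rcases eq_or_lt_of_le ht.1 with h0 | h0
  · subst h0
    have e1 : vMinus n (fun σ => f (σ ^ 2)) (fun σ => C (σ ^ 2)) A B ε δ r 0 = (1 - δ) * v0 n r := by
      rw [vMinus, if_pos (by simpa using hr.1), vOut]; ring
    have e2 : vPlus n (fun σ => f (σ ^ 2)) (fun σ => C (σ ^ 2)) A B ε δ r 0 = (1 + δ) * v0 n r := by
      rw [vPlus, if_pos (by simpa using hr.1), vOut]; ring
    rw [e1, e2]
    rcases eq_or_lt_of_le hr.1 with h1 | h1
    · subst h1
      simp [v0, h00]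
    · have := hRiv r ⟨h1, hr.2.trans k3⟩
      rw [v0_eq, ← hb.hm]
      exact ⟨by linarith [this.1], by linarith [this.2]⟩
  · have a1 := H₁ r hr t ⟨h0, ht.2.trans l1⟩
    have a2 := H₂ r hr t ⟨h0, ht.2.trans l2⟩
    rw [vGlue, if_neg (by norm_num)] at a1
    rw [vGlue, if_pos rfl] at a2
    exact ⟨a1, a2⟩

end Bounds

end

section

open Set Filter Topology
open scoped ContDiff

/-! ### The asymptotic profile -/

/-- A sandwich needs only $sW\le s\cdot{}$piece, which holds for each active piece of a minimum. On
overlaps either piece may therefore be used. -/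
theorem IsGluing.le_i {s : ℝ} {W i p o : ℝ → ℝ → ℝ} {a b c d : ℝ → ℝ} {t r : ℝ}
    (h : IsGluing s W i p o a b c d t) (hr : r < b t) : s * W r t ≤ s * i r t := by
  rcases lt_or_ge r (a t) with h1 | h1
  · rw [h.eq_i _ h1]
  · rw [h.eq_ip _ h1 hr]; exact min_le_left _ _

theorem IsGluing.le_p {s : ℝ} {W i p o : ℝ → ℝ → ℝ} {a b c d : ℝ → ℝ} {t r : ℝ}
    (h : IsGluing s W i p o a b c d t) (hr : a t ≤ r) (hr' : r < d t) : s * W r t ≤ s * p r t := by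
  rcases lt_or_ge r (b t) with h1 | h1
  · rw [h.eq_ip _ hr h1]; exact min_le_right _ _
  rcases lt_or_ge r (c t) with h2 | h2
  · rw [h.eq_p _ h1 h2]
  · rw [h.eq_po _ h2 hr']; exact min_le_left _ _

theorem IsGluing.le_o {s : ℝ} {W i p o : ℝ → ℝ → ℝ} {a b c d : ℝ → ℝ} {t r : ℝ}
    (h : IsGluing s W i p o a b c d t) (hr : c t ≤ r) : s * W r t ≤ s * o r t := by
  rcases lt_or_ge r (d t) with h1 | h1
  · rw [h.eq_po _ hr h1]; exact min_le_right _ _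
  · rw [h.eq_o _ h1]

/-- Taking $s=\pm1$ treats the upper and the lower bound with one computation. -/
theorem abs_div_sub_one_le {x D η : ℝ} (hD : 0 < D) (h : ∀ s : ℝ, s ^ 2 = 1 → s * x ≤ (s + η) * D) :
    |x / D - 1| ≤ η := by
  have h1 := h 1 (by norm_num)
  have h2 := h (-1) (by norm_num)
  rw [abs_le, div_sub_one hD.ne', le_div_iff₀ hD, div_le_iff₀ hD]
  constructor <;> linarith

theorem abs_outP_sub_le {m c l : ℝ} (hm : 1 ≤ m) (hc : 0 ≤ c) (hcm : c ≤ m) (hl : 0 ≤ l)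
    (hl1 : l ≤ 1) : |outP m c l - 2 * m * c * l| ≤ 7 * m ^ 2 * c * l ^ 2 := by
  have e : outP m c l - 2 * m * c * l
      = c * l ^ 2 * (m - 2 * m * c - 2 * c * l + 3 / 2 * c * l ^ 2) := by rw [outP]; ring
  have h1 : m * c ≤ m * m := by gcongr
  have h2 : 0 ≤ m * c := by positivity
  have h3 : m * 1 ≤ m * m := by gcongr
  have h4 : c * l ≤ m * 1 := by gcongr
  have h5 : 0 ≤ c * l := by positivity
  have h6 : c * l ^ 2 ≤ m * 1 := by gcongr; exact pow_le_one₀ hl hl1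
  have h7 : 0 ≤ c * l ^ 2 := by positivity
  have h8 : |m - 2 * m * c - 2 * c * l + 3 / 2 * c * l ^ 2| ≤ 7 * m ^ 2 := by
    rw [abs_le]; constructor <;> linarith
  rw [e, abs_mul, abs_of_nonneg h7]
  calc c * l ^ 2 * |m - 2 * m * c - 2 * c * l + 3 / 2 * c * l ^ 2| ≤ c * l ^ 2 * (7 * m ^ 2) := by
        gcongr
    _ = _ := by ring

section Profile

variable {n : ℕ} {m : ℝ} {f p C Cd Cdd : ℝ → ℝ} {A B ε δ rs ts : ℝ}

theorem BarrierSetup.gamma_bounds (h : BarrierSetup n m f p C Cd Cdd A B ε δ rs ts) {s : ℝ}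
    (hs : s ^ 2 = 1) : 0 ≤ gammaC n A ε δ s ∧ gammaC n A ε δ s ≤ δ + 2 * ε := by
  have e : gammaC n A ε δ s = δ + (1 + s * δ) * gammaG m A ε := by
    rw [gammaC, gammaG, ← h.hm]; ring
  obtain ⟨h1, h2⟩ := one_add_mul_delta_mem hs h.hδ h.hδ1.le
  have h3 := gammaG_nonneg (A := A) h.hm1 h.hε
  have h4 := gammaG_le (A := A) h.hm1 h.hε
  have h5 := h.hδ
  have h6 : (1 + s * δ) * gammaG m A ε ≤ 2 * ε := by
    gcongr; linarith
  have h7 : 0 ≤ (1 + s * δ) * gammaG m A ε := mul_nonneg (by linarith) h3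
  rw [e]
  constructor <;> linarith

/-- The relative deviation from the profile is $\delta+2\varepsilon$, from $\gamma_\pm$, plus
$B^2\kappa t/r^2$, from the correction term; the latter is small when $r\gg\theta$. -/
theorem BarrierSetup.vPar_le (h : BarrierSetup n m f p C Cd Cdd A B ε δ rs ts) {s r t : ℝ}
    (hs : s ^ 2 = 1) (ht : t ∈ Ioo (0 : ℝ) 1) (hr : 0 < r) :
    s * vPar n A B ε δ s r t ≤ (s + (δ + 2 * ε) + B ^ 2 * (kap t * (t / r ^ 2)))
      * (m / 2 * kap t * (1 + 2 * m * (t / r ^ 2))) := by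
  have hm1 := h.hm1
  have hκ := kap_pos ht
  have ht0 := ht.1
  rw [vPar_eq_parBar ht, ← h.hm, parBar]
  set z := t / r ^ 2 with hz
  have hz0 : 0 < z := by positivity
  set D := m / 2 * kap t * (1 + 2 * m * z) with hD
  have hD0 : 0 < D := by positivity
  have h1 : kap t * z ≤ D := by
    have : 1 * (kap t * z) ≤ m ^ 2 * (kap t * z) := by
      gcongr; exact one_le_pow₀ hm1
    have h2 : 0 ≤ m / 2 * kap t := by positivity
    have e : D = m / 2 * kap t + m ^ 2 * (kap t * z) := by rw [hD]; ring
    linarith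
  have h2 : B ^ 2 * (kap t * z) * (kap t * z) ≤ B ^ 2 * (kap t * z) * D := by gcongr
  have h3 : gammaC n A ε δ s * D ≤ (δ + 2 * ε) * D := by
    gcongr; exact (h.gamma_bounds hs).2
  have e : s * ((1 + s * gammaC n A ε δ s) * kap t * (m / 2 * (1 + 2 * m * z))
      + s * B ^ 2 * kap t ^ 2 * z ^ 2) = s * D + s ^ 2 * (gammaC n A ε δ s * D)
        + s ^ 2 * (B ^ 2 * (kap t * z) * (kap t * z)) := by rw [hD]; ring
  rw [e, hs]
  linarith

theorem BarrierSetup.vOut_le (h : BarrierSetup n m f p C Cd Cdd A B ε δ rs ts) {s r t : ℝ}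
    (hs : s ^ 2 = 1) (hr : r ∈ Ioo (0 : ℝ) 1) (hk : kap r ≤ 1) (ht : 0 ≤ t) :
    s * vOut n ε δ s r t ≤ (s + (δ + 2 * ε + 14 * m * kap r))
      * (m / 4 * kap r * (1 + 2 * m * (t / r ^ 2))) := by
  have hm1 := h.hm1
  have hε := h.hε
  have hε1 := h.eps_le
  have hκ := kap_pos hr
  have hr0 := hr.1
  obtain ⟨d1, d2⟩ := one_add_mul_delta_mem hs h.hδ h.hδ1.le
  obtain ⟨g1, g2⟩ := one_add_mul_delta_mem hs hε (by linarith)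
  rw [vOut_eq_outBar hr, ← h.hm, outBar]
  set c := (1 + s * δ) * (m / 4) with hc
  have hc0 : 0 ≤ c := mul_nonneg (by linarith) (by linarith)
  have hcm : c ≤ 9 / 8 * (m / 4) := by rw [hc]; gcongr
  have hP := (abs_le.1 (abs_outP_sub_le hm1 hc0 (by linarith : c ≤ m) hκ.le hk))
  set z := t / r ^ 2 with hz
  have hz0 : 0 ≤ z := by positivity
  set l := kap r
  set Q := outP m c l - 2 * m * c * l with hQ
  have hsQ : s * Q ≤ 7 * m ^ 2 * c * l ^ 2 := by
    rcases sq_eq_one_iff.1 hs with rfl | rfl <;> linarith [hP.1, hP.2]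
  have e : s * (c * l + (1 + s * ε) * z * outP m c l)
      = s * (m / 4 * l * (1 + 2 * m * z)) + s ^ 2 * (δ * (m / 4 * l * (1 + 2 * m * z)))
        + s ^ 2 * (ε * c * l * (2 * m * z)) + (1 + s * ε) * z * (s * Q) := by
    rw [hQ, hc]; ring
  have h1 : (1 + s * ε) * z * (s * Q) ≤ 9 / 8 * z * (7 * m ^ 2 * (9 / 8 * (m / 4)) * l ^ 2) := by
    have k1 : (1 + s * ε) * z * (s * Q) ≤ (1 + s * ε) * z * (7 * m ^ 2 * c * l ^ 2) := by
      have : 0 ≤ (1 + s * ε) * z := mul_nonneg (by linarith) hz0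
      gcongr
    refine k1.trans ?_
    gcongr
  have h2 : ε * c * l * (2 * m * z) ≤ ε * (9 / 8 * (m / 4)) * l * (2 * m * z) := by gcongr
  have h3 : 0 ≤ ε * (m / 4 * l) := by positivity
  have h4 : 0 ≤ ε * (m / 4 * l) * (2 * m * z) := by positivity
  have h5 : 0 ≤ m * l * (m / 4 * l) := by positivity
  have h6 : 0 ≤ m * l * (m / 4 * l) * (m * z) := by positivity
  rw [e, hs]
  linarith

theorem BarrierSetup.abs_kC_sq_sub (h : BarrierSetup n m f p C Cd Cdd A B ε δ rs ts) {s : ℝ}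
    (hs : s ^ 2 = 1) : |kC n A ε δ s ^ 2 - 1 / m ^ 2| ≤ 2 * (δ + 3 * ε) := by
  have hm1 := h.hm1
  obtain ⟨⟨hq1, hq2⟩, hk, hq3⟩ := h.kC_spec hs
  obtain ⟨g1, g2⟩ := h.gamma_bounds hs
  set q := kC n A ε δ s ^ 2
  have hq0 : 0 < q := by positivity
  have hε := h.hε
  have e : q - 1 / m ^ 2 = -(s * (q * (gammaC n A ε δ s + ε / (2 * m ^ 2)))) := by
    have h1 : 1 = q * (m ^ 2 * (1 + s * gammaC n A ε δ s) + s * ε / 2) := by rw [← hq3]; field_simp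
    field_simp
    linarith
  have hm2 : 1 ≤ m ^ 2 := one_le_pow₀ hm1
  rw [e, abs_neg, abs_mul, abs_eq_one_of_sq_eq_one hs, one_mul, abs_of_nonneg (by positivity)]
  have h2 : q ≤ 2 := hq2.trans (div_le_self (by norm_num) hm2)
  have h3 : ε / (2 * m ^ 2) ≤ ε := div_le_self hε.le (by linarith)
  calc q * (gammaC n A ε δ s + ε / (2 * m ^ 2)) ≤ 2 * (δ + 2 * ε + ε) := by gcongr
    _ = _ := by ring

variable {v : ℝ → ℝ → ℝ}

/-- `v` lies between the glued barriers on a neighbourhood of the corner `(0,0)`. -/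
def IsSandwiched (n : ℕ) (f C : ℝ → ℝ) (A B ε δ : ℝ) (v : ℝ → ℝ → ℝ) : Prop :=
  ∃ R > 0, ∃ T > 0, ∀ r ∈ Icc 0 R, ∀ t ∈ Ioc 0 T, ∀ s : ℝ, s ^ 2 = 1 →
    s * v r t ≤ s * vGlue n f C A B ε δ s r t

theorem tendsto_const_mul_sqrt (c : ℝ) : Tendsto (fun t => c * Real.sqrt t) (𝓝[>] 0) (𝓝 0) := by
  have := (Real.continuous_sqrt.tendsto 0).mono_left (nhdsWithin_le_nhds (s := Ioi 0))
  simpa using this.const_mul c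

/-- Since $\varepsilon\le1$, $c_4\le A$ gives $c_4\le\rho_*$, so the whole range of $\rho$ is
covered by the parabolic piece. -/
theorem profile_parabolic (hb : BarrierSetup n m f p C Cd Cdd A B ε δ rs ts)
    (hv : IsSandwiched n f C A B ε δ v) {η c₄ : ℝ} (hη : 0 < η) (hc₄A : c₄ ≤ A)
    (hsmall : δ + 2 * ε ≤ η / 2) :
    ∃ c₃ > 0, ∃ t₀ > 0, ∀ t ∈ Ioo 0 t₀, ∀ ρ,
      c₃ / Real.sqrt (-Real.log t) < ρ → ρ < c₄ → |v (ρ * Real.sqrt t) t /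
        (((n : ℝ) - 1) / (-2 * Real.log t) * (1 + 2 * ((n : ℝ) - 1) / ρ ^ 2)) - 1| ≤ η := by
  obtain ⟨R, hR, T, hT, hv⟩ := hv
  have hm1 := hb.hm1
  have hB := hb.hB
  have hε := hb.hε
  have hA0 : 0 < A := by linarith [hb.hA]
  have hσ := hb.sigma_pos
  -- The first summand puts $r$ beyond $\sigma_*\theta$; the second makes
  -- $B^2\kappa/\rho^2\le\eta/2$.
  set c₃ := sigmaStar B ε + B * Real.sqrt (2 / η) with hc₃
  have hs2 := Real.sqrt_pos.2 (by positivity : 0 < 2 / η)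
  have hc₃0 : 0 < c₃ := by positivity
  obtain ⟨u, hu, huv⟩ := exists_Ioo_of_eventually
    ((tendsto_const_mul_sqrt A).eventually (gt_mem_nhds hR))
  refine ⟨c₃, hc₃0, min u (min T ts), lt_min hu (lt_min hT hb.hts0), fun t ht ρ hρ hρ' => ?_⟩
  have ht0 := ht.1
  have htu : t < u := ht.2.trans_le (min_le_left _ _)
  have htT : t < T := ht.2.trans_le ((min_le_right _ _).trans (min_le_left _ _))
  have htts : t < ts := ht.2.trans_le ((min_le_right _ _).trans (min_le_right _ _))
  have ht1 : t ∈ Ioo (0 : ℝ) 1 := ⟨ht0, htts.trans hb.hts⟩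
  have hl := neg_log_pos ht1
  have hsl := Real.sqrt_pos.2 hl
  have hst := Real.sqrt_pos.2 ht0
  have hρ0 : 0 < ρ := lt_trans (by positivity) hρ
  have hκ := kap_pos ht1
  have hg := fun s hs => hb.isGluing (s := s) hs ⟨ht0, htts⟩
  have hθ : theta t = Real.sqrt t / Real.sqrt (-Real.log t) := by rw [theta, Real.sqrt_div ht0.le]
  have hr1 : sigmaStar B ε * theta t ≤ ρ * Real.sqrt t := by
    rw [div_lt_iff₀ hsl] at hρ
    rw [hθ, ← mul_div_assoc, div_le_iff₀ hsl]
    have : sigmaStar B ε ≤ ρ * Real.sqrt (-Real.log t) := by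
      refine le_trans ?_ hρ.le
      rw [hc₃]; have := mul_pos (by linarith : 0 < B) hs2; linarith
    calc sigmaStar B ε * Real.sqrt t ≤ ρ * Real.sqrt (-Real.log t) * Real.sqrt t := by gcongr
      _ = _ := by ring
  have hρA : A ≤ rhoStar A ε := by
    rw [rhoStar, le_div_iff₀ (Real.sqrt_pos.2 hε)]
    have : Real.sqrt ε ≤ 1 := Real.sqrt_le_one.2 (by linarith [hb.eps_le])
    nlinarith
  have hr2 : ρ * Real.sqrt t < 3 * rhoStar A ε * Real.sqrt t := by
    gcongr; linarith
  have hr3 : ρ * Real.sqrt t ≤ R := by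
    have h1 := huv t ⟨ht0, htu⟩
    have h2 : ρ * Real.sqrt t ≤ A * Real.sqrt t := by gcongr; linarith
    linarith
  have hr0 : 0 < ρ * Real.sqrt t := by positivity
  have hz : t / (ρ * Real.sqrt t) ^ 2 = 1 / ρ ^ 2 := by
    rw [mul_pow, Real.sq_sqrt ht0.le]; field_simp
  have hD : ((n : ℝ) - 1) / (-2 * Real.log t) * (1 + 2 * ((n : ℝ) - 1) / ρ ^ 2)
      = m / 2 * kap t * (1 + 2 * m * (t / (ρ * Real.sqrt t) ^ 2)) := by
    rw [hz, ← hb.hm, kap]; ring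
  rw [hD]
  refine abs_div_sub_one_le (by positivity) fun s hs => ?_
  refine (hv _ ⟨hr0.le, hr3⟩ t ⟨ht0, htT.le⟩ s hs).trans (((hg s hs).le_p hr1 hr2).trans
    ((hb.vPar_le hs ht1 hr0).trans ?_))
  have h3 : B ^ 2 * (kap t * (t / (ρ * Real.sqrt t) ^ 2)) ≤ η / 2 := by
    have k1 : B * Real.sqrt (2 / η) ≤ ρ * Real.sqrt (-Real.log t) := by
      rw [div_lt_iff₀ hsl] at hρ
      linarith
    have k2 : (B * Real.sqrt (2 / η)) ^ 2 ≤ (ρ * Real.sqrt (-Real.log t)) ^ 2 := by gcongr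
    rw [mul_pow, mul_pow, Real.sq_sqrt (by positivity), Real.sq_sqrt hl.le] at k2
    have e : kap t * (1 / ρ ^ 2) = 1 / (ρ ^ 2 * -Real.log t) := by rw [kap]; ring
    rw [hz, e, mul_one_div, div_le_iff₀ (by positivity)]
    rw [← mul_div_assoc, div_le_iff₀ hη] at k2
    linarith
  have : (0 : ℝ) < m / 2 * kap t * (1 + 2 * m * (t / (ρ * Real.sqrt t) ^ 2)) := by positivity
  refine mul_le_mul_of_nonneg_right ?_ this.le
  linarith

/-- Beyond $\rho_*\sqrt t$ the outer piece applies. In the remaining range $c_1\sqrt t<r<\rho_*\sqrt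
t$ the parabolic bound is translated by means of $\kappa(r)\approx2\kappa(t)$. -/
theorem profile_outer (hb : BarrierSetup n m f p C Cd Cdd A B ε δ rs ts)
    (hv : IsSandwiched n f C A B ε δ v) {η c₁ : ℝ} (hη : 0 < η) (hη1 : η ≤ 1) (hc₁ : 0 < c₁)
    (hsmall : δ + 2 * ε ≤ η / 4) :
    ∃ c₂ > 0, ∃ t₀ > 0, ∀ t ∈ Ioo 0 t₀, ∀ r, c₁ * Real.sqrt t < r → r < c₂ →
      |v r t / (((n : ℝ) - 1) / (-4 * Real.log r) * (1 + 2 * ((n : ℝ) - 1) * (t / r ^ 2))) - 1|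
        ≤ η := by
  obtain ⟨R, hR, T, hT, hv⟩ := hv
  have hm1 := hb.hm1
  have hB := hb.hB
  have hε := hb.hε
  have hσ := hb.sigma_pos
  have hρ := hb.rho_pos
  -- This makes the error $14m\kappa(r)$ of the outer piece at most $\eta/4$.
  obtain ⟨Rk, hRk, hRkv⟩ := exists_kap_le (l := η / (56 * m)) (by positivity)
  set c := 3 * rhoStar A ε with hc
  have hc0 : 0 < c := by positivity
  have hν : 2 - η / 8 < (2 : ℝ) := by linarith
  have hν' : (2 : ℝ) < 2 + η / 8 := by linarith
  have l1 : Tendsto (fun t => B ^ 2 * (kap t / c₁ ^ 2)) (𝓝[>] 0) (𝓝 0) := by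
    simpa using (tendsto_kap_zero.div_const (c₁ ^ 2)).const_mul (B ^ 2)
  have l2 : Tendsto (fun t => sigmaStar B ε * Real.sqrt (kap t)) (𝓝[>] 0) (𝓝 0) := by
    have := (Real.continuous_sqrt.tendsto 0).comp tendsto_kap_zero
    simpa using this.const_mul (sigmaStar B ε)
  obtain ⟨u, hu, huv⟩ := exists_Ioo_of_eventually
    (((((tendsto_kap_ratio c₁).eventually (lt_mem_nhds hν)).and
      ((tendsto_kap_ratio c).eventually (gt_mem_nhds hν'))).and
      ((l1.eventually (gt_mem_nhds (by positivity : 0 < η / 8))).and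
        (l2.eventually (gt_mem_nhds hc₁)))).and
      ((tendsto_const_mul_sqrt c).eventually (gt_mem_nhds one_pos)))
  refine ⟨min R Rk, lt_min hR hRk.1, min u (min T ts), lt_min hu (lt_min hT hb.hts0),
    fun t ht r hr hr' => ?_⟩
  have ht0 := ht.1
  have htu : t < u := ht.2.trans_le (min_le_left _ _)
  have htT : t < T := ht.2.trans_le ((min_le_right _ _).trans (min_le_left _ _))
  have htts : t < ts := ht.2.trans_le ((min_le_right _ _).trans (min_le_right _ _))
  have ht1 : t ∈ Ioo (0 : ℝ) 1 := ⟨ht0, htts.trans hb.hts⟩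
  obtain ⟨⟨⟨e1, e2⟩, e3, e4⟩, e5⟩ := huv t ⟨ht0, htu⟩
  have hst := Real.sqrt_pos.2 ht0
  have hr0 : 0 < r := lt_trans (by positivity) hr
  have hrR : r ≤ R := hr'.le.trans (min_le_left _ _)
  have hrk : r ≤ Rk := hr'.le.trans (min_le_right _ _)
  have hr1 : r ∈ Ioo (0 : ℝ) 1 := ⟨hr0, hrk.trans_lt hRk.2⟩
  have hκ := kap_pos ht1
  have hκr := kap_pos hr1
  have hkr := hRkv r hr0 hrk
  have hg := fun s hs => hb.isGluing (s := s) hs ⟨ht0, htts⟩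
  have hD : ((n : ℝ) - 1) / (-4 * Real.log r) * (1 + 2 * ((n : ℝ) - 1) * (t / r ^ 2))
      = m / 4 * kap r * (1 + 2 * m * (t / r ^ 2)) := by
    rw [← hb.hm, kap]; ring
  rw [hD]
  have hD0 : 0 < m / 4 * kap r * (1 + 2 * m * (t / r ^ 2)) := by positivity
  refine abs_div_sub_one_le hD0 fun s hs => ?_
  refine (hv _ ⟨hr0.le, hrR⟩ t ⟨ht0, htT.le⟩ s hs).trans ?_
  rcases le_or_gt (rhoStar A ε * Real.sqrt t) r with hle | hlt
  · refine ((hg s hs).le_o hle).trans ((hb.vOut_le hs hr1 ?_ ht0.le).trans ?_)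
    · refine hkr.trans ((div_le_one (by positivity)).2 (by linarith))
    · have : 14 * m * kap r ≤ η / 4 := by
        rw [le_div_iff₀ (by positivity)] at hkr
        linarith
      gcongr
      linarith
  · have ha : sigmaStar B ε * theta t ≤ r := by
      rw [theta_eq_sqrt ht1]
      have : sigmaStar B ε * Real.sqrt (kap t) * Real.sqrt t ≤ c₁ * Real.sqrt t := by gcongr
      linarith
    have hrc : r < c * Real.sqrt t := by
      refine hlt.trans ?_
      rw [hc]; gcongr; linarith
    refine ((hg s hs).le_p ha hrc).trans ((hb.vPar_le hs ht1 hr0).trans ?_)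
    have k1 : kap t * (2 - η / 8) ≤ kap r := by
      have := kap_mono (mul_pos hc₁ hst) hr.le hr1.2
      rw [kap_mul_sqrt hc₁ ht1] at this
      refine le_trans ?_ this
      gcongr
    have k2 : kap r ≤ kap t * (2 + η / 8) := by
      refine (kap_mono hr0 hrc.le e5).trans ?_
      rw [kap_mul_sqrt hc0 ht1]
      gcongr
    have k3 : B ^ 2 * (kap t * (t / r ^ 2)) ≤ η / 8 := by
      have k4 : t / r ^ 2 ≤ 1 / c₁ ^ 2 := by
        rw [div_le_div_iff₀ (by positivity) (by positivity), one_mul]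
        calc t * c₁ ^ 2 = (c₁ * Real.sqrt t) ^ 2 := by rw [mul_pow, Real.sq_sqrt ht0.le]; ring
          _ ≤ r ^ 2 := by gcongr
      refine le_trans ?_ e3.le
      rw [div_eq_mul_one_div (kap t)]
      exact mul_le_mul_of_nonneg_left (mul_le_mul_of_nonneg_left k4 hκ.le) (sq_nonneg B)
    set z := t / r ^ 2
    set x := kap t
    set y := kap r
    have hz0 : 0 < z := by positivity
    set N := 1 + 2 * m * z with hN
    have hN0 : 0 < N := by positivity
    have h1 : (s + (δ + 2 * ε) + B ^ 2 * (x * z)) * (m / 2 * x * N)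
        ≤ (s + 3 * η / 8) * (m / 2 * x * N) :=
      mul_le_mul_of_nonneg_right (by linarith) (by positivity)
    refine h1.trans ?_
    have h2 : (s + 3 * η / 8) * (2 * x) ≤ (s + η) * y := by
      have hηx : 0 ≤ η * x := by positivity
      have hηηx : 0 ≤ η * (η * x) := by positivity
      have hηηx' : η * (η * x) ≤ 1 * (η * x) := by gcongr
      have n1 := mul_le_mul_of_nonneg_left k1 hη.le
      have n2 := mul_le_mul_of_nonneg_left k2 hη.le
      rcases sq_eq_one_iff.1 hs with rfl | rfl
      · linarith
      · linarith
    calc (s + 3 * η / 8) * (m / 2 * x * N) = (s + 3 * η / 8) * (2 * x) * (m / 4 * N) := by ring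
      _ ≤ (s + η) * y * (m / 4 * N) := by gcongr
      _ = _ := by ring

/-- As $\delta,\varepsilon\to0$ one has $k_\pm^2\to1/m^2$, so uniform continuity of $f$ on a compact
range compares $f(k_\pm^2\sigma^2)$ with $f(\sigma^2/m^2)$; the correction term is $O(\kappa)$. The
positive lower bound $c$ for $f$ converts absolute into relative errors. -/
theorem profile_inner (hb : BarrierSetup n m f p C Cd Cdd A B ε δ rs ts)
    (hv : IsSandwiched n f C A B ε δ v) {η c₅ c ν : ℝ} (hη : 0 < η) (hc₅ : 0 < c₅) (hc₅B : c₅ ≤ B)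
    (hc : 0 < c) (hcf : ∀ x ∈ Icc 0 (c₅ ^ 2), c ≤ f x)
    (hν : ∀ x ∈ Icc 0 (2 * c₅ ^ 2), ∀ y ∈ Icc 0 (2 * c₅ ^ 2), |x - y| < ν → |f x - f y| ≤ η / 2 * c)
    (hsmall : 2 * (δ + 3 * ε) * c₅ ^ 2 < ν) :
    ∃ t₀ > 0, ∀ t ∈ Ioo 0 t₀, ∀ σ, 0 < σ → σ < c₅ →
      |v (σ * theta t) t / f ((σ / ((n : ℝ) - 1)) ^ 2) - 1| ≤ η := by
  obtain ⟨R, hR, T, hT, hv⟩ := hv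
  have hm1 := hb.hm1
  have hε := hb.hε
  have hm2 : 1 ≤ m ^ 2 := one_le_pow₀ hm1
  obtain ⟨L, hL, hLC⟩ := hb.hC.exists_le_mul hb.hf hb.hC0 (2 * c₅ ^ 2)
  have l1 : Tendsto (fun t => 2 * kap t * (L * c₅ ^ 2)) (𝓝[>] 0) (𝓝 0) := by
    simpa using (tendsto_kap_zero.const_mul 2).mul_const (L * c₅ ^ 2)
  have l2 : Tendsto (fun t => c₅ * theta t) (𝓝[>] 0) (𝓝 0) := by
    have h1 : Tendsto (fun t => c₅ * Real.sqrt t * Real.sqrt (kap t)) (𝓝[>] 0) (𝓝 (0 * 0)) := by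
      refine (tendsto_const_mul_sqrt c₅).mul ?_
      have := (Real.continuous_sqrt.tendsto 0).comp tendsto_kap_zero
      rwa [Real.sqrt_zero] at this
    rw [zero_mul] at h1
    refine h1.congr' ?_
    filter_upwards [Ioo_mem_nhdsGT one_pos] with t ht
    rw [theta_eq_sqrt ht, mul_assoc]
  obtain ⟨u, hu, huv⟩ := exists_Ioo_of_eventually
    (((l1.eventually (gt_mem_nhds (by positivity : 0 < η / 2 * c))).and
      (l2.eventually (gt_mem_nhds hR))).and (tendsto_kap_zero.eventually (gt_mem_nhds one_pos)))
  refine ⟨min u (min T ts), lt_min hu (lt_min hT hb.hts0), fun t ht σ hσ hσ' => ?_⟩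
  have ht0 := ht.1
  have htu : t < u := ht.2.trans_le (min_le_left _ _)
  have htT : t < T := ht.2.trans_le ((min_le_right _ _).trans (min_le_left _ _))
  have htts : t < ts := ht.2.trans_le ((min_le_right _ _).trans (min_le_right _ _))
  have ht1 : t ∈ Ioo (0 : ℝ) 1 := ⟨ht0, htts.trans hb.hts⟩
  obtain ⟨⟨e1, e2⟩, e3⟩ := huv t ⟨ht0, htu⟩
  have hθ := theta_pos ht1
  have hκ := kap_pos ht1
  have hg := fun s hs => hb.isGluing (s := s) hs ⟨ht0, htts⟩
  have hσ2 : σ ^ 2 ≤ c₅ ^ 2 := by gcongr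
  have hx : (σ / ((n : ℝ) - 1)) ^ 2 = 1 / m ^ 2 * σ ^ 2 := by rw [← hb.hm]; ring
  rw [hx]
  have hx1 : 1 / m ^ 2 * σ ^ 2 ≤ c₅ ^ 2 := by
    calc 1 / m ^ 2 * σ ^ 2 ≤ 1 * c₅ ^ 2 := by
          gcongr; exact (div_le_one (by positivity)).2 hm2
      _ = _ := one_mul _
  have hx0 : 0 ≤ 1 / m ^ 2 * σ ^ 2 := by positivity
  have hcx := hcf _ ⟨hx0, hx1⟩
  have hBσ : c₅ ≤ sigmaStar B ε := by
    rw [sigmaStar, le_div_iff₀ (Real.sqrt_pos.2 hε)]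
    have : Real.sqrt ε ≤ 1 := Real.sqrt_le_one.2 (by linarith [hb.eps_le])
    nlinarith
  have hr1 : σ * theta t < 3 * sigmaStar B ε * theta t := by
    gcongr; linarith
  have hr2 : σ * theta t ≤ R := by
    have : σ * theta t ≤ c₅ * theta t := by gcongr
    linarith
  refine abs_div_sub_one_le (hc.trans_le hcx) fun s hs => ?_
  refine (hv _ ⟨by positivity, hr2⟩ t ⟨ht0, htT.le⟩ s hs).trans (((hg s hs).le_i hr1).trans ?_)
  obtain ⟨⟨hq1, hq2⟩, hk, -⟩ := hb.kC_spec hs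
  have hqd := hb.abs_kC_sq_sub hs
  rw [vIn_eq_inBar ht1, inBar, inX_at_scale ht1]
  set q := kC n A ε δ s ^ 2
  have hq0 : 0 < q := by positivity
  have hq2' : q ≤ 2 := hq2.trans (div_le_self (by norm_num) hm2)
  have hX : q * σ ^ 2 ∈ Icc 0 (2 * c₅ ^ 2) := ⟨by positivity, by gcongr⟩
  have h1 := hν _ hX (1 / m ^ 2 * σ ^ 2) ⟨hx0, by linarith [sq_nonneg c₅]⟩ (by
    rw [← sub_mul, abs_mul, abs_of_nonneg (sq_nonneg σ)]
    refine lt_of_le_of_lt ?_ hsmall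
    have := hb.hδ
    gcongr)
  have h2 : s * f (q * σ ^ 2) ≤ s * f (1 / m ^ 2 * σ ^ 2) + η / 2 * c := by
    obtain ⟨a1, a2⟩ := abs_le.1 h1
    rcases sq_eq_one_iff.1 hs with rfl | rfl <;> linarith
  have h3 : s * ((1 - s * ε) * ((kap t + kap t ^ 2) / 2) * (C (q * σ ^ 2) / q)) ≤ η / 2 * c := by
    have b1 := hLC _ hX
    have b2 : |C (q * σ ^ 2) / q| ≤ L * c₅ ^ 2 := by
      rw [abs_div, abs_of_pos hq0, div_le_iff₀ hq0]
      calc |C (q * σ ^ 2)| ≤ L * (q * σ ^ 2) := b1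
        _ ≤ L * (q * c₅ ^ 2) := by gcongr
        _ = _ := by ring
    have b3 : |(1 - s * ε) * ((kap t + kap t ^ 2) / 2)| ≤ 2 * kap t := by
      have hε1 := hb.eps_le
      have k1 : kap t ^ 2 ≤ kap t := by nlinarith
      have k2 : |1 - s * ε| ≤ 2 := by
        rcases sq_eq_one_iff.1 hs with rfl | rfl <;> rw [abs_le] <;> constructor <;> linarith
      rw [abs_mul, abs_of_nonneg (by positivity : 0 ≤ (kap t + kap t ^ 2) / 2)]
      gcongr
      linarith
    refine le_trans (le_abs_self _) (le_trans ?_ e1.le)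
    rw [abs_mul, abs_eq_one_of_sq_eq_one hs, one_mul, abs_mul]
    gcongr
  have h4 : η * c ≤ η * f (1 / m ^ 2 * σ ^ 2) := by gcongr
  rw [mul_add]
  linarith

end Profile

end

/-! ### Choice of parameters and conclusion. -/

section

open Set Filter Topology
open scoped ContDiff

section Main

variable {n : ℕ} {m : ℝ} {f p C Cd Cdd : ℝ → ℝ}

theorem exists_barrierSetup (hm : m = (n : ℝ) - 1) (hm1 : 1 ≤ m) (hf : BryantFun m f p)
    (hC : BryantCorr m f p C Cd Cdd) (hC0 : C 0 = 0) :
    ∃ rs > 0, rs < 1 ∧ ∀ A ≥ 1, ∀ ε : ℝ, 0 < ε → ε < 1 / (24 * m) → ∃ B₀ ≥ 1, ∀ B ≥ B₀,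
      ∃ ts > 0, ts < 1 ∧ ∀ δ : ℝ, 0 < δ → δ < 1 / 8 →
        BarrierSetup n m f p C Cd Cdd A B ε δ rs ts := by
  obtain ⟨rs, hrs0, hrs, H⟩ := exists_gluedBarrierPair hm hm1 hf hC
  refine ⟨rs, hrs0, hrs, fun A hA ε hε hε1 => ?_⟩
  obtain ⟨B₀, hB₀, H⟩ := H A hA ε hε hε1
  refine ⟨max B₀ m, le_max_of_le_left hB₀, fun B hB => ?_⟩
  have hBB₀ : B₀ ≤ B := (le_max_left _ _).trans hB
  have hBm : m ≤ B := (le_max_right _ _).trans hB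
  obtain ⟨ts, hts, ht⟩ := ((H B hBB₀).and (Ioo_mem_nhdsGT one_pos)).exists
  refine ⟨ts, ht.1, ht.2, fun δ hδ hδ1 => ⟨hm, hm1, hf, hC, hC0, hA, hm1.trans hBm, hBm, hε, ?_, hδ,
    hδ1, hrs0, ht.2, ht.1, hts δ hδ hδ1⟩⟩
  rw [lt_div_iff₀ (by positivity)] at hε1
  linarith

theorem isSandwiched_of_bounds {A B ε δ R T : ℝ} {v : ℝ → ℝ → ℝ} (hR : 0 < R) (hT : 0 < T)
    (h : ∀ r ∈ Icc 0 R, ∀ t ∈ Icc 0 T,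
      vMinus n (fun σ => f (σ ^ 2)) (fun σ => C (σ ^ 2)) A B ε δ r t ≤ v r t ∧
      v r t ≤ vPlus n (fun σ => f (σ ^ 2)) (fun σ => C (σ ^ 2)) A B ε δ r t) :
    IsSandwiched n f C A B ε δ v := by
  refine ⟨R, hR, T, hT, fun r hr t ht s hs => ?_⟩
  obtain ⟨h1, h2⟩ := h r hr t ⟨ht.1.le, ht.2⟩
  rcases sq_eq_one_iff.1 hs with rfl | rfl
  · rw [vGlue, if_pos rfl]; linarith
  · rw [vGlue, if_neg (by norm_num)]; linarith

/-- The parameters of the sandwich are free, so they are adapted to the required accuracy: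
$\delta=\varepsilon$ small in terms of $\eta$, with $A\ge c_4$ for the parabolic range and $B\ge
c_5$ for the inner one. -/
theorem hasNeckpinchProfile_of_sandwich {v : ℝ → ℝ → ℝ} (hm1 : 1 ≤ m) (hf : BryantFun m f p)
    (H : ∀ A ≥ 1, ∀ ε : ℝ, 0 < ε → ε < 1 / (24 * m) → ∃ B₀, ∀ B ≥ B₀, ∀ δ : ℝ, 0 < δ → δ < 1 / 8 →
      ∃ rs ts, BarrierSetup n m f p C Cd Cdd A B ε δ rs ts ∧ IsSandwiched n f C A B ε δ v) :
    HasNeckpinchProfile n (fun σ => f (σ ^ 2)) v := by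
  have small : ∀ x > 0, ∃ e > 0, e < 1 / (24 * m) ∧ e < 1 / 8 ∧ e ≤ x := fun x hx => by
    have h1 : 0 < min (1 / (24 * m)) (1 / 8) := by positivity
    have h2 : 0 < min x (min (1 / (24 * m)) (1 / 8) / 2) := by positivity
    have h3 : min x (min (1 / (24 * m)) (1 / 8) / 2) < min (1 / (24 * m)) (1 / 8) :=
      (min_le_right _ _).trans_lt (half_lt_self h1)
    exact ⟨_, h2, h3.trans_le (min_le_left _ _), h3.trans_le (min_le_right _ _), min_le_left _ _⟩
  constructor
  · intro η hη c₁ hc₁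
    have hη' : 0 < min η 1 := by positivity
    obtain ⟨e, he, he1, he2, hex⟩ := small (min η 1 / 12) (by positivity)
    obtain ⟨B₀, H⟩ := H 1 le_rfl e he he1
    obtain ⟨rs, ts, hb, hv⟩ := H B₀ le_rfl e he he2
    obtain ⟨c₂, hc₂, t₀, ht₀, hP⟩ := profile_outer hb hv hη' (min_le_right _ _) hc₁ (by linarith)
    exact ⟨c₂, hc₂, t₀, ht₀, fun t ht r hr hr' => (hP t ht r hr hr').trans (min_le_left _ _)⟩
  · intro η hη c₄ _
    obtain ⟨e, he, he1, he2, hex⟩ := small (η / 6) (by positivity)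
    obtain ⟨B₀, H⟩ := H (max 1 c₄) (le_max_left _ _) e he he1
    obtain ⟨rs, ts, hb, hv⟩ := H B₀ le_rfl e he he2
    exact profile_parabolic hb hv hη (le_max_right _ _) (by linarith)
  · intro η hη c₅ hc₅
    obtain ⟨c, hc, hcf⟩ := hf.exists_pos_le (c₅ ^ 2)
    have huc : UniformContinuousOn f (Icc 0 (2 * c₅ ^ 2)) :=
      isCompact_Icc.uniformContinuousOn_of_continuous (hf.continuousOn_Ici.mono Icc_subset_Ici_self)
    obtain ⟨ν, hν, hνf⟩ := Metric.uniformContinuousOn_iff.1 huc (η / 2 * c) (by positivity)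
    obtain ⟨e, he, he1, he2, hex⟩ := small (ν / (9 * c₅ ^ 2)) (by positivity)
    obtain ⟨B₀, H⟩ := H 1 le_rfl e he he1
    obtain ⟨rs, ts, hb, hv⟩ := H (max B₀ c₅) (le_max_left _ _) e he he2
    refine profile_inner hb hv hη hc₅ (le_max_right _ _) hc hcf (ν := ν)
      (fun x hx y hy hxy => (hνf x hx y hy hxy).le) ?_
    rw [le_div_iff₀ (by positivity)] at hex
    linarith

end Main

end

end RicciNeckpinch

end

theorem mainTheorem3 (n : ℕ) (hn : 2 ≤ n) :
    ∃ 𝔅 ℭ : ℝ → ℝ,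
      RicciNeckpinch.IsBryantProfile n 𝔅 ∧ RicciNeckpinch.IsBryantCorrection n 𝔅 ℭ ∧
      (∃ A₀ > 0, ∃ rs > 0, rs < 1 ∧ ∀ A ≥ A₀, ∃ ε₀ > 0, ∃ δ₀ > 0,
        ∀ ε : ℝ, 0 < ε → ε < ε₀ → ∃ B₀ ≥ 1, ∀ B ≥ B₀, ∃ ts > 0, ts < 1 ∧
        ∀ δ : ℝ, 0 < δ → δ < δ₀ →
          RicciNeckpinch.IsGluedBarrierPair n 𝔅 ℭ A B ε δ rs ts ∧
          ∀ (vInit : ℝ → ℝ) (r₁ t₁ : ℝ) (v : ℝ → ℝ → ℝ),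
            RicciNeckpinch.IsNeckpinchData n vInit → 0 < r₁ → 0 < t₁ →
            RicciNeckpinch.IsSmoothSolution n vInit r₁ t₁ v →
            ∃ rbar > 0, ∃ tbar > 0, rbar < r₁ ∧ rbar ≤ rs ∧ tbar < t₁ ∧ tbar < ts ∧
              ∀ r ∈ Set.Icc 0 rbar, ∀ t ∈ Set.Icc 0 tbar,
                RicciNeckpinch.vMinus n 𝔅 ℭ A B ε δ r t ≤ v r t ∧
                v r t ≤ RicciNeckpinch.vPlus n 𝔅 ℭ A B ε δ r t) ∧
      (∀ (vInit : ℝ → ℝ) (r₁ t₁ : ℝ) (v : ℝ → ℝ → ℝ),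
        RicciNeckpinch.IsNeckpinchData n vInit → 0 < r₁ → 0 < t₁ →
        RicciNeckpinch.IsSmoothSolution n vInit r₁ t₁ v →
        RicciNeckpinch.HasNeckpinchProfile n 𝔅 v) := by
  have hm1 : 1 ≤ (n : ℝ) - 1 := by
    have : (2 : ℝ) ≤ n := by exact_mod_cast hn
    linarith
  obtain ⟨f, p, hf⟩ := RicciNeckpinch.exists_bryantFun hm1
  obtain ⟨C₁, Cd, Cdd, hC₁⟩ := hf.exists_bryantCorr hm1
  have hC := hC₁.update_zero
  have hC0 : Function.update C₁ 0 0 0 = 0 := Function.update_self _ _ _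
  generalize Function.update C₁ 0 0 = C at hC hC0
  obtain ⟨rs, hrs0, hrs, H⟩ := RicciNeckpinch.exists_barrierSetup rfl hm1 hf hC hC0
  have bounds : ∀ {A B ε δ ts : ℝ} (vInit : ℝ → ℝ) (r₁ t₁ : ℝ) (v : ℝ → ℝ → ℝ),
      RicciNeckpinch.BarrierSetup n ((n : ℝ) - 1) f p C Cd Cdd A B ε δ rs ts → RicciNeckpinch.IsNeckpinchData n vInit →
      0 < r₁ → 0 < t₁ → RicciNeckpinch.IsSmoothSolution n vInit r₁ t₁ v →
      ∃ rbar > 0, ∃ tbar > 0, rbar < r₁ ∧ rbar ≤ rs ∧ tbar < t₁ ∧ tbar < ts ∧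
        ∀ r ∈ Set.Icc 0 rbar, ∀ t ∈ Set.Icc 0 tbar,
          RicciNeckpinch.vMinus n (fun σ => f (σ ^ 2)) (fun σ => C (σ ^ 2)) A B ε δ r t ≤ v r t ∧
          v r t ≤ RicciNeckpinch.vPlus n (fun σ => f (σ ^ 2)) (fun σ => C (σ ^ 2)) A B ε δ r t := by
    intro A B ε δ ts vInit r₁ t₁ v hb hi hr₁ ht₁ hv
    obtain ⟨v1, v2, vt, hsol⟩ := hv.exists_solData
    have hcusp := hi.isCuspInitial (by linarith)
    refine hsol.barrier_bounds hb hr₁ ht₁ (fun d hd => ?_)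
      ((hv.initial 0 ⟨le_rfl, hr₁⟩).trans hi.zero)
    obtain ⟨R, hR, hRv⟩ := hcusp d hd
    refine ⟨min R (r₁ / 2), lt_min hR (by linarith), fun r hr => ?_⟩
    have h1 : r ≤ r₁ / 2 := hr.2.trans (min_le_right _ _)
    simp only [hv.initial r ⟨hr.1.le, by linarith⟩]
    exact hRv r ⟨hr.1, hr.2.trans (min_le_left _ _)⟩
  refine ⟨fun σ => f (σ ^ 2), fun σ => C (σ ^ 2), RicciNeckpinch.isBryantProfile_of_bryantFun hf,
    hC.isBryantCorrection hf hC0, ⟨1, one_pos, rs, hrs0, hrs, fun A hA => ?_⟩, ?_⟩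
  -- With $\varepsilon<1/(24m)$ and $\delta<1/8$ the factors $1\pm\gamma_\pm$ stay in
  -- $[49/64,81/64]$ and $12m\varepsilon\le1$ holds, as the parabolic error bound needs.
  · refine ⟨1 / (24 * ((n : ℝ) - 1)), by positivity, 1 / 8, by norm_num, fun ε hε hε1 => ?_⟩
    obtain ⟨B₀, hB₀, H⟩ := H A hA ε hε hε1
    refine ⟨B₀, hB₀, fun B hB => ?_⟩
    obtain ⟨ts, hts0, hts, H⟩ := H B hB
    exact ⟨ts, hts0, hts, fun δ hδ hδ1 => ⟨(H δ hδ hδ1).pair, fun vInit r₁ t₁ v hi hr₁ ht₁ hv =>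
      bounds vInit r₁ t₁ v (H δ hδ hδ1) hi hr₁ ht₁ hv⟩⟩
  · intro vInit r₁ t₁ v hi hr₁ ht₁ hv
    refine RicciNeckpinch.hasNeckpinchProfile_of_sandwich (C := C) (Cd := Cd) (Cdd := Cdd) hm1 hf
      fun A hA ε hε hε1 => ?_
    obtain ⟨B₀, hB₀, H⟩ := H A hA ε hε hε1
    refine ⟨B₀, fun B hB δ hδ hδ1 => ?_⟩
    obtain ⟨ts, hts0, hts, H⟩ := H B hB
    have hb := H δ hδ hδ1
    obtain ⟨R, hR, T, hT, -, -, -, -, hbd⟩ := bounds vInit r₁ t₁ v hb hi hr₁ ht₁ hv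
    exact ⟨rs, ts, hb, RicciNeckpinch.isSandwiched_of_bounds hR hT hbd⟩
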